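/- For $g=0,1,2,\dots$ let $\mathcal F_{2g}$ be the closed oriented surface of genus $2g$, obtained by gluing a surface of genus $g$ with one open disc removed to its mirror image along the boundary circle, and let $\sigma_1:\mathcal F_{2g}\to\mathcal F_{2g}$ be the involution that fixes this circle and interchanges the two halves. Let $M_{2g}=(\mathcal F_{2g}\times S^2)/\sigma$ be the closed smooth $4$-manifold obtained from the free orientation preserving involution $\sigma(v,w)=(\sigma_1(v),-w)$. Fix an orientation, a Riemannian metric and a spin structure on $M_{2g}$, and let $\Delta^+$ and $\Delta^-$ be the associated positive and negative spinor bundles, i.e. the rank $2$ complex vector bundles with structure group $SU(2)$ associated to the two factors of $\mathrm{Spin}(4)=SU(2)\times SU(2)$, where the first factor is the one that acts nontrivially on self-dual $2$-forms and the second the one that acts nontrivially on anti-self-dual $2$-forms. Then, evaluated on the fundamental class of $M_{2g}$, $$c_2(\Delta^+)=2g-1\qquad\text{and}\qquad c_2(\Delta^-)=1-2g .$$ -/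

import Mathlib

open Set Filter Topology Manifold
open scoped ContDiff

noncomputable section

/-! ## Regular level surfaces in Euclidean 3-space -/

namespace LevelSurface

/-- Euclidean 3-space. -/
abbrev Space : Type := EuclideanSpace ℝ (Fin 3)
/-- The Euclidean plane. -/
abbrev Plane : Type := EuclideanSpace ℝ (Fin 2)

/-- `f` is smooth and has no critical point on its zero set. -/
structure HasRegularZeros (f : Space → ℝ) : Prop where
  smooth : ContDiff ℝ ∞ f
  fderiv_ne_zero : ∀ p, f p = 0 → fderiv ℝ f p ≠ 0

/-- The zero set of `f`, with the subspace topology. -/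
abbrev ZeroSet (f : Space → ℝ) : Type := {p : Space // f p = 0}

/-- A nonzero linear form on 3-space extends to a linear isomorphism onto `ℝ × Plane`. -/
theorem exists_equiv {φ : Space →L[ℝ] ℝ} (hφ : φ ≠ 0) :
    ∃ (T : Space →L[ℝ] Plane) (e : Space ≃L[ℝ] ℝ × Plane),
      (e : Space →L[ℝ] ℝ × Plane) = φ.prod T := by
  have hs : Function.Surjective φ := φ.toLinearMap.surjective (by
    intro h; apply hφ; ext x; simpa using congrArg (fun l => l x) h)
  have hker : Module.finrank ℝ φ.toLinearMap.ker = 2 := by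
    have h1 := φ.toLinearMap.finrank_range_add_finrank_ker
    have h2 : φ.toLinearMap.range = ⊤ := LinearMap.range_eq_top.2 hs
    rw [h2] at h1
    simp at h1
    omega
  let K := φ.toLinearMap.ker
  obtain ⟨π, hπ⟩ := Submodule.exists_isCompl K
  let pr : Space →ₗ[ℝ] K := Submodule.projectionOnto K π hπ
  let L : K ≃ₗ[ℝ] Plane := LinearEquiv.ofFinrankEq K Plane (by simp [K, hker])
  let T : Space →L[ℝ] Plane := LinearMap.toContinuousLinearMap (L.toLinearMap ∘ₗ pr)
  have hinj : Function.Injective (φ.prod T) := by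
    rw [injective_iff_map_eq_zero]
    intro x hx
    have hx' : φ x = 0 ∧ T x = 0 := by simpa using hx
    have hk : x ∈ K := by simpa [K] using hx'.1
    have h2 : pr x = 0 := by
      have : L (pr x) = 0 := hx'.2
      simpa using this
    have h3 : pr x = ⟨x, hk⟩ := Submodule.projectionOnto_apply_left hπ ⟨x, hk⟩
    rw [h3] at h2
    simpa using congrArg Subtype.val h2
  refine ⟨T, (LinearEquiv.ofInjectiveOfFinrankEq (φ.prod T).toLinearMap hinj
    (by simp)).toContinuousLinearEquiv, ?_⟩
  ext x <;> rfl

variable {f : Space → ℝ}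

/-- Flattening of the zero set near `p`: a diffeomorphism between open sets whose first
component is `f` and whose second component is linear. -/
theorem exists_flattening (hf : HasRegularZeros f) (p : Space) (hp : f p = 0) :
    ∃ (T : Space →L[ℝ] Plane) (Φ : OpenPartialHomeomorph Space (ℝ × Plane)),
      p ∈ Φ.source ∧ (∀ q, Φ q = (f q, T q)) ∧ ContDiffOn ℝ ∞ Φ.symm Φ.target := by
  obtain ⟨T, e, he⟩ := exists_equiv (hf.fderiv_ne_zero p hp)
  have hF : ContDiff ℝ ∞ (fun q => (f q, T q)) := hf.smooth.prodMk T.contDiff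
  have hd : ∀ q, HasFDerivAt (fun q => (f q, T q)) ((fderiv ℝ f q).prod T) q := fun q =>
    ((hf.smooth.differentiable (by simp)) q).hasFDerivAt.prodMk T.hasFDerivAt
  have hdp : HasFDerivAt (fun q => (f q, T q)) (e : Space →L[ℝ] ℝ × Plane) p := he ▸ hd p
  let Ψ := hF.contDiffAt.toOpenPartialHomeomorph _ hdp (by simp)
  have hΨ : (Ψ : Space → ℝ × Plane) = fun q => (f q, T q) :=
    hF.contDiffAt.toOpenPartialHomeomorph_coe hdp (by simp)
  let U : Set Space := (fun q => fderiv ℝ (fun q => (f q, T q)) q) ⁻¹'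
    range ((↑) : (Space ≃L[ℝ] ℝ × Plane) → Space →L[ℝ] ℝ × Plane)
  have hU : IsOpen U :=
    (ContinuousLinearEquiv.isOpen).preimage (hF.continuous_fderiv (by simp))
  refine ⟨T, Ψ.restrOpen U hU, ?_, fun q => ?_, ?_⟩
  · refine ⟨hF.contDiffAt.mem_toOpenPartialHomeomorph_source hdp (by simp), ?_⟩
    exact ⟨e, hdp.fderiv.symm⟩
  · exact congrFun hΨ q
  · intro y hy
    have hy1 : y ∈ Ψ.target := by
      have := hy
      simp [OpenPartialHomeomorph.restrOpen] at this
      exact this.1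
    have hy2 : Ψ.symm y ∈ U := ((Ψ.restrOpen U hU).map_target hy).2
    obtain ⟨e', he'⟩ := hy2
    have : ContDiffAt ℝ ∞ Ψ.symm y := by
      refine Ψ.contDiffAt_symm (f₀' := e') hy1 ?_ ?_
      · rw [hΨ, he']; exact (hd _).differentiableAt.hasFDerivAt
      · rw [hΨ]; exact hF.contDiffAt
    exact this.contDiffWithinAt

/-- The linear map to the plane that serves as chart near `p`. -/
def proj (hf : HasRegularZeros f) (p : ZeroSet f) : Space →L[ℝ] Plane := (exists_flattening hf p.1 p.2).choose
/-- A flattening of the zero set near `p`. -/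
def flattening (hf : HasRegularZeros f) (p : ZeroSet f) : OpenPartialHomeomorph Space (ℝ × Plane) :=
  (exists_flattening hf p.1 p.2).choose_spec.choose

theorem flattening_spec (hf : HasRegularZeros f) (p : ZeroSet f) :
    p.1 ∈ (flattening hf p).source ∧ (∀ q, flattening hf p q = (f q, proj hf p q)) ∧
      ContDiffOn ℝ ∞ (flattening hf p).symm (flattening hf p).target :=
  (exists_flattening hf p.1 p.2).choose_spec.choose_spec

theorem symm_mem (hf : HasRegularZeros f) (p : ZeroSet f) {y : Plane} (hy : ((0 : ℝ), y) ∈ (flattening hf p).target) :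
    f ((flattening hf p).symm (0, y)) = 0 := by
  have h := (flattening hf p).right_inv hy
  rw [(flattening_spec hf p).2.1] at h
  exact congrArg Prod.fst h

open Classical in
/-- The chart of the zero set of `f` around `p`: the restriction of a linear map to the plane. -/
def chart (hf : HasRegularZeros f) (p : ZeroSet f) : OpenPartialHomeomorph (ZeroSet f) Plane where
  toFun q := proj hf p q.1
  invFun y := if hy : ((0 : ℝ), y) ∈ (flattening hf p).target then
    ⟨(flattening hf p).symm (0, y), symm_mem hf p hy⟩ else p
  source := {q | q.1 ∈ (flattening hf p).source}
  target := {y | ((0 : ℝ), y) ∈ (flattening hf p).target}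
  map_source' q hq := by
    have h := (flattening hf p).map_source hq
    rw [(flattening_spec hf p).2.1, q.2] at h
    exact h
  map_target' y hy := by
    have hy' : ((0 : ℝ), y) ∈ (flattening hf p).target := hy
    simp only [hy', dite_true]
    exact (flattening hf p).map_target hy'
  left_inv' q hq := by
    have h := (flattening hf p).map_source hq
    have h2 := (flattening hf p).left_inv hq
    rw [(flattening_spec hf p).2.1, q.2] at h h2
    simp only [h, dite_true]
    exact Subtype.ext h2
  right_inv' y hy := by
    have hy' : ((0 : ℝ), y) ∈ (flattening hf p).target := hy
    simp only [hy', dite_true]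
    have h := (flattening hf p).right_inv hy
    rw [(flattening_spec hf p).2.1] at h
    exact congrArg Prod.snd h
  open_source := (flattening hf p).open_source.preimage continuous_subtype_val
  open_target := (flattening hf p).open_target.preimage (by fun_prop)
  continuousOn_toFun := ((proj hf p).continuous.comp continuous_subtype_val).continuousOn
  continuousOn_invFun := by
    have hi : Topology.IsInducing (Subtype.val : ZeroSet f → Space) := ⟨rfl⟩
    rw [hi.continuousOn_iff]
    refine ContinuousOn.congr (f := fun y => (flattening hf p).symm ((0 : ℝ), y)) ?_ ?_
    · exact (flattening hf p).continuousOn_symm.comp (by fun_prop) (fun y hy => hy)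
    · intro y hy
      have hy' : ((0 : ℝ), y) ∈ (flattening hf p).target := hy
      simp [hy']

open Classical in
theorem chart_symm_val (hf : HasRegularZeros f) (p : ZeroSet f) {y : Plane} (hy : y ∈ (chart hf p).target) :
    ((chart hf p).symm y).1 = (flattening hf p).symm (0, y) := by
  have hy' : ((0 : ℝ), y) ∈ (flattening hf p).target := hy
  have h : (chart hf p).symm y = if hy : ((0 : ℝ), y) ∈ (flattening hf p).target then
    ⟨(flattening hf p).symm (0, y), symm_mem hf p hy⟩ else p := rfl
  rw [h]
  simp [hy']


theorem contDiffOn_chart_symm (hf : HasRegularZeros f) (p : ZeroSet f) :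
    ContDiffOn ℝ ∞ (fun y => ((chart hf p).symm y).1) (chart hf p).target := by
  refine ContDiffOn.congr (f := fun y => (flattening hf p).symm ((0 : ℝ), y)) ?_
    (fun y hy => chart_symm_val hf p hy)
  exact (flattening_spec hf p).2.2.comp (by fun_prop) (fun y hy => hy)

/-- The zero set as a smooth surface: the charts are restrictions of linear maps. -/
abbrev chartedSpace (hf : HasRegularZeros f) : ChartedSpace Plane (ZeroSet f) where
  atlas := range (chart hf)
  chartAt := chart hf
  mem_chart_source p := (flattening_spec hf p).1
  chart_mem_atlas p := mem_range_self p

theorem isManifold (hf : HasRegularZeros f) :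
    let _ := chartedSpace hf
    IsManifold 𝓘(ℝ, Plane) ∞ (ZeroSet f) := by
  let _ := chartedSpace hf
  refine isManifold_of_contDiffOn _ _ _ ?_
  rintro _ _ ⟨p, rfl⟩ ⟨q, rfl⟩
  have : ContDiffOn ℝ ∞ (fun y => proj hf q ((chart hf p).symm y).1) (chart hf p).target :=
    (proj hf q).contDiff.comp_contDiffOn (contDiffOn_chart_symm hf p)
  refine this.mono ?_
  intro y hy
  simp at hy
  exact hy.1

/-- The inclusion into 3-space is smooth. -/
theorem contMDiff_val (hf : HasRegularZeros f) :
    let _ := chartedSpace hf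
    ContMDiff 𝓘(ℝ, Plane) 𝓘(ℝ, Space) ∞ (fun p : ZeroSet f => p.1) := by
  let _ := chartedSpace hf
  have := isManifold hf
  intro _ p
  rw [contMDiffAt_iff]
  refine ⟨continuous_subtype_val.continuousAt, ?_⟩
  simp only [mfld_simps]
  have := contDiffOn_chart_symm hf p
  refine (this.contDiffAt ((chart hf p).open_target.mem_nhds ?_)).contDiffWithinAt
  exact (chart hf p).map_source (flattening_spec hf p).1

/-- A map into the surface is smooth as soon as it is smooth into 3-space. -/
theorem contMDiff_of_val (hf : HasRegularZeros f) {E H N : Type*} [NormedAddCommGroup E] [NormedSpace ℝ E]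
    [TopologicalSpace H] {I : ModelWithCorners ℝ E H} [TopologicalSpace N] [ChartedSpace H N]
    {u : N → ZeroSet f} (hu : ContMDiff I 𝓘(ℝ, Space) ∞ (fun x => (u x).1)) :
    let _ := chartedSpace hf
    ContMDiff I 𝓘(ℝ, Plane) ∞ u := by
  let _ := chartedSpace hf
  intro _ x
  rw [contMDiffAt_iff_target]
  constructor
  · exact (continuous_induced_rng.2 hu.continuous).continuousAt
  · exact ((proj hf (u x)).contMDiff.comp hu) x

end LevelSurface

/-! ## The surface of genus `2g` with its mirror involution -/

namespace MirrorSurface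
open LevelSurface

/-- A function on the `(x, z)`-plane, even in `z`, which is nonnegative exactly on the closed disc of
radius `3g + 2` about the origin with `2g` disjoint open unit discs removed, the discs about
`(0, 3c)` for the integers `c ≠ 0` with `|c| ≤ g`. -/
def planarFun (g : ℕ) (x z : ℝ) : ℝ :=
  ((3 * g + 2) ^ 2 - x ^ 2 - z ^ 2) *
    ∏ c ∈ (Finset.Icc (-(g : ℤ)) g).erase 0, (x ^ 2 + (z - 3 * c) ^ 2 - 1)

/-- The defining equation `y² = planarFun g x z` of the surface, for the coordinates
`x = p 0`, `y = p 1`, `z = p 2`. -/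
def equation (g : ℕ) (p : Space) : ℝ := p 1 ^ 2 - planarFun g (p 0) (p 2)

theorem contDiff_equation (g : ℕ) : ContDiff ℝ ∞ (equation g) := by
  unfold equation planarFun
  refine ContDiff.sub (by fun_prop) (ContDiff.mul (by fun_prop) ?_)
  exact contDiff_prod fun c _ => by fun_prop

theorem planarFun_neg (g : ℕ) (x z : ℝ) : planarFun g x (-z) = planarFun g x z := by
  unfold planarFun
  congr 1
  · ring
  · refine Finset.prod_bij' (fun c _ => -c) (fun c _ => -c) ?_ ?_ ?_ ?_ ?_
    · intro c hc; simp at hc ⊢; omega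
    · intro c hc; simp at hc ⊢; omega
    · simp
    · simp
    · intro c _; push_cast; ring

theorem hole_ne {x z : ℝ} {a b : ℤ} (hab : a ≠ b) (ha : x ^ 2 + (z - 3 * a) ^ 2 - 1 = 0) :
    x ^ 2 + (z - 3 * b) ^ 2 - 1 ≠ 0 := by
  intro hb
  have h1 : ((a : ℝ) - b) * (2 * z - 3 * (a + b)) = 0 := by linarith
  have h2 : (a : ℝ) - b ≠ 0 := sub_ne_zero.2 (by exact_mod_cast hab)
  have h3 : 2 * z - 3 * (a + b) = 0 := (mul_eq_zero.1 h1).resolve_left h2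
  have h4 : (1 : ℝ) ≤ ((a : ℝ) - b) ^ 2 := by
    have : (1 : ℤ) ≤ (a - b) ^ 2 := by
      have : (a - b) ^ 2 ≠ 0 := pow_ne_zero _ (sub_ne_zero.2 hab)
      have := sq_nonneg (a - b)
      omega
    exact_mod_cast this
  nlinarith [sq_nonneg x]

theorem outside_pos {g : ℕ} {x z : ℝ} (h : (3 * (g : ℝ) + 2) ^ 2 ≤ x ^ 2 + z ^ 2)
    {c : ℤ} (hc : c ∈ (Finset.Icc (-(g : ℤ)) g).erase 0) :
    0 < x ^ 2 + (z - 3 * c) ^ 2 - 1 := by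
  have hc' : |(c : ℝ)| ≤ g := by
    simp at hc
    rw [abs_le]
    constructor
    · exact_mod_cast hc.2.1
    · exact_mod_cast hc.2.2
  set s := √(x ^ 2 + z ^ 2)
  have hs2 : s ^ 2 = x ^ 2 + z ^ 2 := Real.sq_sqrt (by positivity)
  have hs0 : 0 ≤ s := Real.sqrt_nonneg _
  have hs : 3 * (g : ℝ) + 2 ≤ s := abs_le_of_sq_le_sq' (by linarith) hs0 |>.2
  have hz : |z| ≤ s := abs_le_of_sq_le_sq (by nlinarith [sq_nonneg x]) hs0
  have h1 : (c : ℝ) * z ≤ |(c : ℝ)| * s := by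
    calc (c : ℝ) * z ≤ |(c : ℝ) * z| := le_abs_self _
      _ = |(c : ℝ)| * |z| := abs_mul _ _
      _ ≤ _ := by gcongr
  have h2 : |(c : ℝ)| ^ 2 = (c : ℝ) ^ 2 := sq_abs _
  nlinarith

theorem isRegular_equation (g : ℕ) : HasRegularZeros (equation g) := by
  refine ⟨contDiff_equation g, fun p hp h0 => ?_⟩
  -- a factorisation of the planar function with one vanishing simple factor
  have key : ∀ (A B : Space → ℝ) (u : Space), Differentiable ℝ A → Differentiable ℝ B →
      (∀ q, equation g q = q 1 ^ 2 - A q * B q) → p 1 = 0 → A p = 0 → B p ≠ 0 →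
      fderiv ℝ A p u ≠ 0 → False := by
    intro A B u hA hB hAB h1 hA0 hB0 hu
    have hd1 : HasFDerivAt (fun q : Space => q 1 ^ 2)
        ((2 * p 1) • (EuclideanSpace.proj 1 : Space →L[ℝ] ℝ)) p := by
      have := ((EuclideanSpace.proj 1 : Space →L[ℝ] ℝ).hasFDerivAt (x := p)).pow 2
      simpa using this
    have hd2 := (hA p).hasFDerivAt.mul (hB p).hasFDerivAt
    have hd := (hd1.sub hd2).fderiv
    have he : equation g = (fun q : Space => q 1 ^ 2) - fun q => A q * B q := funext hAB
    have h0' := h0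
    rw [he] at h0'
    have h2 := congrArg (fun l => l u) (hd.symm.trans h0')
    simp [h1, hA0] at h2
    exact h2.elim hB0 hu
  by_cases h1 : p 1 = 0
  · have hQ : planarFun g (p 0) (p 2) = 0 := by
      have := hp
      simp [equation, h1] at this
      exact this
    rcases mul_eq_zero.1 hQ with hR | hP
    · refine key (fun q => (3 * (g : ℝ) + 2) ^ 2 - q 0 ^ 2 - q 2 ^ 2)
        (fun q => ∏ c ∈ (Finset.Icc (-(g : ℤ)) g).erase 0, (q 0 ^ 2 + (q 2 - 3 * c) ^ 2 - 1))
        p (by fun_prop) ?_ (fun q => rfl) h1 hR ?_ ?_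
      · have : ContDiff ℝ 1 (fun q : Space => ∏ c ∈ (Finset.Icc (-(g : ℤ)) g).erase 0,
            (q 0 ^ 2 + (q 2 - 3 * (c : ℝ)) ^ 2 - 1)) := contDiff_prod fun c _ => by fun_prop
        exact this.differentiable (by simp)
      · exact Finset.prod_ne_zero_iff.2 fun c hc =>
          (outside_pos (by linarith) hc).ne'
      · have hd : HasFDerivAt (fun q : Space => (3 * (g : ℝ) + 2) ^ 2 - q 0 ^ 2 - q 2 ^ 2)
            (-((2 * p 0) • (EuclideanSpace.proj 0 : Space →L[ℝ] ℝ)) -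
              (2 * p 2) • (EuclideanSpace.proj 2 : Space →L[ℝ] ℝ)) p := by
          have h0 := ((EuclideanSpace.proj 0 : Space →L[ℝ] ℝ).hasFDerivAt (x := p)).pow 2
          have h2 := ((EuclideanSpace.proj 2 : Space →L[ℝ] ℝ).hasFDerivAt (x := p)).pow 2
          simpa using (h0.const_sub ((3 * (g : ℝ) + 2) ^ 2)).fun_sub h2
        rw [hd.fderiv]
        simp
        intro h
        have : (0 : ℝ) < (3 * (g : ℝ) + 2) ^ 2 := by positivity
        nlinarith
    · obtain ⟨a, ha, ha0⟩ := Finset.prod_eq_zero_iff.1 hP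
      refine key (fun q => q 0 ^ 2 + (q 2 - 3 * a) ^ 2 - 1)
        (fun q => ((3 * (g : ℝ) + 2) ^ 2 - q 0 ^ 2 - q 2 ^ 2) *
          ∏ c ∈ ((Finset.Icc (-(g : ℤ)) g).erase 0).erase a,
            (q 0 ^ 2 + (q 2 - 3 * c) ^ 2 - 1))
        (p - EuclideanSpace.single 2 (3 * (a : ℝ))) (by fun_prop) ?_ (fun q => ?_) h1 ha0 ?_ ?_
      · have : ContDiff ℝ 1 (fun q : Space => ((3 * (g : ℝ) + 2) ^ 2 - q 0 ^ 2 - q 2 ^ 2) *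
          ∏ c ∈ ((Finset.Icc (-(g : ℤ)) g).erase 0).erase a,
            (q 0 ^ 2 + (q 2 - 3 * (c : ℝ)) ^ 2 - 1)) :=
          ContDiff.mul (by fun_prop) (contDiff_prod fun c _ => by fun_prop)
        exact this.differentiable (by simp)
      · simp only [equation, planarFun]
        rw [← Finset.mul_prod_erase _ _ ha]
        ring
      · refine mul_ne_zero ?_ (Finset.prod_ne_zero_iff.2 fun c hc => ?_)
        · intro hR
          have := outside_pos (g := g) (x := p 0) (z := p 2) (by linarith) ha
          linarith
        · exact hole_ne (Finset.ne_of_mem_erase hc).symm ha0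
      · have hd : HasFDerivAt (fun q : Space => q 0 ^ 2 + (q 2 - 3 * (a : ℝ)) ^ 2 - 1)
            ((2 * p 0) • (EuclideanSpace.proj 0 : Space →L[ℝ] ℝ) +
              (2 * (p 2 - 3 * a)) • (EuclideanSpace.proj 2 : Space →L[ℝ] ℝ)) p := by
          have h0 := ((EuclideanSpace.proj 0 : Space →L[ℝ] ℝ).hasFDerivAt (x := p)).pow 2
          have h2 := (((EuclideanSpace.proj 2 : Space →L[ℝ] ℝ).hasFDerivAt (x := p)).sub_const
            (3 * (a : ℝ))).pow 2
          simpa using (h0.add h2).sub_const 1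
        rw [hd.fderiv]
        simp
        intro h
        nlinarith
  · have hd := (((contDiff_equation g).differentiable (by simp)) p).hasFDerivAt.hasLineDerivAt
      (EuclideanSpace.single 1 (1 : ℝ))
    rw [h0] at hd
    have hl : HasDerivAt (fun t : ℝ => (p 1 + t) ^ 2 - planarFun g (p 0) (p 2)) (2 * p 1) 0 := by
      have := (((hasDerivAt_id (0 : ℝ)).const_add (p 1)).pow 2).sub_const
        (planarFun g (p 0) (p 2))
      simpa using this
    have he : (fun t : ℝ => equation g (p + t • EuclideanSpace.single 1 (1 : ℝ))) =
        fun t : ℝ => (p 1 + t) ^ 2 - planarFun g (p 0) (p 2) := by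
      funext t
      simp [equation]
    unfold HasLineDerivAt at hd
    rw [he] at hd
    have := hd.unique hl
    simp at this
    exact h1 this



/-- The closed surface `F` of genus `2g`, as a regular level surface in 3-space. It is the double
of the disc with `2g` holes `{planarFun g ≥ 0}` along its boundary circles, so its genus is `2g`.
The plane `z = 0` meets it in one circle `{y² = planarFun g x 0}`; the part with `z ≥ 0` is the
double of the half disc with `g` holes along its boundary except for the segment on `z = 0`, hence
a surface of genus `g` with one open disc removed, and the part with `z ≤ 0` is its mirror image.
For `g = 0` it is the round sphere of radius `2`. -/
abbrev Surface (g : ℕ) : Type := ZeroSet (equation g)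

instance (g : ℕ) : ChartedSpace Plane (Surface g) := chartedSpace (isRegular_equation g)

instance (g : ℕ) : IsManifold 𝓘(ℝ, Plane) ∞ (Surface g) := isManifold (isRegular_equation g)

instance (g : ℕ) : CompactSpace (Surface g) := by
  refine (isCompact_iff_compactSpace (s := {p : Space | equation g p = 0})).1 ?_
  refine Metric.isCompact_of_isClosed_isBounded
    (isClosed_eq (contDiff_equation g).continuous continuous_const) ?_
  have hQ : Continuous fun p : Space => planarFun g (p 0) (p 2) := by
    have : Continuous fun p : Space => p 1 ^ 2 - equation g p :=
      (by fun_prop : Continuous fun p : Space => p 1 ^ 2).sub (contDiff_equation g).continuous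
    refine this.congr fun p => ?_
    simp [equation]
  obtain ⟨C, hC⟩ := ((isCompact_closedBall (0 : Space) (3 * (g : ℝ) + 2)).image hQ).bddAbove
  have hin : ∀ p : Space, equation g p = 0 → p 0 ^ 2 + p 2 ^ 2 ≤ (3 * (g : ℝ) + 2) ^ 2 := by
    intro p hp
    by_contra! h
    have hP : 0 < ∏ c ∈ (Finset.Icc (-(g : ℤ)) g).erase 0,
        (p 0 ^ 2 + (p 2 - 3 * (c : ℝ)) ^ 2 - 1) :=
      Finset.prod_pos fun c hc => outside_pos h.le hc
    have h1 : p 1 ^ 2 = planarFun g (p 0) (p 2) := sub_eq_zero.1 hp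
    have : planarFun g (p 0) (p 2) < 0 := mul_neg_of_neg_of_pos (by linarith) hP
    nlinarith [sq_nonneg (p 1)]
  refine (Metric.isBounded_closedBall (x := (0 : Space))
    (r := √((3 * (g : ℝ) + 2) ^ 2 + C))).subset ?_
  intro p hp
  have h0 := hin p hp
  have h1 : p 1 ^ 2 = planarFun g (p 0) (p 2) := sub_eq_zero.1 hp
  have h2 : p 1 ^ 2 ≤ C := by
    rw [h1]
    refine hC ⟨!₂[p 0, 0, p 2], ?_, by simp⟩
    rw [mem_closedBall_zero_iff, EuclideanSpace.norm_eq]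
    refine Real.sqrt_le_iff.2 ⟨by positivity, ?_⟩
    simpa [Fin.sum_univ_three] using h0
  rw [mem_closedBall_zero_iff, EuclideanSpace.norm_eq]
  refine Real.sqrt_le_sqrt ?_
  simp [Fin.sum_univ_three]
  linarith

/-- The mirror involution `(x, y, z) ↦ (x, y, -z)`, which fixes the circle `z = 0` and interchanges
the halves `z ≥ 0` and `z ≤ 0`. -/
def mirror (g : ℕ) (p : Surface g) : Surface g :=
  ⟨!₂[p.1 0, p.1 1, -p.1 2], by
    have := p.2
    simpa [equation, planarFun_neg] using this⟩

theorem mirror_mirror (g : ℕ) (p : Surface g) : mirror g (mirror g p) = p := by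
  apply Subtype.ext
  ext i
  fin_cases i <;> simp [mirror]

theorem contMDiff_mirror (g : ℕ) :
    ContMDiff 𝓘(ℝ, Plane) 𝓘(ℝ, Plane) ∞ (mirror g) := by
  refine contMDiff_of_val (isRegular_equation g) ?_
  have h : ContDiff ℝ ∞ fun q : Space => (!₂[q 0, q 1, -q 2] : Space) := by
    rw [contDiff_euclidean]
    intro i
    fin_cases i <;> simp <;> fun_prop
  exact h.contMDiff.comp (contMDiff_val (isRegular_equation g))

end MirrorSurface

/-! ## The 4-manifold `M_{2g} = F ×_σ S²` -/

/-- The unit sphere in Euclidean 3-space. -/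
abbrev Sphere2 : Type := Metric.sphere (0 : EuclideanSpace ℝ (Fin 3)) 1

section Quotient
open MirrorSurface LevelSurface

instance : Fact (Module.finrank ℝ (EuclideanSpace ℝ (Fin 3)) = 2 + 1) := ⟨by simp⟩

/-- The fixed point free involution `σ (v, w) = (mirror v, -w)` of `F × S²`. -/
def involution (g : ℕ) (x : Surface g × Sphere2) : Surface g × Sphere2 :=
  (mirror g x.1, -x.2)

theorem involution_involution (g : ℕ) (x : Surface g × Sphere2) :
    involution g (involution g x) = x := by
  simp [involution, mirror_mirror]

theorem involution_ne (g : ℕ) (x : Surface g × Sphere2) : involution g x ≠ x := by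
  intro h
  have h2 : -x.2 = x.2 := congrArg Prod.snd h
  exact (ne_neg_of_mem_unit_sphere ℝ x.2) h2.symm

/-- The model of the 4-manifolds `F × S²` and `M_{2g}`. -/
abbrev coverModel : ModelWithCorners ℝ (Plane × Plane) (ModelProd Plane Plane) :=
  𝓘(ℝ, Plane).prod 𝓘(ℝ, Plane)

theorem contMDiff_involution (g : ℕ) :
    ContMDiff coverModel coverModel ∞ (involution g) :=
  ((contMDiff_mirror g).comp contMDiff_fst).prodMk
    ((contMDiff_neg_sphere (n := 2) (E := EuclideanSpace ℝ (Fin 3))).comp contMDiff_snd)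

/-- The group `{1, -1}` acts on `F × S²`, with `-1` acting by the involution. -/
instance involutionAction (g : ℕ) : MulAction ℤˣ (Surface g × Sphere2) where
  smul u x := if u = 1 then x else involution g x
  one_smul x := if_pos rfl
  mul_smul u v x := by
    rcases Int.units_eq_one_or u with rfl | rfl <;> rcases Int.units_eq_one_or v with rfl | rfl
    · rfl
    · rfl
    · rfl
    · exact (involution_involution g x).symm

theorem contMDiff_unit_smul (g : ℕ) (u : ℤˣ) :
    ContMDiff coverModel coverModel ∞ (fun x : Surface g × Sphere2 => u • x) := by
  rcases Int.units_eq_one_or u with rfl | rfl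
  · exact contMDiff_id
  · exact contMDiff_involution g

instance (g : ℕ) : ContinuousConstSMul ℤˣ (Surface g × Sphere2) :=
  ⟨fun u => (contMDiff_unit_smul g u).continuous⟩

instance (g : ℕ) : IsCancelSMul ℤˣ (Surface g × Sphere2) where
  left_cancel' u x y h := by
    rcases Int.units_eq_one_or u with rfl | rfl
    · exact h
    · have h2 := congrArg (involution g) (h : involution g x = involution g y)
      change involution g (involution g x) = involution g (involution g y) at h2
      rwa [involution_involution, involution_involution] at h2
  right_cancel' u v x h := by
    rcases Int.units_eq_one_or u with rfl | rfl <;> rcases Int.units_eq_one_or v with rfl | rfl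
    · rfl
    · exact absurd (h : x = involution g x).symm (involution_ne g x)
    · exact absurd (h : involution g x = x) (involution_ne g x)
    · rfl

/-- The closed 4-manifold `M_{2g}`: the quotient of `F × S²` by the involution `σ`. -/
abbrev M2g (g : ℕ) : Type := MulAction.orbitRel.Quotient ℤˣ (Surface g × Sphere2)


/-- If a local homeomorphism `f : X → Y` is the quotient by a group of diffeomorphisms of the smooth
manifold `X`, then `Y` is a smooth manifold. -/
theorem isManifold_quotient {E H X Y G : Type*} [NormedAddCommGroup E] [NormedSpace ℝ E]
    [TopologicalSpace H] (I : ModelWithCorners ℝ E H) [TopologicalSpace X] [TopologicalSpace Y]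
    [ChartedSpace H X] [IsManifold I ∞ X] [SMul G X] {f : X → Y} (hf : IsLocalHomeomorph f)
    {s : Y → X} (hs : Function.RightInverse s f) (hfG : ∀ (u : G) (x : X), f (u • x) = f x)
    (hG : ∀ x y : X, f x = f y → ∃ u : G, u • x = y)
    (hsm : ∀ u : G, ContMDiff I I ∞ (fun x : X => u • x)) :
    letI := hf.chartedSpaceOfRightInverse (H := H) hs
    IsManifold I ∞ Y := by
  let _ := hf.chartedSpaceOfRightInverse (H := H) hs
  refine isManifold_of_contDiffOn I ∞ Y ?_
  rintro _ _ ⟨p, rfl⟩ ⟨q, rfl⟩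
  set L₁ := hf.localInverseAt (s p) with hL₁
  set L₂ := hf.localInverseAt (s q) with hL₂
  set c₁ := chartAt H (s p)
  set c₂ := chartAt H (s q)
  rintro y ⟨hy, hyr⟩
  simp only [mem_preimage, mfld_simps] at hy
  obtain ⟨⟨hy1, hy2⟩, hy3, hy4⟩ := hy
  set x₁ := c₁.symm (I.symm y) with hx₁
  have hL₁s : ∀ x, L₁.symm x = f x := congrFun (hf.localInverseAt_symm _)
  have hL₂s : ∀ x, L₂.symm x = f x := congrFun (hf.localInverseAt_symm _)
  rw [hL₁s] at hy3 hy4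
  obtain ⟨u, hu⟩ := hG x₁ (L₂ (f x₁)) (by rw [← hL₂s (L₂ (f x₁)), L₂.left_inv hy3])
  have hx₁c : x₁ ∈ c₁.source := c₁.map_target hy1
  -- near `x₁` the composition `L₂ ∘ f` is the action of `u`
  have hev : ∀ᶠ x in 𝓝 x₁, L₂ (f x) = u • x := by
    have h1 : ∀ᶠ x in 𝓝 x₁, u • x ∈ L₂.target := by
      refine (hsm u).continuous.continuousAt.eventually_mem (L₂.open_target.mem_nhds ?_)
      rw [hu]
      exact L₂.map_source hy3
    filter_upwards [h1] with x hx
    rw [← hfG u x, ← hL₂s, L₂.right_inv hx]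
  have hsmooth := (contMDiffAt_iff_of_mem_maximalAtlas (I := I) (I' := I) (n := ∞)
    (IsManifold.chart_mem_maximalAtlas (I := I) (n := ∞) (s p))
    (IsManifold.chart_mem_maximalAtlas (I := I) (n := ∞) (s q)) hx₁c
    (by rw [hu]; exact hy4 : u • x₁ ∈ c₂.source)).1 (hsm u x₁)
  have h2 := hsmooth.2
  have hy' : c₁.extend I x₁ = y := by
    simp [hx₁, c₁.right_inv hy1, I.right_inv hyr]
  rw [hy'] at h2
  refine (h2.mono (inter_subset_right)).congr_of_eventuallyEq ?_ ?_
  · have hcont : ContinuousAt (fun y => c₁.symm (I.symm y)) y :=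
      (c₁.continuousAt_symm hy1).comp (f := I.symm) I.continuous_symm.continuousAt
    have h3 : ∀ᶠ y' in 𝓝 y, L₂ (f (c₁.symm (I.symm y'))) = u • (c₁.symm (I.symm y')) :=
      hcont.eventually hev
    filter_upwards [mem_nhdsWithin_of_mem_nhds h3] with y' hy'
    simp only [Function.comp_apply, mfld_simps, hL₁s, hy']
    rfl
  · simp only [Function.comp_apply, mfld_simps, hL₁s, ← hx₁, ← hu]
    rfl

instance (g : ℕ) : T2Space (M2g g) := inferInstance
instance (g : ℕ) : CompactSpace (M2g g) := inferInstance

instance (g : ℕ) : IsManifold coverModel ∞ (M2g g) := by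
  have h := isQuotientCoveringMap_quotientMk_of_properlyDiscontinuousSMul
    (G := ℤˣ) (E := Surface g × Sphere2)
  exact isManifold_quotient coverModel (G := ℤˣ) h.isCoveringMap.isLocalHomeomorph
    (Function.Surjective.hasRightInverse Quotient.mk_surjective).choose_spec
    (fun u x => Quotient.sound (MulAction.mem_orbit _ _))
    (fun x y hxy => by
      obtain ⟨u, hu⟩ := Quotient.exact hxy.symm
      exact ⟨u, hu⟩)
    (contMDiff_unit_smul g)

end Quotient

/-! ## Chern numbers of complex vector bundles over oriented 4-manifolds -/

section Bundles

variable {E H : Type*} [NormedAddCommGroup E] [NormedSpace ℝ E] [TopologicalSpace H]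
  (I : ModelWithCorners ℝ E H) {M : Type*} [TopologicalSpace M] [ChartedSpace H M]

/-- The coordinate expression of a complex-valued 1-form in the chart centred at `c`:
its pullback under the inverse of the chart. -/
def chartForm (c : M) (α : ∀ x : M, TangentSpace I x →L[ℝ] ℂ) (y : E) : E →L[ℝ] ℂ :=
  (α ((extChartAt I c).symm y)).comp (mfderiv 𝓘(ℝ, E) I (extChartAt I c).symm y)

variable (M) in
/-- A smooth complex vector bundle of rank `r` over `M`, given by an open cover and a smooth
cocycle of transition matrices. Over `U i` there is a frame `s i` (a row of `r` sections), and
`s j = s i * g i j` over `U i ∩ U j`. -/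
structure ComplexBundle (r : ℕ) where
  /-- index set of the cover -/
  ι : Type
  /-- trivialising open sets -/
  U : ι → Set M
  isOpen : ∀ i, IsOpen (U i)
  cover : ∀ x, ∃ i, x ∈ U i
  /-- transition matrices -/
  g : ι → ι → M → Matrix (Fin r) (Fin r) ℂ
  smooth : ∀ i j a b, ContMDiffOn I 𝓘(ℝ, ℂ) ∞ (fun x => g i j x a b) (U i ∩ U j)
  g_self : ∀ i, ∀ x ∈ U i, g i i x = 1
  g_comp : ∀ i j k, ∀ x ∈ U i ∩ U j ∩ U k, g i j x * g j k x = g i k x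

variable {I} {r : ℕ}

/-- Some trivialising set that contains `x`. -/
def ComplexBundle.idx (V : ComplexBundle I M r) (x : M) : V.ι := (V.cover x).choose

/-- A smooth connection on `V`: matrices of 1-forms `A i` on the sets `U i`, with
`∇ (s i) = s i * A i`, hence `A j = g⁻¹ * A i * g + g⁻¹ * dg` for `g = g i j`. -/
structure ComplexBundle.Connection (V : ComplexBundle I M r) where
  /-- the connection matrices -/
  form : V.ι → Fin r → Fin r → ∀ x : M, TangentSpace I x →L[ℝ] ℂ
  smooth : ∀ i a b (c : M), ContDiffOn ℝ ∞ (chartForm I c (form i a b))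
    ((extChartAt I c).target ∩ (extChartAt I c).symm ⁻¹' V.U i)
  gauge : ∀ i j, ∀ x ∈ V.U i ∩ V.U j, ∀ v : TangentSpace I x,
    (Matrix.of fun a b => form j a b x v) =
      V.g j i x * (Matrix.of fun a b => form i a b x v) * V.g i j x +
      V.g j i x * (Matrix.of fun a b => mfderiv I 𝓘(ℝ, ℂ) (fun z => V.g i j z a b) x v)

namespace ComplexBundle.Connection

variable {V : ComplexBundle I M r} (D : V.Connection)

/-- The curvature `dA + A ∧ A` over `U i`, in the coordinates of the chart centred at `c`,
at the coordinate point `y`. -/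
def curvature (c : M) (i : V.ι) (y v w : E) : Matrix (Fin r) (Fin r) ℂ :=
  Matrix.of fun a b =>
    fderiv ℝ (chartForm I c (D.form i a b)) y v w - fderiv ℝ (chartForm I c (D.form i a b)) y w v +
    ∑ k : Fin r, (chartForm I c (D.form i a k) y v * chartForm I c (D.form i k b) y w -
      chartForm I c (D.form i a k) y w * chartForm I c (D.form i k b) y v)

/-- The second Chern form `(tr (F ∧ F) - tr F ∧ tr F) / (8 π²)` of the connection, in the
coordinates of the chart centred at `c`, at the coordinate point `y`. The wedge product of two
2-forms is written as the sum over the six `(2,2)`-shuffles. -/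
def chernForm (c : M) (y : E) (v : Fin 4 → E) : ℂ :=
  let F : Fin 4 → Fin 4 → Matrix (Fin r) (Fin r) ℂ := fun k l =>
    D.curvature c (V.idx ((extChartAt I c).symm y)) y (v k) (v l)
  let P : Matrix (Fin r) (Fin r) ℂ → Matrix (Fin r) (Fin r) ℂ → ℂ := fun X Y =>
    (X * Y).trace - X.trace * Y.trace
  (1 / (8 * (Real.pi : ℂ) ^ 2)) *
    (P (F 0 1) (F 2 3) - P (F 0 2) (F 1 3) + P (F 0 3) (F 1 2) +
      P (F 1 2) (F 0 3) - P (F 1 3) (F 0 2) + P (F 2 3) (F 0 1))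

end ComplexBundle.Connection

variable (I M) in
/-- An orientation of the 4-manifold `M`: an orientation of every tangent space, such that the
coordinate frames of every chart have locally constant sign. -/
structure ManifoldOrientation where
  /-- the orientation of the tangent spaces -/
  orient : ∀ x : M, Orientation ℝ (TangentSpace I x) (Fin 4)
  continuousOn_sign : ∀ (c : M) (v : Fin 4 → E), ContinuousOn
    (fun x : M => ((SignType.sign ((orient x).someVector fun k =>
      mfderiv 𝓘(ℝ, E) I (extChartAt I c).symm (extChartAt I c x) (v k)) : SignType) : ℝ))
    (chartAt H c).source

/-- `1` on positively oriented frames, `-1` on negatively oriented ones, `0` on dependent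
tuples. -/
def ManifoldOrientation.sign (o : ManifoldOrientation I M) (x : M)
    (v : Fin 4 → TangentSpace I x) : ℝ :=
  ((SignType.sign ((o.orient x).someVector v) : SignType) : ℝ)

variable [MeasurableSpace E] [BorelSpace E]

/-- The integral over the oriented manifold `M` of the second Chern form of a connection,
computed with a partition of unity `ρ` subordinate to the charts. The linear coordinates on the
model space `E` are those of the basis `b`, with Lebesgue measure `b.addHaar`. -/
def ComplexBundle.Connection.chernIntegral {V : ComplexBundle I M r} (D : V.Connection)
    (o : ManifoldOrientation I M) (b : Module.Basis (Fin 4) ℝ E)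
    (ρ : SmoothPartitionOfUnity M I M univ) : ℂ :=
  ∑ᶠ c : M, ∫ y in (extChartAt I c).target,
    ((ρ c ((extChartAt I c).symm y) *
      o.sign ((extChartAt I c).symm y)
        (fun k => mfderiv 𝓘(ℝ, E) I (extChartAt I c).symm y (b k)) : ℝ) : ℂ) *
    D.chernForm c y b ∂b.addHaar

/-- `⟨c₂(V), [M]⟩ = k` for a smooth complex vector bundle `V` over a closed oriented 4-manifold
`M`: by Chern-Weil theory, there are connections on `V`, and for every one of them the second
Chern form has integral `k`. -/
def ComplexBundle.HasSecondChernNumber [T2Space M] [CompactSpace M] [I.Boundaryless]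
    [IsManifold I ∞ M] (V : ComplexBundle I M r) (o : ManifoldOrientation I M)
    (b : Module.Basis (Fin 4) ℝ E) (k : ℤ) : Prop :=
  Nonempty V.Connection ∧
    ∀ (D : V.Connection) (ρ : SmoothPartitionOfUnity M I M univ),
      ρ.IsSubordinate (fun c => (chartAt H c).source) → D.chernIntegral o b ρ = k

end Bundles

/-! ## Spin structures and spinor bundles in dimension 4 -/

section Spin
open scoped Matrix

/-- The group `SU(2)`. -/
abbrev SU2 : Type := Matrix.specialUnitaryGroup (Fin 2) ℂ

/-- The group `Spin(4) = SU(2) × SU(2)`. -/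
abbrev Spin4 : Type := SU2 × SU2

/-- The unit quaternions `1, i, j, k` as complex `2 × 2`-matrices; their real span, identified
with `ℝ⁴` by this oriented orthonormal basis, is the algebra of quaternions. -/
def quaternionUnit : Fin 4 → Matrix (Fin 2) (Fin 2) ℂ :=
  ![1, !![Complex.I, 0; 0, -Complex.I], !![0, 1; -1, 0], !![0, Complex.I; Complex.I, 0]]

/-- The double covering `Spin(4) → SO(4)`: the pair `(A, B)` acts on the quaternions by
`X ↦ A X B⁻¹`. The entries are computed with the inner product `⟨X, Y⟩ = ½ Re tr (Xᴴ Y)`. -/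
def spinCover (s : Spin4) : Matrix (Fin 4) (Fin 4) ℝ :=
  Matrix.of fun l k =>
    (1 / 2) * ((quaternionUnit l)ᴴ * (s.1.1 * quaternionUnit k * (s.2.1)ᴴ)).trace.re

variable {E H : Type*} [NormedAddCommGroup E] [NormedSpace ℝ E] [TopologicalSpace H]
  {I : ModelWithCorners ℝ E H} {M : Type*} [TopologicalSpace M] [ChartedSpace H M] [IsManifold I ∞ M]

/-- A spin structure on the oriented Riemannian 4-manifold `M`: a lift of the cocycle of the
oriented orthonormal frame bundle through the double covering `Spin(4) → SO(4)`. Over `U i` there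
is an oriented orthonormal frame `e i`; on overlaps `e j = e i * R` where `R` is the image in
`SO(4)` of `lift i j`, and the lifts satisfy the cocycle condition. -/
structure SpinStructure (o : ManifoldOrientation I M)
    (h : Bundle.ContMDiffRiemannianMetric I ∞ E (fun x : M => TangentSpace I x)) where
  /-- index set of the cover -/
  ι : Type
  /-- open sets over which the frames are defined -/
  U : ι → Set M
  isOpen : ∀ i, IsOpen (U i)
  cover : ∀ x, ∃ i, x ∈ U i
  /-- the local frames of the tangent bundle -/
  e : ι → Fin 4 → ∀ x : M, TangentSpace I x
  smooth_e : ∀ i k, ContMDiffOn I I.tangent ∞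
    (fun x => (⟨x, e i k x⟩ : TangentBundle I M)) (U i)
  orthonormal : ∀ i, ∀ x ∈ U i, ∀ k l, h.inner x (e i k x) (e i l x) = if k = l then 1 else 0
  oriented : ∀ i, ∀ x ∈ U i, o.sign x (fun k => e i k x) = 1
  /-- the `Spin(4)`-valued transition functions -/
  lift : ι → ι → M → Spin4
  smooth_fst : ∀ i j a b, ContMDiffOn I 𝓘(ℝ, ℂ) ∞ (fun x => (lift i j x).1.1 a b) (U i ∩ U j)
  smooth_snd : ∀ i j a b, ContMDiffOn I 𝓘(ℝ, ℂ) ∞ (fun x => (lift i j x).2.1 a b) (U i ∩ U j)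
  lift_self : ∀ i, ∀ x ∈ U i, lift i i x = 1
  lift_comp : ∀ i j k, ∀ x ∈ U i ∩ U j ∩ U k, lift i j x * lift j k x = lift i k x
  cover_lift : ∀ i j, ∀ x ∈ U i ∩ U j, ∀ k,
    e j k x = ∑ l, spinCover (lift i j x) l k • e i l x

variable {o : ManifoldOrientation I M}
  {h : Bundle.ContMDiffRiemannianMetric I ∞ E (fun x : M => TangentSpace I x)}

/-- The positive spinor bundle: associated to the first factor of `Spin(4) = SU(2) × SU(2)`, the
one that acts nontrivially on the self-dual 2-forms. -/
def SpinStructure.positiveSpinor (S : SpinStructure o h) : ComplexBundle I M 2 where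
  ι := S.ι
  U := S.U
  isOpen := S.isOpen
  cover := S.cover
  g i j x := (S.lift i j x).1.1
  smooth := S.smooth_fst
  g_self i x hx := by rw [S.lift_self i x hx]; rfl
  g_comp i j k x hx := by rw [← S.lift_comp i j k x hx]; rfl

/-- The negative spinor bundle: associated to the second factor of `Spin(4) = SU(2) × SU(2)`, the
one that acts nontrivially on the anti-self-dual 2-forms. -/
def SpinStructure.negativeSpinor (S : SpinStructure o h) : ComplexBundle I M 2 where
  ι := S.ι
  U := S.U
  isOpen := S.isOpen
  cover := S.cover
  g i j x := (S.lift i j x).2.1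
  smooth := S.smooth_snd
  g_self i x hx := by rw [S.lift_self i x hx]; rfl
  g_comp i j k x hx := by rw [← S.lift_comp i j k x hx]; rfl

end Spin

/-- The standard basis of the model space `ℝ² × ℝ²`. -/
def coverBasis : Module.Basis (Fin 4) ℝ (LevelSurface.Plane × LevelSurface.Plane) :=
  ((EuclideanSpace.basisFun (Fin 2) ℝ).toBasis.prod
    (EuclideanSpace.basisFun (Fin 2) ℝ).toBasis).reindex finSumFinEquiv

end

/-! For a closed oriented spin 4-manifold, `c₂(Δ^±) = -p₁/4 ∓ χ/2`. Here `χ(M_{2g}) = (2 - 4g) · 2 /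
2 = 2 - 4g`, and `p₁ = 0` because the double cover `F × S²` carries a product metric. So the two
numbers are `±(2g - 1)`, whatever the orientation. The proof obtains this by Chern-Weil theory, from
one well chosen connection upstairs.

Chern-Weil theory. The second Chern form is independent of the frame and of the chart
(`chernForm_eq`, `chernForm_eq_chernField`). Multiplied by the sign of the orientation it is a
density. The integral of this density does not depend on the connection, because two Chern forms
differ locally by the differential of a transgression form (`wedge22_sub_eq_fderiv_transgression`,
`integral_chernDensity_eq`). Connections exist (`nonempty_connection`), and the pulled back density
on `F × S²` has twice the integral (`IsSmoothQuotient.integral_pullConnection`).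

The connection. The tangent spaces of `F × S²` are the orthogonal complements of `(n, 0)` and `(0,
m)` in `ℝ³ ⊕ ℝ³`, where `n` and `m` are the unit normals. The frames of the spin structure are made
orthonormal for the induced metric by the inverse square root of their Gram matrix. This is
equivariant under rotations, so the `Spin(4)`-valued transition functions stay the same, and the
projected connection lifts through either half spin representation. Its curvature is the sum of the
quarter turns of the two tangent planes, with minus the pulled back area forms of the two Gauss maps
as coefficients (`curv_frameForm`). The quarter turns are parallel, so adding `β` and `γ` times them
changes the curvature only by `dβ` and `dγ`. These are chosen so that the area form of the sphere is
replaced by a form of the same total area `4π` concentrated near the north pole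
(`Profile.extD_form`).

The count. The Chern form becomes a constant times the product of two concentrated forms
(`secondChern_frameForm`). It lives near the points where both normals point north, and each of them
contributes `(4π)²` times the local degree of the Gauss map of `F` (`NormalPair.exists_cutoff`). On
`F` these points are the top of the outer circle, with sign `+`, and the lowest points of the `2g`
holes, with sign `-`. The signs add up to `1 - 2g = χ(F)/2` (`sum_heightSign`). With the factor
`∓1/(8π²)` the integral upstairs is `±2(2g - 1)`, and half of it remains on the quotient.

The two half spin representations differ only in the sign of the wedge term of their trace forms
(`trace_halfPlus_mul`, `trace_halfMinus_mul`). The orientation drops out because the sign of the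
frame in the curvature and the sign in the integral multiply to the sign of a fixed volume form
(`chernDensity_connection`). -/

open Set Filter Topology Manifold
open scoped ContDiff

noncomputable section
set_option linter.unusedSectionVars false

/-! ### Local Chern-Weil theory: algebra-valued 1-forms on a vector space. -/

namespace ChernWeil

variable {E F 𝔸 : Type*} [NormedAddCommGroup E] [NormedSpace ℝ E]
  [NormedAddCommGroup F] [NormedSpace ℝ F] [NormedRing 𝔸] [NormedAlgebra ℝ 𝔸]

/-- The exterior derivative of a vector-valued 1-form. -/
def extD (α : E → E →L[ℝ] F) (y v w : E) : F := fderiv ℝ α y v w - fderiv ℝ α y w v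

/-- The curvature `dA + A ∧ A` of an algebra-valued 1-form. -/
def curv (A : E → E →L[ℝ] 𝔸) (y v w : E) : 𝔸 :=
  extD A y v w + (A y v * A y w - A y w * A y v)

theorem fderiv_apply_const {G : Type*} [NormedAddCommGroup G] [NormedSpace ℝ G]
    {α : E → G →L[ℝ] F} {y : E} (h : DifferentiableAt ℝ α y) (v : E) (w : G) :
    fderiv ℝ (fun z => α z w) y v = fderiv ℝ α y v w := by
  have := (h.hasFDerivAt.clm_apply (hasFDerivAt_const w y)).fderiv
  rw [this]; simp

theorem extD_congr {α β : E → E →L[ℝ] F} {y : E} (h : α =ᶠ[𝓝 y] β) (v w : E) :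
    extD α y v w = extD β y v w := by
  simp [extD, h.fderiv_eq]

theorem curv_congr {A B : E → E →L[ℝ] 𝔸} {y : E} (h : A =ᶠ[𝓝 y] B) (v w : E) :
    curv A y v w = curv B y v w := by
  simp [curv, extD_congr h, h.self_of_nhds]

theorem curv_swap (A : E → E →L[ℝ] 𝔸) (y v w : E) : curv A y v w = - curv A y w v := by
  simp only [curv, extD]; abel

theorem snd_fderiv_symm {φ : E → F} {y : E} (h : ContDiffAt ℝ 2 φ y) (v w : E) :
    fderiv ℝ (fderiv ℝ φ) y v w = fderiv ℝ (fderiv ℝ φ) y w v := by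
  have := h.isSymmSndFDerivAt (by simp)
  exact this v w

theorem differentiableAt_fderiv {φ : E → F} {y : E} (h : ContDiffAt ℝ 2 φ y) :
    DifferentiableAt ℝ (fderiv ℝ φ) y :=
  (h.fderiv_right (m := 1) (by norm_num)).differentiableAt (by norm_num)

/-- The product rule produces an extra term in which `α` is applied to the second derivative of `φ`.
It disappears after antisymmetrisation. -/
theorem extD_pullback {E' : Type*} [NormedAddCommGroup E'] [NormedSpace ℝ E']
    {α : E' → E' →L[ℝ] F} {φ : E → E'} {y : E}
    (hα : DifferentiableAt ℝ α (φ y)) (hφ : ContDiffAt ℝ 2 φ y) (v w : E) :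
    extD (fun z => (α (φ z)).comp (fderiv ℝ φ z)) y v w =
      extD α (φ y) (fderiv ℝ φ y v) (fderiv ℝ φ y w) := by
  have hd : HasFDerivAt φ (fderiv ℝ φ y) y := (hφ.differentiableAt (by norm_num)).hasFDerivAt
  have h1 := (hα.hasFDerivAt.comp y hd).clm_comp (differentiableAt_fderiv hφ).hasFDerivAt
  have h2 : fderiv ℝ (fun z => (α (φ z)).comp (fderiv ℝ φ z)) y = _ := h1.fderiv
  simp only [extD, h2]
  simp [snd_fderiv_symm hφ v w]

/-- Naturality of the curvature. It serves both for changes of chart and for pulling back to the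
double cover. -/
theorem curv_pullback {E' : Type*} [NormedAddCommGroup E'] [NormedSpace ℝ E']
    {A : E' → E' →L[ℝ] 𝔸} {φ : E → E'} {y : E}
    (hA : DifferentiableAt ℝ A (φ y)) (hφ : ContDiffAt ℝ 2 φ y) (v w : E) :
    curv (fun z => (A (φ z)).comp (fderiv ℝ φ z)) y v w =
      curv A (φ y) (fderiv ℝ φ y v) (fderiv ℝ φ y w) := by
  rw [curv, extD_pullback hA hφ]
  rfl

/-- The curvature is conjugated by a change of gauge. -/
theorem curv_gauge {A A' : E → E →L[ℝ] 𝔸} {g u : E → 𝔸} {y : E}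
    (hA : DifferentiableAt ℝ A y) (hg : ContDiffAt ℝ 2 g y) (hu : DifferentiableAt ℝ u y)
    (hug : ∀ᶠ z in 𝓝 y, u z * g z = 1) (hgu : g y * u y = 1)
    (hA' : ∀ᶠ z in 𝓝 y, ∀ v, A' z v = u z * A z v * g z + u z * fderiv ℝ g z v)
    (hA'd : DifferentiableAt ℝ A' y) (v w : E) :
    curv A' y v w = u y * curv A y v w * g y := by
  have hgd : HasFDerivAt g (fderiv ℝ g y) y := (hg.differentiableAt (by norm_num)).hasFDerivAt
  -- The derivative of an inverse, found by differentiating `u * g = 1`.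
  have hdu : ∀ v, fderiv ℝ u y v = - (u y * fderiv ℝ g y v * u y) := by
    intro v
    have h1 := (hu.hasFDerivAt.mul' hgd).fderiv
    have h2 : fderiv ℝ (fun z => u z * g z) y = 0 := by
      have : (fun z => u z * g z) =ᶠ[𝓝 y] fun _ => (1 : 𝔸) := hug
      rw [this.fderiv_eq]; simp
    have h3 : u y * fderiv ℝ g y v + fderiv ℝ u y v * g y = 0 := by
      have := congrArg (fun l => l v) (h1.symm.trans h2)
      simpa using this
    have h4 : fderiv ℝ u y v = fderiv ℝ u y v * g y * u y := by rw [mul_assoc, hgu, mul_one]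
    rw [h4, eq_neg_of_add_eq_zero_right h3, neg_mul]
  have key : ∀ v w, fderiv ℝ A' y v w =
      u y * A y w * fderiv ℝ g y v + (u y * fderiv ℝ A y v w + fderiv ℝ u y v * A y w) * g y +
      (u y * fderiv ℝ (fderiv ℝ g) y v w + fderiv ℝ u y v * fderiv ℝ g y w) := by
    intro v w
    rw [← fderiv_apply_const hA'd]
    have h1 : (fun z => A' z w) =ᶠ[𝓝 y] fun z => u z * A z w * g z + u z * fderiv ℝ g z w := by
      filter_upwards [hA'] with z hz using hz w
    rw [h1.fderiv_eq]
    have hAw := hA.hasFDerivAt.clm_apply (hasFDerivAt_const w y)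
    have hgw := (differentiableAt_fderiv hg).hasFDerivAt.clm_apply (hasFDerivAt_const w y)
    have h2 := ((hu.hasFDerivAt.mul' hAw).mul' hgd).add (hu.hasFDerivAt.mul' hgw)
    have h3 : fderiv ℝ (fun z => u z * A z w * g z + u z * fderiv ℝ g z w) y = _ := h2.fderiv
    rw [h3]
    simp [add_mul]
  have hA'y := hA'.self_of_nhds
  -- The second derivatives of `g` cancel by symmetry. The rest is an identity modulo `g y * u y =
  -- 1`; `e1` and `e2` contract this product inside the quadratic term.
  simp only [curv, extD, key, hA'y, hdu, snd_fderiv_symm hg v w]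
  have e1 : ∀ x z : 𝔸, x * g y * (u y * z) = x * z := by
    intro x z; rw [mul_assoc, ← mul_assoc (g y), hgu, one_mul]
  have e2 : ∀ X d e x: 𝔸, (u y * X * g y + u y * d) * (u y * x * g y + u y * e) =
      u y * X * x * g y + u y * X * e + u y * d * u y * x * g y + u y * d * u y * e := by
    intro X d e x
    rw [add_mul, mul_add, mul_add, mul_assoc (u y) x, e1, e1]
    noncomm_ring
  rw [e2, e2]
  noncomm_ring

/-- The wedge product of two 2-forms, evaluated on four vectors, with respect to a pairing. -/
def wedge22 {𝔸 𝔹 ℂ' : Type*} [AddCommGroup ℂ'] (P : 𝔸 → 𝔹 → ℂ') (F : Fin 4 → Fin 4 → 𝔸)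
    (G : Fin 4 → Fin 4 → 𝔹) : ℂ' :=
  P (F 0 1) (G 2 3) - P (F 0 2) (G 1 3) + P (F 0 3) (G 1 2) +
    P (F 1 2) (G 0 3) - P (F 1 3) (G 0 2) + P (F 2 3) (G 0 1)

/-- The pairing of the second Chern form attached to a trace. -/
def chernPairing (τ : 𝔸 →L[ℝ] ℂ) (X Y : 𝔸) : ℂ := τ (X * Y) - τ X * τ Y

/-- The covariant derivative of a function in the direction `v`. -/
def covD (A : E → E →L[ℝ] 𝔸) (X : E → 𝔸) (y v : E) : 𝔸 :=
  fderiv ℝ X y v + (A y v * X y - X y * A y v)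

/-- A trace kills commutators: `[A, X] Y + X [A, Y] = [A, X Y]`. So ordinary derivatives of the
pairing may be replaced by covariant ones. -/
theorem fderiv_chernPairing (τ : 𝔸 →L[ℝ] ℂ) (hτ : ∀ X Y, τ (X * Y) = τ (Y * X))
    (A : E → E →L[ℝ] 𝔸) {X Y : E → 𝔸} {y : E} (hX : DifferentiableAt ℝ X y)
    (hY : DifferentiableAt ℝ Y y) (v : E) :
    fderiv ℝ (fun z => chernPairing τ (X z) (Y z)) y v =
      chernPairing τ (covD A X y v) (Y y) + chernPairing τ (X y) (covD A Y y v) := by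
  have h1 := (τ.hasFDerivAt.comp y (hX.hasFDerivAt.mul' hY.hasFDerivAt)).sub
    ((τ.hasFDerivAt.comp y hX.hasFDerivAt).mul (τ.hasFDerivAt.comp y hY.hasFDerivAt))
  have h2 : fderiv ℝ (fun z => chernPairing τ (X z) (Y z)) y = _ := h1.fderiv
  rw [h2]
  have e1 := hτ (A y v) (X y)
  have e2 := hτ (A y v) (Y y)
  have e3 := hτ (A y v) (X y * Y y)
  simp only [chernPairing, covD, mul_add, add_mul, map_add, map_sub, mul_sub, sub_mul,
    sub_apply, add_apply, ContinuousLinearMap.comp_apply,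
    smul_apply, smul_eq_mul, Function.comp_apply, e1, e2,
    MulOpposite.smul_eq_mul_unop, MulOpposite.unop_op] at *
  have e4 : τ (A y v * X y * Y y) = τ (X y * (Y y * A y v)) := by
    rw [mul_assoc, e3, mul_assoc]
  rw [e4, mul_assoc (X y) (A y v)]
  ring

/-- Bianchi identity on constant vector fields. The second derivatives of `A` cancel in pairs by
symmetry, the mixed terms cancel against the commutators of `covD`, and the cubic terms satisfy the
Jacobi identity. -/
theorem bianchi {A : E → E →L[ℝ] 𝔸} {y : E} (hA : ContDiffAt ℝ 2 A y) (v w x : E) :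
    covD A (fun z => curv A z v w) y x + covD A (fun z => curv A z w x) y v +
      covD A (fun z => curv A z x v) y w = 0 := by
  have hd := hA.differentiableAt (by norm_num)
  have h2 := differentiableAt_fderiv hA
  have key : ∀ v w x, fderiv ℝ (fun z => curv A z v w) y x =
      fderiv ℝ (fderiv ℝ A) y x v w - fderiv ℝ (fderiv ℝ A) y x w v +
      ((A y v * fderiv ℝ A y x w + fderiv ℝ A y x v * A y w) -
        (A y w * fderiv ℝ A y x v + fderiv ℝ A y x w * A y v)) := by
    intro v w x
    have hv := hd.hasFDerivAt.clm_apply (hasFDerivAt_const v y)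
    have hw := hd.hasFDerivAt.clm_apply (hasFDerivAt_const w y)
    have hvw := (h2.hasFDerivAt.clm_apply (hasFDerivAt_const v y)).clm_apply (hasFDerivAt_const w y)
    have hwv := (h2.hasFDerivAt.clm_apply (hasFDerivAt_const w y)).clm_apply (hasFDerivAt_const v y)
    have h3 := (hvw.sub hwv).add ((hv.mul' hw).sub (hw.mul' hv))
    have h4 : fderiv ℝ (fun z => curv A z v w) y = _ := h3.fderiv
    rw [h4]
    simp
  simp only [covD, key]
  simp only [curv, extD]
  have s1 : fderiv ℝ (fderiv ℝ A) y x v = fderiv ℝ (fderiv ℝ A) y v x := snd_fderiv_symm hA x v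
  have s2 : fderiv ℝ (fderiv ℝ A) y w v = fderiv ℝ (fderiv ℝ A) y v w := snd_fderiv_symm hA w v
  have s3 : fderiv ℝ (fderiv ℝ A) y x w = fderiv ℝ (fderiv ℝ A) y w x := snd_fderiv_symm hA x w
  rw [s1, s2, s3]
  noncomm_ring

/-- A component of the transgression 3-form between the connections `A + a / 2` and `A - a / 2`. -/
def transgression (τ : 𝔸 →L[ℝ] ℂ) (A a : E → E →L[ℝ] 𝔸) (u v w : E) (y : E) : ℂ :=
  2 * (chernPairing τ (a y u) (curv A y v w) - chernPairing τ (a y v) (curv A y u w) +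
    chernPairing τ (a y w) (curv A y u v)) +
  (1 / 2) * chernPairing τ (a y u) (a y v * a y w - a y w * a y v)

theorem differentiableAt_curv {A : E → E →L[ℝ] 𝔸} {y : E} (hA : ContDiffAt ℝ 2 A y) (v w : E) :
    DifferentiableAt ℝ (fun z => curv A z v w) y := by
  have hd := hA.differentiableAt (by norm_num)
  have h2 := differentiableAt_fderiv hA
  have c : ∀ v, DifferentiableAt ℝ (fun z => A z v) y := fun v =>
    hd.clm_apply (differentiableAt_const v)
  have c2 : ∀ v w, DifferentiableAt ℝ (fun z => fderiv ℝ A z v w) y := fun v w =>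
    (h2.clm_apply (differentiableAt_const v)).clm_apply (differentiableAt_const w)
  exact ((c2 v w).sub (c2 w v)).add (((c v).mul (c w)).sub ((c w).mul (c v)))

theorem differentiableAt_chernPairing (τ : 𝔸 →L[ℝ] ℂ) {X Y : E → 𝔸} {y : E}
    (hX : DifferentiableAt ℝ X y) (hY : DifferentiableAt ℝ Y y) :
    DifferentiableAt ℝ (fun z => chernPairing τ (X z) (Y z)) y :=
  (τ.differentiableAt.comp y (hX.mul hY)).sub
    ((τ.differentiableAt.comp y hX).mul (τ.differentiableAt.comp y hY))

/-- All derivatives are rewritten as covariant derivatives. In the cubic term cyclicity of the trace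
moves the differentiated factor to the front, so that it takes the same form in all three slots. -/
theorem fderiv_transgression (τ : 𝔸 →L[ℝ] ℂ) (hτ : ∀ X Y, τ (X * Y) = τ (Y * X))
    {A a : E → E →L[ℝ] 𝔸} {y : E} (hA : ContDiffAt ℝ 2 A y) (ha : DifferentiableAt ℝ a y)
    (u v w x : E) :
    let c := chernPairing τ
    let D : E → E → 𝔸 := fun x u => covD A (fun z => a z u) y x
    let DF : E → E → E → 𝔸 := fun x u v => covD A (fun z => curv A z u v) y x
    fderiv ℝ (transgression τ A a u v w) y x =
      2 * (c (D x u) (curv A y v w) + c (a y u) (DF x v w)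
        - c (D x v) (curv A y u w) - c (a y v) (DF x u w)
        + c (D x w) (curv A y u v) + c (a y w) (DF x u v)) +
      (1 / 2) * (c (D x u) (a y v * a y w - a y w * a y v) +
        c (D x v) (a y w * a y u - a y u * a y w) + c (D x w) (a y u * a y v - a y v * a y u)) := by
  intro c D DF
  have da : ∀ u, DifferentiableAt ℝ (fun z => a z u) y := fun u =>
    ha.clm_apply (differentiableAt_const u)
  have dF := differentiableAt_curv hA
  have dd : ∀ v w, DifferentiableAt ℝ (fun z => a z v * a z w - a z w * a z v) y := fun v w =>
    ((da v).mul (da w)).sub ((da w).mul (da v))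
  have d1 := fun u v w => (differentiableAt_chernPairing τ (da u) (dF v w)).hasFDerivAt
  have d2 := (differentiableAt_chernPairing τ (da u) (dd v w)).hasFDerivAt
  have h1 := ((((d1 u v w).sub (d1 v u w)).add (d1 w u v)).const_mul (2 : ℂ)).add
    (d2.const_mul (1 / 2 : ℂ))
  have h2 : fderiv ℝ (transgression τ A a u v w) y = _ := h1.fderiv
  have hcov : covD A (fun z => a z v * a z w - a z w * a z v) y x =
      D x v * a y w + a y v * D x w - D x w * a y v - a y w * D x v := by
    have := ((da v).hasFDerivAt.mul' (da w).hasFDerivAt).sub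
      ((da w).hasFDerivAt.mul' (da v).hasFDerivAt)
    have h3 : fderiv ℝ (fun z => a z v * a z w - a z w * a z v) y = _ := this.fderiv
    simp only [covD, h3, D]
    simp
    noncomm_ring
  rw [h2]
  have k : chernPairing τ (a y u) (D x v * a y w + a y v * D x w - D x w * a y v - a y w * D x v) =
      c (D x v) (a y w * a y u - a y u * a y w) + c (D x w) (a y u * a y v - a y v * a y u) := by
    have t3 : ∀ X Y Z, τ (X * (Y * Z)) = τ (Y * (Z * X)) := fun X Y Z => by
      rw [hτ X, mul_assoc]
    simp only [c, chernPairing, mul_add, mul_sub, map_add, map_sub, hτ (a y w) (a y u),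
      hτ (a y v) (a y u), hτ (D x v) (a y w), hτ (D x w) (a y v), sub_self, mul_zero, sub_zero]
    rw [t3 (a y u) (D x v), t3 (a y u) (a y v) (D x w), t3 (a y v) (D x w), t3 (a y u) (D x w),
      t3 (a y u) (a y w) (D x v), t3 (a y w) (D x v)]
    ring
  simp only [add_apply, smul_apply,
    sub_apply, smul_eq_mul]
  rw [fderiv_chernPairing τ hτ A (da u) (dF v w), fderiv_chernPairing τ hτ A (da v) (dF u w),
    fderiv_chernPairing τ hτ A (da w) (dF u v), fderiv_chernPairing τ hτ A (da u) (dd v w),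
    hcov, k]
  simp only [D, DF, c]
  ring

/-- The difference of the second Chern forms of two connections is exact. -/
theorem wedge22_sub_eq_fderiv_transgression (τ : 𝔸 →L[ℝ] ℂ) (hτ : ∀ X Y, τ (X * Y) = τ (Y * X))
    {A a : E → E →L[ℝ] 𝔸} {y : E} (hA : ContDiffAt ℝ 2 A y) (ha : DifferentiableAt ℝ a y)
    (v : Fin 4 → E) :
    let F₁ := fun k l => curv (fun z => A z + (1 / 2 : ℝ) • a z) y (v k) (v l)
    let F₀ := fun k l => curv (fun z => A z - (1 / 2 : ℝ) • a z) y (v k) (v l)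
    wedge22 (chernPairing τ) F₁ F₁ - wedge22 (chernPairing τ) F₀ F₀ =
      fderiv ℝ (transgression τ A a (v 1) (v 2) (v 3)) y (v 0) -
      fderiv ℝ (transgression τ A a (v 0) (v 2) (v 3)) y (v 1) +
      fderiv ℝ (transgression τ A a (v 0) (v 1) (v 3)) y (v 2) -
      fderiv ℝ (transgression τ A a (v 0) (v 1) (v 2)) y (v 3) := by
  -- The transgression is `2 ∫ P(a, F_t) dt` along `A + t a` for `|t| ≤ 1/2`, with `F_t = F + t d_A
  -- a + t² a ∧ a`. The symmetric interval removes the term linear in `t`. The cubic coefficient is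
  -- `2 · (1/12) · 3 = 1/2`, because the three shuffles of `P(a, a ∧ a)` agree.
  intro F₁ F₀
  have hd := hA.differentiableAt (by norm_num)
  set D : E → E → 𝔸 := fun x u => covD A (fun z => a z u) y x with hD
  have hD' : ∀ x u, D x u = fderiv ℝ a y x u + (A y x * a y u - a y u * A y x) := fun x u => by
    simp only [hD, covD]; rw [fderiv_apply_const ha]
  set H : E → E → 𝔸 := fun x u => a y x * a y u - a y u * a y x with hH
  have e1 : ∀ k l, F₁ k l = curv A y (v k) (v l) + (1 / 2 : ℝ) • (D (v k) (v l) - D (v l) (v k)) +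
      (1 / 4 : ℝ) • H (v k) (v l) := by
    intro k l
    have := (hd.hasFDerivAt.add (ha.hasFDerivAt.const_smul (1 / 2 : ℝ))).fderiv
    have h3 : fderiv ℝ (fun z => A z + (1 / 2 : ℝ) • a z) y = _ := this
    simp only [F₁, curv, extD, h3, hD', hH]
    simp only [add_apply, smul_apply, mul_add, add_mul,
      smul_mul_assoc, mul_smul_comm, smul_smul, smul_sub, smul_add]
    module
  have e0 : ∀ k l, F₀ k l = curv A y (v k) (v l) - (1 / 2 : ℝ) • (D (v k) (v l) - D (v l) (v k)) +
      (1 / 4 : ℝ) • H (v k) (v l) := by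
    intro k l
    have := (hd.hasFDerivAt.sub (ha.hasFDerivAt.const_smul (1 / 2 : ℝ))).fderiv
    have h3 : fderiv ℝ (fun z => A z - (1 / 2 : ℝ) • a z) y = _ := this
    simp only [F₀, curv, extD, h3, hD', hH]
    simp only [sub_apply, smul_apply, mul_sub, sub_mul,
      smul_mul_assoc, mul_smul_comm, smul_smul, smul_sub, smul_add]
    module
  have cs : ∀ X Y, chernPairing τ X Y = chernPairing τ Y X := fun X Y => by
    simp only [chernPairing, hτ X Y, mul_comm]
  -- Only the terms of odd degree in `Y`, `Y'` survive in the difference of the two endpoints.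
  have pol : ∀ X Y Z : 𝔸, ∀ X' Y' Z' : 𝔸,
      chernPairing τ (X + (1 / 2 : ℝ) • Y + (1 / 4 : ℝ) • Z) (X' + (1 / 2 : ℝ) • Y' + (1 / 4 : ℝ) • Z') -
      chernPairing τ (X - (1 / 2 : ℝ) • Y + (1 / 4 : ℝ) • Z) (X' - (1 / 2 : ℝ) • Y' + (1 / 4 : ℝ) • Z') =
      chernPairing τ Y X' + chernPairing τ Y' X +
        (1 / 4) * (chernPairing τ Y Z' + chernPairing τ Y' Z) := by
    intro X Y Z X' Y' Z'
    rw [cs Y' X, cs Y' Z]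
    simp only [chernPairing, mul_add, add_mul, mul_sub, sub_mul, map_add, map_sub, map_smul,
      smul_mul_assoc, mul_smul_comm, Complex.real_smul]
    push_cast
    ring
  have subl : ∀ X Y Z, chernPairing τ (X - Y) Z = chernPairing τ X Z - chernPairing τ Y Z := by
    intro X Y Z
    simp only [chernPairing, sub_mul, map_sub]; ring
  have addr : ∀ X Y Z, chernPairing τ Z (X + Y) = chernPairing τ Z X + chernPairing τ Z Y := by
    intro X Y Z
    simp only [chernPairing, mul_add, map_add]; ring
  have negr : ∀ X Z, chernPairing τ Z (-X) = - chernPairing τ Z X := by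
    intro X Z
    simp only [chernPairing, mul_neg, map_neg]; ring
  have zr : ∀ Z, chernPairing τ Z 0 = 0 := fun Z => by simp [chernPairing]
  -- Bianchi
  have neg2 : ∀ v w x, covD A (fun z => curv A z v w) y x =
      - covD A (fun z => curv A z w v) y x := by
    intro v w x
    have h1 : (fun z => curv A z v w) = fun z => - curv A z w v :=
      funext fun z => curv_swap A z _ _
    simp only [covD, h1, fderiv_fun_neg, neg_apply, curv_swap A y v w]
    noncomm_ring
  -- The Bianchi identity paired with a fixed element, with the signs in which the derivatives of
  -- the curvature occur in the exterior derivative of the transgression.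
  have B : ∀ Z x v w, chernPairing τ Z (covD A (fun z => curv A z v w) y x) -
      chernPairing τ Z (covD A (fun z => curv A z x w) y v) +
      chernPairing τ Z (covD A (fun z => curv A z x v) y w) = 0 := by
    intro Z x v w
    have h2 := bianchi hA v w x
    rw [neg2 w x] at h2
    rw [sub_eq_add_neg, ← negr, ← addr, ← addr, h2, zr]
  have hH2 : ∀ x u, a y x * a y u - a y u * a y x = H x u := fun _ _ => rfl
  have hHs : ∀ x u, H x u = - H u x := fun x u => by simp only [hH]; abel
  simp only [fderiv_transgression τ hτ hA ha, wedge22, e1, e0]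
  have Fs : ∀ u v, curv A y u v = - curv A y v u := fun u v => curv_swap A y u v
  have P1 := pol (curv A y (v 0) (v 1)) (D (v 0) (v 1) - D (v 1) (v 0)) (H (v 0) (v 1))
    (curv A y (v 2) (v 3)) (D (v 2) (v 3) - D (v 3) (v 2)) (H (v 2) (v 3))
  have P2 := pol (curv A y (v 0) (v 2)) (D (v 0) (v 2) - D (v 2) (v 0)) (H (v 0) (v 2))
    (curv A y (v 1) (v 3)) (D (v 1) (v 3) - D (v 3) (v 1)) (H (v 1) (v 3))
  have P3 := pol (curv A y (v 0) (v 3)) (D (v 0) (v 3) - D (v 3) (v 0)) (H (v 0) (v 3))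
    (curv A y (v 1) (v 2)) (D (v 1) (v 2) - D (v 2) (v 1)) (H (v 1) (v 2))
  have P4 := pol (curv A y (v 1) (v 2)) (D (v 1) (v 2) - D (v 2) (v 1)) (H (v 1) (v 2))
    (curv A y (v 0) (v 3)) (D (v 0) (v 3) - D (v 3) (v 0)) (H (v 0) (v 3))
  have P5 := pol (curv A y (v 1) (v 3)) (D (v 1) (v 3) - D (v 3) (v 1)) (H (v 1) (v 3))
    (curv A y (v 0) (v 2)) (D (v 0) (v 2) - D (v 2) (v 0)) (H (v 0) (v 2))
  have P6 := pol (curv A y (v 2) (v 3)) (D (v 2) (v 3) - D (v 3) (v 2)) (H (v 2) (v 3))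
    (curv A y (v 0) (v 1)) (D (v 0) (v 1) - D (v 1) (v 0)) (H (v 0) (v 1))
  have B0 := B (a y (v 0)) (v 1) (v 2) (v 3)
  have B1 := B (a y (v 1)) (v 0) (v 2) (v 3)
  have B2 := B (a y (v 2)) (v 0) (v 1) (v 3)
  have B3 := B (a y (v 3)) (v 0) (v 1) (v 2)
  simp only [hH2, subl, ← hD] at *
  rw [hHs (v 3) (v 1), hHs (v 3) (v 0), hHs (v 2) (v 0)]
  simp only [negr]
  -- One polarisation for each of the six shuffles. The four Bianchi identities remove the
  -- derivatives of the curvature, one for each slot of `a`.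
  linear_combination P1 - P2 + P3 + P4 - P5 + P6 + 2 * B0 - 2 * B1 + 2 * B2 - 2 * B3

/-- The pairing of the second Chern form as a bilinear map. -/
def chernPairingₗ (τ : 𝔸 →L[ℝ] ℂ) : 𝔸 →ₗ[ℝ] 𝔸 →ₗ[ℝ] ℂ :=
  LinearMap.mk₂ ℝ (chernPairing τ)
    (fun X Y Z => by simp only [chernPairing, add_mul, map_add]; ring)
    (fun c X Y => by
      simp only [chernPairing, smul_mul_assoc, map_smul, Complex.real_smul]; ring)
    (fun X Y Z => by simp only [chernPairing, mul_add, map_add]; ring)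
    (fun c X Y => by
      simp only [chernPairing, mul_smul_comm, map_smul, Complex.real_smul]; ring)

/-- The curvature at a point as a bilinear map. -/
def curvₗ (A : E → E →L[ℝ] 𝔸) (y : E) : E →ₗ[ℝ] E →ₗ[ℝ] 𝔸 :=
  LinearMap.mk₂ ℝ (curv A y)
    (fun v w x => by
      simp only [curv, extD, map_add, add_apply, add_mul, mul_add]; abel)
    (fun c v w => by
      simp only [curv, extD, map_smul, smul_apply, smul_mul_assoc, mul_smul_comm]; module)
    (fun v w x => by
      simp only [curv, extD, map_add, add_apply, add_mul, mul_add]; abel)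
    (fun c v w => by
      simp only [curv, extD, map_smul, smul_apply, smul_mul_assoc, mul_smul_comm]; module)

theorem curv_self (A : E → E →L[ℝ] 𝔸) (y v : E) : curv A y v v = 0 := by
  simp [curv, extD]

section Wedge

variable {V 𝔹 ℭ W : Type*} [AddCommGroup V] [Module ℝ V] [AddCommGroup 𝔹] [Module ℝ 𝔹]
  [AddCommGroup ℭ] [Module ℝ ℭ] [AddCommGroup W] [Module ℝ W]

/-- The wedge product of two 2-forms as an alternating map. -/
def wedge22Alt (P : 𝔹 →ₗ[ℝ] ℭ →ₗ[ℝ] W) (F : V →ₗ[ℝ] V →ₗ[ℝ] 𝔹) (G : V →ₗ[ℝ] V →ₗ[ℝ] ℭ)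
    (hF : ∀ v, F v v = 0) (hG : ∀ v, G v v = 0) : V [⋀^Fin 4]→ₗ[ℝ] W where
  toFun v := wedge22 (fun X Y => P X Y) (fun k l => F (v k) (v l)) (fun k l => G (v k) (v l))
  map_update_add' v i x y := by
    -- The field quantifies over all decidability instances; with the canonical one
    -- `Function.update` can be evaluated.
    have e : ‹DecidableEq (Fin 4)› = instDecidableEqFin 4 := Subsingleton.elim _ _
    subst e
    fin_cases i <;> simp [wedge22, Function.update] <;> abel
  map_update_smul' v i c x := by
    have e : ‹DecidableEq (Fin 4)› = instDecidableEqFin 4 := Subsingleton.elim _ _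
    subst e
    fin_cases i <;> simp [wedge22, Function.update] <;> module
  map_eq_zero_of_eq' v i j h hij := by
    have hF' : ∀ v w, F v w = - F w v := fun v w => by
      have := hF (v + w)
      simp only [map_add, LinearMap.add_apply, hF, zero_add, add_zero] at this
      exact eq_neg_of_add_eq_zero_right this
    have hG' : ∀ v w, G v w = - G w v := fun v w => by
      have := hG (v + w)
      simp only [map_add, LinearMap.add_apply, hG, zero_add, add_zero] at this
      exact eq_neg_of_add_eq_zero_right this
    have key : ∀ i j : Fin 4, i < j → v i = v j →
        wedge22 (fun X Y => P X Y) (fun k l => F (v k) (v l)) (fun k l => G (v k) (v l)) = 0 := by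
      intro i j hij h
      fin_cases i <;> fin_cases j <;> simp at hij <;> simp at h <;>
        simp [wedge22, h, hF, hG]
      · rw [hF' (v 2) (v 1), hG' (v 2) (v 1)]; simp
      · rw [hF' (v 3) (v 1), hG' (v 3) (v 1), hF' (v 3) (v 2), hG' (v 3) (v 2)]; simp
      · rw [hF' (v 3) (v 2), hG' (v 3) (v 2)]; simp
    rcases lt_or_gt_of_ne hij with hl | hl
    · exact key i j hl h
    · exact key j i hl h.symm

/-- A real alternating form of top degree scales by the determinant. -/
theorem alternating_comp_det {ι : Type*} [Fintype ι] [DecidableEq ι] (b : Module.Basis ι ℝ V)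
    (f : V [⋀^ι]→ₗ[ℝ] ℝ) (A : V →ₗ[ℝ] V) : (f fun k => A (b k)) = LinearMap.det A * f b := by
  have h := congrArg (fun g => g fun k => A (b k)) (f.eq_smul_basis_det b)
  simp only [AlternatingMap.smul_apply, smul_eq_mul] at h
  rw [h, mul_comm]
  congr 1
  have := b.det_comp A b
  rw [b.det_self, mul_one] at this
  exact this

/-- A complex alternating form of top degree scales by the determinant. -/
theorem alternating_comp_det_complex {ι : Type*} [Fintype ι] [DecidableEq ι]
    (b : Module.Basis ι ℝ V) (f : V [⋀^ι]→ₗ[ℝ] ℂ) (A : V →ₗ[ℝ] V) :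
    (f fun k => A (b k)) = LinearMap.det A * f b := by
  apply Complex.ext
  · simpa using alternating_comp_det b (Complex.reLm.compAlternatingMap f) A
  · simpa using alternating_comp_det b (Complex.imLm.compAlternatingMap f) A

end Wedge

/-- The integral of the divergence of a compactly supported differentiable function vanishes. -/
theorem integral_fderiv_eq_zero [FiniteDimensional ℝ E] [MeasurableSpace E] [BorelSpace E]
    (μ : MeasureTheory.Measure E) [μ.IsAddHaarMeasure] {f : E → ℂ} (hf : ContDiff ℝ 1 f)
    (hc : HasCompactSupport f) (v : E) : ∫ y, fderiv ℝ f y v ∂μ = 0 := by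
  -- Integration by parts against the constant function `1`.
  have h := integral_smul_fderiv_eq_neg_fderiv_smul_of_integrable (μ := μ) (f := fun _ : E => (1 : ℝ))
    (g := f) (v := v) (by simp) ?_ ?_ (fun x _ => differentiableAt_const _)
    (fun x _ => (hf.differentiable (by norm_num)) x)
  · simpa using h
  · have hi : Continuous fun y => fderiv ℝ f y v :=
      (hf.continuous_fderiv (by norm_num)).clm_apply continuous_const
    simpa using hi.integrable_of_hasCompactSupport (hc.fderiv_apply ℝ v)
  · simpa using hf.continuous.integrable_of_hasCompactSupport hc

end ChernWeil

/-! ### Integration of densities on compact manifolds. -/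

namespace Density
open MeasureTheory

variable {E H : Type*} [NormedAddCommGroup E] [NormedSpace ℝ E] [TopologicalSpace H]
  {I : ModelWithCorners ℝ E H} {M : Type*} [TopologicalSpace M] [ChartedSpace H M]

variable (I M) in
/-- Functions of a point of `M` and a linear parametrisation of the tangent space there. -/
abbrev Field : Type _ := ∀ x : M, (E →L[ℝ] TangentSpace I x) → ℂ

/-- A density: a field that scales with the absolute value of the determinant. -/
def IsDensity (w : Field I M) : Prop :=
  ∀ (x : M) (L : E →L[ℝ] TangentSpace I x) (A : E →L[ℝ] E), w x (L.comp A) = |A.det| * w x L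

/-- The pullback of a field along a parametrisation. -/
def pull (w : Field I M) (ψ : E → M) (y : E) : ℂ := w (ψ y) (mfderiv 𝓘(ℝ, E) I ψ y)

/-- The product of a function and a field. -/
def mulField (f : M → ℝ) (w : Field I M) : Field I M := fun x L => f x * w x L

theorem IsDensity.mulField {w : Field I M} (hw : IsDensity w) (f : M → ℝ) :
    IsDensity (mulField f w) := by
  intro x L A
  simp only [Density.mulField, hw x L A]; ring

/-- Every tangent space is `E` by definition, so a parametrisation can be moved along an equality of
base points, which rewriting in a dependent type does not allow. -/
theorem field_congr (w : Field I M) {p q : M} (h : p = q) (L : E →L[ℝ] E) :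
    (w p : (E →L[ℝ] E) → ℂ) L = (w q : (E →L[ℝ] E) → ℂ) L := by
  subst h; rfl

theorem pull_congr (w : Field I M) {ψ ψ' : E → M} {y : E} (h : ψ =ᶠ[𝓝 y] ψ') :
    pull w ψ y = pull w ψ' y :=
  (field_congr w h.self_of_nhds (mfderiv 𝓘(ℝ, E) I ψ y)).trans
    (congrArg (w (ψ' y)) h.mfderiv_eq)

theorem pull_comp {w : Field I M} (hw : IsDensity w) {ψ : E → M} {φ : E → E} {y : E}
    (hψ : MDifferentiableAt 𝓘(ℝ, E) I ψ (φ y)) (hφ : DifferentiableAt ℝ φ y) :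
    pull w (ψ ∘ φ) y = |(fderiv ℝ φ y).det| * pull w ψ (φ y) := by
  have h := mfderiv_comp y hψ hφ.mdifferentiableAt
  unfold pull
  rw [h, mfderiv_eq_fderiv]
  exact hw (ψ (φ y)) _ _

/-- A differentiable chart with values in the model vector space. -/
structure IsSmoothChart (I : ModelWithCorners ℝ E H) (e : PartialEquiv M E) : Prop where
  open_source : IsOpen e.source
  open_target : IsOpen e.target
  mdiff : MDifferentiableOn I 𝓘(ℝ, E) e e.source
  mdiff_symm : MDifferentiableOn 𝓘(ℝ, E) I e.symm e.target

theorem isSmoothChart_extChartAt [I.Boundaryless] [IsManifold I ∞ M] (c : M) :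
    IsSmoothChart I (extChartAt I c) where
  open_source := isOpen_extChartAt_source c
  open_target := isOpen_extChartAt_target c
  mdiff := by
    have := (contMDiffOn_extChartAt (I := I) (n := ∞) (x := c)).mdifferentiableOn (by simp)
    simpa using this
  mdiff_symm := (contMDiffOn_extChartAt_symm (I := I) (n := ∞) c).mdifferentiableOn (by simp)

section ChangeOfChart

variable {e₁ e₂ : PartialEquiv M E} (h₁ : IsSmoothChart I e₁) (h₂ : IsSmoothChart I e₂)
include h₁ h₂

theorem isOpen_overlap : IsOpen (e₁.target ∩ e₁.symm ⁻¹' e₂.source) :=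
  h₁.mdiff_symm.continuousOn.isOpen_inter_preimage h₁.open_target h₂.open_source

theorem differentiableAt_transition {y : E} (hy : y ∈ e₁.target ∩ e₁.symm ⁻¹' e₂.source) :
    DifferentiableAt ℝ (e₂ ∘ e₁.symm) y := by
  rw [← mdifferentiableAt_iff_differentiableAt]
  exact ((h₂.mdiff _ hy.2).mdifferentiableAt (h₂.open_source.mem_nhds hy.2)).comp y
    ((h₁.mdiff_symm y hy.1).mdifferentiableAt (h₁.open_target.mem_nhds hy.1))

/-- Near `y` the inverse of the first chart is the inverse of the second one composed with the
transition map, so the transformation law of a density applies. -/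
theorem pull_transition {w : Field I M} (hw : IsDensity w) {y : E}
    (hy : y ∈ e₁.target ∩ e₁.symm ⁻¹' e₂.source) :
    pull w e₁.symm y = |(fderiv ℝ (e₂ ∘ e₁.symm) y).det| * pull w e₂.symm ((e₂ ∘ e₁.symm) y) := by
  have ht : (e₂ ∘ e₁.symm) y ∈ e₂.target := e₂.map_source hy.2
  rw [← pull_comp hw ((h₂.mdiff_symm _ ht).mdifferentiableAt (h₂.open_target.mem_nhds ht))
    (differentiableAt_transition h₁ h₂ hy)]
  refine pull_congr w ?_
  filter_upwards [(isOpen_overlap h₁ h₂).mem_nhds hy] with z hz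
  exact (e₂.left_inv hz.2).symm

omit h₁ h₂ [NormedAddCommGroup E] [NormedSpace ℝ E] [TopologicalSpace M] in
theorem image_overlap : (e₂ ∘ e₁.symm) '' (e₁.target ∩ e₁.symm ⁻¹' e₂.source) =
    e₂.target ∩ e₂.symm ⁻¹' e₁.source := by
  ext z
  constructor
  · rintro ⟨y, hy, rfl⟩
    refine ⟨e₂.map_source hy.2, ?_⟩
    simp only [Function.comp_apply, mem_preimage, e₂.left_inv hy.2]
    exact e₁.map_target hy.1
  · rintro ⟨h1, h2⟩
    refine ⟨e₁ (e₂.symm z), ⟨e₁.map_source h2, ?_⟩, ?_⟩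
    · simp only [mem_preimage, e₁.left_inv h2]; exact e₂.map_target h1
    · simp only [Function.comp_apply, e₁.left_inv h2, e₂.right_inv h1]

variable [FiniteDimensional ℝ E] [MeasurableSpace E] [BorelSpace E] (μ : Measure E)
  [μ.IsAddHaarMeasure]

/-- The integral of a density supported in two charts can be computed in either. -/
theorem integral_chart_eq {w : Field I M} (hw : IsDensity w)
    (hs : ∀ x ∉ e₁.source ∩ e₂.source, ∀ L, w x L = 0) :
    (IntegrableOn (pull w e₁.symm) e₁.target μ ↔ IntegrableOn (pull w e₂.symm) e₂.target μ) ∧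
    ∫ y in e₁.target, pull w e₁.symm y ∂μ = ∫ y in e₂.target, pull w e₂.symm y ∂μ := by
  set A₁ := e₁.target ∩ e₁.symm ⁻¹' e₂.source with hA₁
  set A₂ := e₂.target ∩ e₂.symm ⁻¹' e₁.source with hA₂
  have o₁ : IsOpen A₁ := isOpen_overlap h₁ h₂
  have o₂ : IsOpen A₂ := isOpen_overlap h₂ h₁
  have z₁ : ∀ y ∈ e₁.target \ A₁, pull w e₁.symm y = 0 := by
    rintro y ⟨hy, hn⟩
    exact hs _ (fun h => hn ⟨hy, h.2⟩) _
  have z₂ : ∀ y ∈ e₂.target \ A₂, pull w e₂.symm y = 0 := by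
    rintro y ⟨hy, hn⟩
    exact hs _ (fun h => hn ⟨hy, h.1⟩) _
  have im : (e₂ ∘ e₁.symm) '' A₁ = A₂ := image_overlap
  have inj : InjOn (e₂ ∘ e₁.symm) A₁ := by
    intro y hy z hz h
    have h' := e₂.injOn hy.2 hz.2 h
    exact e₁.symm.injOn hy.1 hz.1 h'
  have hd : ∀ y ∈ A₁, HasFDerivWithinAt (e₂ ∘ e₁.symm) (fderiv ℝ (e₂ ∘ e₁.symm) y) A₁ y :=
    fun y hy => (differentiableAt_transition h₁ h₂ hy).hasFDerivAt.hasFDerivWithinAt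
  have hp : ∀ y ∈ A₁, |(fderiv ℝ (e₂ ∘ e₁.symm) y).det| • pull w e₂.symm ((e₂ ∘ e₁.symm) y) =
      pull w e₁.symm y := fun y hy => by
    rw [pull_transition h₁ h₂ hw hy, Complex.real_smul]
  -- The density vanishes off the overlap, so both sides reduce to `A₁` and `A₂`, which the
  -- transition map exchanges; the change of variables formula finishes.
  have i₁ : IntegrableOn (pull w e₁.symm) e₁.target μ ↔ IntegrableOn (pull w e₁.symm) A₁ μ :=
    ⟨fun h => h.mono_set inter_subset_left, fun h =>
      h.of_forall_sdiff_eq_zero h₁.open_target.measurableSet z₁⟩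
  have i₂ : IntegrableOn (pull w e₂.symm) e₂.target μ ↔ IntegrableOn (pull w e₂.symm) A₂ μ :=
    ⟨fun h => h.mono_set inter_subset_left, fun h =>
      h.of_forall_sdiff_eq_zero h₂.open_target.measurableSet z₂⟩
  constructor
  · rw [i₁, i₂, ← im, integrableOn_image_iff_integrableOn_abs_det_fderiv_smul μ o₁.measurableSet hd inj]
    exact integrableOn_congr_fun (fun y hy => (hp y hy).symm) o₁.measurableSet
  · have j₁ : ∫ y in e₁.target, pull w e₁.symm y ∂μ = ∫ y in A₁, pull w e₁.symm y ∂μ :=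
      (setIntegral_eq_of_subset_of_forall_sdiff_eq_zero h₁.open_target.measurableSet
        inter_subset_left z₁)
    have j₂ : ∫ y in e₂.target, pull w e₂.symm y ∂μ = ∫ y in A₂, pull w e₂.symm y ∂μ :=
      (setIntegral_eq_of_subset_of_forall_sdiff_eq_zero h₂.open_target.measurableSet
        inter_subset_left z₂)
    rw [j₁, j₂]
    rw [← im, integral_image_eq_integral_abs_det_fderiv_smul μ o₁.measurableSet hd inj]
    exact setIntegral_congr_fun o₁.measurableSet fun y hy => (hp y hy).symm

end ChangeOfChart

section Global

variable [FiniteDimensional ℝ E] [MeasurableSpace E] [BorelSpace E] (μ : Measure E)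
  [μ.IsAddHaarMeasure] [T2Space M] [CompactSpace M] [I.Boundaryless] [IsManifold I ∞ M]
  (ρ : SmoothPartitionOfUnity M I M univ)

/-- The integral of a density, computed with a partition of unity. -/
def integral (w : Field I M) : ℂ :=
  ∑ᶠ c : M, ∫ y in (extChartAt I c).target, pull (mulField (ρ c) w) (extChartAt I c).symm y ∂μ

/-- Integrability of a density with respect to a partition of unity. -/
def Integrable (w : Field I M) : Prop :=
  ∀ c : M, IntegrableOn (pull (mulField (ρ c) w) (extChartAt I c).symm) (extChartAt I c).target μ

/-- Continuity of a field in the charts. -/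
def IsCont (w : Field I M) : Prop :=
  ∀ c : M, ContinuousOn (pull w (extChartAt I c).symm) (extChartAt I c).target

omit [FiniteDimensional ℝ E] [MeasurableSpace E] [BorelSpace E] [T2Space M]
  [I.Boundaryless] [IsManifold I ∞ M] in
theorem finite_partition : {c : M | (Function.support (ρ c)).Nonempty}.Finite :=
  ρ.locallyFinite.finite_nonempty_of_compact

/-- The finitely many indices of nonzero members of a partition of unity. -/
def indices : Finset M := (finite_partition ρ).toFinset

omit [FiniteDimensional ℝ E] [MeasurableSpace E] [BorelSpace E] [T2Space M]
  [I.Boundaryless] [IsManifold I ∞ M] in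
theorem eq_zero_of_notMem_indices {c : M} (hc : c ∉ indices ρ) (x : M) : ρ c x = 0 := by
  by_contra h
  exact hc ((finite_partition ρ).mem_toFinset.2 ⟨x, h⟩)

omit [FiniteDimensional ℝ E] [MeasurableSpace E] [BorelSpace E] [T2Space M]
  [I.Boundaryless] [IsManifold I ∞ M] in
theorem sum_indices (x : M) : ∑ c ∈ indices ρ, ρ c x = 1 := by
  rw [← ρ.sum_eq_one (mem_univ x)]
  refine (finsum_eq_sum_of_support_subset _ fun c hc => ?_).symm
  by_contra h
  exact hc (eq_zero_of_notMem_indices ρ h x)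

omit [FiniteDimensional ℝ E] [T2Space M] [I.Boundaryless] [IsManifold I ∞ M] [BorelSpace E]
  [μ.IsAddHaarMeasure] in
theorem integral_eq_sum (w : Field I M) : integral μ ρ w = ∑ c ∈ indices ρ,
    ∫ y in (extChartAt I c).target, pull (mulField (ρ c) w) (extChartAt I c).symm y ∂μ := by
  refine finsum_eq_sum_of_support_subset _ fun c hc => ?_
  by_contra h
  apply hc
  have : pull (mulField (ρ c) w) (extChartAt I c).symm = 0 := by
    funext y
    simp only [pull, mulField, eq_zero_of_notMem_indices ρ h, Complex.ofReal_zero, zero_mul,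
      Pi.zero_apply]
  simp only [this, Pi.zero_apply, integral_zero]

omit [FiniteDimensional ℝ E] [T2Space M] [I.Boundaryless] [IsManifold I ∞ M] [BorelSpace E]
  [μ.IsAddHaarMeasure] in
theorem integral_sum {ι : Type*} (t : Finset ι) (w : ι → Field I M)
    (hw : ∀ i ∈ t, Integrable μ ρ (w i)) :
    integral μ ρ (fun x L => ∑ i ∈ t, w i x L) = ∑ i ∈ t, integral μ ρ (w i) := by
  simp only [integral_eq_sum]
  rw [Finset.sum_comm]
  refine Finset.sum_congr rfl fun c _ => ?_
  rw [← integral_finsetSum _ fun i hi => hw i hi c]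
  refine integral_congr_ae (ae_of_all _ fun y => ?_)
  simp [pull, mulField, Finset.mul_sum]

omit [FiniteDimensional ℝ E] [T2Space M] [I.Boundaryless] [IsManifold I ∞ M] [BorelSpace E]
  [μ.IsAddHaarMeasure] in
theorem integral_sub {w w' : Field I M} (hw : Integrable μ ρ w) (hw' : Integrable μ ρ w') :
    integral μ ρ (fun x L => w x L - w' x L) = integral μ ρ w - integral μ ρ w' := by
  simp only [integral_eq_sum]
  rw [← Finset.sum_sub_distrib]
  refine Finset.sum_congr rfl fun c _ => ?_
  rw [← MeasureTheory.integral_sub (hw c) (hw' c)]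
  refine integral_congr_ae (ae_of_all _ fun y => ?_)
  simp [pull, mulField, mul_sub]

variable {ρ} (hρ : ρ.IsSubordinate fun c => (chartAt H c).source)
include hρ

omit [FiniteDimensional ℝ E] [MeasurableSpace E] [BorelSpace E] [T2Space M] [CompactSpace M]
  [I.Boundaryless] [IsManifold I ∞ M] in
theorem eq_zero_of_notMem_source {c x : M} (hx : x ∉ (extChartAt I c).source) : ρ c x = 0 := by
  by_contra h
  apply hx
  rw [extChartAt_source]
  exact hρ c (subset_tsupport _ h)

/-- The integral of a density supported in a chart can be computed in the chart. -/
theorem integral_eq_of_chart {w : Field I M} (hw : IsDensity w) {e : PartialEquiv M E}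
    (he : IsSmoothChart I e) (hs : ∀ x ∉ e.source, ∀ L, w x L = 0)
    (hi : IntegrableOn (pull w e.symm) e.target μ) :
    Integrable μ ρ w ∧ integral μ ρ w = ∫ y in e.target, pull w e.symm y ∂μ := by
  have hz : ∀ c, ∀ x ∉ (extChartAt I c).source ∩ e.source, ∀ L, mulField (ρ c) w x L = 0 := by
    intro c x hx L
    by_cases h : x ∈ e.source
    · simp [mulField, eq_zero_of_notMem_source hρ (fun h' => hx ⟨h', h⟩)]
    · simp [mulField, hs x h]
  -- Each piece `ρ c * w` is supported in the chart at `c` and in `e`. All pieces are therefore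
  -- moved to `e`, where the functions `ρ c` add up to `1`.
  have key := fun c => integral_chart_eq (isSmoothChart_extChartAt c) he μ (hw.mulField (ρ c)) (hz c)
  have hint : ∀ c, IntegrableOn (pull (mulField (ρ c) w) e.symm) e.target μ := by
    intro c
    have hc : ContinuousOn (fun y => ((ρ c (e.symm y) : ℝ) : ℂ)) e.target :=
      Complex.continuous_ofReal.comp_continuousOn
        ((ρ c).contMDiff.continuous.comp_continuousOn he.mdiff_symm.continuousOn)
    refine MeasureTheory.Integrable.bdd_mul (c := 1) hi
      (hc.aestronglyMeasurable he.open_target.measurableSet) (ae_of_all _ fun y => ?_)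
    rw [Complex.norm_real, Real.norm_of_nonneg (ρ.nonneg c _)]
    exact ρ.le_one c _
  refine ⟨fun c => (key c).1.2 (hint c), ?_⟩
  rw [integral_eq_sum]
  simp only [fun c => (key c).2]
  rw [← integral_finsetSum _ fun c _ => hint c]
  refine integral_congr_ae (ae_of_all _ fun y => ?_)
  simp only [pull, mulField]
  rw [← Finset.sum_mul, ← Complex.ofReal_sum, sum_indices ρ, Complex.ofReal_one, one_mul]

omit hρ in
-- The chart image of the support of `f` is compact and contained in the target, and the coordinate
-- expression is continuous there and zero elsewhere.
theorem integrableOn_of_isCont {w : Field I M} (hw : IsCont w) {f : M → ℝ} (hf : Continuous f)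
    {c : M} (hc : tsupport f ⊆ (chartAt H c).source) :
    IntegrableOn (pull (mulField f w) (extChartAt I c).symm) (extChartAt I c).target μ := by
  have hsm := isSmoothChart_extChartAt (I := I) c
  have hK : IsCompact (extChartAt I c '' tsupport f) :=
    (isClosed_tsupport f).isCompact.image_of_continuousOn
      (hsm.mdiff.continuousOn.mono (by rwa [extChartAt_source]))
  have hKt : extChartAt I c '' tsupport f ⊆ (extChartAt I c).target := by
    rintro _ ⟨x, hx, rfl⟩
    exact (extChartAt I c).map_source (by rw [extChartAt_source]; exact hc hx)
  have hcont : ContinuousOn (pull (mulField f w) (extChartAt I c).symm) (extChartAt I c).target :=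
    (Complex.continuous_ofReal.comp_continuousOn
      (hf.comp_continuousOn hsm.mdiff_symm.continuousOn)).mul (hw c)
  refine IntegrableOn.of_forall_sdiff_eq_zero ((hcont.mono hKt).integrableOn_compact hK)
    hsm.open_target.measurableSet ?_
  rintro y ⟨hy, hn⟩
  have : f ((extChartAt I c).symm y) = 0 := by
    by_contra h
    exact hn ⟨_, subset_tsupport _ h, (extChartAt I c).right_inv hy⟩
  simp only [pull, mulField, this, Complex.ofReal_zero, zero_mul]

theorem IsCont.integrable {w : Field I M} (hw : IsCont w) : Integrable μ ρ w := fun c =>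
  integrableOn_of_isCont μ hw (ρ c).contMDiff.continuous (hρ c)

section Cover

variable {N : Type*} [TopologicalSpace N] [ChartedSpace H N] [T2Space N] [CompactSpace N]
  [IsManifold I ∞ N] {ρN : SmoothPartitionOfUnity N I N univ}
  (hρN : ρN.IsSubordinate fun c => (chartAt H c).source)

omit hρ in
omit [T2Space M] [CompactSpace M] [I.Boundaryless] [IsManifold I ∞ M] [FiniteDimensional ℝ E]
  [MeasurableSpace E] [BorelSpace E] [T2Space N] [CompactSpace N] [IsManifold I ∞ N] in
/-- The pullback of a field along a map of manifolds. -/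
def pullback (π : N → M) (w : Field I M) : Field I N :=
  fun x L => w (π x) ((mfderiv I I π x).comp L)

omit hρ in
omit [T2Space M] [CompactSpace M] [I.Boundaryless] [IsManifold I ∞ M] [FiniteDimensional ℝ E]
  [MeasurableSpace E] [BorelSpace E] [T2Space N] [CompactSpace N] [IsManifold I ∞ N] in
theorem IsDensity.pullback {w : Field I M} (hw : IsDensity w) (π : N → M) :
    IsDensity (Density.pullback π w) := fun x L A => hw (π x) ((mfderiv I I π x).comp L) A

omit hρ in
omit [T2Space M] [CompactSpace M] [I.Boundaryless] [IsManifold I ∞ M] [FiniteDimensional ℝ E]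
  [MeasurableSpace E] [BorelSpace E] [T2Space N] [CompactSpace N] [IsManifold I ∞ N] in
theorem pull_pullback {w : Field I M} {π : N → M} {ψ : E → N} {y : E}
    (hπ : MDifferentiableAt I I π (ψ y)) (hψ : MDifferentiableAt 𝓘(ℝ, E) I ψ y) :
    pull (Density.pullback π w) ψ y = pull w (π ∘ ψ) y := by
  have h := mfderiv_comp y hπ hψ
  unfold pull Density.pullback
  rw [h]
  rfl

include hρN in
/-- The integral of the pullback of a density under a finite covering, given by its local
sections. -/
theorem integral_pullback {J : Type*} [Fintype J] {w : Field I M} (hw : IsDensity w)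
    (hc : IsCont w) {π : N → M} (hπ : MDifferentiable I I π) (ℓ : M → J → M → N)
    (hℓ : ∀ c j, MDifferentiableOn I I (ℓ c j) (chartAt H c).source)
    (hπℓ : ∀ c j, ∀ x ∈ (chartAt H c).source, π (ℓ c j x) = x)
    (hopen : ∀ c j, IsOpen {n | π n ∈ (chartAt H c).source ∧ ℓ c j (π n) = n})
    (hex : ∀ c n, π n ∈ (chartAt H c).source → ∃! j, ℓ c j (π n) = n) :
    integral μ ρN (pullback π w) = Fintype.card J * integral μ ρ w := by
  classical
  -- The `j`-th sheet over the chart at `c`. Composing `π` with this chart makes the sheet a chart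
  -- `e c j` of `N` with the same target.
  let S : M → J → Set N := fun c j => {n | π n ∈ (chartAt H c).source ∧ ℓ c j (π n) = n}
  let e : M → J → PartialEquiv N E := fun c j =>
    { toFun := fun n => extChartAt I c (π n)
      invFun := fun y => ℓ c j ((extChartAt I c).symm y)
      source := S c j
      target := (extChartAt I c).target
      map_source' := fun n hn => (extChartAt I c).map_source (by rw [extChartAt_source]; exact hn.1)
      map_target' := fun y hy => by
        have h1 := (extChartAt I c).map_target hy
        rw [extChartAt_source] at h1
        refine ⟨?_, ?_⟩ <;> rw [hπℓ c j _ h1]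
        exact h1
      left_inv' := fun n hn => by
        rw [(extChartAt I c).left_inv (by rw [extChartAt_source]; exact hn.1)]
        exact hn.2
      right_inv' := fun y hy => by
        have h1 := (extChartAt I c).map_target hy
        rw [extChartAt_source] at h1
        rw [hπℓ c j _ h1, (extChartAt I c).right_inv hy] }
  have he : ∀ c j, IsSmoothChart I (e c j) := fun c j => by
    have hsm := isSmoothChart_extChartAt (I := I) c
    refine ⟨hopen c j, hsm.open_target, ?_, ?_⟩
    · exact hsm.mdiff.comp hπ.mdifferentiableOn fun n hn => by
        rw [mem_preimage, extChartAt_source]; exact hn.1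
    · exact (hℓ c j).comp hsm.mdiff_symm fun y hy => by
        have h1 := (extChartAt I c).map_target hy
        rwa [extChartAt_source] at h1
  -- The pullback is cut into one piece for each chart and sheet. In the chart `e c j` the piece has
  -- the coordinate expression of `ρ c * w`, so its integral does not depend on the sheet.
  let v : M × J → Field I N := fun p => mulField (fun n => if n ∈ S p.1 p.2 then ρ p.1 (π n) else 0)
    (pullback π w)
  have hv : ∀ p, Integrable μ ρN (v p) ∧ integral μ ρN (v p) = ∫ y in (extChartAt I p.1).target,
      pull (mulField (ρ p.1) w) (extChartAt I p.1).symm y ∂μ := by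
    rintro ⟨c, j⟩
    have hsm := isSmoothChart_extChartAt (I := I) c
    have hpull : ∀ y ∈ (extChartAt I c).target, pull (v (c, j)) (e c j).symm y =
        pull (mulField (ρ c) w) (extChartAt I c).symm y := by
      intro y hy
      have h0 : (e c j).symm y ∈ S c j := (e c j).map_target hy
      have h1 := (extChartAt I c).map_target hy
      rw [extChartAt_source] at h1
      have h2 : π ((e c j).symm y) = (extChartAt I c).symm y := hπℓ c j _ h1
      have h3 : pull (pullback π w) (e c j).symm y = pull w (extChartAt I c).symm y := by
        rw [pull_pullback (hπ _) (((he c j).mdiff_symm y hy).mdifferentiableAt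
          ((he c j).open_target.mem_nhds hy))]
        refine pull_congr w ?_
        filter_upwards [hsm.open_target.mem_nhds hy] with z hz
        have h1 := (extChartAt I c).map_target hz
        rw [extChartAt_source] at h1
        exact hπℓ c j _ h1
      change ((if (e c j).symm y ∈ S c j then ρ c (π ((e c j).symm y)) else 0 : ℝ) : ℂ) *
        pull (pullback π w) (e c j).symm y = (ρ c ((extChartAt I c).symm y) : ℝ) *
          pull w (extChartAt I c).symm y
      rw [h3, if_pos h0, h2]
    have hi : IntegrableOn (pull (v (c, j)) (e c j).symm) (e c j).target μ :=
      (integrableOn_congr_fun hpull hsm.open_target.measurableSet).2 (hc.integrable μ hρ c)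
    have := integral_eq_of_chart μ hρN ((hw.pullback π).mulField _) (he c j)
      (fun x hx L => by
        have : x ∉ S c j := hx
        simp [mulField, this]) hi
    refine ⟨this.1, this.2.trans ?_⟩
    exact setIntegral_congr_fun hsm.open_target.measurableSet hpull
  have hsum : pullback π w = fun x L => ∑ p ∈ indices ρ ×ˢ Finset.univ, v p x L := by
    funext x L
    rw [Finset.sum_product]
    -- Over the chart at `c` each point lies on exactly one sheet; outside it `ρ c` vanishes.
    have : ∀ c, ∑ j, v (c, j) x L = ρ c (π x) * pullback π w x L := by
      intro c
      by_cases hx : π x ∈ (chartAt H c).source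
      · obtain ⟨j, hj, hu⟩ := hex c x hx
        rw [Finset.sum_eq_single j]
        · have : x ∈ S c j := ⟨hx, hj⟩
          simp [v, mulField, this]
        · intro k _ hk
          have : x ∉ S c k := fun h => hk (hu k h.2)
          simp [v, mulField, this]
        · simp
      · have h0 : ρ c (π x) = 0 := eq_zero_of_notMem_source hρ (by rwa [extChartAt_source])
        have : ∀ j, x ∉ S c j := fun j h => hx h.1
        simp [v, mulField, this, h0]
    simp only [this]
    rw [← Finset.sum_mul, ← Complex.ofReal_sum, sum_indices ρ, Complex.ofReal_one, one_mul]
  rw [hsum, integral_sum μ ρN _ v fun p _ => (hv p).1]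
  simp only [fun p => (hv p).2]
  rw [Finset.sum_product, integral_eq_sum, Finset.mul_sum]
  refine Finset.sum_congr rfl fun c _ => ?_
  simp

end Cover

end Global

end Density

/-! ### Matrices as a normed algebra, and matrix-valued 1-forms. -/

namespace ChernWeil

/-- Square matrices, as a normed algebra. -/
def Mat (r : ℕ) (𝕜 : Type*) : Type _ := Matrix (Fin r) (Fin r) 𝕜

namespace Mat

variable {r : ℕ} {𝕜 : Type*} [RCLike 𝕜]

/-- The operator norm for the maximum norm. -/
def normedRing (r : ℕ) (𝕜 : Type*) [RCLike 𝕜] : NormedRing (Mat r 𝕜) := Matrix.linftyOpNormedRing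

instance : NormedRing (Mat r 𝕜) := normedRing r 𝕜

/-- The real algebra structure. -/
def normedAlgebra (r : ℕ) (𝕜 : Type*) [RCLike 𝕜] : NormedAlgebra ℝ (Mat r 𝕜) :=
  Matrix.linftyOpNormedAlgebra

instance : NormedAlgebra ℝ (Mat r 𝕜) := normedAlgebra r 𝕜

instance : FiniteDimensional ℝ (Mat r 𝕜) :=
  inferInstanceAs (FiniteDimensional ℝ (Matrix (Fin r) (Fin r) 𝕜))

/-- The matrix with given entries. -/
def of (f : Fin r → Fin r → 𝕜) : Mat r 𝕜 := Matrix.of f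

@[simp] theorem of_apply (f : Fin r → Fin r → 𝕜) (a b : Fin r) : of f a b = f a b := rfl

@[ext] theorem ext {X Y : Mat r 𝕜} (h : ∀ a b, X a b = Y a b) : X = Y := Matrix.ext h

@[simp] theorem add_apply (X Y : Mat r 𝕜) (a b : Fin r) : (X + Y) a b = X a b + Y a b := rfl

@[simp] theorem sub_apply (X Y : Mat r 𝕜) (a b : Fin r) : (X - Y) a b = X a b - Y a b := rfl

@[simp] theorem neg_apply (X : Mat r 𝕜) (a b : Fin r) : (-X) a b = -X a b := rfl

@[simp] theorem zero_apply (a b : Fin r) : (0 : Mat r 𝕜) a b = 0 := rfl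

@[simp] theorem smul_apply (c : ℝ) (X : Mat r 𝕜) (a b : Fin r) : (c • X) a b = c • X a b := rfl

theorem one_apply (a b : Fin r) : (1 : Mat r 𝕜) a b = if a = b then 1 else 0 :=
  Matrix.one_apply

theorem mul_apply (X Y : Mat r 𝕜) (a b : Fin r) : (X * Y) a b = ∑ k, X a k * Y k b :=
  Matrix.mul_apply

end Mat

section MatrixEntries

variable {E 𝕜 : Type*} [NormedAddCommGroup E] [NormedSpace ℝ E] [RCLike 𝕜] {r : ℕ}

/-- The matrices supported in one entry. -/
def singleL (a b : Fin r) : 𝕜 →L[ℝ] Mat r 𝕜 :=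
  LinearMap.toContinuousLinearMap
    { toFun := fun z => Mat.of (Matrix.single a b z)
      map_add' := fun x y => Matrix.single_add a b x y
      map_smul' := fun c x => (Matrix.smul_single c a b x).symm }

/-- The entries of a matrix. -/
def entryL (a b : Fin r) : Mat r 𝕜 →L[ℝ] 𝕜 :=
  LinearMap.toContinuousLinearMap
    { toFun := fun X => X a b
      map_add' := fun _ _ => rfl
      map_smul' := fun _ _ => rfl }

@[simp] theorem entryL_apply (a b : Fin r) (X : Mat r 𝕜) : entryL a b X = X a b := rfl

@[simp] theorem Mat.sum_apply {ι : Type*} (s : Finset ι) (X : ι → Mat r 𝕜) (a b : Fin r) :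
    (∑ i ∈ s, X i) a b = ∑ i ∈ s, X i a b := map_sum (entryL a b) X s

/-- The trace as a continuous linear map. -/
def traceL : Mat r 𝕜 →L[ℝ] 𝕜 :=
  LinearMap.toContinuousLinearMap
    { toFun := fun X => Matrix.trace X
      map_add' := Matrix.trace_add
      map_smul' := fun c X => Matrix.trace_smul c X }

theorem traceL_apply (X : Mat r 𝕜) : traceL X = Matrix.trace X := rfl

theorem traceL_mul_comm (X Y : Mat r 𝕜) : traceL (X * Y) = traceL (Y * X) :=
  Matrix.trace_mul_comm (X : Matrix (Fin r) (Fin r) 𝕜) Y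

theorem Mat.eq_sum_single (X : Mat r 𝕜) : X = ∑ a, ∑ b, singleL a b (X a b) := by
  ext c d
  simp only [Mat.sum_apply]
  change _ = ∑ a, ∑ b, Matrix.single a b (X a b) c d
  simp only [← Matrix.sum_apply]
  exact congrFun (congrFun (Matrix.matrix_eq_sum_single X) c) d

theorem contDiffAt_matrix {n : ℕ∞ω} {h : E → Mat r 𝕜} {y : E}
    (hh : ∀ a b, ContDiffAt ℝ n (fun z => h z a b) y) : ContDiffAt ℝ n h y := by
  have : h = fun z => ∑ a, ∑ b, singleL a b (h z a b) := funext fun z => (h z).eq_sum_single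
  rw [this]
  exact ContDiffAt.sum fun a _ => ContDiffAt.sum fun b _ =>
    ContDiffAt.continuousLinearMap_comp (singleL (𝕜 := 𝕜) a b) (hh a b)

theorem ContDiffAt.entry {n : ℕ∞ω} {h : E → Mat r 𝕜} {y : E} (hh : ContDiffAt ℝ n h y)
    (a b : Fin r) : ContDiffAt ℝ n (fun z => h z a b) y :=
  ContDiffAt.continuousLinearMap_comp (entryL (𝕜 := 𝕜) a b) hh

theorem fderiv_matrix_apply {h : E → Mat r 𝕜} {y : E}
    (hh : DifferentiableAt ℝ h y) (v : E) (a b : Fin r) :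
    fderiv ℝ h y v a b = fderiv ℝ (fun z => h z a b) y v := by
  have h1 : HasFDerivAt (fun z => h z a b) ((entryL (𝕜 := 𝕜) a b).comp (fderiv ℝ h y)) y :=
    (entryL (𝕜 := 𝕜) a b).hasFDerivAt.comp y hh.hasFDerivAt
  rw [h1.fderiv]; simp

/-- The matrix-valued 1-form with given entries. -/
def ofEntries (α : Fin r → Fin r → E → E →L[ℝ] 𝕜) (y : E) : E →L[ℝ] Mat r 𝕜 :=
  ∑ a, ∑ b, (singleL a b).comp (α a b y)

@[simp] theorem ofEntries_apply (α : Fin r → Fin r → E → E →L[ℝ] 𝕜) (y v : E) :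
    ofEntries α y v = Mat.of fun a b => α a b y v := by
  rw [Mat.eq_sum_single (Mat.of fun a b => α a b y v)]
  simp [ofEntries, sum_apply]

theorem contDiffAt_ofEntries {n : ℕ∞ω} {α : Fin r → Fin r → E → E →L[ℝ] 𝕜} {y : E}
    (hα : ∀ a b, ContDiffAt ℝ n (α a b) y) : ContDiffAt ℝ n (ofEntries α) y := by
  unfold ofEntries
  exact ContDiffAt.sum fun a _ => ContDiffAt.sum fun b _ => contDiffAt_const.clm_comp (hα a b)

theorem fderiv_ofEntries_apply {α : Fin r → Fin r → E → E →L[ℝ] 𝕜} {y : E}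
    (hα : ∀ a b, DifferentiableAt ℝ (α a b) y) (v w : E) (a b : Fin r) :
    fderiv ℝ (ofEntries α) y v w a b = fderiv ℝ (α a b) y v w := by
  have hd : DifferentiableAt ℝ (ofEntries α) y := by
    unfold ofEntries
    exact DifferentiableAt.fun_sum fun a _ => DifferentiableAt.fun_sum fun b _ =>
      (differentiableAt_const _).clm_comp (hα a b)
  have h1 : (fun z => ofEntries α z w a b) = fun z => α a b z w := by
    funext z; rw [ofEntries_apply]; rfl
  rw [← fderiv_apply_const hd, fderiv_matrix_apply (hd.clm_apply (differentiableAt_const w)), h1,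
    fderiv_apply_const (hα a b)]

end MatrixEntries

/-! ### Forms on manifolds in charts, and their pullbacks. -/

section Forms

variable {E H : Type*} [NormedAddCommGroup E] [NormedSpace ℝ E] [TopologicalSpace H]
  {I : ModelWithCorners ℝ E H} {M : Type*} [TopologicalSpace M] [ChartedSpace H M]

/-- The pullback of a complex-valued 1-form along a map of manifolds. -/
def pullForm {N : Type*} [TopologicalSpace N] [ChartedSpace H N] (f : N → M)
    (α : ∀ x : M, TangentSpace I x →L[ℝ] ℂ) (x : N) : TangentSpace I x →L[ℝ] ℂ :=
  (α (f x)).comp (mfderiv I I f x)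

theorem form_congr (α : ∀ x : M, TangentSpace I x →L[ℝ] ℂ) {p q : M} (h : p = q) (L : E →L[ℝ] E) :
    (α p : E →L[ℝ] ℂ).comp L = (α q : E →L[ℝ] ℂ).comp L := by
  subst h; rfl

/-- The tangent space at `ψ y` is identified with `E` by the preferred chart at `ψ y`, so the
manifold derivative is by definition a derivative in that chart. -/
theorem mfderiv_eq_fderiv_chart {ψ : E → M} {y : E} (h : MDifferentiableAt 𝓘(ℝ, E) I ψ y) :
    (mfderiv 𝓘(ℝ, E) I ψ y : E →L[ℝ] E) = fderiv ℝ (extChartAt I (ψ y) ∘ ψ) y := by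
  have : mfderiv 𝓘(ℝ, E) I ψ y = fderivWithin ℝ (writtenInExtChartAt 𝓘(ℝ, E) I y ψ)
      (range 𝓘(ℝ, E)) (extChartAt 𝓘(ℝ, E) y y) := by
    unfold mfderiv
    exact if_pos h
  refine this.trans ?_
  simp [writtenInExtChartAt]
  rfl

variable [I.Boundaryless] [IsManifold I ∞ M]

theorem mdiff_chart_symm {c : M} {y : E} (hy : y ∈ (extChartAt I c).target) :
    MDifferentiableAt 𝓘(ℝ, E) I (extChartAt I c).symm y :=
  ((Density.isSmoothChart_extChartAt (I := I) c).mdiff_symm y hy).mdifferentiableAt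
    ((isOpen_extChartAt_target c).mem_nhds hy)

theorem mdiff_chart {c x : M} (hx : x ∈ (chartAt H c).source) :
    MDifferentiableAt I 𝓘(ℝ, E) (extChartAt I c) x := by
  rw [← extChartAt_source I] at hx
  exact ((Density.isSmoothChart_extChartAt (I := I) c).mdiff x hx).mdifferentiableAt
    ((isOpen_extChartAt_source c).mem_nhds hx)

theorem chart_symm_mem_source {c : M} {y : E} (hy : y ∈ (extChartAt I c).target) :
    (extChartAt I c).symm y ∈ (chartAt H c).source := by
  have := (extChartAt I c).map_target hy
  rwa [extChartAt_source] at this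

section Maps

variable {N : Type*} [TopologicalSpace N] [ChartedSpace H N] [IsManifold I ∞ N]

/-- A map in the charts centred at `c` and `c'`. -/
def inCharts (I : ModelWithCorners ℝ E H) (f : N → M) (c : N) (c' : M) : E → E :=
  extChartAt I c' ∘ f ∘ (extChartAt I c).symm

theorem eventually_chart_symm_inCharts {f : N → M} {c : N} {c' : M} {y : E}
    (hy : y ∈ (extChartAt I c).target)
    (hf : ContinuousAt f ((extChartAt I c).symm y))
    (hc : f ((extChartAt I c).symm y) ∈ (chartAt H c').source) :
    ∀ᶠ z in 𝓝 y, z ∈ (extChartAt I c).target ∧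
      f ((extChartAt I c).symm z) ∈ (chartAt H c').source ∧
      (extChartAt I c').symm (inCharts I f c c' z) = f ((extChartAt I c).symm z) := by
  have h1 : ContinuousAt (f ∘ (extChartAt I c).symm) y :=
    hf.comp (mdiff_chart_symm hy).continuousAt
  filter_upwards [(isOpen_extChartAt_target c).mem_nhds hy,
    h1.eventually_mem ((chartAt H c').open_source.mem_nhds hc)] with z hz hz'
  exact ⟨hz, hz', (extChartAt I c').left_inv (by rw [extChartAt_source]; exact hz')⟩

theorem contDiffAt_inCharts {f : N → M} {c : N} {c' : M} {y : E}
    (hy : y ∈ (extChartAt I c).target) (hf : ContMDiffAt I I ∞ f ((extChartAt I c).symm y))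
    (hc : f ((extChartAt I c).symm y) ∈ (chartAt H c').source) :
    ContDiffAt ℝ ∞ (inCharts I f c c') y := by
  rw [← contMDiffAt_iff_contDiffAt]
  refine (contMDiffAt_extChartAt' hc).comp y (hf.comp y ?_)
  exact (contMDiffOn_extChartAt_symm c).contMDiffAt ((isOpen_extChartAt_target c).mem_nhds hy)

/-- The map `f` composed with the inverse of the chart at `c` agrees near `y` with `inCharts`
followed by the inverse of the chart at `c'`. The chain rule is applied to both factorisations. -/
theorem chartForm_pullForm (α : ∀ x : M, TangentSpace I x →L[ℝ] ℂ) {f : N → M} {c : N} {c' : M}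
    {y : E} (hy : y ∈ (extChartAt I c).target)
    (hf : MDifferentiableAt I I f ((extChartAt I c).symm y))
    (hc : f ((extChartAt I c).symm y) ∈ (chartAt H c').source) :
    chartForm I c (pullForm f α) y =
      (chartForm I c' α (inCharts I f c c' y)).comp (fderiv ℝ (inCharts I f c c') y) := by
  have hs := mdiff_chart_symm (I := I) hy
  have hev := eventually_chart_symm_inCharts hy hf.continuousAt hc
  have hφ : MDifferentiableAt 𝓘(ℝ, E) 𝓘(ℝ, E) (inCharts I f c c') y :=
    (mdiff_chart hc).comp y (hf.comp y hs)
  have ht : inCharts I f c c' y ∈ (extChartAt I c').target :=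
    (extChartAt I c').map_source (by rw [extChartAt_source]; exact hc)
  have h1 := mfderiv_comp y hf hs
  have h2 := mfderiv_comp y (mdiff_chart_symm (I := I) ht) hφ
  have h3 : f ∘ (extChartAt I c).symm =ᶠ[𝓝 y] (extChartAt I c').symm ∘ inCharts I f c c' := by
    filter_upwards [hev] with z hz using hz.2.2.symm
  have h4 := h3.mfderiv_eq (I := 𝓘(ℝ, E)) (I' := I)
  rw [mfderiv_eq_fderiv] at h2
  unfold chartForm pullForm
  refine (congrArg (fun L : E →L[ℝ] E =>
    (α (f ((extChartAt I c).symm y)) : E →L[ℝ] ℂ).comp L) h1.symm).trans ?_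
  refine (form_congr α h3.self_of_nhds (mfderiv 𝓘(ℝ, E) I (f ∘ (extChartAt I c).symm) y)).trans ?_
  exact congrArg (fun L => (α ((extChartAt I c').symm (inCharts I f c c' y)) : E →L[ℝ] ℂ).comp L)
    (h4.trans h2)

/-- Smoothness of a 1-form in the charts over a set. -/
def SmoothForm (I : ModelWithCorners ℝ E H) {M : Type*} [TopologicalSpace M] [ChartedSpace H M]
    (U : Set M) (α : ∀ x : M, TangentSpace I x →L[ℝ] ℂ) : Prop :=
  ∀ c : M, ContDiffOn ℝ ∞ (chartForm I c α)
    ((extChartAt I c).target ∩ (extChartAt I c).symm ⁻¹' U)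

theorem isOpen_chart_preimage {U : Set M} (hU : IsOpen U) (c : M) :
    IsOpen ((extChartAt I c).target ∩ (extChartAt I c).symm ⁻¹' U) :=
  (Density.isSmoothChart_extChartAt (I := I) c).mdiff_symm.continuousOn.isOpen_inter_preimage
    (isOpen_extChartAt_target c) hU

theorem SmoothForm.contDiffAt {U : Set M} (hU : IsOpen U)
    {α : ∀ x : M, TangentSpace I x →L[ℝ] ℂ} (h : SmoothForm I U α) {c : M} {y : E}
    (hy : y ∈ (extChartAt I c).target) (hyU : (extChartAt I c).symm y ∈ U) :
    ContDiffAt ℝ ∞ (chartForm I c α) y :=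
  (h c).contDiffAt ((isOpen_chart_preimage hU c).mem_nhds ⟨hy, hyU⟩)

theorem SmoothForm.pullForm {U : Set M} (hU : IsOpen U)
    {α : ∀ x : M, TangentSpace I x →L[ℝ] ℂ} (h : SmoothForm I U α) {f : N → M}
    (hf : ContMDiff I I ∞ f) : SmoothForm I (f ⁻¹' U) (ChernWeil.pullForm f α) := by
  rintro c y ⟨hy, hyU⟩
  set c' := f ((extChartAt I c).symm y)
  have hc : f ((extChartAt I c).symm y) ∈ (chartAt H c').source := mem_chart_source H _
  have hev := eventually_chart_symm_inCharts (I := I) hy hf.continuous.continuousAt hc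
  have hφ := contDiffAt_inCharts hy (hf _) hc
  have hα : ContDiffAt ℝ ∞ (chartForm I c' α) (inCharts I f c c' y) := by
    refine h.contDiffAt hU ((extChartAt I c').map_source (by rw [extChartAt_source]; exact hc)) ?_
    rw [hev.self_of_nhds.2.2]
    exact hyU
  have h1 : ContDiffAt ℝ ∞ (fun z => (chartForm I c' α (inCharts I f c c' z)).comp
      (fderiv ℝ (inCharts I f c c') z)) y :=
    (hα.comp y hφ).clm_comp (hφ.fderiv_right (m := ∞) (by simp))
  refine (h1.congr_of_eventuallyEq ?_).contDiffWithinAt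
  filter_upwards [hev] with z hz
  exact chartForm_pullForm α hz.1 ((hf _).mdifferentiableAt (by simp)) hz.2.1

variable {r : ℕ}

/-- The matrix-valued coordinate expression of a matrix of 1-forms. -/
def chartMatrix (I : ModelWithCorners ℝ E H) {M : Type*} [TopologicalSpace M] [ChartedSpace H M]
    (c : M) (α : Fin r → Fin r → ∀ x : M, TangentSpace I x →L[ℝ] ℂ) :
    E → E →L[ℝ] Mat r ℂ :=
  ofEntries fun a b => chartForm I c (α a b)

theorem chartMatrix_apply (c : M) (α : Fin r → Fin r → ∀ x : M, TangentSpace I x →L[ℝ] ℂ)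
    (y v : E) : chartMatrix I c α y v = Mat.of fun a b => chartForm I c (α a b) y v :=
  ofEntries_apply _ y v

theorem contDiffAt_chartMatrix {U : Set M} (hU : IsOpen U)
    {α : Fin r → Fin r → ∀ x : M, TangentSpace I x →L[ℝ] ℂ} (h : ∀ a b, SmoothForm I U (α a b))
    {c : M} {y : E} (hy : y ∈ (extChartAt I c).target) (hyU : (extChartAt I c).symm y ∈ U) :
    ContDiffAt ℝ ∞ (chartMatrix I c α) y :=
  contDiffAt_ofEntries fun a b => (h a b).contDiffAt hU hy hyU

theorem chartMatrix_pullForm (α : Fin r → Fin r → ∀ x : M, TangentSpace I x →L[ℝ] ℂ) {f : N → M}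
    {c : N} {c' : M} {y : E} (hy : y ∈ (extChartAt I c).target)
    (hf : MDifferentiableAt I I f ((extChartAt I c).symm y))
    (hc : f ((extChartAt I c).symm y) ∈ (chartAt H c').source) :
    chartMatrix I c (fun a b => pullForm f (α a b)) y =
      (chartMatrix I c' α (inCharts I f c c' y)).comp (fderiv ℝ (inCharts I f c c') y) := by
  ext v a b
  rw [ContinuousLinearMap.comp_apply, chartMatrix_apply, chartMatrix_apply]
  simp only [Mat.of_apply, chartForm_pullForm (α a b) hy hf hc]
  rfl

/-- For `f = id` this is the behaviour of the curvature under a change of chart; for the covering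
map it compares the curvatures upstairs and below. -/
theorem curv_chartMatrix_pullForm {U : Set M} (hU : IsOpen U)
    {α : Fin r → Fin r → ∀ x : M, TangentSpace I x →L[ℝ] ℂ} (h : ∀ a b, SmoothForm I U (α a b))
    {f : N → M} (hf : ContMDiff I I ∞ f) {c : N} {c' : M} {y : E}
    (hy : y ∈ (extChartAt I c).target)
    (hc : f ((extChartAt I c).symm y) ∈ (chartAt H c').source)
    (hyU : f ((extChartAt I c).symm y) ∈ U) (v w : E) :
    curv (chartMatrix I c fun a b => pullForm f (α a b)) y v w =
      curv (chartMatrix I c' α) (inCharts I f c c' y) (fderiv ℝ (inCharts I f c c') y v)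
        (fderiv ℝ (inCharts I f c c') y w) := by
  have hev := eventually_chart_symm_inCharts (I := I) hy hf.continuous.continuousAt hc
  have hφ := contDiffAt_inCharts hy (hf _) hc
  rw [← curv_pullback _ (hφ.of_le ENat.LEInfty.out)]
  · refine curv_congr ?_ v w
    filter_upwards [hev] with z hz
    exact chartMatrix_pullForm α hz.1 ((hf _).mdifferentiableAt (by simp)) hz.2.1
  · refine (contDiffAt_chartMatrix hU h ?_ ?_).differentiableAt (by simp)
    · exact (extChartAt I c').map_source (by rw [extChartAt_source]; exact hc)
    · rw [hev.self_of_nhds.2.2]; exact hyU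

end Maps

end Forms

end ChernWeil

/-! ### The second Chern form: independence of the frame and of the chart. -/

namespace ChernWeil

section Conjugation

variable {r : ℕ}

/-- The second Chern polynomial of a curvature matrix evaluated on four vectors. -/
def secondChern (F : Fin 4 → Fin 4 → Mat r ℂ) : ℂ :=
  (1 / (8 * (Real.pi : ℂ) ^ 2)) * wedge22 (chernPairing traceL) F F

theorem chernPairing_conj {u g : Mat r ℂ} (h : g * u = 1) (X Y : Mat r ℂ) :
    chernPairing traceL (u * X * g) (u * Y * g) = chernPairing traceL X Y := by
  have key : ∀ Z : Mat r ℂ, traceL (u * Z * g) = traceL Z := fun Z => by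
    rw [traceL_mul_comm, ← mul_assoc, h, one_mul]
  have h2 : u * X * g * (u * Y * g) = u * (X * Y) * g := by
    calc u * X * g * (u * Y * g) = u * X * (g * u) * Y * g := by noncomm_ring
      _ = _ := by rw [h]; noncomm_ring
  simp only [chernPairing, h2, key]

theorem secondChern_conj {u g : Mat r ℂ} (h : g * u = 1) (F : Fin 4 → Fin 4 → Mat r ℂ) :
    secondChern (fun k l => u * F k l * g) = secondChern F := by
  simp only [secondChern, wedge22, chernPairing_conj h]

end Conjugation

variable {E H : Type*} [NormedAddCommGroup E] [NormedSpace ℝ E] [TopologicalSpace H]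
  {I : ModelWithCorners ℝ E H} {M : Type*} [TopologicalSpace M] [ChartedSpace H M]
  [I.Boundaryless] [IsManifold I ∞ M] {r : ℕ} {V : ComplexBundle I M r}

theorem mem_idx (V : ComplexBundle I M r) (x : M) : x ∈ V.U (V.idx x) := (V.cover x).choose_spec

theorem g_inv (V : ComplexBundle I M r) {i j : V.ι} {x : M} (hi : x ∈ V.U i) (hj : x ∈ V.U j) :
    V.g i j x * V.g j i x = 1 := by
  rw [V.g_comp i j i x ⟨⟨hi, hj⟩, hi⟩, V.g_self i x hi]

theorem mem_target_chart (x : M) : extChartAt I x x ∈ (extChartAt I x).target :=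
  mem_extChartAt_target x

/-- A transition matrix in a chart. -/
def chartTransition (V : ComplexBundle I M r) (c : M) (i j : V.ι) (y : E) : Mat r ℂ :=
  V.g i j ((extChartAt I c).symm y)

theorem contMDiffAt_g (V : ComplexBundle I M r) {i j : V.ι} {x : M} (hi : x ∈ V.U i)
    (hj : x ∈ V.U j) (a b : Fin r) : ContMDiffAt I 𝓘(ℝ, ℂ) ∞ (fun x => V.g i j x a b) x :=
  (V.smooth i j a b).contMDiffAt (((V.isOpen i).inter (V.isOpen j)).mem_nhds ⟨hi, hj⟩)

section ChartTransition

variable {c : M} {i j : V.ι} {y : E} (hy : y ∈ (extChartAt I c).target)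
  (hi : (extChartAt I c).symm y ∈ V.U i) (hj : (extChartAt I c).symm y ∈ V.U j)
include hy hi hj

theorem contDiffAt_chartTransition : ContDiffAt ℝ ∞ (chartTransition V c i j) y :=
  contDiffAt_matrix fun a b => by
    rw [← contMDiffAt_iff_contDiffAt]
    exact (contMDiffAt_g V hi hj a b).comp y
      ((contMDiffOn_extChartAt_symm c).contMDiffAt ((isOpen_extChartAt_target c).mem_nhds hy))

theorem fderiv_chartTransition (v : E) (a b : Fin r) :
    fderiv ℝ (chartTransition V c i j) y v a b =
      mfderiv I 𝓘(ℝ, ℂ) (fun z => V.g i j z a b) ((extChartAt I c).symm y)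
        (mfderiv 𝓘(ℝ, E) I (extChartAt I c).symm y v) := by
  rw [fderiv_matrix_apply ((contDiffAt_chartTransition hy hi hj).differentiableAt (by simp)),
    ← mfderiv_eq_fderiv]
  exact congrArg (fun L : E →L[ℝ] ℂ => L v)
    (mfderiv_comp y ((contMDiffAt_g V hi hj a b).mdifferentiableAt (by simp))
      (mdiff_chart_symm hy))

/-- The gauge condition of a connection read in a chart, in the form required by `curv_gauge`. -/
theorem chartMatrix_gauge (D : V.Connection) (v : E) :
    chartMatrix I c (D.form j) y v =
      chartTransition V c j i y * chartMatrix I c (D.form i) y v * chartTransition V c i j y +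
        chartTransition V c j i y * fderiv ℝ (chartTransition V c i j) y v := by
  have h := D.gauge i j ((extChartAt I c).symm y) ⟨hi, hj⟩
    (mfderiv 𝓘(ℝ, E) I (extChartAt I c).symm y v)
  have hd : fderiv ℝ (chartTransition V c i j) y v = Mat.of fun a b =>
      mfderiv I 𝓘(ℝ, ℂ) (fun z => V.g i j z a b) ((extChartAt I c).symm y)
        (mfderiv 𝓘(ℝ, E) I (extChartAt I c).symm y v) :=
    Mat.ext fun a b => fderiv_chartTransition hy hi hj v a b
  rw [hd, chartMatrix_apply, chartMatrix_apply]
  exact h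

end ChartTransition

theorem smoothForm (D : V.Connection) (i : V.ι) (a b : Fin r) :
    SmoothForm I (V.U i) (D.form i a b) := D.smooth i a b

theorem contDiffAt_form (D : V.Connection) {c : M} {i : V.ι} {y : E}
    (hy : y ∈ (extChartAt I c).target) (hi : (extChartAt I c).symm y ∈ V.U i) :
    ContDiffAt ℝ ∞ (chartMatrix I c (D.form i)) y :=
  contDiffAt_chartMatrix (V.isOpen i) (smoothForm D i) hy hi

/-- Identifies the curvature given by its entries with the curvature of an algebra-valued form, so
that the local theory applies. -/
theorem curvature_eq (D : V.Connection) {c : M} {i : V.ι} {y : E}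
    (hy : y ∈ (extChartAt I c).target) (hi : (extChartAt I c).symm y ∈ V.U i) (v w : E) :
    D.curvature c i y v w = curv (chartMatrix I c (D.form i)) y v w := by
  have hd : ∀ a b, DifferentiableAt ℝ (chartForm I c (D.form i a b)) y := fun a b =>
    ((smoothForm D i a b).contDiffAt (V.isOpen i) hy hi).differentiableAt (by simp)
  refine Mat.ext fun a b => ?_
  have h1 := fderiv_ofEntries_apply hd v w a b
  have h2 := fderiv_ofEntries_apply hd w v a b
  simp only [curv, extD, Mat.add_apply, Mat.sub_apply, Mat.mul_apply, chartMatrix_apply,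
    Mat.of_apply]
  rw [show fderiv ℝ (chartMatrix I c (D.form i)) y v w a b = _ from h1,
    show fderiv ℝ (chartMatrix I c (D.form i)) y w v a b = _ from h2]
  simp only [ComplexBundle.Connection.curvature, Matrix.of_apply, Finset.sum_sub_distrib]

theorem curv_form_gauge (D : V.Connection) {c : M} {i j : V.ι} {y : E}
    (hy : y ∈ (extChartAt I c).target) (hi : (extChartAt I c).symm y ∈ V.U i)
    (hj : (extChartAt I c).symm y ∈ V.U j) (v w : E) :
    curv (chartMatrix I c (D.form j)) y v w =
      chartTransition V c j i y * curv (chartMatrix I c (D.form i)) y v w *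
        chartTransition V c i j y := by
  have hev : ∀ᶠ z in 𝓝 y, z ∈ (extChartAt I c).target ∧ (extChartAt I c).symm z ∈ V.U i ∧
      (extChartAt I c).symm z ∈ V.U j := by
    filter_upwards [(isOpen_chart_preimage (V.isOpen i) c).mem_nhds ⟨hy, hi⟩,
      (isOpen_chart_preimage (V.isOpen j) c).mem_nhds ⟨hy, hj⟩] with z h1 h2
    exact ⟨h1.1, h1.2, h2.2⟩
  refine curv_gauge ((contDiffAt_form D hy hi).differentiableAt (by simp))
    ((contDiffAt_chartTransition hy hi hj).of_le ENat.LEInfty.out)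
    ((contDiffAt_chartTransition hy hj hi).differentiableAt (by simp)) ?_ ?_ ?_
    ((contDiffAt_form D hy hj).differentiableAt (by simp)) v w
  · filter_upwards [hev] with z hz
    exact g_inv V hz.2.2 hz.2.1
  · exact g_inv V hi hj
  · filter_upwards [hev] with z hz v
    exact chartMatrix_gauge hz.1 hz.2.1 hz.2.2 D v

/-- The Chern form is defined with the arbitrary choice `V.idx`, which may jump from point to point.
Conjugation invariance of the trace permits any trivialising index instead, in particular one fixed
in a neighbourhood. -/
theorem chernForm_eq (D : V.Connection) {c : M} {i : V.ι} {y : E}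
    (hy : y ∈ (extChartAt I c).target) (hi : (extChartAt I c).symm y ∈ V.U i) (v : Fin 4 → E) :
    D.chernForm c y v =
      secondChern fun k l => curv (chartMatrix I c (D.form i)) y (v k) (v l) := by
  have hx := mem_idx V ((extChartAt I c).symm y)
  have h1 : D.chernForm c y v = secondChern fun k l =>
      (D.curvature c (V.idx ((extChartAt I c).symm y)) y (v k) (v l) : Mat r ℂ) := rfl
  rw [h1, ← secondChern_conj (u := chartTransition V c (V.idx ((extChartAt I c).symm y)) i y)
    (g := chartTransition V c i (V.idx ((extChartAt I c).symm y)) y) (g_inv V hi hx)]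
  congr 1
  funext k l
  rw [curvature_eq D hy hx, curv_form_gauge D hy hi hx]

section Pullback

variable {N : Type*} [TopologicalSpace N] [ChartedSpace H N] [IsManifold I ∞ N]

/-- The pullback of a complex vector bundle. -/
def pullBundle (V : ComplexBundle I M r) {f : N → M} (hf : ContMDiff I I ∞ f) :
    ComplexBundle I N r where
  ι := V.ι
  U i := f ⁻¹' V.U i
  isOpen i := (V.isOpen i).preimage hf.continuous
  cover x := V.cover (f x)
  g i j x := V.g i j (f x)
  smooth i j a b := (V.smooth i j a b).comp hf.contMDiffOn fun _ h => h
  g_self i x hx := V.g_self i (f x) hx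
  g_comp i j k x hx := V.g_comp i j k (f x) hx

/-- The pullback of a connection. -/
def pullConnection (D : V.Connection) {f : N → M} (hf : ContMDiff I I ∞ f) :
    (pullBundle V hf).Connection where
  form i a b := pullForm f (D.form i a b)
  smooth i a b := (smoothForm D i a b).pullForm (V.isOpen i) hf
  gauge i j x hx v := by
    have h := D.gauge i j (f x) hx (mfderiv I I f x v)
    have h2 : (Matrix.of fun a b => mfderiv I 𝓘(ℝ, ℂ) (fun z => V.g i j (f z) a b) x v) =
        Matrix.of fun a b => mfderiv I 𝓘(ℝ, ℂ) (fun z => V.g i j z a b) (f x)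
          (mfderiv I I f x v) := by
      ext a b
      exact congrArg (fun L : E →L[ℝ] ℂ => L v)
        (mfderiv_comp x ((contMDiffAt_g V hx.1 hx.2 a b).mdifferentiableAt (by simp))
          ((hf x).mdifferentiableAt (by simp)))
    refine h.trans ?_
    exact congrArg (fun Z => V.g j i (f x) * (Matrix.of fun a b => D.form i a b (f x)
      (mfderiv I I f x v)) * V.g i j (f x) + V.g j i (f x) * Z) h2.symm

theorem chernForm_pullConnection (D : V.Connection) {f : N → M} (hf : ContMDiff I I ∞ f)
    {c : N} {c' : M} {y : E} (hy : y ∈ (extChartAt I c).target)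
    (hc : f ((extChartAt I c).symm y) ∈ (chartAt H c').source) (v : Fin 4 → E) :
    (pullConnection D hf).chernForm c y v = D.chernForm c' (inCharts I f c c' y)
      (fun k => fderiv ℝ (inCharts I f c c') y (v k)) := by
  have hev := (eventually_chart_symm_inCharts (I := I) hy hf.continuous.continuousAt hc).self_of_nhds
  have hx := mem_idx V (f ((extChartAt I c).symm y))
  refine (chernForm_eq (i := V.idx (f ((extChartAt I c).symm y))) (pullConnection D hf) hy hx
    v).trans (Eq.trans (congrArg secondChern ?_) (chernForm_eq D
      (i := V.idx (f ((extChartAt I c).symm y)))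
      ((extChartAt I c').map_source (by rw [extChartAt_source]; exact hc))
      (Set.mem_of_eq_of_mem hev.2.2 hx) _).symm)
  funext k l
  exact curv_chartMatrix_pullForm (V.isOpen _) (smoothForm D _) hf hy hc hx (v k) (v l)

/-- The second Chern form on tangent vectors. -/
def chernField (D : V.Connection) (x : M) (v : Fin 4 → TangentSpace I x) : ℂ :=
  D.chernForm x (extChartAt I x x) v

theorem fderiv_inCharts {f : N → M} {x : N} (hf : MDifferentiableAt I I f x) :
    fderiv ℝ (inCharts I f x (f x)) (extChartAt I x x) = mfderiv I I f x := by
  have : mfderiv I I f x = fderivWithin ℝ (writtenInExtChartAt I I x f) (range I)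
      (extChartAt I x x) := by
    unfold mfderiv
    exact if_pos hf
  refine Eq.trans ?_ this.symm
  rw [I.range_eq_univ, fderivWithin_univ]
  rfl

theorem chernField_pullConnection (D : V.Connection) {f : N → M} (hf : ContMDiff I I ∞ f) (x : N)
    (v : Fin 4 → TangentSpace I x) :
    chernField (pullConnection D hf) x v = chernField D (f x) fun k => mfderiv I I f x (v k) := by
  have hx : (extChartAt I x).symm (extChartAt I x x) = x := extChartAt_to_inv x
  have h := chernForm_pullConnection D hf (c := x) (c' := f x) (mem_target_chart (I := I) x)
    (by rw [hx]; exact mem_chart_source H _) v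
  have h2 : inCharts I f x (f x) (extChartAt I x x) = extChartAt I (f x) (f x) := by
    simp only [inCharts, Function.comp_apply, hx]
  rw [h2, fderiv_inCharts ((hf x).mdifferentiableAt (by simp))] at h
  exact h

end Pullback

/-- Independence of the chart: the identity of `M`, read in the chart at `c` and in the chart at the
point itself, is treated as a pullback. -/
theorem chernForm_eq_chernField (D : V.Connection) {c : M} {y : E}
    (hy : y ∈ (extChartAt I c).target) (v : Fin 4 → E) :
    D.chernForm c y v = chernField D ((extChartAt I c).symm y)
      fun k => mfderiv 𝓘(ℝ, E) I (extChartAt I c).symm y (v k) := by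
  set x := (extChartAt I c).symm y
  have hi := mem_idx V x
  have h1 := fun (a b : Fin r) => (smoothForm D (V.idx x) a b)
  have hx : x ∈ (chartAt H x).source := mem_chart_source H x
  have hφ : inCharts I (id : M → M) c x y = extChartAt I x x := rfl
  have h2 := mfderiv_eq_fderiv_chart (mdiff_chart_symm (I := I) hy)
  have hp : ∀ α : ∀ x : M, TangentSpace I x →L[ℝ] ℂ, pullForm (I := I) (id : M → M) α = α := by
    intro α
    funext z
    unfold pullForm
    rw [mfderiv_id]
    rfl
  unfold chernField
  refine (chernForm_eq D hy hi v).trans (Eq.trans (congrArg secondChern ?_)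
    (chernForm_eq D (i := V.idx x) (mem_target_chart x)
      (by rw [extChartAt_to_inv]; exact hi) _).symm)
  funext k l
  have h3 := curv_chartMatrix_pullForm (V.isOpen _) h1 (contMDiff_id (I := I) (n := ∞)) hy
    (c' := x) hx hi (v k) (v l)
  simp only [hp] at h3
  refine h3.trans ?_
  rw [hφ]
  exact congrArg₂ (curv (chartMatrix I x (D.form (V.idx x))) (extChartAt I x x))
    (congrArg (fun L : E →L[ℝ] E => L (v k)) h2.symm)
    (congrArg (fun L : E →L[ℝ] E => L (v l)) h2.symm)

end ChernWeil

/-! ### Orientation signs, and the density of the Chern form. -/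

namespace ChernWeil

variable {E H : Type*} [NormedAddCommGroup E] [NormedSpace ℝ E] [TopologicalSpace H]
  {I : ModelWithCorners ℝ E H} {M : Type*} [TopologicalSpace M] [ChartedSpace H M]

variable (I M) in
/-- A locally constant sign of parametrisations of the tangent spaces. -/
structure SignField where
  val : ∀ x : M, (E →L[ℝ] TangentSpace I x) → ℝ
  comp : ∀ (x : M) (L : E →L[ℝ] TangentSpace I x) (A : E →L[ℝ] E),
    val x (L.comp A) = ((SignType.sign A.det : SignType) : ℝ) * val x L
  loc : ∀ (c : M), ∀ y ∈ (extChartAt I c).target, ∀ᶠ z in 𝓝 y,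
    val ((extChartAt I c).symm z) (mfderiv 𝓘(ℝ, E) I (extChartAt I c).symm z) =
      val ((extChartAt I c).symm y) (mfderiv 𝓘(ℝ, E) I (extChartAt I c).symm y)

theorem SignField.congr (s : SignField I M) {p q : M} (h : p = q) (L : E →L[ℝ] E) :
    (s.val p : (E →L[ℝ] E) → ℝ) L = (s.val q : (E →L[ℝ] E) → ℝ) L := by
  subst h; rfl

theorem sign_mul_self (t : ℝ) : ((SignType.sign t : SignType) : ℝ) * t = |t| := by
  rcases lt_trichotomy t 0 with h | h | h
  · simp [sign_neg h, abs_of_neg h]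
  · simp [h]
  · simp [sign_pos h, abs_of_pos h]

/-- Distinct values among `-1, 0, 1` are at distance at least `1`, so real continuity forces local
constancy. -/
theorem eventually_eq_of_continuousAt_sign {X : Type*} [TopologicalSpace X] {f : X → SignType}
    {x : X} (h : ContinuousAt (fun z => ((f z : SignType) : ℝ)) x) : ∀ᶠ z in 𝓝 x, f z = f x := by
  filter_upwards [h.eventually (Metric.ball_mem_nhds _ one_pos)] with z hz
  change dist _ _ < (1 : ℝ) at hz
  rw [Real.dist_eq, abs_lt] at hz
  revert hz
  generalize f z = a
  generalize f x = b
  cases a <;> cases b <;> norm_num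

variable [I.Boundaryless] [IsManifold I ∞ M]

/-- The sign field of an orientation and a basis of the model space. -/
def signField (o : ManifoldOrientation I M) (b : Module.Basis (Fin 4) ℝ E) : SignField I M where
  val x L := o.sign x fun k => L (b k)
  comp x L A := by
    let L' : E →L[ℝ] E := L
    -- A representative of the orientation, pulled back to the model space. It is a form of top
    -- degree and scales by the determinant.
    let f : E [⋀^Fin 4]→ₗ[ℝ] ℝ := (o.orient x).someVector.compLinearMap (L' : E →ₗ[ℝ] E)
    have h : (f fun k => A (b k)) = LinearMap.det (A : E →ₗ[ℝ] E) * f b :=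
      alternating_comp_det b f A
    have h2 : SignType.sign (f fun k => A (b k)) = SignType.sign A.det * SignType.sign (f b) := by
      rw [h, sign_mul]
    have h3 := congrArg (fun t : SignType => (t : ℝ)) h2
    exact h3.trans (SignType.coe_mul _ _)
  loc c y hy := by
    have h := (o.continuousOn_sign c b).continuousAt
      ((chartAt H c).open_source.mem_nhds (chart_symm_mem_source hy))
    have h2 := eventually_eq_of_continuousAt_sign
      (h.comp (mdiff_chart_symm (I := I) hy).continuousAt)
    have key : ∀ z ∈ (extChartAt I c).target,
        (o.sign ((extChartAt I c).symm z) fun k =>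
          mfderiv 𝓘(ℝ, E) I (extChartAt I c).symm z (b k)) =
        o.sign ((extChartAt I c).symm z) fun k => mfderiv 𝓘(ℝ, E) I (extChartAt I c).symm
          (extChartAt I c ((extChartAt I c).symm z)) (b k) := fun z hz =>
      congrArg (fun t => o.sign ((extChartAt I c).symm z) fun k =>
        (mfderiv 𝓘(ℝ, E) I (extChartAt I c).symm t : E →L[ℝ] E) (b k))
        ((extChartAt I c).right_inv hz).symm
    filter_upwards [h2, (isOpen_extChartAt_target c).mem_nhds hy] with z hz hzt
    exact (key z hzt).trans
      ((congrArg (fun t : SignType => (t : ℝ)) hz).trans (key y hy).symm)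

section PullSign

variable {N : Type*} [TopologicalSpace N] [ChartedSpace H N] [IsManifold I ∞ N]
  [FiniteDimensional ℝ E]

/-- The pullback of a sign field along a local diffeomorphism. -/
def SignField.pull (s : SignField I M) {f : N → M} (hf : ContMDiff I I ∞ f)
    (hinv : ∀ x, (mfderiv I I f x).IsInvertible) : SignField I N where
  val x L := s.val (f x) ((mfderiv I I f x).comp L)
  comp x L A := s.comp (f x) ((mfderiv I I f x).comp L) A
  loc c y hy := by
    set x := (extChartAt I c).symm y with hxdef
    set c' := f x with hc'
    have hc : f x ∈ (chartAt H c').source := mem_chart_source H _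
    have hev := eventually_chart_symm_inCharts (I := I) hy hf.continuous.continuousAt hc
    set φ := inCharts I f c c'
    have hφ : ContDiffAt ℝ ∞ φ y := contDiffAt_inCharts hy (hf _) hc
    have hcont : ContinuousAt (fun z => (fderiv ℝ φ z).det) y :=
      ContinuousLinearMap.continuous_det.continuousAt.comp
        (hφ.continuousAt_fderiv (by simp))
    -- In charts the derivative of `f` is a composition of three invertible maps, so its determinant
    -- keeps its sign near `y`.
    have hdet : (fderiv ℝ φ y).det ≠ 0 := by
      have h1 := mfderiv_comp y ((hf x).mdifferentiableAt (by simp)) (mdiff_chart_symm (I := I) hy)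
      have h2 := mfderiv_comp y (g := extChartAt I c') (f := f ∘ (extChartAt I c).symm)
        (mdiff_chart hc) (((hf x).mdifferentiableAt (by simp)).comp y (mdiff_chart_symm (I := I) hy))
      have i1 : (mfderiv 𝓘(ℝ, E) I (extChartAt I c).symm y).IsInvertible := by
        have := isInvertible_mfderivWithin_extChartAt_symm (I := I) (x := c) hy
        rwa [I.range_eq_univ, mfderivWithin_univ] at this
      have i2 : (mfderiv I 𝓘(ℝ, E) (extChartAt I c') (f x)).IsInvertible :=
        isInvertible_mfderiv_extChartAt (by rw [extChartAt_source]; exact hc)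
      have i3 := i2.comp ((hinv x).comp i1)
      have h3 : fderiv ℝ φ y = (mfderiv I 𝓘(ℝ, E) (extChartAt I c') (f x)).comp
          ((mfderiv I I f x).comp (mfderiv 𝓘(ℝ, E) I (extChartAt I c).symm y)) := by
        rw [← mfderiv_eq_fderiv]
        exact h2.trans (congrArg (fun L : E →L[ℝ] E =>
          (mfderiv I 𝓘(ℝ, E) (extChartAt I c') (f x) : E →L[ℝ] E).comp L) h1)
      obtain ⟨e, he⟩ : (fderiv ℝ φ y).IsInvertible := h3 ▸ i3
      rw [← he]
      exact e.toLinearEquiv.isUnit_det'.ne_zero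
    have hsign : ∀ᶠ z in 𝓝 y, SignType.sign (fderiv ℝ φ z).det =
        SignType.sign (fderiv ℝ φ y).det := by
      rcases lt_or_gt_of_ne hdet with h | h
      · filter_upwards [hcont.eventually (gt_mem_nhds h)] with z hz
        rw [sign_neg hz, sign_neg h]
      · filter_upwards [hcont.eventually (lt_mem_nhds h)] with z hz
        rw [sign_pos hz, sign_pos h]
    have hφt : φ y ∈ (extChartAt I c').target :=
      (extChartAt I c').map_source (by rw [extChartAt_source]; exact hc)
    have hloc := hφ.continuousAt.eventually (s.loc c' (φ y) hφt)
    -- The chain rule reduces the sign upstairs to the sign below times the sign of the determinant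
    -- of `φ`; both factors are locally constant.
    have hformula : ∀ᶠ z in 𝓝 y,
        s.val (f ((extChartAt I c).symm z)) ((mfderiv I I f ((extChartAt I c).symm z)).comp
          (mfderiv 𝓘(ℝ, E) I (extChartAt I c).symm z)) =
        ((SignType.sign (fderiv ℝ φ z).det : SignType) : ℝ) *
          s.val ((extChartAt I c').symm (φ z))
            (mfderiv 𝓘(ℝ, E) I (extChartAt I c').symm (φ z)) := by
      have hdiff : ∀ᶠ z in 𝓝 y, DifferentiableAt ℝ φ z :=
        ((hφ.of_le (m := 1) ENat.LEInfty.out).eventually (by simp)).mono fun z hz =>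
          hz.differentiableAt (by simp)
      filter_upwards [hev.eventually_nhds, hdiff] with z hz hd
      have hz0 := hz.self_of_nhds
      have ht : φ z ∈ (extChartAt I c').target :=
        (extChartAt I c').map_source (by rw [extChartAt_source]; exact hz0.2.1)
      have h1 := mfderiv_comp z ((hf ((extChartAt I c).symm z)).mdifferentiableAt (by simp))
        (mdiff_chart_symm (I := I) hz0.1)
      have h2 := mfderiv_comp z (mdiff_chart_symm (I := I) ht) hd.mdifferentiableAt
      have h3 : f ∘ (extChartAt I c).symm =ᶠ[𝓝 z] (extChartAt I c').symm ∘ φ := by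
        filter_upwards [hz] with z' hz' using hz'.2.2.symm
      have h4 := h3.mfderiv_eq (I := 𝓘(ℝ, E)) (I' := I)
      refine (congrArg (s.val (f ((extChartAt I c).symm z))) h1.symm).trans ?_
      refine (s.congr h3.self_of_nhds _).trans ?_
      refine (congrArg (s.val ((extChartAt I c').symm (φ z))) (h4.trans h2)).trans ?_
      rw [mfderiv_eq_fderiv]
      exact s.comp _ _ _
    filter_upwards [hformula, hsign, hloc] with z h1 h2 h3
    refine h1.trans (Eq.trans ?_ hformula.self_of_nhds.symm)
    rw [h2, h3]

end PullSign

section Density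

variable {r : ℕ} {V : ComplexBundle I M r}

/-- The second Chern form at a point as an alternating form. -/
def chernAlt (D : V.Connection) (x : M) : E [⋀^Fin 4]→ₗ[ℝ] ℂ :=
  let A := chartMatrix I x (D.form (V.idx x))
  let y := extChartAt I x x
  ((1 / (8 * (Real.pi : ℂ) ^ 2)) : ℂ) •
    wedge22Alt (chernPairingₗ traceL) (curvₗ A y) (curvₗ A y) (curv_self A y) (curv_self A y)

theorem chernAlt_apply (D : V.Connection) (x : M) (v : Fin 4 → E) :
    chernAlt D x v = chernField D x v :=
  (chernForm_eq D (i := V.idx x) (mem_target_chart x)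
    (Set.mem_of_eq_of_mem (extChartAt_to_inv (I := I) x) (mem_idx V x)) v).symm

/-- The density of the second Chern form for a sign field. -/
def chernDensity (s : SignField I M) (D : V.Connection) (b : Module.Basis (Fin 4) ℝ E) :
    Density.Field I M :=
  fun x L => s.val x L * chernField D x fun k => L (b k)

/-- The Chern form scales by `det A` and the sign by the sign of `det A`; their product is `|det
A|`. -/
theorem isDensity_chernDensity (s : SignField I M) (D : V.Connection)
    (b : Module.Basis (Fin 4) ℝ E) : Density.IsDensity (chernDensity s D b) := by
  intro x L A
  let L' : E →L[ℝ] E := L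
  have h := alternating_comp_det_complex b ((chernAlt D x).compLinearMap (L' : E →ₗ[ℝ] E)) A
  have h1 : (chernField D x fun k => L (A (b k))) = (A.det : ℂ) * chernField D x fun k => L (b k) := by
    refine (chernAlt_apply D x _).symm.trans (h.trans ?_)
    exact congrArg (fun t => (A.det : ℂ) * t) (chernAlt_apply D x _)
  have h2 : (((s.val x (L.comp A)) : ℝ) : ℂ) = ((((SignType.sign A.det : SignType) : ℝ) *
      s.val x L : ℝ) : ℂ) := congrArg _ (s.comp x L A)
  have h3 : (((SignType.sign A.det : SignType) : ℝ) : ℂ) * (A.det : ℂ) = (|A.det| : ℝ) := by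
    rw [← sign_mul_self]; push_cast; rfl
  change ((s.val x (L.comp A) : ℝ) : ℂ) * (chernField D x fun k => L (A (b k))) =
    ((|A.det| : ℝ) : ℂ) * ((s.val x L : ℂ) * chernField D x fun k => L (b k))
  rw [h1, h2, ← h3]
  push_cast
  ring

theorem pull_chernDensity (s : SignField I M) (D : V.Connection) (b : Module.Basis (Fin 4) ℝ E)
    {c : M} {y : E} (hy : y ∈ (extChartAt I c).target) :
    Density.pull (chernDensity s D b) (extChartAt I c).symm y =
      s.val ((extChartAt I c).symm y) (mfderiv 𝓘(ℝ, E) I (extChartAt I c).symm y) *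
        D.chernForm c y b := by
  rw [chernForm_eq_chernField D hy]
  rfl

section Smoothness

variable {𝔸 : Type*} [NormedRing 𝔸] [NormedAlgebra ℝ 𝔸]

theorem contDiffAt_curv {A : E → E →L[ℝ] 𝔸} {y : E} (hA : ContDiffAt ℝ ∞ A y) (v w : E) :
    ContDiffAt ℝ ∞ (fun z => curv A z v w) y := by
  have h2 : ContDiffAt ℝ ∞ (fderiv ℝ A) y := hA.fderiv_right (m := ∞) (by simp)
  have c1 : ∀ v, ContDiffAt ℝ ∞ (fun z => A z v) y := fun v => hA.clm_apply contDiffAt_const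
  have c2 : ∀ v w, ContDiffAt ℝ ∞ (fun z => fderiv ℝ A z v w) y := fun v w =>
    (h2.clm_apply contDiffAt_const).clm_apply contDiffAt_const
  unfold curv extD
  exact ((c2 v w).sub (c2 w v)).add (((c1 v).mul (c1 w)).sub ((c1 w).mul (c1 v)))

theorem contDiffAt_chernPairing (τ : 𝔸 →L[ℝ] ℂ) {X Y : E → 𝔸} {y : E} (hX : ContDiffAt ℝ ∞ X y)
    (hY : ContDiffAt ℝ ∞ Y y) : ContDiffAt ℝ ∞ (fun z => chernPairing τ (X z) (Y z)) y := by
  unfold chernPairing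
  exact (ContDiffAt.continuousLinearMap_comp τ (hX.mul hY)).sub
    ((ContDiffAt.continuousLinearMap_comp τ hX).mul (ContDiffAt.continuousLinearMap_comp τ hY))

theorem contDiffAt_transgression (τ : 𝔸 →L[ℝ] ℂ) {A a : E → E →L[ℝ] 𝔸} {y : E}
    (hA : ContDiffAt ℝ ∞ A y) (ha : ContDiffAt ℝ ∞ a y) (u v w : E) :
    ContDiffAt ℝ ∞ (transgression τ A a u v w) y := by
  have c1 : ∀ v, ContDiffAt ℝ ∞ (fun z => a z v) y := fun v => ha.clm_apply contDiffAt_const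
  have c2 := fun v w => contDiffAt_curv hA v w
  have c3 := fun u v w => contDiffAt_chernPairing τ (c1 u) (c2 v w)
  have c4 := contDiffAt_chernPairing τ (c1 u) (((c1 v).mul (c1 w)).sub ((c1 w).mul (c1 v)))
  unfold transgression
  exact (contDiffAt_const.mul (((c3 u v w).sub (c3 v u w)).add (c3 w u v))).add
    (contDiffAt_const.mul c4)

theorem transgression_eq_zero (τ : 𝔸 →L[ℝ] ℂ) (A : E → E →L[ℝ] 𝔸) {a : E → E →L[ℝ] 𝔸} {y : E}
    (ha : a y = 0) (u v w : E) : transgression τ A a u v w y = 0 := by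
  simp [transgression, ha, chernPairing]

end Smoothness

/-- The index `V.idx` is frozen at its value at `y`, which is legitimate in a neighbourhood by
`chernForm_eq`. -/
theorem contDiffAt_chernForm (D : V.Connection) {c : M} {y : E}
    (hy : y ∈ (extChartAt I c).target) (v : Fin 4 → E) :
    ContDiffAt ℝ ∞ (fun z => D.chernForm c z v) y := by
  set i := V.idx ((extChartAt I c).symm y) with hi
  have hx : (extChartAt I c).symm y ∈ V.U i := mem_idx V _
  have hA := contDiffAt_form D hy hx
  have c2 := fun k l => contDiffAt_curv hA (v k) (v l)
  have c3 := fun k l k' l' => contDiffAt_chernPairing traceL (c2 k l) (c2 k' l')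
  have h : ContDiffAt ℝ ∞ (fun z => secondChern fun k l =>
      curv (chartMatrix I c (D.form i)) z (v k) (v l)) y := by
    unfold secondChern wedge22
    exact contDiffAt_const.mul ((((((c3 _ _ _ _).sub (c3 _ _ _ _)).add (c3 _ _ _ _)).add
      (c3 _ _ _ _)).sub (c3 _ _ _ _)).add (c3 _ _ _ _))
  refine h.congr_of_eventuallyEq ?_
  filter_upwards [(isOpen_chart_preimage (V.isOpen i) c).mem_nhds ⟨hy, hx⟩] with z hz
  exact chernForm_eq D hz.1 hz.2 v

theorem isCont_chernDensity (s : SignField I M) (D : V.Connection)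
    (b : Module.Basis (Fin 4) ℝ E) : Density.IsCont (chernDensity s D b) := by
  intro c y hy
  refine ContinuousAt.continuousWithinAt ?_
  have h1 := (contDiffAt_chernForm D hy b).continuousAt
  have h2 : ContinuousAt (fun z => ((s.val ((extChartAt I c).symm y)
      (mfderiv 𝓘(ℝ, E) I (extChartAt I c).symm y) : ℝ) : ℂ) * D.chernForm c z b) y :=
    continuousAt_const.mul h1
  refine h2.congr ?_
  filter_upwards [s.loc c y hy, (isOpen_extChartAt_target c).mem_nhds hy] with z hz hzt
  rw [pull_chernDensity s D b hzt, hz]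

/-- The passage from the Chern number of the statement to the integral of a density. -/
theorem chernIntegral_eq [MeasurableSpace E] [BorelSpace E] (D : V.Connection)
    (o : ManifoldOrientation I M) (b : Module.Basis (Fin 4) ℝ E)
    (ρ : SmoothPartitionOfUnity M I M univ) :
    D.chernIntegral o b ρ = Density.integral b.addHaar ρ (chernDensity (signField o b) D b) := by
  unfold ComplexBundle.Connection.chernIntegral Density.integral
  refine finsum_congr fun c => ?_
  refine MeasureTheory.setIntegral_congr_fun (isOpen_extChartAt_target c).measurableSet
    fun y hy => ?_
  have h := pull_chernDensity (signField o b) D b hy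
  change _ = (ρ c ((extChartAt I c).symm y) : ℂ) *
    Density.pull (chernDensity (signField o b) D b) (extChartAt I c).symm y
  rw [h]
  change ((ρ c ((extChartAt I c).symm y) * (signField o b).val ((extChartAt I c).symm y)
    (mfderiv 𝓘(ℝ, E) I (extChartAt I c).symm y) : ℝ) : ℂ) * _ = _
  push_cast
  ring

theorem pullback_chernDensity {N : Type*} [TopologicalSpace N] [ChartedSpace H N]
    [IsManifold I ∞ N] [FiniteDimensional ℝ E] (s : SignField I M) (D : V.Connection)
    (b : Module.Basis (Fin 4) ℝ E) {f : N → M} (hf : ContMDiff I I ∞ f)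
    (hinv : ∀ x, (mfderiv I I f x).IsInvertible) :
    Density.pullback f (chernDensity s D b) =
      chernDensity (s.pull hf hinv) (pullConnection D hf) b := by
  funext x L
  exact congrArg (fun t : ℂ => (s.val (f x) ((mfderiv I I f x).comp L) : ℂ) * t)
    (chernField_pullConnection D hf x fun k => L (b k)).symm

end Density

end ChernWeil

/-! ### Independence of the connection, and existence of connections. -/

namespace ChernWeil

variable {E H : Type*} [NormedAddCommGroup E] [NormedSpace ℝ E] [TopologicalSpace H]
  {I : ModelWithCorners ℝ E H} {M : Type*} [TopologicalSpace M] [ChartedSpace H M]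
  [I.Boundaryless] [IsManifold I ∞ M] {r : ℕ} {V : ComplexBundle I M r}

/-- Off the closed set `K` the connection forms agree on a whole neighbourhood, hence so do their
derivatives. -/
theorem chernForm_congr {D D' : V.Connection} {K : Set M} (hK : IsClosed K)
    (h : ∀ x ∉ K, ∀ j a b, D'.form j a b x = D.form j a b x) {c : M} {y : E}
    (hy : y ∈ (extChartAt I c).target) (hx : (extChartAt I c).symm y ∉ K) (v : Fin 4 → E) :
    D'.chernForm c y v = D.chernForm c y v := by
  have hi := mem_idx V ((extChartAt I c).symm y)
  rw [chernForm_eq D hy hi, chernForm_eq D' hy hi]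
  congr 1
  funext k l
  refine curv_congr ?_ _ _
  filter_upwards [(isOpen_chart_preimage hK.isOpen_compl c).mem_nhds ⟨hy, hx⟩] with z hz
  ext w a b
  rw [chartMatrix_apply, chartMatrix_apply]
  simp only [Mat.of_apply, chartForm, h _ hz.2]

theorem chernDensity_congr (s : SignField I M) (b : Module.Basis (Fin 4) ℝ E) {D D' : V.Connection}
    {K : Set M} (hK : IsClosed K) (h : ∀ x ∉ K, ∀ j a b, D'.form j a b x = D.form j a b x)
    {x : M} (hx : x ∉ K) (L : E →L[ℝ] TangentSpace I x) :
    chernDensity s D' b x L = chernDensity s D b x L :=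
  congrArg (fun t : ℂ => (s.val x L : ℂ) * t)
    (chernForm_congr hK h (mem_target_chart (I := I) x)
      (fun h' => hx (Set.mem_of_eq_of_mem (extChartAt_to_inv (I := I) x).symm h')) _)

variable [FiniteDimensional ℝ E] [MeasurableSpace E] [BorelSpace E]
  [T2Space M] [CompactSpace M]

/-- Connections which differ on a compact subset of a chart domain over which the bundle is
trivialised have the same integral of the second Chern form. -/
theorem integral_chernDensity_congr (s : SignField I M) (b : Module.Basis (Fin 4) ℝ E)
    {ρ : SmoothPartitionOfUnity M I M univ} (hρ : ρ.IsSubordinate fun c => (chartAt H c).source)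
    {D D' : V.Connection} {c : M} {i : V.ι} {K O : Set M} (hK : IsClosed K) (hKO : K ⊆ O)
    (hO : IsOpen O) (hOc : O ⊆ (chartAt H c).source) (hOi : O ⊆ V.U i) {σ : ℝ}
    (hσ : ∀ y ∈ (extChartAt I c).target, (extChartAt I c).symm y ∈ O →
      s.val ((extChartAt I c).symm y) (mfderiv 𝓘(ℝ, E) I (extChartAt I c).symm y) = σ)
    (h : ∀ x ∉ K, ∀ j a b, D'.form j a b x = D.form j a b x) :
    Density.integral b.addHaar ρ (chernDensity s D' b) =
      Density.integral b.addHaar ρ (chernDensity s D b) := by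
  set e := extChartAt I c
  set W := e.target ∩ e.symm ⁻¹' O with hW
  have hWo : IsOpen W := isOpen_chart_preimage hO c
  have hsrc : K ⊆ e.source := by
    rw [extChartAt_source]; exact hKO.trans hOc
  set K' := e '' K with hK'
  have hK'c : IsCompact K' := hK.isCompact.image_of_continuousOn
    ((Density.isSmoothChart_extChartAt (I := I) c).mdiff.continuousOn.mono hsrc)
  have hK'W : K' ⊆ W := by
    rintro _ ⟨x, hx, rfl⟩
    refine ⟨e.map_source (hsrc hx), ?_⟩
    change e.symm (e x) ∈ O
    rw [e.left_inv (hsrc hx)]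
    exact hKO hx
  have hnK : ∀ y ∈ e.target, y ∉ K' → e.symm y ∉ K := fun y hy hn hx =>
    hn ⟨e.symm y, hx, e.right_inv hy⟩
  set a : E → E →L[ℝ] Mat r ℂ := fun y =>
    chartMatrix I c (D'.form i) y - chartMatrix I c (D.form i) y with ha
  -- The midpoint of the two connection forms, so that they become `A + a / 2` and `A - a / 2`.
  set A : E → E →L[ℝ] Mat r ℂ := fun y => chartMatrix I c (D.form i) y + (1 / 2 : ℝ) • a y with hA
  have hWd : ∀ y ∈ W, ContDiffAt ℝ ∞ A y ∧ ContDiffAt ℝ ∞ a y := by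
    intro y hy
    have h1 := contDiffAt_form D hy.1 (hOi hy.2)
    have h2 := contDiffAt_form D' hy.1 (hOi hy.2)
    exact ⟨h1.add ((h2.sub h1).const_smul (1 / 2 : ℝ)), h2.sub h1⟩
  have ha0 : ∀ y ∈ e.target, y ∉ K' → a y = 0 := by
    intro y hy hn
    ext w p q
    simp only [ha, sub_apply, chartMatrix_apply, Mat.sub_apply, Mat.of_apply]
    exact sub_eq_zero.2 (congrArg (fun L : E →L[ℝ] ℂ =>
      L (mfderiv 𝓘(ℝ, E) I (extChartAt I c).symm y w)) (h _ (hnK y hy hn) i p q))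
  -- Extension by zero. It is continuously differentiable because `a` vanishes off the compact set
  -- `K'`, so the transgression already vanishes near the boundary of `W`.
  set T : E → E → E → E → ℂ := fun u v w => W.indicator (transgression traceL A a u v w) with hT
  have hT0 : ∀ u v w, ∀ y ∉ K', T u v w y = 0 := by
    intro u v w y hy
    by_cases hyW : y ∈ W
    · simp only [hT, Set.indicator_of_mem hyW]
      exact transgression_eq_zero _ _ (ha0 y hyW.1 hy) _ _ _
    · simp only [hT, Set.indicator_of_notMem hyW]
  have hTev : ∀ u v w, ∀ y ∈ W, T u v w =ᶠ[𝓝 y] transgression traceL A a u v w := by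
    intro u v w y hy
    filter_upwards [hWo.mem_nhds hy] with z hz
    simp only [hT, Set.indicator_of_mem hz]
  have hTd : ∀ u v w, ContDiff ℝ 1 (T u v w) := by
    intro u v w
    rw [contDiff_iff_contDiffAt]
    intro y
    by_cases hyW : y ∈ W
    · have h1 := contDiffAt_transgression traceL (hWd y hyW).1 (hWd y hyW).2 u v w
      exact (h1.of_le ENat.LEInfty.out).congr_of_eventuallyEq (hTev u v w y hyW)
    · refine (contDiffAt_const (c := (0 : ℂ))).congr_of_eventuallyEq ?_
      filter_upwards [hK'c.isClosed.isOpen_compl.mem_nhds fun hy => hyW (hK'W hy)] with z hz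
      exact hT0 u v w z hz
  have hTc : ∀ u v w, HasCompactSupport (T u v w) := fun u v w =>
    HasCompactSupport.intro hK'c fun y hy => hT0 u v w y hy
  have hTi : ∀ u v w x, MeasureTheory.Integrable (fun y => fderiv ℝ (T u v w) y x) b.addHaar :=
    fun u v w x => (((hTd u v w).continuous_fderiv one_ne_zero).clm_apply
      continuous_const).integrable_of_hasCompactSupport ((hTc u v w).fderiv_apply ℝ x)
  set κ : ℂ := (σ : ℂ) * (1 / (8 * (Real.pi : ℂ) ^ 2)) with hκ
  -- The exterior derivative of the transgression on the basis vectors. It is a sum of directional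
  -- derivatives of compactly supported functions, so its integral vanishes.
  set G : E → ℂ := fun y => κ * (fderiv ℝ (T (b 1) (b 2) (b 3)) y (b 0) -
    fderiv ℝ (T (b 0) (b 2) (b 3)) y (b 1) + fderiv ℝ (T (b 0) (b 1) (b 3)) y (b 2) -
    fderiv ℝ (T (b 0) (b 1) (b 2)) y (b 3)) with hG
  have hGi : MeasureTheory.Integrable G b.addHaar :=
    ((((hTi _ _ _ _).sub (hTi _ _ _ _)).add (hTi _ _ _ _)).sub (hTi _ _ _ _)).const_mul _
  have hGint : ∫ y, G y ∂b.addHaar = 0 := by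
    have hz := fun u v w x => integral_fderiv_eq_zero b.addHaar (hTd u v w) (hTc u v w) x
    have e1 := MeasureTheory.integral_sub (hTi (b 1) (b 2) (b 3) (b 0))
      (hTi (b 0) (b 2) (b 3) (b 1))
    have e2 := MeasureTheory.integral_add ((hTi (b 1) (b 2) (b 3) (b 0)).sub
      (hTi (b 0) (b 2) (b 3) (b 1))) (hTi (b 0) (b 1) (b 3) (b 2))
    have e3 := MeasureTheory.integral_sub (((hTi (b 1) (b 2) (b 3) (b 0)).sub
      (hTi (b 0) (b 2) (b 3) (b 1))).add (hTi (b 0) (b 1) (b 3) (b 2))) (hTi (b 0) (b 1) (b 2) (b 3))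
    simp only [Pi.sub_apply, Pi.add_apply] at e1 e2 e3
    simp only [hG]
    rw [MeasureTheory.integral_const_mul, e3, e2, e1, hz, hz, hz, hz]
    simp
  have hG0 : ∀ y ∉ K', G y = 0 := by
    intro y hy
    have hz : ∀ u v w, fderiv ℝ (T u v w) y = 0 := by
      intro u v w
      have : T u v w =ᶠ[𝓝 y] fun _ => (0 : ℂ) := by
        filter_upwards [hK'c.isClosed.isOpen_compl.mem_nhds hy] with z hz using hT0 u v w z hz
      rw [this.fderiv_eq]
      simp
    simp [hG, hz]
  set w : Density.Field I M := fun x L => chernDensity s D' b x L - chernDensity s D b x L with hw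
  have hwd : Density.IsDensity w := by
    intro x L B
    simp only [hw, isDensity_chernDensity s D' b x L B, isDensity_chernDensity s D b x L B]
    ring
  have hw0 : ∀ x ∉ K, ∀ L, w x L = 0 := fun x hx L =>
    sub_eq_zero.2 (chernDensity_congr s b hK h hx L)
  -- On `W` the orientation sign has the constant value `σ`, which can therefore be taken out of the
  -- derivative.
  have hpull : Set.EqOn (Density.pull w e.symm) G e.target := by
    intro y hy
    by_cases hyW : y ∈ W
    · have e1 : Density.pull w e.symm y = Density.pull (chernDensity s D' b) e.symm y -
          Density.pull (chernDensity s D b) e.symm y := rfl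
      rw [e1, pull_chernDensity s D' b hy, pull_chernDensity s D b hy, hσ y hy hyW.2,
        chernForm_eq D hy (hOi hyW.2), chernForm_eq D' hy (hOi hyW.2)]
      have hd := wedge22_sub_eq_fderiv_transgression traceL traceL_mul_comm
        ((hWd y hyW).1.of_le ENat.LEInfty.out) ((hWd y hyW).2.differentiableAt (by simp)) b
      have f1 : (fun z => A z + (1 / 2 : ℝ) • a z) = chartMatrix I c (D'.form i) := by
        funext z; simp only [hA, ha]; module
      have f0 : (fun z => A z - (1 / 2 : ℝ) • a z) = chartMatrix I c (D.form i) := by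
        funext z; simp only [hA]; module
      simp only [f1, f0] at hd
      simp only [secondChern, hG, (hTev _ _ _ y hyW).fderiv_eq, hκ]
      rw [← hd]
      ring
    · have hyK : y ∉ K' := fun hy' => hyW (hK'W hy')
      rw [hG0 y hyK]
      exact hw0 _ (hnK y hy hyK) _
  have hto := (isOpen_extChartAt_target (I := I) c).measurableSet
  have hint : ∫ y in e.target, Density.pull w e.symm y ∂b.addHaar = 0 := by
    rw [MeasureTheory.setIntegral_congr_fun hto hpull,
      MeasureTheory.setIntegral_eq_integral_of_forall_compl_eq_zero, hGint]
    exact fun y hy => hG0 y fun hy' => hy (hK'W hy').1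
  have hwi := (Density.integral_eq_of_chart b.addHaar hρ hwd
    (Density.isSmoothChart_extChartAt c) (fun x hx L => hw0 x (fun hx' => hx (hsrc hx')) L)
    (hGi.integrableOn.congr_fun hpull.symm hto)).2
  rw [hint] at hwi
  have hsub := Density.integral_sub b.addHaar ρ
    ((isCont_chernDensity s D' b).integrable b.addHaar hρ)
    ((isCont_chernDensity s D b).integrable b.addHaar hρ)
  exact sub_eq_zero.1 (hsub.symm.trans hwi)

/-- The affine combination of two connections by a smooth function. -/
def interp (D₀ D₁ : V.Connection) (f : M → ℝ) (hf : ContMDiff I 𝓘(ℝ, ℝ) ∞ f) : V.Connection where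
  form i a b x := D₀.form i a b x + f x • (D₁.form i a b x - D₀.form i a b x)
  smooth i a b c := by
    have h0 := D₀.smooth i a b c
    have h1 := D₁.smooth i a b c
    have h2 : ContDiffOn ℝ ∞ (fun y => f ((extChartAt I c).symm y))
        ((extChartAt I c).target ∩ (extChartAt I c).symm ⁻¹' V.U i) :=
      ((hf.comp_contMDiffOn (contMDiffOn_extChartAt_symm c)).contDiffOn).mono inter_subset_left
    exact h0.add (h2.smul (h1.sub h0))
  gauge i j x hx v := by
    have h0 := D₀.gauge i j x hx v
    have h1 := D₁.gauge i j x hx v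
    -- In the gauge law the inhomogeneous term enters with total weight `(1 - f) + f = 1`; this is
    -- why affine combinations of connections are connections.
    have hs : ∀ k, (Matrix.of fun a b => (D₀.form k a b x + f x • (D₁.form k a b x -
        D₀.form k a b x)) v) = (1 - f x) • (Matrix.of fun a b => D₀.form k a b x v) +
          f x • (Matrix.of fun a b => D₁.form k a b x v) := by
      intro k
      ext a b
      change D₀.form k a b x v + f x • (D₁.form k a b x v - D₀.form k a b x v) =
        (1 - f x) • D₀.form k a b x v + f x • D₁.form k a b x v
      module
    rw [hs, hs, h0, h1]
    simp only [mul_add, add_mul, mul_smul_comm, smul_mul_assoc, smul_add]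
    module

theorem interp_of_eq_zero (D₀ D₁ : V.Connection) {f : M → ℝ} (hf : ContMDiff I 𝓘(ℝ, ℝ) ∞ f) {x : M}
    (h : f x = 0) (i : V.ι) (a b : Fin r) :
    (interp D₀ D₁ f hf).form i a b x = D₀.form i a b x := by
  refine ContinuousLinearMap.ext fun v => ?_
  change D₀.form i a b x v + f x • (D₁.form i a b x v - D₀.form i a b x v) = _
  rw [h, zero_smul, add_zero]

theorem interp_of_eq_one (D₀ D₁ : V.Connection) {f : M → ℝ} (hf : ContMDiff I 𝓘(ℝ, ℝ) ∞ f) {x : M}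
    (h : f x = 1) (i : V.ι) (a b : Fin r) :
    (interp D₀ D₁ f hf).form i a b x = D₁.form i a b x := by
  refine ContinuousLinearMap.ext fun v => ?_
  change D₀.form i a b x v + f x • (D₁.form i a b x v - D₀.form i a b x v) = _
  rw [h, one_smul, add_sub_cancel]

/-- The integral of the second Chern form does not depend on the connection. -/
theorem integral_chernDensity_eq (s : SignField I M) (b : Module.Basis (Fin 4) ℝ E)
    {ρ : SmoothPartitionOfUnity M I M univ} (hρ : ρ.IsSubordinate fun c => (chartAt H c).source)
    (D₀ D₁ : V.Connection) :
    Density.integral b.addHaar ρ (chernDensity s D₁ b) =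
      Density.integral b.addHaar ρ (chernDensity s D₀ b) := by
  classical
  -- Neighbourhoods small enough to lie in a chart and in a trivialising set and to carry a constant
  -- orientation sign.
  have hO : ∀ x : M, ∃ O : Set M, IsOpen O ∧ x ∈ O ∧ O ⊆ (chartAt H x).source ∧
      O ⊆ V.U (V.idx x) ∧ ∃ σ : ℝ, ∀ y ∈ (extChartAt I x).target, (extChartAt I x).symm y ∈ O →
        s.val ((extChartAt I x).symm y) (mfderiv 𝓘(ℝ, E) I (extChartAt I x).symm y) = σ := by
    intro x
    have hl := s.loc x _ (mem_target_chart x)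
    obtain ⟨S, hS, hSo, hxS⟩ := eventually_nhds_iff.1 hl
    refine ⟨(chartAt H x).source ∩ extChartAt I x ⁻¹' S ∩ V.U (V.idx x), ?_, ?_, ?_, ?_,
      s.val ((extChartAt I x).symm (extChartAt I x x))
        (mfderiv 𝓘(ℝ, E) I (extChartAt I x).symm (extChartAt I x x)), ?_⟩
    · refine IsOpen.inter ?_ (V.isOpen _)
      have := (Density.isSmoothChart_extChartAt (I := I) x).mdiff.continuousOn.isOpen_inter_preimage
        (isOpen_extChartAt_source x) hSo
      rwa [extChartAt_source] at this
    · exact ⟨⟨mem_chart_source H x, hxS⟩, mem_idx V x⟩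
    · exact fun z hz => hz.1.1
    · exact fun z hz => hz.2
    · intro y hy hyO
      refine hS y ?_
      have := hyO.1.2
      change extChartAt I x ((extChartAt I x).symm y) ∈ S at this
      rwa [(extChartAt I x).right_inv hy] at this
  choose O hOo hxO hOc hOi σ hσ using hO
  obtain ⟨f, hf⟩ := SmoothPartitionOfUnity.exists_isSubordinate I (isClosed_univ (X := M)) O hOo
    fun x _ => mem_iUnion.2 ⟨x, hxO x⟩
  have hsm : ∀ t : Finset M, ContMDiff I 𝓘(ℝ, ℝ) ∞ fun x => ∑ c ∈ t, f c x := fun t =>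
    contMDiff_finsetSum fun c _ => (f c).contMDiff
  -- The passage from `D₀` to `D₁` is made one member of the partition of unity at a time; each step
  -- changes the connection only on the support of `f c`.
  have key : ∀ t : Finset M,
      Density.integral b.addHaar ρ (chernDensity s (interp D₀ D₁ _ (hsm t)) b) =
        Density.integral b.addHaar ρ (chernDensity s D₀ b) := by
    intro t
    induction t using Finset.induction_on with
    | empty =>
      congr 1
      funext x L
      refine chernDensity_congr s b isClosed_empty (fun x _ j p q => ?_) (notMem_empty x) L
      exact interp_of_eq_zero D₀ D₁ (hsm ∅) Finset.sum_empty j p q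
    | insert c t hc ih =>
      rw [← ih]
      refine integral_chernDensity_congr s b hρ (isClosed_tsupport (f c)) (hf c) (hOo c) (hOc c)
        (hOi c) (hσ c) fun x hx j p q => ?_
      have : f c x = 0 := image_eq_zero_of_notMem_tsupport hx
      simp [interp, Finset.sum_insert hc, this]
  rw [← key (Density.indices f)]
  congr 1
  funext x L
  refine chernDensity_congr s b isClosed_empty (fun x _ j p q => ?_) (notMem_empty x) L
  exact (interp_of_eq_one D₀ D₁ (hsm _) (Density.sum_indices f x) j p q).symm

section Existence

omit [FiniteDimensional ℝ E] [MeasurableSpace E] [BorelSpace E] [T2Space M] [CompactSpace M] in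
theorem fderiv_chartTransition_self (V : ComplexBundle I M r) {i j : V.ι} {x : M} (hi : x ∈ V.U i)
    (hj : x ∈ V.U j) (v : E) (a b : Fin r) :
    fderiv ℝ (chartTransition V x i j) (extChartAt I x x) v a b =
      mfderiv I 𝓘(ℝ, ℂ) (fun z => V.g i j z a b) x v := by
  have hx := extChartAt_to_inv (I := I) x
  rw [fderiv_matrix_apply ((contDiffAt_chartTransition (mem_target_chart x)
    (Set.mem_of_eq_of_mem hx hi) (Set.mem_of_eq_of_mem hx hj)).differentiableAt (by simp))]
  have : mfderiv I 𝓘(ℝ, ℂ) (fun z => V.g i j z a b) x =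
      fderivWithin ℝ (writtenInExtChartAt I 𝓘(ℝ, ℂ) x fun z => V.g i j z a b) (range I)
        (extChartAt I x x) := by
    unfold mfderiv
    exact if_pos ((contMDiffAt_g V hi hj a b).mdifferentiableAt (by simp))
  rw [I.range_eq_univ, fderivWithin_univ] at this
  exact (congrArg (fun L : E →L[ℝ] ℂ => L v) this).symm

/-- The differentiated cocycle condition. -/
theorem fderiv_chartTransition_mul (V : ComplexBundle I M r) {i j k : V.ι} {c : M} {y : E}
    (hy : y ∈ (extChartAt I c).target) (hi : (extChartAt I c).symm y ∈ V.U i)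
    (hj : (extChartAt I c).symm y ∈ V.U j) (hk : (extChartAt I c).symm y ∈ V.U k) (v : E) :
    fderiv ℝ (chartTransition V c i k) y v =
      chartTransition V c i j y * fderiv ℝ (chartTransition V c j k) y v +
        fderiv ℝ (chartTransition V c i j) y v * chartTransition V c j k y := by
  have h1 : chartTransition V c i k =ᶠ[𝓝 y] fun z =>
      chartTransition V c i j z * chartTransition V c j k z := by
    filter_upwards [(isOpen_chart_preimage (V.isOpen i) c).mem_nhds ⟨hy, hi⟩,
      (isOpen_chart_preimage (V.isOpen j) c).mem_nhds ⟨hy, hj⟩,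
      (isOpen_chart_preimage (V.isOpen k) c).mem_nhds ⟨hy, hk⟩] with z h1 h2 h3
    exact (V.g_comp i j k _ ⟨⟨h1.2, h2.2⟩, h3.2⟩).symm
  have h2 := ((contDiffAt_chartTransition hy hi hj).differentiableAt (by simp)).hasFDerivAt.mul'
    ((contDiffAt_chartTransition hy hj hk).differentiableAt (by simp)).hasFDerivAt
  rw [h1.fderiv_eq]
  exact congrArg (fun L : E →L[ℝ] Mat r ℂ => L v) h2.fderiv

/-- The differential of an entry of a transition matrix. -/
def dEntry (V : ComplexBundle I M r) (i j : V.ι) (a b : Fin r) (x : M) : E →L[ℝ] ℂ :=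
  mfderiv I 𝓘(ℝ, ℂ) (fun z => V.g i j z a b) x

/-- A complex vector bundle over a compact manifold has a connection. -/
theorem nonempty_connection (V : ComplexBundle I M r) : Nonempty V.Connection := by
  obtain ⟨ρ, hρ⟩ := SmoothPartitionOfUnity.exists_isSubordinate I (isClosed_univ (X := M)) V.U
    V.isOpen fun x _ => mem_iUnion.2 (V.cover x)
  set t := (ρ.locallyFinite.finite_nonempty_of_compact).toFinset with ht
  have hsum : ∀ x, ∑ k ∈ t, ρ k x = 1 := by
    intro x
    rw [← ρ.sum_eq_one (mem_univ x)]
    refine (finsum_eq_sum_of_support_subset _ fun k hk => ?_).symm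
    exact (Set.Finite.mem_toFinset _).2 ⟨x, hk⟩
  have hρU : ∀ k x, x ∉ V.U k → ρ k x = 0 := fun k x hx =>
    image_eq_zero_of_notMem_tsupport fun h => hx (hρ k h)
  -- The connection for which the frame `s k` is parallel has the form `g i k * d(g k i)` in the
  -- frame `s i`. These flat connections are averaged with the partition of unity.
  let φ : V.ι → Fin r → Fin r → M → (E →L[ℝ] ℂ) := fun i a b x =>
    ∑ k ∈ t, ρ k x • ∑ l, V.g i k x a l • dEntry V k i l b x
  refine ⟨⟨φ, fun i a b c => ?_, fun i j x hx v => ?_⟩⟩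
  · rintro y ⟨hy, hi⟩
    refine ContDiffAt.contDiffWithinAt ?_
    let S : E → E →L[ℝ] E := fun z => mfderiv 𝓘(ℝ, E) I (extChartAt I c).symm z
    have hterm : ∀ k ∈ t, ContDiffAt ℝ ∞ (fun z : E => ρ k ((extChartAt I c).symm z) •
        ∑ l, V.g i k ((extChartAt I c).symm z) a l •
          (dEntry V k i l b ((extChartAt I c).symm z)).comp (S z)) y := by
      intro k _
      by_cases hk : (extChartAt I c).symm y ∈ V.U k
      · have h1 : ContDiffAt ℝ ∞ (fun z : E => ρ k ((extChartAt I c).symm z) •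
            ∑ l, chartTransition V c i k z a l •
              fderiv ℝ (fun z' => chartTransition V c k i z' l b) z) y := by
          have hρs : ContDiffAt ℝ ∞ (fun z : E => ρ k ((extChartAt I c).symm z)) y := by
            rw [← contMDiffAt_iff_contDiffAt]
            exact ((ρ k).contMDiff _).comp y
              ((contMDiffOn_extChartAt_symm c).contMDiffAt
                ((isOpen_extChartAt_target c).mem_nhds hy))
          refine hρs.smul (ContDiffAt.sum fun l _ => ?_)
          refine (ContDiffAt.entry (contDiffAt_chartTransition hy hi hk) a l).smul ?_
          exact (ContDiffAt.entry (contDiffAt_chartTransition hy hk hi) l b).fderiv_right (m := ∞) (by simp)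
        refine h1.congr_of_eventuallyEq ?_
        filter_upwards [(isOpen_chart_preimage (V.isOpen i) c).mem_nhds ⟨hy, hi⟩,
          (isOpen_chart_preimage (V.isOpen k) c).mem_nhds ⟨hy, hk⟩] with z hzi hzk
        refine congrArg _ (Finset.sum_congr rfl fun l _ => congrArg _ ?_)
        ext w
        rw [← fderiv_matrix_apply
          ((contDiffAt_chartTransition hzk.1 hzk.2 hzi.2).differentiableAt (by simp)),
          fderiv_chartTransition hzk.1 hzk.2 hzi.2]
        rfl
      -- Outside `V.U k` the transition matrices need not be smooth, but there the factor `ρ k`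
      -- vanishes in a neighbourhood.
      · refine (contDiffAt_const (c := (0 : E →L[ℝ] ℂ))).congr_of_eventuallyEq ?_
        have hk' : (extChartAt I c).symm y ∈ (tsupport (ρ k))ᶜ := fun h => hk (hρ k h)
        filter_upwards [(isOpen_chart_preimage (isClosed_tsupport (ρ k)).isOpen_compl c).mem_nhds
          ⟨hy, hk'⟩] with z hz
        rw [image_eq_zero_of_notMem_tsupport hz.2]
        exact zero_smul ℝ (_ : E →L[ℝ] ℂ)
    refine (ContDiffAt.sum hterm).congr_of_eventuallyEq (Eventually.of_forall fun z => ?_)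
    refine ContinuousLinearMap.ext fun w => ?_
    change φ i a b ((extChartAt I c).symm z) (S z w) = _
    simp only [φ, sum_apply, smul_apply, ContinuousLinearMap.comp_apply]
  · set y := extChartAt I x x
    have hy := mem_target_chart (I := I) x
    have hxx := extChartAt_to_inv (I := I) x
    have hU : ∀ k, x ∈ V.U k → (extChartAt I x).symm y ∈ V.U k := fun k hk =>
      Set.mem_of_eq_of_mem hxx hk
    have hform : ∀ (v : E) (j : V.ι), x ∈ V.U j → (Mat.of fun a b => φ j a b x v) =
        ∑ k ∈ t, ρ k x • (chartTransition V x j k y * fderiv ℝ (chartTransition V x k j) y v) := by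
      intro v j hj
      ext a b
      simp only [Mat.of_apply, Mat.sum_apply, Mat.smul_apply, Mat.mul_apply, φ]
      simp only [sum_apply, smul_apply]
      refine Finset.sum_congr rfl fun k _ => ?_
      by_cases hk : x ∈ V.U k
      · refine congrArg (fun z : ℂ => ρ k x • z) (Finset.sum_congr rfl fun l _ => ?_)
        rw [fderiv_chartTransition_self V hk hj, chartTransition, hxx]
        rfl
      · rw [hρU k x hk, zero_smul, zero_smul]
    have hg : ∀ i j, chartTransition V x i j y = V.g i j x := fun i j => by
      rw [chartTransition, hxx]
    have hgauge : ∀ v : E, (Mat.of fun a b => φ j a b x v) =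
        chartTransition V x j i y * (Mat.of fun a b => φ i a b x v) * chartTransition V x i j y +
          chartTransition V x j i y * fderiv ℝ (chartTransition V x i j) y v := by
      intro v
      rw [hform v j hx.2, hform v i hx.1, Finset.mul_sum, Finset.sum_mul]
      -- The inhomogeneous term is distributed over the partition of unity, so that the gauge law
      -- can be checked for each `k` separately.
      have h1 : chartTransition V x j i y * fderiv ℝ (chartTransition V x i j) y v =
          ∑ k ∈ t, ρ k x • (chartTransition V x j i y *
            fderiv ℝ (chartTransition V x i j) y v) := by
        rw [← Finset.sum_smul, hsum, one_smul]
      rw [h1, ← Finset.sum_add_distrib]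
      refine Finset.sum_congr rfl fun k _ => ?_
      by_cases hk : x ∈ V.U k
      · have e1 : chartTransition V x j k y =
            chartTransition V x j i y * chartTransition V x i k y :=
          (V.g_comp j i k _ ⟨⟨hU j hx.2, hU i hx.1⟩, hU k hk⟩).symm
        have e2 : chartTransition V x i k y * chartTransition V x k i y = 1 :=
          g_inv V (hU i hx.1) (hU k hk)
        rw [fderiv_chartTransition_mul V (y := y) hy (hU k hk) (hU i hx.1) (hU j hx.2), e1, mul_smul_comm,
          smul_mul_assoc, ← smul_add]
        congr 1
        calc _ = chartTransition V x j i y * (chartTransition V x i k y *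
                chartTransition V x k i y) * fderiv ℝ (chartTransition V x i j) y v +
              chartTransition V x j i y * (chartTransition V x i k y *
                fderiv ℝ (chartTransition V x k i) y v) * chartTransition V x i j y := by
              noncomm_ring
          _ = _ := by rw [e2, mul_one, add_comm]
      · simp [hρU k x hk]
    have hd : fderiv ℝ (chartTransition V x i j) y v =
        Mat.of fun a b => mfderiv I 𝓘(ℝ, ℂ) (fun z => V.g i j z a b) x v :=
      Mat.ext fun a b => fderiv_chartTransition_self V hx.1 hx.2 v a b
    refine (hgauge v).trans ?_
    rw [hg, hg]
    exact congrArg (fun Z : Matrix (Fin r) (Fin r) ℂ => V.g j i x *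
      (Matrix.of fun a b => φ i a b x v) * V.g i j x + V.g j i x * Z) hd

end Existence

end ChernWeil

/-! ## Smooth quotients by free actions -/

section SmoothQuotient

variable {E H X Y G : Type*} [NormedAddCommGroup E] [NormedSpace ℝ E] [TopologicalSpace H]
  {I : ModelWithCorners ℝ E H} [I.Boundaryless] [TopologicalSpace X] [TopologicalSpace Y]
  [ChartedSpace H X] [IsManifold I ∞ X] [ChartedSpace H Y] [IsManifold I ∞ Y]
  [Group G] [MulAction G X] {f : X → Y}

/-- A smooth quotient map of manifolds by a group action, with charts given by local inverses. -/
structure IsSmoothQuotient (I : ModelWithCorners ℝ E H) [ChartedSpace H X] [ChartedSpace H Y]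
    (G : Type*) [Group G] [MulAction G X] (f : X → Y) (s : Y → X) : Prop where
  isLocalHomeomorph : IsLocalHomeomorph f
  rightInverse : Function.RightInverse s f
  smul : ∀ (u : G) (x : X), f (u • x) = f x
  exists_smul : ∀ x y : X, f x = f y → ∃ u : G, u • x = y
  smooth : ∀ u : G, ContMDiff I I ∞ (fun x : X => u • x)
  chart : ∀ c : Y, chartAt H c =
    (isLocalHomeomorph.localInverseAt (s c)).trans (chartAt H (s c))

namespace IsSmoothQuotient

variable {s : Y → X} (hf : IsSmoothQuotient I G f s)
include hf

theorem apply_localInverse_symm (c : X) (x : X) :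
    (hf.isLocalHomeomorph.localInverseAt c).symm x = f x :=
  congrFun (hf.isLocalHomeomorph.localInverseAt_symm c) x

theorem mem_localInverse_source {c y : Y} (hy : y ∈ (chartAt H c).source) :
    y ∈ (hf.isLocalHomeomorph.localInverseAt (s c)).source ∧
      hf.isLocalHomeomorph.localInverseAt (s c) y ∈ (chartAt H (s c)).source := by
  rw [hf.chart c] at hy
  simpa using hy

theorem extChartAt_apply (c y : Y) :
    extChartAt I c y = extChartAt I (s c) (hf.isLocalHomeomorph.localInverseAt (s c) y) := by
  simp only [extChartAt, hf.chart c]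
  rfl

/-- Near a point the local inverse composed with the quotient map is the action of an element. -/
theorem eventually_localInverse {c : X} {u : G} {x : X}
    (h : u • x ∈ (hf.isLocalHomeomorph.localInverseAt c).target) :
    ∀ᶠ x' in 𝓝 x, hf.isLocalHomeomorph.localInverseAt c (f x') = u • x' := by
  filter_upwards [(hf.smooth u).continuous.continuousAt.eventually_mem
    ((hf.isLocalHomeomorph.localInverseAt c).open_target.mem_nhds h)] with x' hx'
  rw [← hf.smul u x', ← hf.apply_localInverse_symm c,
    (hf.isLocalHomeomorph.localInverseAt c).right_inv hx']

/-- A chart of `Y` is a local inverse of `f` followed by a chart of `X`, so in charts `f` is the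
action of a group element. -/
theorem contMDiff : ContMDiff I I ∞ f := by
  intro x
  rw [contMDiffAt_iff_target]
  refine ⟨hf.isLocalHomeomorph.continuous.continuousAt, ?_⟩
  obtain ⟨u, hu⟩ := hf.exists_smul x (s (f x)) (hf.rightInverse (f x)).symm
  have h1 : ContMDiffAt I 𝓘(ℝ, E) ∞ (extChartAt I (s (f x)) ∘ fun x' => u • x') x := by
    refine ContMDiffAt.comp x ?_ (hf.smooth u x)
    exact contMDiffAt_extChartAt' (by rw [hu]; exact mem_chart_source H _)
  refine h1.congr_of_eventuallyEq ?_
  filter_upwards [hf.eventually_localInverse (c := s (f x)) (u := u) (x := x)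
    (by rw [hu]; exact hf.isLocalHomeomorph.self_mem_localInverseAt_target)] with x' hx'
  rw [Function.comp_apply, hf.extChartAt_apply, hx']
  rfl

/-- In the chart of `Y` at `c` and the chart of `X` at `s c` the local inverse is the identity. -/
theorem contMDiffAt_localInverse {c y : Y} (hy : y ∈ (chartAt H c).source) :
    ContMDiffAt I I ∞ (hf.isLocalHomeomorph.localInverseAt (s c)) y := by
  have h1 : ContMDiffAt I I ∞ ((extChartAt I (s c)).symm ∘ extChartAt I c) y := by
    refine ContMDiffAt.comp y ?_ (contMDiffAt_extChartAt' hy)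
    refine (contMDiffOn_extChartAt_symm (s c)).contMDiffAt
      ((isOpen_extChartAt_target (s c)).mem_nhds ?_)
    rw [hf.extChartAt_apply]
    refine (extChartAt I (s c)).map_source ?_
    rw [extChartAt_source]
    exact (hf.mem_localInverse_source hy).2
  refine h1.congr_of_eventuallyEq ?_
  filter_upwards [(chartAt H c).open_source.mem_nhds hy] with z hz
  rw [Function.comp_apply, hf.extChartAt_apply, (extChartAt I (s c)).left_inv]
  rw [extChartAt_source]
  exact (hf.mem_localInverse_source hz).2

/-- The local sections of the quotient map over the chart centred at `c`. -/
def lift (c : Y) (u : G) (y : Y) : X := u • hf.isLocalHomeomorph.localInverseAt (s c) y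

theorem contMDiffAt_lift {c y : Y} (u : G) (hy : y ∈ (chartAt H c).source) :
    ContMDiffAt I I ∞ (hf.lift c u) y :=
  (hf.smooth u _).comp y (hf.contMDiffAt_localInverse hy)

theorem apply_lift {c y : Y} (u : G) (hy : y ∈ (chartAt H c).source) : f (hf.lift c u y) = y := by
  rw [lift, hf.smul]
  exact hf.isLocalHomeomorph.apply_localInverseAt_of_mem (hf.mem_localInverse_source hy).1

/-- Describes the sheet of `u` as the translate by `u` of the open image of the local inverse; this
makes the sheets open. -/
theorem lift_eq_iff {c : Y} (u : G) {x : X} (hx : f x ∈ (chartAt H c).source) :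
    hf.lift c u (f x) = x ↔
      u⁻¹ • x ∈ (hf.isLocalHomeomorph.localInverseAt (s c)).target := by
  rw [lift, smul_eq_iff_eq_inv_smul]
  constructor
  · intro h
    rw [← h]
    exact (hf.isLocalHomeomorph.localInverseAt (s c)).map_source (hf.mem_localInverse_source hx).1
  · intro h
    rw [← hf.smul u⁻¹ x, ← hf.apply_localInverse_symm (s c),
      (hf.isLocalHomeomorph.localInverseAt (s c)).right_inv h]

theorem exists_lift_eq (c : Y) {x : X} (hx : f x ∈ (chartAt H c).source) :
    ∃ u : G, hf.lift c u (f x) = x :=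
  hf.exists_smul _ _
    (hf.isLocalHomeomorph.apply_localInverseAt_of_mem (hf.mem_localInverse_source hx).1)

theorem isOpen_lift_eq (c : Y) (u : G) :
    IsOpen {x | f x ∈ (chartAt H c).source ∧ hf.lift c u (f x) = x} := by
  have : {x | f x ∈ (chartAt H c).source ∧ hf.lift c u (f x) = x} =
      f ⁻¹' (chartAt H c).source ∩
        (fun x => u⁻¹ • x) ⁻¹' (hf.isLocalHomeomorph.localInverseAt (s c)).target := by
    ext x
    exact and_congr_right fun hx => hf.lift_eq_iff u hx
  rw [this]
  exact ((chartAt H c).open_source.preimage hf.isLocalHomeomorph.continuous).inter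
    ((hf.isLocalHomeomorph.localInverseAt (s c)).open_target.preimage (hf.smooth u⁻¹).continuous)

/-- Transitivity on the fibres gives a sheet through each point, and freeness of the action gives
its uniqueness. -/
theorem existsUnique_lift_eq [IsCancelSMul G X] (c : Y) (x : X)
    (hx : f x ∈ (chartAt H c).source) : ∃! u : G, hf.lift c u (f x) = x := by
  obtain ⟨u, hu⟩ := hf.exists_lift_eq c hx
  refine ⟨u, hu, fun u' hu' => ?_⟩
  exact IsCancelSMul.right_cancel u' u _ (hu'.trans hu.symm)

/-- Near `x` the map `f` and one of its local sections are inverse to each other, and so are their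
differentials. -/
theorem isInvertible_mfderiv (x : X) : (mfderiv I I f x).IsInvertible := by
  set c := f x
  have hc : f x ∈ (chartAt H c).source := mem_chart_source H _
  obtain ⟨u, hu⟩ := hf.exists_lift_eq c hc
  have hfx : ∀ x, MDifferentiableAt I I f x := fun x => (hf.contMDiff x).mdifferentiableAt (by simp)
  have hl : MDifferentiableAt I I (hf.lift c u) (f x) :=
    (hf.contMDiffAt_lift u hc).mdifferentiableAt (by simp)
  have h1 := mfderiv_comp x hl (hfx x)
  have h2 := mfderiv_comp (f x) (hfx _) hl
  have e1 : hf.lift c u ∘ f =ᶠ[𝓝 x] id := by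
    filter_upwards [(hf.isOpen_lift_eq c u).mem_nhds ⟨hc, hu⟩] with z hz using hz.2
  have e2 : f ∘ hf.lift c u =ᶠ[𝓝 (f x)] id := by
    filter_upwards [(chartAt H c).open_source.mem_nhds hc] with z hz using hf.apply_lift u hz
  rw [e1.mfderiv_eq, mfderiv_id] at h1
  rw [e2.mfderiv_eq, mfderiv_id] at h2
  have key : ∀ z, z = x → (mfderiv I I f z : E →L[ℝ] E) = mfderiv I I f x := by
    rintro z rfl; rfl
  have h2' : ContinuousLinearMap.id ℝ E = (mfderiv I I f x : E →L[ℝ] E).comp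
      (mfderiv I I (hf.lift c u) (f x) : E →L[ℝ] E) :=
    h2.trans (congrArg (fun L : E →L[ℝ] E =>
      L.comp (mfderiv I I (hf.lift c u) (f x) : E →L[ℝ] E)) (key _ hu))
  refine ⟨ContinuousLinearEquiv.equivOfInverse (mfderiv I I f x : E →L[ℝ] E)
    (mfderiv I I (hf.lift c u) (f x) : E →L[ℝ] E) (fun v => ?_) fun v => ?_, rfl⟩
  · exact (congrArg (fun L : E →L[ℝ] E => L v) h1).symm
  · exact (congrArg (fun L : E →L[ℝ] E => L v) h2').symm

end IsSmoothQuotient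

/-- Chern integrals of a connection can be computed on a finite quotient cover. -/
theorem IsSmoothQuotient.integral_pullConnection [FiniteDimensional ℝ E] [MeasurableSpace E]
    [BorelSpace E] [T2Space X] [CompactSpace X] [T2Space Y] [CompactSpace Y] [Fintype G]
    [IsCancelSMul G X] {s : Y → X} (hf : IsSmoothQuotient I G f s) {r : ℕ}
    {V : ComplexBundle I Y r} (D : V.Connection) (σ : ChernWeil.SignField I Y)
    (b : Module.Basis (Fin 4) ℝ E) {ρ : SmoothPartitionOfUnity Y I Y univ}
    (hρ : ρ.IsSubordinate fun c => (chartAt H c).source)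
    {ρX : SmoothPartitionOfUnity X I X univ}
    (hρX : ρX.IsSubordinate fun c => (chartAt H c).source) :
    Density.integral b.addHaar ρX (ChernWeil.chernDensity
        (σ.pull hf.contMDiff hf.isInvertible_mfderiv)
        (ChernWeil.pullConnection D hf.contMDiff) b) =
      Fintype.card G * Density.integral b.addHaar ρ (ChernWeil.chernDensity σ D b) := by
  rw [← ChernWeil.pullback_chernDensity σ D b hf.contMDiff hf.isInvertible_mfderiv]
  exact Density.integral_pullback b.addHaar hρ hρX (ChernWeil.isDensity_chernDensity σ D b)
    (ChernWeil.isCont_chernDensity σ D b) (fun x => (hf.contMDiff x).mdifferentiableAt (by simp))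
    hf.lift (fun c u y hy =>
      ((hf.contMDiffAt_lift u hy).mdifferentiableAt (by simp)).mdifferentiableWithinAt)
    (fun c u y hy => hf.apply_lift u hy) hf.isOpen_lift_eq hf.existsUnique_lift_eq

end SmoothQuotient

/-! ### The double cover of the quotient by the involution. -/

section DoubleCover
open MirrorSurface LevelSurface

/-- The double cover of `M2g`. -/
def doubleCover (g : ℕ) (x : Surface g × Sphere2) : M2g g := Quotient.mk _ x

theorem exists_isSmoothQuotient (g : ℕ) :
    ∃ s, IsSmoothQuotient coverModel ℤˣ (doubleCover g) s := by
  have h := isQuotientCoveringMap_quotientMk_of_properlyDiscontinuousSMul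
    (G := ℤˣ) (E := Surface g × Sphere2)
  refine ⟨_, h.isCoveringMap.isLocalHomeomorph,
    (Function.Surjective.hasRightInverse Quotient.mk_surjective).choose_spec,
    fun u x => Quotient.sound (MulAction.mem_orbit _ _), fun x y hxy => ?_,
    contMDiff_unit_smul g, fun c => rfl⟩
  obtain ⟨u, hu⟩ := Quotient.exact hxy.symm
  exact ⟨u, hu⟩

end DoubleCover

/-! ## The inverse square root of a positive definite matrix -/

namespace Matrix
open scoped MatrixOrder

variable {ι : Type*} [Fintype ι] [DecidableEq ι]

theorem PosDef.exists_sqrt {P : Matrix ι ι ℝ} (hP : P.PosDef) : (CFC.sqrt P).PosDef ∧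
    CFC.sqrt P * CFC.sqrt P = P := by
  have h0 : 0 ≤ P := hP.posSemidef.nonneg
  have h1 : CFC.sqrt P * CFC.sqrt P = P := CFC.sqrt_mul_sqrt_self P h0
  refine ⟨?_, h1⟩
  rw [(Matrix.nonneg_iff_posSemidef.1 (CFC.sqrt_nonneg P)).posDef_iff_isUnit]
  have h2 : IsUnit (CFC.sqrt P * CFC.sqrt P) := by rw [h1]; exact hP.isUnit
  exact isUnit_of_mul_isUnit_left h2

/-- The trace of `Yᴴ (P Y + Y Q)` is a sum of two nonnegative numbers, so `tr (Yᴴ P Y) = 0`. This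
gives the uniqueness of positive square roots and the invertibility of the derivative of squaring.
-/
theorem PosDef.eq_zero_of_mul_add_mul {P Q Y : Matrix ι ι ℝ} (hP : P.PosDef) (hQ : Q.PosDef)
    (h : P * Y + Y * Q = 0) : Y = 0 := by
  have h1 : 0 ≤ (Yᴴ * P * Y).trace := (hP.posSemidef.conjTranspose_mul_mul_same Y).trace_nonneg
  have h2 : 0 ≤ (Y * Q * Yᴴ).trace := (hQ.posSemidef.mul_mul_conjTranspose_same Y).trace_nonneg
  have h3 : (Yᴴ * P * Y).trace + (Y * Q * Yᴴ).trace = 0 := by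
    rw [trace_mul_comm (Y * Q) Yᴴ, mul_assoc Yᴴ P Y, ← trace_add, ← mul_add, h, mul_zero, trace_zero]
  obtain ⟨hS, hSS⟩ := hP.exists_sqrt
  set S := CFC.sqrt P
  have h4 : (Yᴴ * P * Y).trace = ((S * Y)ᴴ * (S * Y)).trace := by
    rw [conjTranspose_mul, hS.isHermitian.eq, ← hSS]
    congr 1
    simp only [mul_assoc]
  have h5 : S * Y = 0 := by
    rw [← trace_conjTranspose_mul_self_eq_zero_iff, ← h4]
    linarith
  exact hS.isUnit.mul_right_eq_zero.1 h5

theorem PosDef.eq_of_mul_self_eq {P Q : Matrix ι ι ℝ} (hP : P.PosDef) (hQ : Q.PosDef)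
    (h : P * P = Q * Q) : P = Q := by
  -- Uses `P (P - Q) + (P - Q) Q = P² - Q²`.
  refine sub_eq_zero.1 (hP.eq_zero_of_mul_add_mul hQ ?_)
  rw [mul_sub, sub_mul, h]
  abel

/-- The inverse square root of a positive definite matrix. -/
def invSqrt (G : Matrix ι ι ℝ) : Matrix ι ι ℝ := CFC.sqrt G⁻¹

theorem PosDef.invSqrt {G : Matrix ι ι ℝ} (hG : G.PosDef) : G.invSqrt.PosDef :=
  hG.inv.exists_sqrt.1

theorem PosDef.invSqrt_mul_self {G : Matrix ι ι ℝ} (hG : G.PosDef) :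
    G.invSqrt * G.invSqrt = G⁻¹ := hG.inv.exists_sqrt.2

theorem PosDef.transpose_invSqrt {G : Matrix ι ι ℝ} (hG : G.PosDef) :
    G.invSqrtᵀ = G.invSqrt := hG.invSqrt.isHermitian

theorem PosDef.invSqrt_mul_mul {G : Matrix ι ι ℝ} (hG : G.PosDef) :
    G.invSqrt * G * G.invSqrt = 1 := by
  have hu : IsUnit G.invSqrt := hG.invSqrt.isUnit
  have h1 : G.invSqrt * (G.invSqrt * G) = 1 := by
    rw [← mul_assoc, hG.invSqrt_mul_self, nonsing_inv_mul _ ((isUnit_iff_isUnit_det _).1 hG.isUnit)]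
  exact mul_eq_one_comm.1 h1

/-- Both sides are positive definite with the same square. This is the equivariance under rotations
that Gram-Schmidt orthonormalisation would not have. -/
theorem PosDef.invSqrt_conj {G R : Matrix ι ι ℝ} (hG : G.PosDef) (hR : Rᵀ * R = 1) :
    (Rᵀ * G * R).invSqrt = Rᵀ * G.invSqrt * R := by
  have hR' : R * Rᵀ = 1 := mul_eq_one_comm.1 hR
  have hu : IsUnit R := IsUnit.of_mul_eq_one _ hR'
  have hinj : Function.Injective R.mulVec := mulVec_injective_iff_isUnit.2 hu
  have hG' : (Rᵀ * G * R).PosDef := hG.conjTranspose_mul_mul_same hinj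
  refine hG'.invSqrt.eq_of_mul_self_eq (hG.invSqrt.conjTranspose_mul_mul_same hinj) ?_
  change _ = Rᵀ * G.invSqrt * R * (Rᵀ * G.invSqrt * R)
  have h1 : Rᵀ * G.invSqrt * R * (Rᵀ * G.invSqrt * R) = Rᵀ * G⁻¹ * R := by
    calc _ = Rᵀ * G.invSqrt * (R * Rᵀ) * G.invSqrt * R := by simp only [mul_assoc]
      _ = Rᵀ * (G.invSqrt * G.invSqrt) * R := by rw [hR', mul_one]; simp only [mul_assoc]
      _ = _ := by rw [hG.invSqrt_mul_self]
  rw [hG'.invSqrt_mul_self, h1, mul_inv_rev, mul_inv_rev, inv_eq_left_inv hR, ← mul_assoc]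
  rw [inv_eq_left_inv hR']

end Matrix

/-! ### Smooth dependence of the inverse square root on the matrix. -/

namespace ChernWeil
open scoped Matrix

variable {E : Type*} [NormedAddCommGroup E] [NormedSpace ℝ E] {r : ℕ}

/-- The transpose. -/
def transposeL : Mat r ℝ →L[ℝ] Mat r ℝ :=
  LinearMap.toContinuousLinearMap
    { toFun := fun X => Matrix.transpose X
      map_add' := fun _ _ => rfl
      map_smul' := fun _ _ => rfl }

@[simp] theorem transposeL_apply (X : Mat r ℝ) (a b : Fin r) : transposeL X a b = X b a := rfl

theorem transposeL_mul (X Y : Mat r ℝ) : transposeL (X * Y) = transposeL Y * transposeL X :=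
  Matrix.transpose_mul (X : Matrix (Fin r) (Fin r) ℝ) Y

theorem transposeL_transposeL (X : Mat r ℝ) : transposeL (transposeL X) = X := rfl

/-- A symmetric matrix near a positive definite one is positive definite. -/
theorem eventually_posDef {X : Type*} [TopologicalSpace X] {Z : X → Mat r ℝ} {y : X}
    (hZ : ContinuousAt Z y) (hy : Matrix.PosDef (Z y))
    (hs : ∀ᶠ z in 𝓝 y, transposeL (Z z) = Z z) : ∀ᶠ z in 𝓝 y, Matrix.PosDef (Z z) := by
  have hentry : ∀ a b, ContinuousAt (fun z => Z z a b) y := fun a b =>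
    (entryL (𝕜 := ℝ) a b).continuous.continuousAt.comp hZ
  let K : Set (Fin r → ℝ) := Metric.sphere 0 1
  have hK : IsCompact K := isCompact_sphere 0 1
  -- Positivity on a compact sphere is an open condition, and homogeneity extends it to all nonzero
  -- vectors.
  have h1 : ∀ᶠ z in 𝓝 y, ∀ x ∈ K, 0 < ∑ a, x a * ∑ b, Z z a b * x b := by
    refine hK.eventually_forall_of_forall_eventually fun x hx => ?_
    have hc : ContinuousAt (fun p : X × (Fin r → ℝ) =>
        ∑ a, p.2 a * ∑ b, Z p.1 a b * p.2 b) (y, x) := by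
      refine tendsto_finsetSum _ fun a _ => ?_
      have hp : ∀ a, ContinuousAt (fun p : X × (Fin r → ℝ) => p.2 a) (y, x) := fun a =>
        ((continuous_apply a).comp continuous_snd).continuousAt
      refine (hp a).mul (tendsto_finsetSum _ fun b _ => ?_)
      exact ((hentry a b).comp (x := (y, x)) continuousAt_fst).mul (hp b)
    refine hc.eventually (lt_mem_nhds ?_)
    have hx0 : x ≠ 0 := by
      rintro rfl
      simp [K] at hx
    have := hy.dotProduct_mulVec_pos hx0
    simpa [dotProduct, Matrix.mulVec] using this
  filter_upwards [h1, hs] with z hz hzs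
  refine Matrix.PosDef.of_dotProduct_mulVec_pos hzs fun x hx => ?_
  have hn : 0 < ‖x‖ := norm_pos_iff.2 hx
  have := hz (‖x‖⁻¹ • x) (by simp [K, norm_smul, hn.ne'])
  have h2 : ∑ a, (‖x‖⁻¹ • x) a * ∑ b, Z z a b * (‖x‖⁻¹ • x) b =
      ‖x‖⁻¹ ^ 2 * ∑ a, x a * ∑ b, Z z a b * x b := by
    simp only [Pi.smul_apply, smul_eq_mul, Finset.mul_sum]
    refine Finset.sum_congr rfl fun a _ => Finset.sum_congr rfl fun b _ => ?_
    ring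
  rw [h2] at this
  have h3 := (mul_pos_iff_of_pos_left (by positivity)).1 this
  simpa [dotProduct, Matrix.mulVec] using h3

/-- The derivative of squaring. -/
def squareDeriv (P : Mat r ℝ) : Mat r ℝ →L[ℝ] Mat r ℝ :=
  ContinuousLinearMap.mul ℝ (Mat r ℝ) P + (ContinuousLinearMap.mul ℝ (Mat r ℝ)).flip P

theorem hasFDerivAt_square (P : Mat r ℝ) :
    HasFDerivAt (fun X : Mat r ℝ => X * X) (squareDeriv P) P := by
  refine ((hasFDerivAt_id P).mul' (hasFDerivAt_id P)).congr_fderiv ?_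
  ext X : 1
  simp [squareDeriv]

theorem exists_squareDeriv_equiv {P : Mat r ℝ} (hP : Matrix.PosDef P) :
    ∃ e : Mat r ℝ ≃L[ℝ] Mat r ℝ, (e : Mat r ℝ →L[ℝ] Mat r ℝ) = squareDeriv P := by
  have hinj : Function.Injective (squareDeriv P).toLinearMap := by
    rw [injective_iff_map_eq_zero]
    intro Y hY
    exact hP.eq_zero_of_mul_add_mul hP hY
  refine ⟨(LinearEquiv.ofInjectiveEndo _ hinj).toContinuousLinearEquiv, ?_⟩
  ext X : 1
  rfl

/-- The inverse square root. -/
def invSqrt (G : Mat r ℝ) : Mat r ℝ := Matrix.invSqrt G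

theorem contDiffAt_ringInverse_comp {G : E → Mat r ℝ} {y : E} (hG : ContDiffAt ℝ ∞ G y)
    (hy : IsUnit (G y)) : ContDiffAt ℝ ∞ (fun z => Ring.inverse (G z)) y := by
  have : CompleteSpace (Mat r ℝ) := FiniteDimensional.complete ℝ _
  obtain ⟨u, hu⟩ := hy
  have h := contDiffAt_ringInverse ℝ (n := ∞) u
  rw [hu] at h
  exact h.comp y hG

/-- The inverse function theorem for squaring gives a smooth root `Z` of the inverse of `G` near
`y`. It remains to see that `Z` is symmetric and positive definite, for then it is the positive root
by uniqueness. -/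
theorem contDiffAt_invSqrt {G : E → Mat r ℝ} {y : E} (hG : ContDiffAt ℝ ∞ G y)
    (hpos : ∀ᶠ z in 𝓝 y, Matrix.PosDef (G z)) : ContDiffAt ℝ ∞ (fun z => invSqrt (G z)) y := by
  have : CompleteSpace (Mat r ℝ) := FiniteDimensional.complete ℝ _
  set S₀ := invSqrt (G y) with hS₀
  have hy := hpos.self_of_nhds
  have hS₀p : Matrix.PosDef S₀ := hy.invSqrt
  obtain ⟨e, he⟩ := exists_squareDeriv_equiv hS₀p
  have hsq : ContDiff ℝ ∞ fun X : Mat r ℝ => X * X := contDiff_id.mul contDiff_id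
  have hd : HasFDerivAt (fun X : Mat r ℝ => X * X) (e : Mat r ℝ →L[ℝ] Mat r ℝ) S₀ :=
    he ▸ hasFDerivAt_square S₀
  let Ψ := hsq.contDiffAt.toOpenPartialHomeomorph _ hd (by simp)
  have hΨ : ∀ X, Ψ X = X * X := fun X => rfl
  have hmem : S₀ ∈ Ψ.source := hsq.contDiffAt.mem_toOpenPartialHomeomorph_source hd (by simp)
  let Hf : E → Mat r ℝ := fun z => Ring.inverse (G z)
  have hHf : ContDiffAt ℝ ∞ Hf y := contDiffAt_ringInverse_comp hG hy.isUnit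
  have hHeq : ∀ z, Matrix.PosDef (G z) → Hf z = invSqrt (G z) * invSqrt (G z) := fun z hz => by
    refine Eq.trans ?_ hz.invSqrt_mul_self.symm
    exact (Matrix.nonsing_inv_eq_ringInverse (A := (G z : Matrix (Fin r) (Fin r) ℝ))).symm
  have hHy : Hf y = Ψ S₀ := hHeq y hy
  have hHt : Hf y ∈ Ψ.target := by rw [hHy]; exact Ψ.map_source hmem
  have hsymm : ContDiffAt ℝ ∞ Ψ.symm (Hf y) := by
    refine Ψ.contDiffAt_symm (f₀' := e) hHt ?_ hsq.contDiffAt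
    rw [hHy, Ψ.left_inv hmem]
    exact hd
  let Z : E → Mat r ℝ := fun z => Ψ.symm (Hf z)
  have hZ : ContDiffAt ℝ ∞ Z y := hsymm.comp y hHf
  have hZy : Z y = S₀ := by
    change Ψ.symm (Hf y) = S₀
    rw [hHy, Ψ.left_inv hmem]
  have hZsq : ∀ᶠ z in 𝓝 y, Z z * Z z = Hf z ∧ Z z ∈ Ψ.source := by
    filter_upwards [hHf.continuousAt.eventually_mem (Ψ.open_target.mem_nhds hHt)] with z hz
    exact ⟨by rw [← hΨ]; exact Ψ.right_inv hz, Ψ.map_target hz⟩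
  -- The transpose of `Z z` is another root of the same matrix near `S₀`, where squaring is
  -- injective.
  have hZt : ∀ᶠ z in 𝓝 y, transposeL (Z z) = Z z := by
    have hc : ContinuousAt (fun z => transposeL (Z z)) y :=
      transposeL.continuous.continuousAt.comp hZ.continuousAt
    have h0 : transposeL (Z y) ∈ Ψ.source := by
      rw [hZy]
      rwa [show transposeL S₀ = S₀ from hy.transpose_invSqrt]
    filter_upwards [hZsq, hc.eventually_mem (Ψ.open_source.mem_nhds h0), hpos] with z hz hz' hp
    refine Ψ.injOn hz' hz.2 ?_
    rw [hΨ, hΨ, ← transposeL_mul, hz.1, hHeq z hp, transposeL_mul]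
    rw [show transposeL (invSqrt (G z)) = invSqrt (G z) from hp.transpose_invSqrt]
  have hZp : ∀ᶠ z in 𝓝 y, Matrix.PosDef (Z z) :=
    eventually_posDef hZ.continuousAt (by rw [hZy]; exact hS₀p) hZt
  refine hZ.congr_of_eventuallyEq ?_
  filter_upwards [hZp, hZsq, hpos] with z h1 h2 h3
  exact h3.invSqrt.eq_of_mul_self_eq h1 ((hHeq z h3).symm.trans h2.1.symm)

end ChernWeil

/-! ## The spin representations of `so(4)` -/

namespace SpinAlgebra
open Matrix
open scoped Matrix

theorem conjTranspose_fin_two (a b c d : ℂ) :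
    !![a, b; c, d]ᴴ = !![star a, star c; star b, star d] := by
  ext i j
  fin_cases i <;> fin_cases j <;> rfl

/-- The imaginary quaternion with coordinates `a, b, c`. -/
def imQuat (a b c : ℝ) : Matrix (Fin 2) (Fin 2) ℂ :=
  !![a * Complex.I, b + c * Complex.I; -b + c * Complex.I, -(a * Complex.I)]

/-- The skew-symmetric matrix with given entries below the diagonal. -/
def skew (a b c d e f : ℝ) : Matrix (Fin 4) (Fin 4) ℝ :=
  !![0, -a, -b, -c; a, 0, -f, e; b, f, 0, -d; c, -e, d, 0]

/-- The coordinates are arranged in complementary pairs `a, d`, then `b, e`, then `c, f`. So the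
Pfaffian is `ad + be + cf`, and the self-dual and anti-self-dual parts are given by the sums and
differences within the pairs. -/
theorem exists_skew {X : Matrix (Fin 4) (Fin 4) ℝ} (hX : Xᵀ = -X) :
    ∃ a b c d e f, X = skew a b c d e f := by
  have h : ∀ i j, X j i = -X i j := fun i j => congrFun (congrFun hX i) j
  refine ⟨X 1 0, X 2 0, X 3 0, X 3 2, X 1 3, X 2 1, ?_⟩
  have h0 : ∀ i, X i i = 0 := fun i => by have := h i i; linarith
  ext i j
  fin_cases i <;> fin_cases j <;> simp [skew, h0] <;> exact h _ _

theorem skew_mul_sub (a b c d e f a' b' c' d' e' f' : ℝ) :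
    skew a b c d e f * skew a' b' c' d' e' f' - skew a' b' c' d' e' f' * skew a b c d e f =
      skew (b * f' - b' * f + c' * e - c * e') (c * d' - c' * d + a' * f - a * f')
        (a * e' - a' * e + b' * d - b * d') (b * c' - b' * c + e * f' - e' * f)
        (c * a' - c' * a + f * d' - f' * d) (a * b' - a' * b + d * e' - d' * e) := by
  ext i j
  fin_cases i <;> fin_cases j <;>
    simp [skew, Matrix.mul_apply, Fin.sum_univ_four] <;> ring

/-- The derivative of the first half spin representation, extended to all matrices. -/
def halfPlus (X : Matrix (Fin 4) (Fin 4) ℝ) : Matrix (Fin 2) (Fin 2) ℂ :=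
  (1 / 4 : ℝ) • ∑ l, ∑ k, X l k • (quaternionUnit l * (quaternionUnit k)ᴴ)

/-- The derivative of the second half spin representation, extended to all matrices. -/
def halfMinus (X : Matrix (Fin 4) (Fin 4) ℝ) : Matrix (Fin 2) (Fin 2) ℂ :=
  (-(1 / 4) : ℝ) • ∑ l, ∑ k, X l k • ((quaternionUnit k)ᴴ * quaternionUnit l)

/-- Only the self-dual part of the skew matrix is seen. -/
theorem halfPlus_skew (a b c d e f : ℝ) :
    halfPlus (skew a b c d e f) = imQuat ((a + d) / 2) ((b + e) / 2) ((c + f) / 2) := by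
  ext i j
  fin_cases i <;> fin_cases j <;>
    simp [halfPlus, skew, imQuat, quaternionUnit, conjTranspose_fin_two, Fin.sum_univ_four,
      Complex.ext_iff] <;>
    (try constructor) <;> ring

/-- Only the anti-self-dual part of the skew matrix is seen. -/
theorem halfMinus_skew (a b c d e f : ℝ) :
    halfMinus (skew a b c d e f) = imQuat ((d - a) / 2) ((e - b) / 2) ((f - c) / 2) := by
  ext i j
  fin_cases i <;> fin_cases j <;>
    simp [halfMinus, skew, imQuat, quaternionUnit, conjTranspose_fin_two, Fin.sum_univ_four,
      Complex.ext_iff] <;>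
    (try constructor) <;> ring

theorem imQuat_mul_sub (a b c a' b' c' : ℝ) :
    imQuat a b c * imQuat a' b' c' - imQuat a' b' c' * imQuat a b c =
      imQuat (2 * (b * c' - c * b')) (2 * (c * a' - a * c')) (2 * (a * b' - b * a')) := by
  ext i j
  fin_cases i <;> fin_cases j <;>
    simp [imQuat, Matrix.mul_apply, Fin.sum_univ_two, Complex.ext_iff] <;>
    constructor <;> ring

theorem trace_imQuat (a b c : ℝ) : (imQuat a b c).trace = 0 := by
  simp [imQuat, Matrix.trace_fin_two]

theorem trace_imQuat_mul (a b c a' b' c' : ℝ) :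
    (imQuat a b c * imQuat a' b' c').trace = ((-2 * (a * a' + b * b' + c * c') : ℝ) : ℂ) := by
  simp [imQuat, Matrix.trace_fin_two, Matrix.mul_apply, Fin.sum_univ_two, Complex.ext_iff]
  constructor <;> ring

section Lie

variable {X Y : Matrix (Fin 4) (Fin 4) ℝ} (hX : Xᵀ = -X) (hY : Yᵀ = -Y)
include hX hY

theorem halfPlus_lie : halfPlus (X * Y - Y * X) =
    halfPlus X * halfPlus Y - halfPlus Y * halfPlus X := by
  obtain ⟨a, b, c, d, e, f, rfl⟩ := exists_skew hX
  obtain ⟨a', b', c', d', e', f', rfl⟩ := exists_skew hY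
  simp only [skew_mul_sub, halfPlus_skew, imQuat_mul_sub]
  congr 1 <;> ring

theorem halfMinus_lie : halfMinus (X * Y - Y * X) =
    halfMinus X * halfMinus Y - halfMinus Y * halfMinus X := by
  obtain ⟨a, b, c, d, e, f, rfl⟩ := exists_skew hX
  obtain ⟨a', b', c', d', e', f', rfl⟩ := exists_skew hY
  simp only [skew_mul_sub, halfMinus_skew, imQuat_mul_sub]
  congr 1 <;> ring

/-- The wedge product of two matrices, viewed as bilinear forms on `ℝ⁴`. -/
theorem trace_halfPlus_mul : (halfPlus X * halfPlus Y).trace =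
    ((-(1 / 2) * (-(1 / 2) * (X * Y).trace +
      ChernWeil.wedge22 (fun s t : ℝ => s * t) X Y) : ℝ) : ℂ) := by
  obtain ⟨a, b, c, d, e, f, rfl⟩ := exists_skew hX
  obtain ⟨a', b', c', d', e', f', rfl⟩ := exists_skew hY
  rw [halfPlus_skew, halfPlus_skew, trace_imQuat_mul]
  congr 1
  simp [skew, ChernWeil.wedge22, Matrix.trace, Matrix.mul_apply, Fin.sum_univ_four]
  ring

/-- The sign of the wedge term is opposite to that in `trace_halfPlus_mul`. It is the source of the
opposite signs of the two Chern numbers. -/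
theorem trace_halfMinus_mul : (halfMinus X * halfMinus Y).trace =
    ((-(1 / 2) * (-(1 / 2) * (X * Y).trace -
      ChernWeil.wedge22 (fun s t : ℝ => s * t) X Y) : ℝ) : ℂ) := by
  obtain ⟨a, b, c, d, e, f, rfl⟩ := exists_skew hX
  obtain ⟨a', b', c', d', e', f', rfl⟩ := exists_skew hY
  rw [halfMinus_skew, halfMinus_skew, trace_imQuat_mul]
  congr 1
  simp [skew, ChernWeil.wedge22, Matrix.trace, Matrix.mul_apply, Fin.sum_univ_four]
  ring

end Lie

theorem trace_halfPlus {X : Matrix (Fin 4) (Fin 4) ℝ} (hX : Xᵀ = -X) : (halfPlus X).trace = 0 := by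
  obtain ⟨a, b, c, d, e, f, rfl⟩ := exists_skew hX
  rw [halfPlus_skew, trace_imQuat]

theorem trace_halfMinus {X : Matrix (Fin 4) (Fin 4) ℝ} (hX : Xᵀ = -X) :
    (halfMinus X).trace = 0 := by
  obtain ⟨a, b, c, d, e, f, rfl⟩ := exists_skew hX
  rw [halfMinus_skew, trace_imQuat]

theorem det_skew (a b c d e f : ℝ) : (skew a b c d e f).det = (a * d + b * e + c * f) ^ 2 := by
  simp [skew, Matrix.det_succ_row_zero, Fin.sum_univ_succ, Fin.succAbove]
  ring

theorem wedge22_skew_self (a b c d e f : ℝ) :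
    ChernWeil.wedge22 (fun s t : ℝ => s * t) (skew a b c d e f) (skew a b c d e f) =
      2 * (a * d + b * e + c * f) := by
  simp [skew, ChernWeil.wedge22]
  ring

/-- The wedge square of a skew form is twice its Pfaffian, and the determinant is the square of the
Pfaffian. -/
theorem wedge22_self_sq {X : Matrix (Fin 4) (Fin 4) ℝ} (hX : Xᵀ = -X) :
    ChernWeil.wedge22 (fun s t : ℝ => s * t) X X ^ 2 = 4 * X.det := by
  obtain ⟨a, b, c, d, e, f, rfl⟩ := exists_skew hX
  rw [wedge22_skew_self, det_skew]
  ring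

/-- Two skew-symmetric matrices of rank two whose sum is a complex structure have wedge product
`±1`. -/
theorem wedge22_sq_eq_one {X Y : Matrix (Fin 4) (Fin 4) ℝ} (hX : Xᵀ = -X) (hY : Yᵀ = -Y)
    (hX0 : X.det = 0) (hY0 : Y.det = 0) (h : (X + Y) * (X + Y) = -1) :
    ChernWeil.wedge22 (fun s t : ℝ => s * t) X Y ^ 2 = 1 := by
  have h1 := wedge22_self_sq hX
  have h2 := wedge22_self_sq hY
  have hXY : (X + Y)ᵀ = -(X + Y) := by rw [transpose_add, hX, hY]; abel
  have h3 := wedge22_self_sq hXY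
  rw [hX0, mul_zero] at h1
  rw [hY0, mul_zero] at h2
  have h1 := pow_eq_zero_iff (two_ne_zero) |>.1 h1
  have h2 := pow_eq_zero_iff (two_ne_zero) |>.1 h2
  -- As `X ∧ X = Y ∧ Y = 0`, the square of `X + Y` is `2 X ∧ Y`. The determinant of `X + Y` is `±1`
  -- because `(X + Y)² = -1`, and it is positive because it is a quarter of a square.
  have h4 : (X + Y).det ^ 2 = 1 := by
    rw [sq, ← det_mul, h, det_neg, det_one, Fintype.card_fin]
    norm_num
  have h5 : ChernWeil.wedge22 (fun s t : ℝ => s * t) (X + Y) (X + Y) =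
      2 * ChernWeil.wedge22 (fun s t : ℝ => s * t) X Y := by
    simp only [ChernWeil.wedge22, Matrix.add_apply] at h1 h2 ⊢
    linear_combination h1 + h2
  rw [h5] at h3
  have h6 : (X + Y).det = 1 := by
    have : (X + Y).det = 1 ∨ (X + Y).det = -1 := by
      rcases mul_eq_zero.1 (show ((X + Y).det - 1) * ((X + Y).det + 1) = 0 by linarith) with h | h
      · exact Or.inl (by linarith)
      · exact Or.inr (by linarith)
    nlinarith [sq_nonneg (ChernWeil.wedge22 (fun s t : ℝ => s * t) X Y)]
  rw [h6] at h3
  linarith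

/-! ### The double covering of the rotation group -/

theorem sum_re_trace_smul (a b c d : ℝ) :
    let X := (a : ℝ) • quaternionUnit 0 + b • quaternionUnit 1 + c • quaternionUnit 2 +
      d • quaternionUnit 3
    ∑ k, ((1 / 2) * ((quaternionUnit k)ᴴ * X).trace.re) • quaternionUnit k = X := by
  intro X
  ext i j
  fin_cases i <;> fin_cases j <;>
    simp [X, quaternionUnit, conjTranspose_fin_two, Fin.sum_univ_four, Complex.ext_iff, Matrix.trace_fin_two,
      Matrix.mul_apply] <;> (try constructor) <;> ring

/-- For a unitary matrix of determinant one the adjoint equals the adjugate. This leaves two free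
complex entries, the coordinates of a quaternion. -/
theorem SU2_eq (A : SU2) : ∃ a b c d : ℝ, A.1 = (a : ℝ) • quaternionUnit 0 +
    b • quaternionUnit 1 + c • quaternionUnit 2 + d • quaternionUnit 3 := by
  obtain ⟨A, hA⟩ := A
  obtain ⟨hu, hd⟩ := Matrix.mem_specialUnitaryGroup_iff.1 hA
  have h1 : star A = A.adjugate := by
    have h2 : A * star A = 1 := (Matrix.mem_unitaryGroup_iff).1 hu
    have h3 : A.adjugate * A = 1 := by rw [adjugate_mul, hd, one_smul]
    calc star A = A.adjugate * A * star A := by rw [h3, one_mul]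
      _ = A.adjugate := by rw [mul_assoc, h2, mul_one]
  rw [adjugate_fin_two] at h1
  have h00 : star (A 0 0) = A 1 1 := by simpa using congrFun (congrFun h1 0) 0
  have h01 : star (A 1 0) = -A 0 1 := by simpa using congrFun (congrFun h1 0) 1
  have e1 := congrArg Complex.re h00
  have e2 := congrArg Complex.im h00
  have e3 := congrArg Complex.re h01
  have e4 := congrArg Complex.im h01
  simp at e1 e2 e3 e4
  refine ⟨(A 0 0).re, (A 0 0).im, (A 0 1).re, (A 0 1).im, ?_⟩
  ext i j
  fin_cases i <;> fin_cases j <;> simp [quaternionUnit, Complex.ext_iff] <;> constructor <;> linarith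

theorem quaternionUnit_mem (k : Fin 4) : ∃ a b c d : ℝ, quaternionUnit k =
    (a : ℝ) • quaternionUnit 0 + b • quaternionUnit 1 + c • quaternionUnit 2 +
      d • quaternionUnit 3 := by
  fin_cases k
  · exact ⟨1, 0, 0, 0, by simp⟩
  · exact ⟨0, 1, 0, 0, by simp⟩
  · exact ⟨0, 0, 1, 0, by simp⟩
  · exact ⟨0, 0, 0, 1, by simp⟩

theorem exists_quaternion_mul (a b c d a' b' c' d' : ℝ) : ∃ a'' b'' c'' d'' : ℝ,
    ((a : ℝ) • quaternionUnit 0 + b • quaternionUnit 1 + c • quaternionUnit 2 +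
      d • quaternionUnit 3) * ((a' : ℝ) • quaternionUnit 0 + b' • quaternionUnit 1 +
      c' • quaternionUnit 2 + d' • quaternionUnit 3) = (a'' : ℝ) • quaternionUnit 0 +
      b'' • quaternionUnit 1 + c'' • quaternionUnit 2 + d'' • quaternionUnit 3 := by
  refine ⟨a * a' - b * b' - c * c' - d * d', a * b' + b * a' + c * d' - d * c',
    a * c' - b * d' + c * a' + d * b', a * d' + b * c' - c * b' + d * a', ?_⟩
  ext i j
  fin_cases i <;> fin_cases j <;>
    simp [quaternionUnit, Complex.ext_iff, Matrix.mul_apply] <;> (try constructor) <;> ring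

theorem star_mul_self (A : SU2) : (A.1)ᴴ * A.1 = 1 :=
  (Matrix.mem_unitaryGroup_iff').1 (Matrix.mem_specialUnitaryGroup_iff.1 A.2).1

theorem mul_star_self (A : SU2) : A.1 * (A.1)ᴴ = 1 :=
  (Matrix.mem_unitaryGroup_iff).1 (Matrix.mem_specialUnitaryGroup_iff.1 A.2).1

/-- Row expansion of the rotation attached to an element of `Spin(4)`. -/
theorem sum_spinCover_smul (s : Spin4) (l : Fin 4) :
    ∑ k, spinCover s l k • quaternionUnit k = (s.1.1)ᴴ * quaternionUnit l * s.2.1 := by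
  have hX : ∃ a b c d : ℝ, (s.1.1)ᴴ * quaternionUnit l * s.2.1 = (a : ℝ) • quaternionUnit 0 +
      b • quaternionUnit 1 + c • quaternionUnit 2 + d • quaternionUnit 3 := by
    obtain ⟨a, b, c, d, h1⟩ := SU2_eq s.1⁻¹
    obtain ⟨a', b', c', d', h2⟩ := quaternionUnit_mem l
    obtain ⟨a'', b'', c'', d'', h3⟩ := SU2_eq s.2
    obtain ⟨x, y, z, w, h4⟩ := exists_quaternion_mul a b c d a' b' c' d'
    have h5 : (s.1.1)ᴴ = (s.1⁻¹).1 := rfl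
    rw [h5, h1, h2, h4, h3]
    exact exists_quaternion_mul _ _ _ _ _ _ _ _
  -- The adjoint of `X ↦ A X B⁻¹` for the inner product `½ Re tr (Xᴴ Y)` is `X ↦ A⁻¹ X B`. So a row
  -- of the rotation consists of the coordinates of this quaternion.
  have hc : ∀ k, spinCover s l k = (1 / 2) *
      ((quaternionUnit k)ᴴ * ((s.1.1)ᴴ * quaternionUnit l * s.2.1)).trace.re := by
    intro k
    have h1 : ((quaternionUnit k)ᴴ * ((s.1.1)ᴴ * quaternionUnit l * s.2.1)) =
        (((s.2.1)ᴴ * (quaternionUnit l)ᴴ * s.1.1) * quaternionUnit k)ᴴ := by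
      simp only [conjTranspose_mul, conjTranspose_conjTranspose, mul_assoc]
    rw [h1, trace_conjTranspose, Complex.star_def, Complex.conj_re]
    unfold spinCover
    rw [of_apply, mul_assoc (s.2.1)ᴴ, mul_assoc (s.2.1)ᴴ, trace_mul_comm (s.2.1)ᴴ]
    simp only [mul_assoc]
  simp only [hc]
  obtain ⟨a, b, c, d, h⟩ := hX
  rw [h]
  exact sum_re_trace_smul a b c d

theorem re_trace_quaternionUnit (k l : Fin 4) :
    ((quaternionUnit k) * (quaternionUnit l)ᴴ).trace.re = if k = l then 2 else 0 := by
  fin_cases k <;> fin_cases l <;>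
    simp [quaternionUnit, conjTranspose_fin_two, Matrix.trace_fin_two, Matrix.mul_apply] <;> norm_num

theorem spinCover_mul_transpose (s : Spin4) : spinCover s * (spinCover s)ᵀ = 1 := by
  ext l m
  have h1 : ((∑ k, spinCover s l k • quaternionUnit k) *
      (∑ k, spinCover s m k • quaternionUnit k)ᴴ).trace.re = 2 * (spinCover s * (spinCover s)ᵀ) l m := by
    simp only [conjTranspose_sum, conjTranspose_smul, star_trivial, Finset.sum_mul, Finset.mul_sum,
      smul_mul_smul_comm, trace_sum, trace_smul, Complex.re_sum, Complex.real_smul,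
      Complex.re_ofReal_mul, re_trace_quaternionUnit, mul_apply, transpose_apply]
    simp
    refine Finset.sum_congr rfl fun k _ => by ring
  rw [sum_spinCover_smul, sum_spinCover_smul] at h1
  have h2 : ((s.1.1)ᴴ * quaternionUnit l * s.2.1 * ((s.1.1)ᴴ * quaternionUnit m * s.2.1)ᴴ) =
      (s.1.1)ᴴ * (quaternionUnit l * (quaternionUnit m)ᴴ * s.1.1) := by
    simp only [conjTranspose_mul, conjTranspose_conjTranspose, mul_assoc]
    rw [← mul_assoc s.2.1, mul_star_self, one_mul]
  rw [h2, trace_mul_comm, mul_assoc, mul_star_self, mul_one, re_trace_quaternionUnit] at h1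
  rw [one_apply]
  split_ifs at h1 ⊢ <;> linarith

theorem transpose_mul_spinCover (s : Spin4) : (spinCover s)ᵀ * spinCover s = 1 :=
  mul_eq_one_comm.1 (spinCover_mul_transpose s)

/-- The quadratic expression of the half spin representation in terms of rows. -/
theorem halfPlus_transpose_mul (R T : Matrix (Fin 4) (Fin 4) ℝ) : halfPlus (Rᵀ * T) =
    (1 / 4 : ℝ) • ∑ l, (∑ k, R l k • quaternionUnit k) * (∑ k, T l k • quaternionUnit k)ᴴ := by
  unfold halfPlus
  congr 1
  simp only [conjTranspose_sum, conjTranspose_smul, star_trivial, Finset.sum_mul, Finset.mul_sum,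
    smul_mul_smul_comm, mul_apply, transpose_apply, Finset.sum_smul]
  rw [Finset.sum_comm]
  refine (Finset.sum_congr rfl fun a _ => Finset.sum_comm).trans ?_
  rw [Finset.sum_comm]

theorem halfMinus_transpose_mul (R T : Matrix (Fin 4) (Fin 4) ℝ) : halfMinus (Rᵀ * T) =
    (-(1 / 4) : ℝ) • ∑ l, (∑ k, T l k • quaternionUnit k)ᴴ * (∑ k, R l k • quaternionUnit k) := by
  unfold halfMinus
  congr 1
  simp only [conjTranspose_sum, conjTranspose_smul, star_trivial, Finset.sum_mul, Finset.mul_sum,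
    smul_mul_smul_comm, mul_apply, transpose_apply, Finset.sum_smul]
  rw [Finset.sum_comm]
  refine (Finset.sum_congr rfl fun a _ => Finset.sum_comm).trans ?_
  rw [Finset.sum_comm]
  refine (Finset.sum_congr rfl fun a _ => Finset.sum_comm).trans ?_
  refine Finset.sum_congr rfl fun l _ => ?_
  refine Finset.sum_congr rfl fun l _ => ?_
  refine Finset.sum_congr rfl fun l _ => ?_
  rw [mul_comm]

theorem sum_mul_spinCover_smul (s : Spin4) (X : Matrix (Fin 4) (Fin 4) ℝ) (l : Fin 4) :
    ∑ k, (X * spinCover s) l k • quaternionUnit k =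
      ∑ m, X l m • ((s.1.1)ᴴ * quaternionUnit m * s.2.1) := by
  simp only [← sum_spinCover_smul, mul_apply, Finset.sum_smul, Finset.smul_sum, smul_smul]
  exact Finset.sum_comm

/-- In a product of a transformed quaternion with the adjoint of another one the second factor of
`s` cancels, and only conjugation by the first is left. -/
theorem halfPlus_conj (s : Spin4) (X : Matrix (Fin 4) (Fin 4) ℝ) :
    halfPlus ((spinCover s)ᵀ * X * spinCover s) = (s.1.1)ᴴ * halfPlus X * s.1.1 := by
  rw [mul_assoc, halfPlus_transpose_mul]
  unfold halfPlus
  rw [mul_smul_comm, smul_mul_assoc]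
  congr 1
  simp only [sum_mul_spinCover_smul, sum_spinCover_smul, conjTranspose_sum, conjTranspose_smul,
    star_trivial, Finset.sum_mul, Finset.mul_sum, mul_smul_comm, smul_mul_assoc]
  refine Finset.sum_congr rfl fun l _ => Finset.sum_congr rfl fun k _ => ?_
  congr 1
  simp only [conjTranspose_mul, conjTranspose_conjTranspose, mul_assoc]
  rw [← mul_assoc s.2.1, mul_star_self, one_mul]

/-- With the adjoint on the left it is the first factor of `s` that cancels. -/
theorem halfMinus_conj (s : Spin4) (X : Matrix (Fin 4) (Fin 4) ℝ) :
    halfMinus ((spinCover s)ᵀ * X * spinCover s) = (s.2.1)ᴴ * halfMinus X * s.2.1 := by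
  rw [mul_assoc, halfMinus_transpose_mul]
  unfold halfMinus
  rw [mul_smul_comm, smul_mul_assoc]
  congr 1
  simp only [sum_mul_spinCover_smul, sum_spinCover_smul, conjTranspose_sum, conjTranspose_smul,
    star_trivial, Finset.sum_mul, Finset.mul_sum, mul_smul_comm, smul_mul_assoc]
  refine Finset.sum_congr rfl fun l _ => Finset.sum_congr rfl fun k _ => ?_
  congr 1
  simp only [conjTranspose_mul, conjTranspose_conjTranspose, mul_assoc]
  rw [← mul_assoc s.1.1, mul_star_self, one_mul]

/-- Averaging over the unit quaternions leaves only the trace. In the Maurer-Cartan computation this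
removes the factor of `Spin(4)` that does not act. -/
theorem sum_quaternionUnit_conj (Y : Matrix (Fin 2) (Fin 2) ℂ) :
    ∑ l, quaternionUnit l * Y * (quaternionUnit l)ᴴ = (2 * Y.trace) • 1 := by
  rw [eta_fin_two Y]
  generalize Y 0 0 = a, Y 0 1 = b, Y 1 0 = c, Y 1 1 = d
  ext i j
  fin_cases i <;> fin_cases j <;>
    simp [quaternionUnit, conjTranspose_fin_two, Fin.sum_univ_four, Matrix.trace_fin_two,
      Complex.ext_iff] <;>
    (try constructor) <;> ring

theorem sum_quaternionUnit_conj' (Y : Matrix (Fin 2) (Fin 2) ℂ) :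
    ∑ l, (quaternionUnit l)ᴴ * Y * quaternionUnit l = (2 * Y.trace) • 1 := by
  rw [eta_fin_two Y]
  generalize Y 0 0 = a, Y 0 1 = b, Y 1 0 = c, Y 1 1 = d
  ext i j
  fin_cases i <;> fin_cases j <;>
    simp [quaternionUnit, conjTranspose_fin_two, Fin.sum_univ_four, Matrix.trace_fin_two,
      Complex.ext_iff] <;>
    (try constructor) <;> ring

/-- The Maurer–Cartan form of the rotation group, mapped to the first factor of the spin group. -/
theorem halfPlus_maurerCartan (s : Spin4) {T : Matrix (Fin 4) (Fin 4) ℝ}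
    {A' B' : Matrix (Fin 2) (Fin 2) ℂ}
    (hT : ∀ l, ∑ k, T l k • quaternionUnit k =
      A'ᴴ * quaternionUnit l * s.2.1 + (s.1.1)ᴴ * quaternionUnit l * B')
    (hB : (s.2.1 * B'ᴴ).trace = 0) :
    halfPlus ((spinCover s)ᵀ * T) = (s.1.1)ᴴ * A' := by
  rw [halfPlus_transpose_mul]
  have h1 : ∀ l, (∑ k, spinCover s l k • quaternionUnit k) * (∑ k, T l k • quaternionUnit k)ᴴ =
      (s.1.1)ᴴ * (quaternionUnit l * 1 * (quaternionUnit l)ᴴ) * A' +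
        (s.1.1)ᴴ * (quaternionUnit l * (s.2.1 * B'ᴴ) * (quaternionUnit l)ᴴ) * s.1.1 := by
    intro l
    rw [hT, sum_spinCover_smul, conjTranspose_add, mul_add]
    simp only [conjTranspose_mul, conjTranspose_conjTranspose, mul_assoc, one_mul]
    rw [← mul_assoc s.2.1 (s.2.1)ᴴ, mul_star_self, one_mul]
  simp only [h1, Finset.sum_add_distrib, ← Finset.sum_mul, ← Finset.mul_sum,
    sum_quaternionUnit_conj, hB]
  simp [Matrix.trace_fin_two, smul_smul]
  ext i j
  simp
  ring

/-- The contribution of `A'` is averaged to a trace, which vanishes. The contribution of `B'` is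
multiplied by `∑ q* q = 4`, and `hB` turns `B'ᴴ B` into `-Bᴴ B'`; the sign of `-1/4` absorbs this.
-/
theorem halfMinus_maurerCartan (s : Spin4) {T : Matrix (Fin 4) (Fin 4) ℝ}
    {A' B' : Matrix (Fin 2) (Fin 2) ℂ}
    (hT : ∀ l, ∑ k, T l k • quaternionUnit k =
      A'ᴴ * quaternionUnit l * s.2.1 + (s.1.1)ᴴ * quaternionUnit l * B')
    (hA : (A' * (s.1.1)ᴴ).trace = 0) (hB : B'ᴴ * s.2.1 = -((s.2.1)ᴴ * B')) :
    halfMinus ((spinCover s)ᵀ * T) = (s.2.1)ᴴ * B' := by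
  rw [halfMinus_transpose_mul]
  have h1 : ∀ l, (∑ k, T l k • quaternionUnit k)ᴴ * (∑ k, spinCover s l k • quaternionUnit k) =
      (s.2.1)ᴴ * ((quaternionUnit l)ᴴ * (A' * (s.1.1)ᴴ) * quaternionUnit l) * s.2.1 +
        B'ᴴ * ((quaternionUnit l)ᴴ * 1 * quaternionUnit l) * s.2.1 := by
    intro l
    rw [hT, sum_spinCover_smul, conjTranspose_add, add_mul]
    simp only [conjTranspose_mul, conjTranspose_conjTranspose, mul_assoc, one_mul]
    rw [← mul_assoc s.1.1 (s.1.1)ᴴ, mul_star_self, one_mul]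
  simp only [h1, Finset.sum_add_distrib, ← Finset.sum_mul, ← Finset.mul_sum,
    sum_quaternionUnit_conj', hA]
  simp [Matrix.trace_fin_two, smul_smul, hB]
  ext i j
  simp
  ring

end SpinAlgebra

/-! ## Curvature of projected connections on rank four bundles in `ℝ³ ⊕ ℝ³` -/

namespace ChernWeil

section Algebra

variable {R : Type*} [Ring R]

/-- One step of the curvature identity: the antisymmetrisation of the left hand side is the
curvature of the projected connection `t df + u ds`. -/
theorem projected_curvature_step {f s t u P Q f₁ f₂ t₁ t₂ s₁ s₂ u₁ u₂ P₁ P₂ Q₁ Q₂ : R}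
    (h1 : t * f + u * s = 1) (hP : f * t = P) (hQ : s * u = Q) (hfu : f * u = 0) (hst : s * t = 0)
    (d1 : t₁ * f + t * f₁ + (u₁ * s + u * s₁) = 0)
    (d2 : t₂ * f + t * f₂ + (u₂ * s + u * s₂) = 0)
    (p1 : f₁ * t + f * t₁ = P₁) (p2 : f₂ * t + f * t₂ = P₂)
    (q1 : s₁ * u + s * u₁ = Q₁) (q2 : s₂ * u + s * u₂ = Q₂)
    (e1 : s₁ * t + s * t₁ = 0) (e2 : s₂ * t + s * t₂ = 0)
    (g1 : f₁ * u + f * u₁ = 0) (g2 : f₂ * u + f * u₂ = 0) :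
    t₁ * f₂ + u₁ * s₂ + (t * f₁ + u * s₁) * (t * f₂ + u * s₂) =
      t * (P₁ * P₂) * f + u * (Q₁ * Q₂) * s := by
  have hPf : P * f = f := by
    calc P * f = f * (t * f + u * s) - (f * u) * s := by rw [← hP]; noncomm_ring
      _ = f := by rw [h1, hfu]; simp
  have hQs : Q * s = s := by
    calc Q * s = s * (t * f + u * s) - (s * t) * f := by rw [← hQ]; noncomm_ring
      _ = s := by rw [h1, hst]; simp
  have hPP : P * P = P := by nth_rw 2 [← hP]; rw [← mul_assoc, hPf, hP]
  have hQQ : Q * Q = Q := by nth_rw 2 [← hQ]; rw [← mul_assoc, hQs, hQ]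
  -- The differentiated projection, sandwiched with the frame, leaves the components normal to the
  -- tangent plane; likewise in `a2`, `b1` and `b2`.
  have a1 : t * P₁ = t₁ * (1 - P) := by
    calc t * P₁ = (t₁ * f + t * f₁ + (u₁ * s + u * s₁)) * t + (t * f + u * s) * t₁ -
          u * (s₁ * t + s * t₁) - t₁ * (f * t) - u₁ * (s * t) := by rw [← p1]; noncomm_ring
      _ = _ := by rw [d1, h1, e1, hP, hst]; noncomm_ring
  have a2 : P₂ * f = (1 - P) * f₂ := by
    calc P₂ * f = f * (t₂ * f + t * f₂ + (u₂ * s + u * s₂)) + f₂ * (t * f + u * s) -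
          (f₂ * u + f * u₂) * s - (f * t) * f₂ - (f * u) * s₂ := by rw [← p2]; noncomm_ring
      _ = _ := by rw [d2, h1, g2, hP, hfu]; noncomm_ring
  have b1 : u * Q₁ = u₁ * (1 - Q) := by
    calc u * Q₁ = (t₁ * f + t * f₁ + (u₁ * s + u * s₁)) * u + (t * f + u * s) * u₁ -
          t * (f₁ * u + f * u₁) - u₁ * (s * u) - t₁ * (f * u) := by rw [← q1]; noncomm_ring
      _ = _ := by rw [d1, h1, g1, hQ, hfu]; noncomm_ring
  have b2 : Q₂ * s = (1 - Q) * s₂ := by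
    calc Q₂ * s = s * (t₂ * f + t * f₂ + (u₂ * s + u * s₂)) + s₂ * (t * f + u * s) -
          (s₂ * t + s * t₂) * f - (s * u) * s₂ - (s * t) * f₂ := by rw [← q2]; noncomm_ring
      _ = _ := by rw [d2, h1, e2, hQ, hst]; noncomm_ring
  -- The quadratic term of the curvature cancels the tangential part of `t₁ * f₂ + u₁ * s₂`, so only
  -- the normal part remains, as in the Gauss equation.
  have c1 : (t * f₁ + u * s₁) * (t * f₂ + u * s₂) = -(t₁ * P * f₂) - u₁ * Q * s₂ := by
    calc _ = (t₁ * f + t * f₁ + (u₁ * s + u * s₁)) * (t * f₂ + u * s₂) - t₁ * (f * t) * f₂ -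
          u₁ * (s * u) * s₂ - t₁ * (f * u) * s₂ - u₁ * (s * t) * f₂ := by noncomm_ring
      _ = _ := by rw [d1, hP, hQ, hfu, hst]; noncomm_ring
  calc _ = t₁ * (1 - P) * f₂ + u₁ * (1 - Q) * s₂ := by rw [c1]; noncomm_ring
    _ = (t₁ * (1 - P)) * ((1 - P) * f₂) + (u₁ * (1 - Q)) * ((1 - Q) * s₂) := by
      have e3 : (1 - P) * (1 - P) = 1 - P := by
        calc _ = 1 - P - P + P * P := by noncomm_ring
          _ = _ := by rw [hPP]; abel
      have e4 : (1 - Q) * (1 - Q) = 1 - Q := by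
        calc _ = 1 - Q - Q + Q * Q := by noncomm_ring
          _ = _ := by rw [hQQ]; abel
      calc _ = t₁ * ((1 - P) * (1 - P)) * f₂ + u₁ * ((1 - Q) * (1 - Q)) * s₂ := by rw [e3, e4]
        _ = _ := by noncomm_ring
    _ = _ := by rw [← a1, ← a2, ← b1, ← b2]; noncomm_ring

/-- The covariant derivative of `t * N * f` for `N` in the image of the projection. -/
theorem projected_covariant_step {f s t u N N₁ f₁ t₁ s₁ u₁ : R}
    (h1 : t * f + u * s = 1) (hN : N * (f * t) = N) (hN' : f * t * N = N) (hfu : f * u = 0)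
    (hst : s * t = 0) (d1 : t₁ * f + t * f₁ + (u₁ * s + u * s₁) = 0) :
    t₁ * N * f + t * N₁ * f + t * N * f₁ +
      ((t * f₁ + u * s₁) * (t * N * f) - (t * N * f) * (t * f₁ + u * s₁)) = t * N₁ * f := by
  have a1 : (t * f₁ + u * s₁) * (t * N * f) = -(t₁ * N * f) := by
    calc _ = (t₁ * f + t * f₁ + (u₁ * s + u * s₁)) * (t * N * f) - t₁ * (f * t * N) * f -
          u₁ * (s * t) * N * f := by noncomm_ring
      _ = _ := by rw [d1, hN', hst]; noncomm_ring
  have a2 : (t * N * f) * (t * f₁ + u * s₁) = t * N * f₁ := by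
    calc _ = t * (N * (f * t)) * f₁ + t * N * (f * u) * s₁ := by noncomm_ring
      _ = _ := by rw [hN, hfu]; noncomm_ring
  rw [a1, a2]
  noncomm_ring

/-- For use with `N` the cross product with the normal, where `-N²` is the tangential projection.
The hypotheses `N * N₁ * N = 0` and `N * N₂ * N = 0` say that the derivatives of the normal are
tangential. -/
theorem sandwich_square {f t N N₁ N₂ C : R} (hP : f * t = -(N * N)) (hf : f * t * f = f)
    (ht : t * (f * t) = t) (hN3 : N * N * N = -N) (hN1 : N * N₁ * N = 0) (hN2 : N * N₂ * N = 0)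
    (hC : N * (N₁ * N₂ - N₂ * N₁) * N = C) :
    t * ((N₁ * N + N * N₁) * (N₂ * N + N * N₂) - (N₂ * N + N * N₂) * (N₁ * N + N * N₁)) * f =
      t * C * f := by
  have key : ∀ {N₁ N₂ : R}, N * N₁ * N = 0 → N * N₂ * N = 0 →
      N * N * ((N₁ * N + N * N₁) * (N₂ * N + N * N₂)) * (N * N) = N * (N₁ * N₂) * N := by
    intro N₁ N₂ h1 h2
    calc _ = N * (N * N₁ * N) * N₂ * N * N * N + N * (N * N₁ * N) * N * N₂ * N * N +
          (N * N * N) * (N₁ * N₂) * (N * N * N) + N * N * N * N₁ * (N * N₂ * N) * N := by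
          noncomm_ring
      _ = _ := by rw [h1, h2, hN3]; noncomm_ring
  have ht' : t * (N * N) = -t := by
    rw [← neg_neg (N * N), ← hP, mul_neg, ht]
  have hf' : N * N * f = -f := by
    rw [← neg_neg (N * N), ← hP, neg_mul, hf]
  calc _ = (t * (N * N)) * ((N₁ * N + N * N₁) * (N₂ * N + N * N₂) -
        (N₂ * N + N * N₂) * (N₁ * N + N * N₁)) * (N * N * f) := by rw [ht', hf']; noncomm_ring
    _ = t * (N * N * ((N₁ * N + N * N₁) * (N₂ * N + N * N₂)) * (N * N) -
        N * N * ((N₂ * N + N * N₂) * (N₁ * N + N * N₁)) * (N * N)) * f := by noncomm_ring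
    _ = _ := by rw [key hN1 hN2, key hN2 hN1, ← hC]; noncomm_ring

theorem sandwich_zero {f t N X : R} (hP : f * t = -(N * N)) (hf : f * t * f = f)
    (ht : t * (f * t) = t) (hX : N * X * N = 0) : t * X * f = 0 := by
  have ht' : t * (N * N) = -t := by
    rw [← neg_neg (N * N), ← hP, mul_neg, ht]
  have hf' : N * N * f = -f := by
    rw [← neg_neg (N * N), ← hP, neg_mul, hf]
  calc _ = (t * (N * N)) * X * (N * N * f) := by rw [ht', hf']; noncomm_ring
    _ = t * N * (N * X * N) * N * f := by noncomm_ring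
    _ = 0 := by rw [hX]; simp

end Algebra

/-! ### Cross products -/

section Cross
open LevelSurface

/-- The matrix of the cross product with `n`, padded by a zero row and a zero column. -/
def crossMat (n : Space) : Mat 4 ℝ :=
  Mat.of ![![0, -n 2, n 1, 0], ![n 2, 0, -n 0, 0], ![-n 1, n 0, 0, 0], ![0, 0, 0, 0]]

/-- The cross product matrix as a linear function. -/
def crossL : Space →L[ℝ] Mat 4 ℝ :=
  LinearMap.toContinuousLinearMap
    { toFun := crossMat
      map_add' := fun x y => by
        ext i j
        fin_cases i <;> fin_cases j <;> simp [crossMat] <;> ring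
      map_smul' := fun c x => by
        ext i j
        fin_cases i <;> fin_cases j <;> simp [crossMat] }

/-- The scalar product. -/
def dot (a b : Space) : ℝ := a 0 * b 0 + a 1 * b 1 + a 2 * b 2

/-- The triple product. -/
def triple (n a b : Space) : ℝ :=
  n 0 * (a 1 * b 2 - a 2 * b 1) + n 1 * (a 2 * b 0 - a 0 * b 2) + n 2 * (a 0 * b 1 - a 1 * b 0)

/-- Crossing with `n` twice and with `c` in between depends only on the component of `c` along `n`.
Taking `c = n` shows that `N` is a quarter turn of the tangent plane; taking `c` orthogonal to `n`
gives zero. -/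
theorem crossL_mul_mul (n c : Space) :
    crossL n * crossL c * crossL n = (-dot n c) • crossL n := by
  ext i j
  change (crossMat n * crossMat c * crossMat n) i j = (-dot n c • crossMat n) i j
  simp only [Mat.mul_apply, Mat.smul_apply, Fin.sum_univ_four]
  fin_cases i <;> fin_cases j <;> simp [crossMat, dot] <;> ring

/-- The commutator is the cross product with `a × b`, so this is `crossL_mul_mul` for the vector `a
× b`. -/
theorem crossL_lie (n a b : Space) :
    crossL n * (crossL a * crossL b - crossL b * crossL a) * crossL n =
      (-triple n a b) • crossL n := by
  ext i j
  change (crossMat n * (crossMat a * crossMat b - crossMat b * crossMat a) * crossMat n) i j =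
    (-triple n a b • crossMat n) i j
  simp only [Mat.mul_apply, Mat.smul_apply, Mat.sub_apply, Fin.sum_univ_four]
  fin_cases i <;> fin_cases j <;> simp [crossMat, triple] <;> ring

theorem transposeL_crossL (n : Space) : transposeL (crossL n) = -crossL n := by
  ext i j
  change transposeL (crossMat n) i j = (-crossMat n) i j
  simp only [transposeL_apply, Mat.neg_apply]
  fin_cases i <;> fin_cases j <;> simp [crossMat]

theorem det_crossL (n : Space) : Matrix.det (crossL n) = 0 := by
  refine Matrix.det_eq_zero_of_row_eq_zero 3 fun j => ?_
  change crossMat n 3 j = 0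
  fin_cases j <;> simp [crossMat]

/-- Two vectors orthogonal to the unit vector `n`. -/
theorem cross_eq_triple {n a b : Space} (hn : dot n n = 1) (ha : dot n a = 0) (hb : dot n b = 0) :
    a 0 * b 1 - a 1 * b 0 = triple n a b * n 2 := by
  simp only [dot, triple] at *
  linear_combination (-(a 0 * b 1 - a 1 * b 0)) * hn + (n 0 * b 1 - n 1 * b 0) * ha -
    (n 0 * a 1 - n 1 * a 0) * hb

end Cross

end ChernWeil

/-! ### Leibniz rules for forms with values in an algebra. -/

namespace ChernWeil
open LevelSurface

variable {E : Type*} [NormedAddCommGroup E] [NormedSpace ℝ E]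

section Calculus

variable {𝔸 F G : Type*} [NormedRing 𝔸] [NormedAlgebra ℝ 𝔸] [NormedAddCommGroup F]
  [NormedSpace ℝ F] [NormedAddCommGroup G] [NormedSpace ℝ G]

theorem fderiv_mul_apply {a b : E → 𝔸} {y : E} (ha : DifferentiableAt ℝ a y)
    (hb : DifferentiableAt ℝ b y) (v : E) :
    fderiv ℝ (fun z => a z * b z) y v = fderiv ℝ a y v * b y + a y * fderiv ℝ b y v := by
  have h : HasFDerivAt (fun z => a z * b z) _ y := ha.hasFDerivAt.mul' hb.hasFDerivAt
  rw [h.fderiv]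
  simp [add_comm]

theorem fderiv_clm_apply_comp (L : F →L[ℝ] G) {f : E → F} {y : E} (hf : DifferentiableAt ℝ f y)
    (v : E) : fderiv ℝ (fun z => L (f z)) y v = L (fderiv ℝ f y v) := by
  have h : HasFDerivAt (fun z => L (f z)) (L.comp (fderiv ℝ f y)) y :=
    L.hasFDerivAt.comp y hf.hasFDerivAt
  rw [h.fderiv]
  rfl

theorem extD_add {α β : E → E →L[ℝ] F} {y : E} (hα : DifferentiableAt ℝ α y)
    (hβ : DifferentiableAt ℝ β y) (v w : E) :
    extD (fun z => α z + β z) y v w = extD α y v w + extD β y v w := by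
  unfold extD
  rw [fderiv_fun_add hα hβ]
  simp only [add_apply]
  abel

theorem extD_mul_fderiv {h g : E → 𝔸} {y : E} (hh : DifferentiableAt ℝ h y)
    (hg : ContDiffAt ℝ 2 g y) (v w : E) :
    extD (fun z => (ContinuousLinearMap.mul ℝ 𝔸 (h z)).comp (fderiv ℝ g z)) y v w =
      fderiv ℝ h y v * fderiv ℝ g y w - fderiv ℝ h y w * fderiv ℝ g y v := by
  have hd := differentiableAt_fderiv hg
  have h1 : DifferentiableAt ℝ
      (fun z => (ContinuousLinearMap.mul ℝ 𝔸 (h z)).comp (fderiv ℝ g z)) y :=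
    (((ContinuousLinearMap.mul ℝ 𝔸).differentiableAt).comp y hh).clm_comp hd
  have h2 : ∀ v w, fderiv ℝ
      (fun z => (ContinuousLinearMap.mul ℝ 𝔸 (h z)).comp (fderiv ℝ g z)) y v w =
        fderiv ℝ h y v * fderiv ℝ g y w + h y * fderiv ℝ (fderiv ℝ g) y v w := by
    intro v w
    rw [← fderiv_apply_const h1]
    have h3 := fderiv_mul_apply hh (hd.clm_apply (differentiableAt_const w)) v
    rw [fderiv_apply_const hd] at h3
    exact h3
  unfold extD
  rw [h2, h2, snd_fderiv_symm hg v w]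
  abel

theorem differentiableAt_smulRight {β : E → E →L[ℝ] ℝ} {X : E → F} {y : E}
    (hβ : DifferentiableAt ℝ β y) (hX : DifferentiableAt ℝ X y) :
    DifferentiableAt ℝ (fun z => (β z).smulRight (X z)) y :=
  DifferentiableAt.comp (g := fun p : (E →L[ℝ] ℝ) × F => p.1.smulRight p.2) y
    ((isBoundedBilinearMap_smulRight (𝕜 := ℝ) (E := E) (F := F)).differentiableAt (β y, X y))
    (hβ.prodMk hX)

theorem extD_smulRight {β : E → E →L[ℝ] ℝ} {X : E → F} {y : E} (hβ : DifferentiableAt ℝ β y)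
    (hX : DifferentiableAt ℝ X y) (v w : E) :
    extD (fun z => (β z).smulRight (X z)) y v w =
      extD β y v w • X y + β y w • fderiv ℝ X y v - β y v • fderiv ℝ X y w := by
  have h1 := differentiableAt_smulRight hβ hX
  have h2 : ∀ v w, fderiv ℝ (fun z => (β z).smulRight (X z)) y v w =
      β y w • fderiv ℝ X y v + fderiv ℝ β y v w • X y := by
    intro v w
    rw [← fderiv_apply_const h1]
    have h3 := ((hβ.clm_apply (differentiableAt_const w)).hasFDerivAt.fun_smul hX.hasFDerivAt).fderiv
    have h4 := congrArg (fun L => L v) h3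
    simp only [add_apply, smul_apply, ContinuousLinearMap.smulRight_apply] at h4
    rw [fderiv_apply_const hβ] at h4
    exact h4
  unfold extD
  rw [h2, h2, sub_smul]
  abel

/-- Compatibility with brackets is required only for the values of `A`: the half spin
representations are extended linearly to all matrices but respect brackets only on skew ones. -/
theorem curv_clm_comp {𝔹 : Type*} [NormedRing 𝔹] [NormedAlgebra ℝ 𝔹] (Λ : 𝔸 →L[ℝ] 𝔹)
    {A : E → E →L[ℝ] 𝔸} {y : E} (hA : DifferentiableAt ℝ A y) (v w : E)
    (hΛ : Λ (A y v * A y w - A y w * A y v) =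
      Λ (A y v) * Λ (A y w) - Λ (A y w) * Λ (A y v)) :
    curv (fun z => Λ.comp (A z)) y v w = Λ (curv A y v w) := by
  have h1 : ∀ v, fderiv ℝ (fun z => Λ.comp (A z)) y v = Λ.comp (fderiv ℝ A y v) := fun v =>
    fderiv_clm_apply_comp (ContinuousLinearMap.compL ℝ E 𝔸 𝔹 Λ) hA v
  unfold curv extD
  rw [h1, h1]
  simp only [ContinuousLinearMap.comp_apply]
  have h2 : Λ (A y v * A y w) - Λ (A y w * A y v) = _ := (map_sub Λ _ _).symm.trans hΛ
  simp only [map_add, map_sub]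
  linear_combination (norm := abel) -h2

end Calculus

/-! ### The primitive of the area form of the sphere, and its localisation -/

/-- A cut-off `S` on `[-1, 1]` from `0` to `1`, with the coefficient of the correction of the
connection that localises the curvature. -/
structure Profile where
  S : ℝ → ℝ
  c : ℝ → ℝ
  smooth_S : ContDiff ℝ ∞ S
  smooth_c : ContDiff ℝ ∞ c
  eq : ∀ t, (1 - t ^ 2) * c t = 2 * S t - 1 - t

namespace Profile

variable (p : Profile)

/-- The left side is minus the coefficient of the area form in the differential of the correction
`c(n₂) (n₀ dn₁ - n₁ dn₀)`. -/
theorem deriv_eq (t : ℝ) : (1 - t ^ 2) * deriv p.c t - 2 * t * p.c t = 2 * deriv p.S t - 1 := by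
  have hc := (p.smooth_c.differentiable (by simp) t).hasDerivAt
  have hS := (p.smooth_S.differentiable (by simp) t).hasDerivAt
  have h1 : HasDerivAt (fun t => (1 - t ^ 2) * p.c t)
      ((-(2 * t)) * p.c t + (1 - t ^ 2) * deriv p.c t) t := by
    have : HasDerivAt (fun t => (1 - t ^ 2) * p.c t) _ t :=
      (((hasDerivAt_id t).pow 2).const_sub 1).mul hc
    convert this using 1
    simp
  have h2 : HasDerivAt (fun t => 2 * p.S t - 1 - t) (2 * deriv p.S t - 1) t :=
    ((hS.const_mul 2).sub_const 1).sub (hasDerivAt_id t)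
  have h3 : (fun t => (1 - t ^ 2) * p.c t) = fun t => 2 * p.S t - 1 - t := funext p.eq
  rw [h3] at h1
  linarith [h1.unique h2]

/-- The correction form at the unit vector `n`. -/
def form (n : Space) (n' : E →L[ℝ] Space) : E →L[ℝ] ℝ :=
  p.c (n 2) • (n 0 • (EuclideanSpace.proj 1 : Space →L[ℝ] ℝ).comp n' -
    n 1 • (EuclideanSpace.proj 0 : Space →L[ℝ] ℝ).comp n')

theorem contDiffAt_form {k : ℕ∞ω} {n : E → Space} {n' : E → E →L[ℝ] Space} {y : E} (hk : k ≤ ∞)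
    (hn : ContDiffAt ℝ k n y) (hn' : ContDiffAt ℝ k n' y) :
    ContDiffAt ℝ k (fun z => p.form (n z) (n' z)) y := by
  have h : ∀ i, ContDiffAt ℝ k (fun z => n z i) y := fun i =>
    ContDiffAt.continuousLinearMap_comp (EuclideanSpace.proj i : Space →L[ℝ] ℝ) hn
  unfold form
  refine ((p.smooth_c.of_le hk).contDiffAt.comp y (h 2)).smul (((h 0).smul ?_).sub ((h 1).smul ?_))
  · exact contDiffAt_const.clm_comp hn'
  · exact contDiffAt_const.clm_comp hn'

end Profile

theorem dot_fderiv_eq_zero {n : E → Space} {y : E} (hn : DifferentiableAt ℝ n y)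
    (h1 : ∀ᶠ z in 𝓝 y, dot (n z) (n z) = 1) (v : E) : dot (n y) (fderiv ℝ n y v) = 0 := by
  have h : ∀ i, HasFDerivAt (fun z => n z i)
      ((EuclideanSpace.proj i : Space →L[ℝ] ℝ).comp (fderiv ℝ n y)) y := fun i =>
    (EuclideanSpace.proj i : Space →L[ℝ] ℝ).hasFDerivAt.comp y hn.hasFDerivAt
  have h2 : HasFDerivAt (fun z => dot (n z) (n z)) _ y :=
    (((h 0).mul (h 0)).add ((h 1).mul (h 1))).add ((h 2).mul (h 2))
  have h3 : (fun z => dot (n z) (n z)) =ᶠ[𝓝 y] fun _ => 1 := h1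
  have h4 := h3.fderiv_eq (𝕜 := ℝ)
  rw [h2.fderiv, fderiv_const_apply] at h4
  have h5 := congrArg (fun L => L v) h4
  simp only [add_apply, smul_apply, ContinuousLinearMap.comp_apply, PiLp.proj_apply,
    smul_eq_mul, zero_apply] at h5
  simp only [dot]
  linarith

/-- With `ω` the area form, the correction is a primitive of `(1 - 2 S') ω`. Such a primitive exists
on the whole sphere because `ω` and `2 S' ω` have the same total integral `4π`. -/
theorem Profile.extD_form (p : Profile) {n : E → Space} {y : E} (hn : ContDiffAt ℝ 2 n y)
    (h1 : ∀ᶠ z in 𝓝 y, dot (n z) (n z) = 1) (v w : E) :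
    extD (fun z => p.form (n z) (fderiv ℝ n z)) y v w -
        triple (n y) (fderiv ℝ n y v) (fderiv ℝ n y w) =
      -2 * deriv p.S (n y 2) * triple (n y) (fderiv ℝ n y v) (fderiv ℝ n y w) := by
  have hnd : DifferentiableAt ℝ n y := hn.differentiableAt (by simp)
  have hdn := differentiableAt_fderiv hn
  have hd : DifferentiableAt ℝ (fun z => p.form (n z) (fderiv ℝ n z)) y :=
    (p.contDiffAt_form (k := 1) ENat.LEInfty.out (hn.of_le (by norm_num))
      (hn.fderiv_right (by norm_num))).differentiableAt (by simp)
  have h : ∀ i, HasFDerivAt (fun z => n z i)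
      ((EuclideanSpace.proj i : Space →L[ℝ] ℝ).comp (fderiv ℝ n y)) y := fun i =>
    (EuclideanSpace.proj i : Space →L[ℝ] ℝ).hasFDerivAt.comp y hnd.hasFDerivAt
  have h' : ∀ w i, HasFDerivAt (fun z => fderiv ℝ n z w i)
      ((EuclideanSpace.proj i : Space →L[ℝ] ℝ).comp (fderiv ℝ (fun z => fderiv ℝ n z w) y)) y :=
    fun w i => (EuclideanSpace.proj i : Space →L[ℝ] ℝ).hasFDerivAt.comp y
      (hdn.clm_apply (differentiableAt_const w)).hasFDerivAt
  have hc : HasFDerivAt (fun z => p.c (n z 2)) _ y :=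
    ((p.smooth_c.differentiable (by simp) (n y 2)).hasDerivAt).comp_hasFDerivAt y (h 2)
  have key : ∀ v w, fderiv ℝ (fun z => p.form (n z) (fderiv ℝ n z)) y v w =
      deriv p.c (n y 2) * fderiv ℝ n y v 2 * (n y 0 * fderiv ℝ n y w 1 - n y 1 * fderiv ℝ n y w 0) +
      p.c (n y 2) * (fderiv ℝ n y v 0 * fderiv ℝ n y w 1 - fderiv ℝ n y v 1 * fderiv ℝ n y w 0 +
        n y 0 * fderiv ℝ (fderiv ℝ n) y v w 1 - n y 1 * fderiv ℝ (fderiv ℝ n) y v w 0) := by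
    intro v w
    rw [← fderiv_apply_const hd]
    have h2 := (hc.mul (((h 0).mul (h' w 1)).sub ((h 1).mul (h' w 0)))).fderiv
    have h3 := congrArg (fun L => L v) h2
    simp only [add_apply, sub_apply, smul_apply, ContinuousLinearMap.comp_apply,
      PiLp.proj_apply, smul_eq_mul, fderiv_apply_const hdn, Pi.sub_apply, Pi.mul_apply] at h3
    refine h3.trans ?_
    ring
  unfold extD
  rw [key, key, snd_fderiv_symm hn v w]
  have ha := dot_fderiv_eq_zero hnd h1 v
  have hb := dot_fderiv_eq_zero hnd h1 w
  have h0 := h1.self_of_nhds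
  have hp := p.deriv_eq (n y 2)
  have hcr := cross_eq_triple h0 ha hb
  generalize fderiv ℝ n y v = a at *
  generalize fderiv ℝ n y w = b at *
  generalize n y = m at *
  -- The product of the differential of the height with the angular form, expressed by the area
  -- form.
  have h5 : a 2 * (m 0 * b 1 - m 1 * b 0) - b 2 * (m 0 * a 1 - m 1 * a 0) =
      -(1 - m 2 ^ 2) * triple m a b := by
    have : a 2 * (m 0 * b 1 - m 1 * b 0) - b 2 * (m 0 * a 1 - m 1 * a 0) =
        -triple m a b + m 2 * (a 0 * b 1 - a 1 * b 0) := by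
      simp only [triple]; ring
    rw [this, hcr]; ring
  linear_combination (deriv p.c (m 2)) * h5 + 2 * p.c (m 2) * hcr - triple m a b * hp

/-! ### Curvature of the projected connection -/

/-- The algebraic relations between the two halves `f`, `s` of an orthonormal frame of the
orthogonal complement of `(n, 0)` and `(0, m)` in `ℝ³ ⊕ ℝ³`. -/
structure FrameRel (f s : Mat 4 ℝ) (n m : Space) : Prop where
  sum : transposeL f * f + transposeL s * s = 1
  left : f * transposeL f = -(crossL n * crossL n)
  right : s * transposeL s = -(crossL m * crossL m)
  zero : f * transposeL s = 0
  dot_left : dot n n = 1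
  dot_right : dot m m = 1

theorem crossL_cube {n : Space} (h : dot n n = 1) :
    crossL n * crossL n * crossL n = -crossL n := by
  rw [crossL_mul_mul, h]; simp

namespace FrameRel

variable {f s : Mat 4 ℝ} {n m : Space} (h : FrameRel f s n m)
include h

theorem zero' : s * transposeL f = 0 := by
  have := congrArg transposeL h.zero
  rw [transposeL_mul, map_zero] at this
  exact this

theorem symm : FrameRel s f m n :=
  ⟨by rw [add_comm]; exact h.sum, h.right, h.left, h.zero', h.dot_right, h.dot_left⟩

theorem mul_mul_left : f * transposeL f * f = f := by
  calc _ = f * (transposeL f * f + transposeL s * s) - f * transposeL s * s := by noncomm_ring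
    _ = f := by rw [h.sum, h.zero]; simp

theorem mul_mul_right : transposeL f * (f * transposeL f) = transposeL f := by
  calc _ = (transposeL f * f + transposeL s * s) * transposeL f -
        transposeL s * (s * transposeL f) := by noncomm_ring
    _ = _ := by rw [h.sum, h.zero']; simp

theorem cross_mul : crossL n * (f * transposeL f) = crossL n := by
  rw [h.left, mul_neg, ← mul_assoc, crossL_cube h.dot_left, neg_neg]

theorem mul_cross : f * transposeL f * crossL n = crossL n := by
  rw [h.left, neg_mul, crossL_cube h.dot_left, neg_neg]

/-- The curvature block. -/
theorem transpose_block : transposeL (transposeL f * crossL n * f) =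
    -(transposeL f * crossL n * f) := by
  rw [transposeL_mul, transposeL_mul, transposeL_transposeL, transposeL_crossL]
  noncomm_ring

omit h in
theorem det_block : Matrix.det (transposeL f * crossL n * f : Mat 4 ℝ) = 0 := by
  have h1 : Matrix.det (transposeL f * crossL n * f : Mat 4 ℝ) =
      Matrix.det (transposeL f) * Matrix.det (crossL n) * Matrix.det f :=
    (Matrix.det_mul _ _).trans (congrArg (· * _) (Matrix.det_mul _ _))
  rw [h1, det_crossL]
  ring

/-- The two quarter turns act on orthogonal planes. -/
theorem block_mul_block : (transposeL f * crossL n * f) * (transposeL s * crossL m * s) = 0 := by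
  calc _ = transposeL f * crossL n * (f * transposeL s) * crossL m * s := by noncomm_ring
    _ = 0 := by rw [h.zero]; simp

theorem block_sq : (transposeL f * crossL n * f) * (transposeL f * crossL n * f) =
    -(transposeL f * f) := by
  calc _ = transposeL f * (crossL n * (f * transposeL f)) * crossL n * f := by noncomm_ring
    _ = transposeL f * (crossL n * crossL n) * f := by rw [h.cross_mul]; noncomm_ring
    _ = -(transposeL f * (f * transposeL f)) * f := by rw [h.left]; noncomm_ring
    _ = _ := by rw [h.mul_mul_right]; noncomm_ring

/-- Quarter turns of two complementary planes add up to a complex structure. With the vanishing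
determinants this makes their wedge product `±1`, the relative orientation of the frame. -/
theorem blocks_sq : (transposeL f * crossL n * f + transposeL s * crossL m * s) *
    (transposeL f * crossL n * f + transposeL s * crossL m * s) = -1 := by
  rw [mul_add, add_mul, add_mul, h.block_mul_block, h.symm.block_mul_block, h.block_sq,
    h.symm.block_sq, ← h.sum]
  abel

/-- The relative orientation of the frame. -/
theorem wedge_sq : wedge22 (fun a b : ℝ => a * b) (transposeL f * crossL n * f)
    (transposeL s * crossL m * s) ^ 2 = 1 :=
  SpinAlgebra.wedge22_sq_eq_one h.transpose_block h.symm.transpose_block det_block det_block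
    h.blocks_sq

end FrameRel

/-- The connection form of the frame `f`, `s` with derivatives `f'`, `s'`, corrected by multiples of
the rotations about the normal vectors. -/
def frameForm (f s : Mat 4 ℝ) (f' s' : E →L[ℝ] Mat 4 ℝ) (n m : Space) (β γ : E →L[ℝ] ℝ) :
    E →L[ℝ] Mat 4 ℝ :=
  (ContinuousLinearMap.mul ℝ (Mat 4 ℝ) (transposeL f)).comp f' +
    (ContinuousLinearMap.mul ℝ (Mat 4 ℝ) (transposeL s)).comp s' +
    β.smulRight (transposeL f * crossL n * f) + γ.smulRight (transposeL s * crossL m * s)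

theorem frameForm_apply (f s : Mat 4 ℝ) (f' s' : E →L[ℝ] Mat 4 ℝ) (n m : Space) (β γ : E →L[ℝ] ℝ)
    (v : E) : frameForm f s f' s' n m β γ v = transposeL f * f' v + transposeL s * s' v +
      β v • (transposeL f * crossL n * f) + γ v • (transposeL s * crossL m * s) := rfl

/-- Adding multiples of parallel endomorphisms `X`, `Y` with `X Y = Y X = 0` changes the curvature
only by the differentials of the coefficients: the quadratic terms commute and the mixed ones vanish
by parallelism. -/
theorem curvature_assemble {R : Type*} [Ring R] [Algebra ℝ R] {θ₁ θ₂ X Y X₁ X₂ Y₁ Y₂ D Z : R}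
    (b₁ b₂ c₁ c₂ p q : ℝ) (hD : D + (θ₁ * θ₂ - θ₂ * θ₁) = Z) (hX₁ : X₁ + (θ₁ * X - X * θ₁) = 0)
    (hX₂ : X₂ + (θ₂ * X - X * θ₂) = 0) (hY₁ : Y₁ + (θ₁ * Y - Y * θ₁) = 0)
    (hY₂ : Y₂ + (θ₂ * Y - Y * θ₂) = 0) (hXY : X * Y = 0) (hYX : Y * X = 0) :
    D + (p • X + b₂ • X₁ - b₁ • X₂) + (q • Y + c₂ • Y₁ - c₁ • Y₂) +
      ((θ₁ + b₁ • X + c₁ • Y) * (θ₂ + b₂ • X + c₂ • Y) -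
        (θ₂ + b₂ • X + c₂ • Y) * (θ₁ + b₁ • X + c₁ • Y)) = Z + p • X + q • Y := by
  rw [eq_neg_of_add_eq_zero_left hX₁, eq_neg_of_add_eq_zero_left hX₂,
    eq_neg_of_add_eq_zero_left hY₁, eq_neg_of_add_eq_zero_left hY₂, ← hD]
  simp only [mul_add, add_mul, smul_mul_assoc, mul_smul_comm, hXY, hYX, smul_zero]
  module

section Curvature

variable {f s : E → Mat 4 ℝ} {n m : E → Space} {y : E}
  (hf : ContDiffAt ℝ 2 f y) (hs : ContDiffAt ℝ 2 s y) (hn : ContDiffAt ℝ 2 n y)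
  (hm : ContDiffAt ℝ 2 m y) (h : ∀ᶠ z in 𝓝 y, FrameRel (f z) (s z) (n z) (m z))
include hf hs hn hm h

theorem fderiv_frameRel (v : E) :
    transposeL (fderiv ℝ f y v) * f y + transposeL (f y) * fderiv ℝ f y v +
        (transposeL (fderiv ℝ s y v) * s y + transposeL (s y) * fderiv ℝ s y v) = 0 ∧
    fderiv ℝ f y v * transposeL (f y) + f y * transposeL (fderiv ℝ f y v) =
      -(crossL (fderiv ℝ n y v) * crossL (n y) + crossL (n y) * crossL (fderiv ℝ n y v)) ∧
    fderiv ℝ f y v * transposeL (s y) + f y * transposeL (fderiv ℝ s y v) = 0 := by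
  have hf1 := hf.differentiableAt two_ne_zero
  have hs1 := hs.differentiableAt two_ne_zero
  have hn1 := hn.differentiableAt two_ne_zero
  have hf2 : DifferentiableAt ℝ (fun z => transposeL (f z)) y :=
    transposeL.differentiableAt.comp y hf1
  have hs2 : DifferentiableAt ℝ (fun z => transposeL (s z)) y :=
    transposeL.differentiableAt.comp y hs1
  have hn2 : DifferentiableAt ℝ (fun z => crossL (n z)) y := crossL.differentiableAt.comp y hn1
  refine ⟨?_, ?_, ?_⟩
  · have h1 : (fun z => transposeL (f z) * f z + transposeL (s z) * s z) =ᶠ[𝓝 y] fun _ => 1 :=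
      h.mono fun z hz => hz.sum
    have h2 := congrArg (fun L : E →L[ℝ] Mat 4 ℝ => L v) (h1.fderiv_eq (𝕜 := ℝ))
    beta_reduce at h2
    rw [fderiv_fun_add (hf2.fun_mul hf1) (hs2.fun_mul hs1), add_apply,
      fderiv_mul_apply hf2 hf1, fderiv_mul_apply hs2 hs1, fderiv_clm_apply_comp _ hf1,
      fderiv_clm_apply_comp _ hs1] at h2
    simpa using h2
  · have h1 : (fun z => f z * transposeL (f z)) =ᶠ[𝓝 y] fun z => -(crossL (n z) * crossL (n z)) :=
      h.mono fun z hz => hz.left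
    have h2 := congrArg (fun L : E →L[ℝ] Mat 4 ℝ => L v) (h1.fderiv_eq (𝕜 := ℝ))
    beta_reduce at h2
    rw [fderiv_fun_neg, neg_apply, fderiv_mul_apply hf1 hf2, fderiv_mul_apply hn2 hn2, fderiv_clm_apply_comp _ hf1,
      fderiv_clm_apply_comp _ hn1] at h2
    exact h2
  · have h1 : (fun z => f z * transposeL (s z)) =ᶠ[𝓝 y] fun _ => 0 := h.mono fun z hz => hz.zero
    have h2 := congrArg (fun L : E →L[ℝ] Mat 4 ℝ => L v) (h1.fderiv_eq (𝕜 := ℝ))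
    beta_reduce at h2
    rw [fderiv_mul_apply hf1 hs2, fderiv_clm_apply_comp _ hs1] at h2
    simpa using h2

theorem fderiv_block (v : E) : fderiv ℝ (fun z => transposeL (f z) * crossL (n z) * f z) y v =
    transposeL (fderiv ℝ f y v) * crossL (n y) * f y +
      transposeL (f y) * crossL (fderiv ℝ n y v) * f y +
      transposeL (f y) * crossL (n y) * fderiv ℝ f y v := by
  have hf1 := hf.differentiableAt two_ne_zero
  have hn1 := hn.differentiableAt two_ne_zero
  have hf2 : DifferentiableAt ℝ (fun z => transposeL (f z)) y :=
    transposeL.differentiableAt.comp y hf1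
  have hn2 : DifferentiableAt ℝ (fun z => crossL (n z)) y := crossL.differentiableAt.comp y hn1
  rw [fderiv_mul_apply (hf2.fun_mul hn2) hf1, fderiv_mul_apply hf2 hn2, fderiv_clm_apply_comp _ hf1,
    fderiv_clm_apply_comp _ hn1]
  noncomm_ring

/-- The quarter turn is parallel: the derivative of a unit normal is orthogonal to it, so `N N' N =
0`. -/
theorem block_covariant (v : E) :
    fderiv ℝ (fun z => transposeL (f z) * crossL (n z) * f z) y v +
      ((transposeL (f y) * fderiv ℝ f y v + transposeL (s y) * fderiv ℝ s y v) *
          (transposeL (f y) * crossL (n y) * f y) - (transposeL (f y) * crossL (n y) * f y) *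
        (transposeL (f y) * fderiv ℝ f y v + transposeL (s y) * fderiv ℝ s y v)) = 0 := by
  have h0 := h.self_of_nhds
  rw [fderiv_block hf hs hn hm h, projected_covariant_step h0.sum h0.cross_mul h0.mul_cross h0.zero
    h0.zero' (fderiv_frameRel hf hs hn hm h v).1]
  refine sandwich_zero h0.left h0.mul_mul_left h0.mul_mul_right ?_
  rw [crossL_mul_mul, dot_fderiv_eq_zero (hn.differentiableAt two_ne_zero)
    (h.mono fun z hz => hz.dot_left)]
  simp

/-- The curvature of one tangent plane bundle is minus the area form pulled back by its Gauss map,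
times the quarter turn. -/
theorem block_square (v w : E) :
    let P := fun v => crossL (fderiv ℝ n y v) * crossL (n y) + crossL (n y) * crossL (fderiv ℝ n y v)
    transposeL (f y) * (P v * P w - P w * P v) * f y =
      (-triple (n y) (fderiv ℝ n y v) (fderiv ℝ n y w)) •
        (transposeL (f y) * crossL (n y) * f y) := by
  have h0 := h.self_of_nhds
  have hN : ∀ v, crossL (n y) * crossL (fderiv ℝ n y v) * crossL (n y) = 0 := by
    intro v
    rw [crossL_mul_mul, dot_fderiv_eq_zero (hn.differentiableAt two_ne_zero)
      (h.mono fun z hz => hz.dot_left)]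
    simp
  refine (sandwich_square h0.left h0.mul_mul_left h0.mul_mul_right (crossL_cube h0.dot_left)
    (hN v) (hN w) (crossL_lie _ _ _)).trans ?_
  rw [mul_smul_comm, smul_mul_assoc]

omit hf hs hn hm h in
theorem contDiffAt_frameForm {k : ℕ∞ω} {f s : E → Mat 4 ℝ} {n m : E → Space}
    {f' s' : E → E →L[ℝ] Mat 4 ℝ} {β γ : E → E →L[ℝ] ℝ}
    (hf : ContDiffAt ℝ k f y) (hs : ContDiffAt ℝ k s y) (hn : ContDiffAt ℝ k n y)
    (hm : ContDiffAt ℝ k m y) (hf' : ContDiffAt ℝ k f' y) (hs' : ContDiffAt ℝ k s' y)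
    (hβ : ContDiffAt ℝ k β y) (hγ : ContDiffAt ℝ k γ y) :
    ContDiffAt ℝ k (fun z => frameForm (f z) (s z) (f' z) (s' z) (n z) (m z) (β z) (γ z)) y := by
  have hl : ∀ {g : E → Mat 4 ℝ} {g' : E → E →L[ℝ] Mat 4 ℝ}, ContDiffAt ℝ k g y →
      ContDiffAt ℝ k g' y → ContDiffAt ℝ k
        (fun z => (ContinuousLinearMap.mul ℝ (Mat 4 ℝ) (transposeL (g z))).comp (g' z)) y := by
    intro g g' hg hg'
    have h1 : ContDiffAt ℝ k (fun z => transposeL (g z)) y :=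
      ContDiffAt.continuousLinearMap_comp transposeL hg
    have h2 : ContDiffAt ℝ k (fun z => ContinuousLinearMap.mul ℝ (Mat 4 ℝ) (transposeL (g z))) y :=
      ContDiffAt.continuousLinearMap_comp (ContinuousLinearMap.mul ℝ (Mat 4 ℝ)) h1
    exact h2.clm_comp hg'
  have hr : ∀ {g : E → Mat 4 ℝ} {p : E → Space} {β : E → E →L[ℝ] ℝ}, ContDiffAt ℝ k g y →
      ContDiffAt ℝ k p y → ContDiffAt ℝ k β y → ContDiffAt ℝ k
        (fun z => (β z).smulRight (transposeL (g z) * crossL (p z) * g z)) y := by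
    intro g p β hg hp hβ
    have h1 : ContDiffAt ℝ k (fun z => transposeL (g z)) y :=
      ContDiffAt.continuousLinearMap_comp transposeL hg
    have h2 : ContDiffAt ℝ k (fun z => crossL (p z)) y :=
      ContDiffAt.continuousLinearMap_comp crossL hp
    exact ContDiffAt.smulRight hβ ((h1.mul h2).mul hg)
  exact (((hl hf hf').add (hl hs hs')).add (hr hf hn hβ)).add (hr hs hm hγ)

omit h in
theorem extD_frameForm {β γ : E → E →L[ℝ] ℝ} (hβ : DifferentiableAt ℝ β y)
    (hγ : DifferentiableAt ℝ γ y) (v w : E) :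
    extD (fun z => frameForm (f z) (s z) (fderiv ℝ f z) (fderiv ℝ s z) (n z) (m z) (β z) (γ z))
        y v w =
      transposeL (fderiv ℝ f y v) * fderiv ℝ f y w - transposeL (fderiv ℝ f y w) * fderiv ℝ f y v +
      (transposeL (fderiv ℝ s y v) * fderiv ℝ s y w - transposeL (fderiv ℝ s y w) * fderiv ℝ s y v) +
      (extD β y v w • (transposeL (f y) * crossL (n y) * f y) +
        β y w • fderiv ℝ (fun z => transposeL (f z) * crossL (n z) * f z) y v -
        β y v • fderiv ℝ (fun z => transposeL (f z) * crossL (n z) * f z) y w) +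
      (extD γ y v w • (transposeL (s y) * crossL (m y) * s y) +
        γ y w • fderiv ℝ (fun z => transposeL (s z) * crossL (m z) * s z) y v -
        γ y v • fderiv ℝ (fun z => transposeL (s z) * crossL (m z) * s z) y w) := by
  have hT : ∀ {g : E → Mat 4 ℝ}, ContDiffAt ℝ 2 g y →
      DifferentiableAt ℝ (fun z => transposeL (g z)) y := fun hg =>
    transposeL.differentiableAt.comp y (hg.differentiableAt two_ne_zero)
  have hC : ∀ {p : E → Space}, ContDiffAt ℝ 2 p y →
      DifferentiableAt ℝ (fun z => crossL (p z)) y := fun hg =>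
    crossL.differentiableAt.comp y (hg.differentiableAt two_ne_zero)
  have hl : ∀ {g : E → Mat 4 ℝ}, ContDiffAt ℝ 2 g y → DifferentiableAt ℝ
      (fun z => (ContinuousLinearMap.mul ℝ (Mat 4 ℝ) (transposeL (g z))).comp (fderiv ℝ g z)) y := by
    intro g hg
    exact ((ContinuousLinearMap.mul ℝ (Mat 4 ℝ)).differentiableAt.comp y (hT hg)).clm_comp
      (differentiableAt_fderiv hg)
  have hr : ∀ {g : E → Mat 4 ℝ} {p : E → Space} {β : E → E →L[ℝ] ℝ}, ContDiffAt ℝ 2 g y →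
      ContDiffAt ℝ 2 p y → DifferentiableAt ℝ β y → DifferentiableAt ℝ
        (fun z => (β z).smulRight (transposeL (g z) * crossL (p z) * g z)) y := by
    intro g p β hg hp hβ
    exact differentiableAt_smulRight hβ
      (((hT hg).fun_mul (hC hp)).fun_mul (hg.differentiableAt two_ne_zero))
  unfold frameForm
  rw [extD_add (((hl hf).fun_add (hl hs)).fun_add (hr hf hn hβ)) (hr hs hm hγ),
    extD_add ((hl hf).fun_add (hl hs)) (hr hf hn hβ), extD_add (hl hf) (hl hs),
    extD_mul_fderiv (hT hf) hf, extD_mul_fderiv (hT hs) hs,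
    extD_smulRight hβ (((hT hf).fun_mul (hC hn)).fun_mul (hf.differentiableAt two_ne_zero)),
    extD_smulRight hγ (((hT hs).fun_mul (hC hm)).fun_mul (hs.differentiableAt two_ne_zero)),
    fderiv_clm_apply_comp _ (hf.differentiableAt two_ne_zero),
    fderiv_clm_apply_comp _ (hf.differentiableAt two_ne_zero),
    fderiv_clm_apply_comp _ (hs.differentiableAt two_ne_zero),
    fderiv_clm_apply_comp _ (hs.differentiableAt two_ne_zero)]

/-- The curvature of the corrected projected connection. -/
theorem curv_frameForm {β γ : E → E →L[ℝ] ℝ} (hβ : DifferentiableAt ℝ β y)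
    (hγ : DifferentiableAt ℝ γ y) (v w : E) :
    curv (fun z => frameForm (f z) (s z) (fderiv ℝ f z) (fderiv ℝ s z) (n z) (m z) (β z) (γ z))
        y v w =
      (extD β y v w - triple (n y) (fderiv ℝ n y v) (fderiv ℝ n y w)) •
          (transposeL (f y) * crossL (n y) * f y) +
        (extD γ y v w - triple (m y) (fderiv ℝ m y v) (fderiv ℝ m y w)) •
          (transposeL (s y) * crossL (m y) * s y) := by
  have h0 := h.self_of_nhds
  have h' : ∀ᶠ z in 𝓝 y, FrameRel (s z) (f z) (m z) (n z) := h.mono fun z hz => hz.symm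
  have r := fun v => fderiv_frameRel hf hs hn hm h v
  have r' := fun v => fderiv_frameRel hs hf hm hn h' v
  have step := fun v w => projected_curvature_step h0.sum rfl rfl h0.zero h0.zero' (r v).1 (r w).1
    (r v).2.1 (r w).2.1 (r' v).2.1 (r' w).2.1 (r' v).2.2 (r' w).2.2 (r v).2.2 (r w).2.2
  have sq := block_square hf hs hn hm h v w
  have sq' := block_square hs hf hm hn h' v w
  have cov := fun v => block_covariant hf hs hn hm h v
  have cov' := fun v => block_covariant hs hf hm hn h' v
  have hXY := h0.block_mul_block
  have hYX := h0.symm.block_mul_block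
  have s12 := step v w
  have s21 := step w v
  unfold curv
  rw [extD_frameForm hf hs hn hm hβ hγ]
  simp only [frameForm_apply]
  have c1 := cov v
  have c2 := cov w
  have d1 := cov' v
  have d2 := cov' w
  rw [add_comm (transposeL (s y) * _)] at d1 d2
  simp only [neg_mul_neg] at s12 s21
  generalize fderiv ℝ (fun z => transposeL (f z) * crossL (n z) * f z) y v = X₁ at *
  generalize fderiv ℝ (fun z => transposeL (f z) * crossL (n z) * f z) y w = X₂ at *
  generalize fderiv ℝ (fun z => transposeL (s z) * crossL (m z) * s z) y v = Y₁ at *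
  generalize fderiv ℝ (fun z => transposeL (s z) * crossL (m z) * s z) y w = Y₂ at *
  -- `Z` is the curvature without the corrections. It is obtained by antisymmetrising the one-step
  -- identities `s12` and `s21`.
  refine (curvature_assemble (β y v) (β y w) (γ y v) (γ y w) (extD β y v w) (extD γ y v w)
    (Z := (-triple (n y) (fderiv ℝ n y v) (fderiv ℝ n y w)) •
        (transposeL (f y) * crossL (n y) * f y) +
      (-triple (m y) (fderiv ℝ m y v) (fderiv ℝ m y w)) • (transposeL (s y) * crossL (m y) * s y))
    ?_ c1 c2 d1 d2 hXY hYX).trans (by module)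
  rw [← sq, ← sq', mul_sub, sub_mul, mul_sub, sub_mul]
  linear_combination (norm := abel) s12 - s21

end Curvature

end ChernWeil

/-! ### Half spin representations, cut-offs and the localised Chern form. -/

namespace ChernWeil
open LevelSurface
open scoped Matrix

/-- The rotation attached to an element of `Spin(4)`. -/
def rotation (s : Spin4) : Mat 4 ℝ := spinCover s

/-- One of the two half spin representations, on the level of Lie algebras. -/
structure HalfSpin where
  toL : Mat 4 ℝ →L[ℝ] Mat 2 ℂ
  sign : ℝ
  pr : Mat 2 ℂ × Mat 2 ℂ →L[ℝ] Mat 2 ℂ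
  lie : ∀ X Y : Mat 4 ℝ, transposeL X = -X → transposeL Y = -Y →
    toL (X * Y - Y * X) = toL X * toL Y - toL Y * toL X
  trace : ∀ X : Mat 4 ℝ, transposeL X = -X → traceL (toL X) = 0
  trace_mul : ∀ X Y : Mat 4 ℝ, transposeL X = -X → transposeL Y = -Y →
    traceL (toL X * toL Y) = ((-(1 / 2) * (-(1 / 2) * traceL (X * Y) +
      sign * wedge22 (fun s t : ℝ => s * t) X Y) : ℝ) : ℂ)
  conj : ∀ (s : Spin4) (X : Mat 4 ℝ), toL (transposeL (rotation s) * X * rotation s) =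
    pr ((s⁻¹).1.1, (s⁻¹).2.1) * toL X * pr (s.1.1, s.2.1)
  maurerCartan : ∀ (s : Spin4) (T : Mat 4 ℝ) (A' B' : Matrix (Fin 2) (Fin 2) ℂ),
    (∀ l, ∑ k, T l k • quaternionUnit k =
      A'ᴴ * quaternionUnit l * s.2.1 + (s.1.1)ᴴ * quaternionUnit l * B') →
    (A' * (s.1.1)ᴴ).trace = 0 → (s.2.1 * B'ᴴ).trace = 0 → B'ᴴ * s.2.1 = -((s.2.1)ᴴ * B') →
    toL (transposeL (rotation s) * T) = pr ((s⁻¹).1.1, (s⁻¹).2.1) * pr (A', B')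

/-- The positive half spin representation. -/
def HalfSpin.plus : HalfSpin where
  toL := LinearMap.toContinuousLinearMap
    { toFun := fun X => SpinAlgebra.halfPlus X
      map_add' := fun X Y => by
        simp only [SpinAlgebra.halfPlus, Mat.add_apply, add_smul, Finset.sum_add_distrib, smul_add]
        rfl
      map_smul' := fun c X => by
        simp only [SpinAlgebra.halfPlus, Mat.smul_apply, smul_assoc, ← Finset.smul_sum]
        exact smul_comm (1 / 4 : ℝ) c (_ : Matrix (Fin 2) (Fin 2) ℂ) }
  sign := 1
  pr := ContinuousLinearMap.fst ℝ _ _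
  lie X Y hX hY := SpinAlgebra.halfPlus_lie hX hY
  trace X hX := SpinAlgebra.trace_halfPlus hX
  trace_mul X Y hX hY := by
    rw [one_mul]
    exact SpinAlgebra.trace_halfPlus_mul hX hY
  conj s X := SpinAlgebra.halfPlus_conj s X
  maurerCartan s T A' B' hT _ hB _ := SpinAlgebra.halfPlus_maurerCartan s hT hB

/-- The negative half spin representation. -/
def HalfSpin.minus : HalfSpin where
  toL := LinearMap.toContinuousLinearMap
    { toFun := fun X => SpinAlgebra.halfMinus X
      map_add' := fun X Y => by
        simp only [SpinAlgebra.halfMinus, Mat.add_apply, add_smul, Finset.sum_add_distrib, smul_add]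
        rfl
      map_smul' := fun c X => by
        simp only [SpinAlgebra.halfMinus, Mat.smul_apply, smul_assoc, ← Finset.smul_sum]
        exact smul_comm (-(1 / 4) : ℝ) c (_ : Matrix (Fin 2) (Fin 2) ℂ) }
  sign := -1
  pr := ContinuousLinearMap.snd ℝ _ _
  lie X Y hX hY := SpinAlgebra.halfMinus_lie hX hY
  trace X hX := SpinAlgebra.trace_halfMinus hX
  trace_mul X Y hX hY := by
    rw [neg_one_mul, ← sub_eq_add_neg]
    exact SpinAlgebra.trace_halfMinus_mul hX hY
  conj s X := SpinAlgebra.halfMinus_conj s X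
  maurerCartan s T A' B' hT hA _ hB := SpinAlgebra.halfMinus_maurerCartan s hT hA hB

/-- A profile whose cut-off vanishes up to a positive threshold. -/
structure Cutoff extends Profile where
  t₀ : ℝ
  pos : 0 < t₀
  lt_one : t₀ < 1
  S_eq_zero : ∀ t ≤ t₀, S t = 0

namespace Cutoff

variable (p : Cutoff)

theorem deriv_S_eq_zero {t : ℝ} (ht : t < p.t₀) : deriv p.S t = 0 := by
  have : p.S =ᶠ[𝓝 t] fun _ => 0 := by
    filter_upwards [eventually_lt_nhds ht] with x hx
    exact p.S_eq_zero x hx.le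
  rw [this.deriv_eq, deriv_const]

/-- The density of the localised area form with respect to the orthogonal projection to the
equatorial plane, at height `t`. -/
def weight (t : ℝ) : ℝ := 2 * deriv p.S t / t

theorem weight_eq_zero {t : ℝ} (ht : t < p.t₀) : p.weight t = 0 := by
  rw [weight, p.deriv_S_eq_zero ht]
  simp

/-- `S` rises from `0` at `t` to `1` at `(1 + t) / 2`. Dividing `2 S - 1 - x = S (1 - x) - (1 - S)
(1 + x)` by `1 - x²` gives `c`. Both fractions are smooth since their numerators vanish near the
zeros of the denominators. -/
theorem exists_threshold {t : ℝ} (ht : 0 < t) (ht' : t < 1) : ∃ p : Cutoff, p.t₀ = t := by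
  let S : ℝ → ℝ := fun x => Real.smoothTransition ((x - t) / ((1 + t) / 2 - t))
  have hd : 0 < (1 + t) / 2 - t := by linarith
  have hS : ContDiff ℝ ∞ S := Real.smoothTransition.contDiff.comp (by fun_prop)
  have h0 : ∀ x ≤ t, S x = 0 := fun x hx =>
    Real.smoothTransition.zero_of_nonpos (div_nonpos_of_nonpos_of_nonneg (by linarith) hd.le)
  have h1 : ∀ x, (1 + t) / 2 ≤ x → S x = 1 := fun x hx =>
    Real.smoothTransition.one_of_one_le (by rw [le_div_iff₀ hd]; linarith)
  let c : ℝ → ℝ := fun x => S x / (1 + x) - (1 - S x) / (1 - x)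
  have hc1 : ContDiff ℝ ∞ fun x => S x / (1 + x) := by
    rw [contDiff_iff_contDiffAt]
    intro x
    by_cases hx : x < t
    · refine (contDiffAt_const (c := (0 : ℝ))).congr_of_eventuallyEq ?_
      filter_upwards [eventually_lt_nhds hx] with z hz
      rw [h0 z hz.le]; simp
    · exact hS.contDiffAt.div (by fun_prop) (by linarith)
  have hc2 : ContDiff ℝ ∞ fun x => (1 - S x) / (1 - x) := by
    rw [contDiff_iff_contDiffAt]
    intro x
    by_cases hx : (1 + t) / 2 < x
    · refine (contDiffAt_const (c := (0 : ℝ))).congr_of_eventuallyEq ?_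
      filter_upwards [eventually_gt_nhds hx] with z hz
      rw [h1 z hz.le]; simp
    · exact (contDiffAt_const.sub hS.contDiffAt).div (by fun_prop) (by linarith)
  refine ⟨⟨⟨S, c, hS, hc1.sub hc2, fun x => ?_⟩, t, ht, ht', h0⟩, rfl⟩
  change (1 - x ^ 2) * (S x / (1 + x) - (1 - S x) / (1 - x)) = 2 * S x - 1 - x
  by_cases ha : 1 + x = 0
  · have hx : x = -1 := by linarith
    rw [h0 x (by linarith), hx]; norm_num
  by_cases hb : 1 - x = 0
  · have hx : x = 1 := by linarith
    rw [h1 x (by linarith), hx]; norm_num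
  field_simp
  ring

end Cutoff

variable {E : Type*} [NormedAddCommGroup E] [NormedSpace ℝ E]

/-- The second Chern form of curvature with two orthogonal blocks of rank two. -/
theorem secondChern_blocks (Ω : HalfSpin) {f s : Mat 4 ℝ} {n m : Space} (h : FrameRel f s n m)
    {κ μ : Fin 4 → Fin 4 → ℝ} (hκ : wedge22 (fun a b : ℝ => a * b) κ κ = 0)
    (hμ : wedge22 (fun a b : ℝ => a * b) μ μ = 0) :
    secondChern (fun k l => Ω.toL (κ k l • (transposeL f * crossL n * f) +
        μ k l • (transposeL s * crossL m * s))) =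
      ((-(1 / (8 * Real.pi ^ 2)) * Ω.sign * wedge22 (fun a b : ℝ => a * b)
        (transposeL f * crossL n * f) (transposeL s * crossL m * s) *
        wedge22 (fun a b : ℝ => a * b) κ μ : ℝ) : ℂ) := by
  have hX := h.transpose_block
  have hY := h.symm.transpose_block
  have hXY := h.block_mul_block
  generalize transposeL f * crossL n * f = X at *
  generalize transposeL s * crossL m * s = Y at *
  -- As `X Y = 0`, only the wedge term of the trace form survives, and it carries the sign of the
  -- representation.
  have hXY0 : traceL (Ω.toL X * Ω.toL Y) =
      ((-(1 / 2) * Ω.sign * wedge22 (fun a b : ℝ => a * b) X Y : ℝ) : ℂ) := by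
    rw [Ω.trace_mul X Y hX hY, hXY, map_zero]
    congr 1
    ring
  generalize wedge22 (fun a b : ℝ => a * b) X Y = w at hXY0 ⊢
  have hP : ∀ a b c d : ℝ, chernPairing traceL (Ω.toL (a • X + b • Y)) (Ω.toL (c • X + d • Y)) =
      a * c * traceL (Ω.toL X * Ω.toL X) + (a * d + b * c) * traceL (Ω.toL X * Ω.toL Y) +
        b * d * traceL (Ω.toL Y * Ω.toL Y) := by
    intro a b c d
    unfold chernPairing
    simp only [map_add, map_smul, add_mul, mul_add, smul_mul_smul_comm, Ω.trace X hX, Ω.trace Y hY,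
      smul_zero, add_zero, mul_zero, sub_zero, traceL_mul_comm (Ω.toL Y) (Ω.toL X)]
    simp only [Complex.real_smul, Complex.ofReal_mul]
    ring
  unfold secondChern
  have hκ' := congrArg (fun t : ℝ => (t : ℂ)) hκ
  have hμ' := congrArg (fun t : ℝ => (t : ℂ)) hμ
  simp only [wedge22] at hκ' hμ' ⊢
  simp only [hP, hXY0]
  push_cast at hκ' hμ' ⊢
  -- The two diagonal terms are multiples of `κ ∧ κ` and `μ ∧ μ`, which vanish; this is the absence
  -- of a Pontryagin contribution.
  linear_combination (1 / (8 * (Real.pi : ℂ) ^ 2)) * traceL (Ω.toL X * Ω.toL X) * hκ' +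
    (1 / (8 * (Real.pi : ℂ) ^ 2)) * traceL (Ω.toL Y * Ω.toL Y) * hμ'

section Local

variable {f s : E → Mat 4 ℝ} {n m : E → Space} {y : E}

/-- The `2`-form `dn₀ ∧ dn₁`. -/
def areaForm (L : E →L[ℝ] Space) (v w : E) : ℝ := L v 0 * L w 1 - L v 1 * L w 0

theorem wedge22_areaForm_self (L : E →L[ℝ] Space) (c : ℝ) (v : Fin 4 → E) :
    wedge22 (fun a b : ℝ => a * b) (fun k l => c * areaForm L (v k) (v l))
      (fun k l => c * areaForm L (v k) (v l)) = 0 := by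
  simp only [wedge22, areaForm]
  ring

/-- The orthogonal projection to the equatorial plane multiplies area by the height `n₂`. Dividing
by the height is harmless because `S'` vanishes below `t₀ > 0`. -/
theorem Cutoff.triple_eq (p : Cutoff) {n a b : Space} (hn : dot n n = 1) (ha : dot n a = 0)
    (hb : dot n b = 0) :
    -2 * deriv p.S (n 2) * triple n a b = -p.weight (n 2) * (a 0 * b 1 - a 1 * b 0) := by
  rw [cross_eq_triple hn ha hb, Cutoff.weight]
  by_cases h : n 2 = 0
  · rw [h, p.deriv_S_eq_zero p.pos]; simp
  · field_simp

/-- The second Chern form of the localised connection. -/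
theorem secondChern_frameForm (Ω : HalfSpin) (p : Cutoff) (hf : ContDiffAt ℝ ∞ f y)
    (hs : ContDiffAt ℝ ∞ s y) (hn : ContDiffAt ℝ ∞ n y) (hm : ContDiffAt ℝ ∞ m y)
    (h : ∀ᶠ z in 𝓝 y, FrameRel (f z) (s z) (n z) (m z)) (v : Fin 4 → E) :
    secondChern (fun k l => curv (fun z => Ω.toL.comp (frameForm (f z) (s z) (fderiv ℝ f z)
        (fderiv ℝ s z) (n z) (m z) (p.form (n z) (fderiv ℝ n z)) (p.form (m z) (fderiv ℝ m z))))
        y (v k) (v l)) =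
      ((-(1 / (8 * Real.pi ^ 2)) * Ω.sign * wedge22 (fun a b : ℝ => a * b)
        (transposeL (f y) * crossL (n y) * f y) (transposeL (s y) * crossL (m y) * s y) *
        (p.weight (n y 2) * p.weight (m y 2) * wedge22 (fun a b : ℝ => a * b)
          (fun k l => areaForm (fderiv ℝ n y) (v k) (v l))
          (fun k l => areaForm (fderiv ℝ m y) (v k) (v l))) : ℝ) : ℂ) := by
  have h0 := h.self_of_nhds
  have hr : ∀ {g : E → Mat 4 ℝ}, ContDiffAt ℝ ∞ g y → ContDiffAt ℝ 1 (fderiv ℝ g) y := fun hg =>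
    (hg.of_le (m := 2) ENat.LEInfty.out).fderiv_right (by norm_num)
  have hr' : ∀ {g : E → Space}, ContDiffAt ℝ ∞ g y → ContDiffAt ℝ 1 (fderiv ℝ g) y := fun hg =>
    (hg.of_le (m := 2) ENat.LEInfty.out).fderiv_right (by norm_num)
  have hβ := p.contDiffAt_form (k := 1) ENat.LEInfty.out (hn.of_le ENat.LEInfty.out) (hr' hn)
  have hγ := p.contDiffAt_form (k := 1) ENat.LEInfty.out (hm.of_le ENat.LEInfty.out) (hr' hm)
  have hd := (contDiffAt_frameForm (k := 1) (hf.of_le ENat.LEInfty.out) (hs.of_le ENat.LEInfty.out)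
    (hn.of_le ENat.LEInfty.out) (hm.of_le ENat.LEInfty.out) (hr hf) (hr hs) hβ hγ).differentiableAt
    one_ne_zero
  have hf2 := hf.of_le (m := 2) ENat.LEInfty.out
  have hs2 := hs.of_le (m := 2) ENat.LEInfty.out
  have hn2 := hn.of_le (m := 2) ENat.LEInfty.out
  have hm2 := hm.of_le (m := 2) ENat.LEInfty.out
  -- Skewness follows by differentiating the orthonormality of the frame. It is what lets the half
  -- spin map respect the bracket in the curvature.
  have hskew : ∀ v, transposeL (frameForm (f y) (s y) (fderiv ℝ f y) (fderiv ℝ s y) (n y) (m y)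
      (p.form (n y) (fderiv ℝ n y)) (p.form (m y) (fderiv ℝ m y)) v) =
      -frameForm (f y) (s y) (fderiv ℝ f y) (fderiv ℝ s y) (n y) (m y)
      (p.form (n y) (fderiv ℝ n y)) (p.form (m y) (fderiv ℝ m y)) v := by
    intro v
    have h1 := (fderiv_frameRel hf2 hs2 hn2 hm2 h v).1
    rw [frameForm_apply]
    simp only [map_add, map_smul, h0.transpose_block, h0.symm.transpose_block, transposeL_mul,
      transposeL_transposeL]
    linear_combination (norm := module) h1
  have hd0 := fun v => dot_fderiv_eq_zero (hn2.differentiableAt two_ne_zero)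
    (h.mono fun z hz => hz.dot_left) v
  have hd1 := fun v => dot_fderiv_eq_zero (hm2.differentiableAt two_ne_zero)
    (h.mono fun z hz => hz.dot_right) v
  have hcurv : ∀ k l, curv (fun z => Ω.toL.comp (frameForm (f z) (s z) (fderiv ℝ f z)
        (fderiv ℝ s z) (n z) (m z) (p.form (n z) (fderiv ℝ n z)) (p.form (m z) (fderiv ℝ m z))))
        y (v k) (v l) = Ω.toL ((-p.weight (n y 2) * areaForm (fderiv ℝ n y) (v k) (v l)) •
          (transposeL (f y) * crossL (n y) * f y) + (-p.weight (m y 2) *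
            areaForm (fderiv ℝ m y) (v k) (v l)) • (transposeL (s y) * crossL (m y) * s y)) := by
    intro k l
    rw [curv_clm_comp Ω.toL hd _ _ (Ω.lie _ _ (hskew _) (hskew _)),
      curv_frameForm hf2 hs2 hn2 hm2 h (hβ.differentiableAt one_ne_zero)
        (hγ.differentiableAt one_ne_zero), p.extD_form hn2 (h.mono fun z hz => hz.dot_left),
      p.extD_form hm2 (h.mono fun z hz => hz.dot_right),
      p.triple_eq h0.dot_left (hd0 _) (hd0 _), p.triple_eq h0.dot_right (hd1 _) (hd1 _)]
    rfl
  simp only [hcurv]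
  rw [secondChern_blocks Ω h0 (wedge22_areaForm_self _ _ v) (wedge22_areaForm_self _ _ v)]
  congr 1
  simp only [wedge22]
  ring

end Local

end ChernWeil

namespace ChernWeil
open LevelSurface
open scoped Matrix

/-! ### Orthonormal frames from immersions -/

/-- The padded matrix with columns `u k`. -/
def colMat (u : Fin 4 → Space) : Mat 4 ℝ :=
  Mat.of fun r k => ![u k 0, u k 1, u k 2, 0] r

theorem colMat_block (u : Fin 4 → Space) (n : Space) (k l : Fin 4) :
    (transposeL (colMat u) * crossL n * colMat u) k l = -triple n (u k) (u l) := by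
  change (transposeL (colMat u) * crossMat n * colMat u) k l = _
  simp only [Mat.mul_apply, transposeL_apply, Fin.sum_univ_four]
  simp [colMat, crossMat, triple]
  ring

theorem colMat_mul (u : Fin 4 → Space) (P : Mat 4 ℝ) :
    colMat u * P = colMat fun k => ∑ l, P l k • u l := by
  ext r k
  simp only [Mat.mul_apply, Fin.sum_univ_four]
  fin_cases r <;> simp [colMat] <;> ring

/-- A square matrix with orthonormal columns has orthonormal rows, written out in blocks. -/
theorem fromBlocks_orthogonal {f s A B : Matrix (Fin 4) (Fin 4) ℝ} (h1 : fᵀ * f + sᵀ * s = 1)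
    (h2 : fᵀ * A + sᵀ * B = 0) (h3 : Aᵀ * A + Bᵀ * B = 1) :
    f * fᵀ + A * Aᵀ = 1 ∧ f * sᵀ + A * Bᵀ = 0 ∧ s * sᵀ + B * Bᵀ = 1 := by
  have h4 : Aᵀ * f + Bᵀ * s = 0 := by
    have := congrArg Matrix.transpose h2
    simpa using this
  have hW : (Matrix.fromBlocks f A s B)ᵀ * Matrix.fromBlocks f A s B = 1 := by
    rw [Matrix.fromBlocks_transpose, Matrix.fromBlocks_multiply, h1, h2, h3, h4,
      Matrix.fromBlocks_one]
  have hW' := mul_eq_one_comm.1 hW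
  rw [Matrix.fromBlocks_transpose, Matrix.fromBlocks_multiply, ← Matrix.fromBlocks_one] at hW'
  obtain ⟨e1, e2, _, e4⟩ := Matrix.fromBlocks_inj.1 hW'
  exact ⟨e1, e2, e4⟩

theorem frameRel_colMat {u w : Fin 4 → Space} {n m : Space} (hn : dot n n = 1) (hm : dot m m = 1)
    (hu : ∀ k, dot n (u k) = 0) (hw : ∀ k, dot m (w k) = 0)
    (h : transposeL (colMat u) * colMat u + transposeL (colMat w) * colMat w = 1) :
    FrameRel (colMat u) (colMat w) n m := by
  -- Both copies of `ℝ³` are padded to `ℝ⁴`. The columns `(n, 0)`, `(e₄, 0)`, `(0, m)`, `(0, e₄)`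
  -- complete the frame to an orthogonal `8 × 8` matrix, and orthonormality of its rows gives the
  -- relations for `f fᵀ`, `f sᵀ` and `s sᵀ`.
  let A : Matrix (Fin 4) (Fin 4) ℝ :=
    !![n 0, 0, 0, 0; n 1, 0, 0, 0; n 2, 0, 0, 0; 0, 1, 0, 0]
  let B : Matrix (Fin 4) (Fin 4) ℝ :=
    !![0, 0, m 0, 0; 0, 0, m 1, 0; 0, 0, m 2, 0; 0, 0, 0, 1]
  simp only [dot] at hn hm hu hw
  obtain ⟨e1, e2, e3⟩ := fromBlocks_orthogonal (f := (colMat u : Matrix (Fin 4) (Fin 4) ℝ))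
    (s := (colMat w : Matrix (Fin 4) (Fin 4) ℝ)) (A := A) (B := B) h (by
      ext k l
      have h1 := hu k
      have h2 := hw k
      have hT : ∀ (u : Fin 4 → Space) (C : Matrix (Fin 4) (Fin 4) ℝ),
          ((colMat u : Matrix (Fin 4) (Fin 4) ℝ)ᵀ * C) k l =
            u k 0 * C 0 l + u k 1 * C 1 l + u k 2 * C 2 l + 0 * C 3 l := fun u C =>
        (Matrix.mul_apply).trans (Fin.sum_univ_four _)
      rw [Matrix.add_apply, hT, hT]
      fin_cases l <;> simp [A, B] <;> linarith) (by
      ext k l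
      simp only [Matrix.add_apply, Matrix.mul_apply, Fin.sum_univ_four, Matrix.transpose_apply]
      fin_cases k <;> fin_cases l <;> simp [A, B] <;> linarith)
  have hAA : A * Aᵀ = 1 + Matrix.of (crossL n * crossL n : Mat 4 ℝ) := by
    ext k l
    change _ = (1 : Matrix (Fin 4) (Fin 4) ℝ) k l + (crossMat n * crossMat n) k l
    simp only [Matrix.mul_apply, Mat.mul_apply, Fin.sum_univ_four, Matrix.transpose_apply]
    fin_cases k <;> fin_cases l <;> simp [A, crossMat, Matrix.one_apply] <;> nlinarith
  have hBB : B * Bᵀ = 1 + Matrix.of (crossL m * crossL m : Mat 4 ℝ) := by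
    ext k l
    change _ = (1 : Matrix (Fin 4) (Fin 4) ℝ) k l + (crossMat m * crossMat m) k l
    simp only [Matrix.mul_apply, Mat.mul_apply, Fin.sum_univ_four, Matrix.transpose_apply]
    fin_cases k <;> fin_cases l <;> simp [B, crossMat, Matrix.one_apply] <;> nlinarith
  have hAB : A * Bᵀ = 0 := by
    ext k l
    simp only [Matrix.mul_apply, Fin.sum_univ_four, Matrix.transpose_apply]
    fin_cases k <;> fin_cases l <;> simp [A, B]
  rw [hAA] at e1
  rw [hAB, add_zero] at e2
  rw [hBB] at e3
  refine ⟨h, ?_, ?_, e2, hn, hm⟩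
  · refine eq_neg_of_add_eq_zero_left ?_
    have e1' : colMat u * transposeL (colMat u) + (1 + crossL n * crossL n) = (1 : Mat 4 ℝ) := e1
    rw [← sub_eq_zero] at e1'
    rw [← e1']
    abel
  · refine eq_neg_of_add_eq_zero_left ?_
    have e3' : colMat w * transposeL (colMat w) + (1 + crossL m * crossL m) = (1 : Mat 4 ℝ) := e3
    rw [← sub_eq_zero] at e3'
    rw [← e3']
    abel

/-- The Gram matrix of a pair of families of vectors. -/
def gram (a b : Mat 4 ℝ) : Mat 4 ℝ := transposeL a * a + transposeL b * b

theorem transposeL_gram (a b : Mat 4 ℝ) : transposeL (gram a b) = gram a b := by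
  simp only [gram, map_add, transposeL_mul, transposeL_transposeL]

theorem posDef_gram {u w : Fin 4 → Space}
    (h : ∀ c : Fin 4 → ℝ, ∑ k, c k • u k = 0 → ∑ k, c k • w k = 0 → c = 0) :
    Matrix.PosDef (gram (colMat u) (colMat w)) := by
  refine Matrix.PosDef.of_dotProduct_mulVec_pos (transposeL_gram _ _) fun c hc => ?_
  have h1 : star c ⬝ᵥ ((gram (colMat u) (colMat w) : Matrix (Fin 4) (Fin 4) ℝ) *ᵥ c) =
      ∑ r : Fin 3, (∑ k, c k • u k) r ^ 2 + ∑ r : Fin 3, (∑ k, c k • w k) r ^ 2 := by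
    simp only [dotProduct, Matrix.mulVec]
    change ∑ k, c k * ∑ l, gram (colMat u) (colMat w) k l * c l = _
    simp only [gram, Mat.add_apply, Mat.mul_apply, Fin.sum_univ_four, transposeL_apply,
      Fin.sum_univ_three]
    simp [colMat]
    ring
  rw [h1]
  have hz : ∀ x : Space, ∑ r : Fin 3, x r ^ 2 = 0 → x = 0 := by
    intro x hx
    ext r
    have := (Finset.sum_eq_zero_iff_of_nonneg (fun r _ => sq_nonneg (x r))).1 hx r (Finset.mem_univ r)
    simpa using this
  have hp : ∀ x : Space, 0 ≤ ∑ r : Fin 3, x r ^ 2 := fun x =>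
    Finset.sum_nonneg fun r _ => sq_nonneg (x r)
  by_contra hcon
  have e1 := hp (∑ k, c k • u k)
  have e2 := hp (∑ k, c k • w k)
  exact hc (h c (hz _ (by linarith)) (hz _ (by linarith)))

/-- The inverse square root of the Gram matrix turns any frame into an orthonormal one for the
induced metric, so no relation between the given metric and the embedding in `ℝ³ ⊕ ℝ³` is needed. -/
theorem frameRel_normalize {u w : Fin 4 → Space} {n m : Space} (hn : dot n n = 1)
    (hm : dot m m = 1) (hu : ∀ k, dot n (u k) = 0) (hw : ∀ k, dot m (w k) = 0)
    (hG : Matrix.PosDef (gram (colMat u) (colMat w))) :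
    FrameRel (colMat u * invSqrt (gram (colMat u) (colMat w)))
      (colMat w * invSqrt (gram (colMat u) (colMat w))) n m := by
  have hP : transposeL (invSqrt (gram (colMat u) (colMat w))) =
    invSqrt (gram (colMat u) (colMat w)) := hG.transpose_invSqrt
  have h1 : invSqrt (gram (colMat u) (colMat w)) * gram (colMat u) (colMat w) *
    invSqrt (gram (colMat u) (colMat w)) = 1 := hG.invSqrt_mul_mul
  generalize invSqrt (gram (colMat u) (colMat w)) = P at *
  have hd : ∀ (n : Space) (u : Fin 4 → Space), (∀ k, dot n (u k) = 0) →
      ∀ k, dot n (∑ l, P l k • u l) = 0 := by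
    intro n u hu k
    have h0 := hu 0
    have h1 := hu 1
    have h2 := hu 2
    have h3 := hu 3
    simp only [dot] at *
    simp only [Fin.sum_univ_four, PiLp.add_apply, PiLp.smul_apply, smul_eq_mul]
    linear_combination P 0 k * h0 + P 1 k * h1 + P 2 k * h2 + P 3 k * h3
  have h2 := h1
  unfold gram at h2
  rw [colMat_mul, colMat_mul]
  refine frameRel_colMat hn hm (hd n u hu) (hd m w hw) ?_
  rw [← colMat_mul, ← colMat_mul, transposeL_mul, transposeL_mul, hP, ← h2]
  noncomm_ring

theorem rotation_mul_transpose (s : Spin4) : rotation s * transposeL (rotation s) = 1 :=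
  SpinAlgebra.spinCover_mul_transpose s

theorem transpose_mul_rotation (s : Spin4) : transposeL (rotation s) * rotation s = 1 :=
  SpinAlgebra.transpose_mul_spinCover s

/-- The normalised frame transforms by the rotation. -/
theorem normalize_rotation {a b : Mat 4 ℝ} (s : Spin4) (hG : Matrix.PosDef (gram a b)) :
    a * rotation s * invSqrt (gram (a * rotation s) (b * rotation s)) =
      a * invSqrt (gram a b) * rotation s := by
  have h1 : gram (a * rotation s) (b * rotation s) =
      transposeL (rotation s) * gram a b * rotation s := by
    unfold gram
    rw [transposeL_mul, transposeL_mul]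
    noncomm_ring
  have h2 : invSqrt (transposeL (rotation s) * gram a b * rotation s) =
      transposeL (rotation s) * invSqrt (gram a b) * rotation s :=
    hG.invSqrt_conj (transpose_mul_rotation s)
  rw [h1, h2]
  calc _ = a * (rotation s * transposeL (rotation s)) * invSqrt (gram a b) * rotation s := by
        noncomm_ring
    _ = _ := by rw [rotation_mul_transpose]; noncomm_ring

/-! ### Derivatives of functions on manifolds -/

variable {E H : Type*} [NormedAddCommGroup E] [NormedSpace ℝ E] [TopologicalSpace H]
  {I : ModelWithCorners ℝ E H} {X : Type*} [TopologicalSpace X] [ChartedSpace H X]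

/-- The differential of a vector-valued function. -/
def tdiff {F : Type*} [NormedAddCommGroup F] [NormedSpace ℝ F] (I : ModelWithCorners ℝ E H)
    {X : Type*} [TopologicalSpace X] [ChartedSpace H X] (g : X → F) (x : X) : E →L[ℝ] F :=
  mfderiv I 𝓘(ℝ, F) g x

variable [I.Boundaryless] [IsManifold I ∞ X]

section Tdiff

variable {F : Type*} [NormedAddCommGroup F] [NormedSpace ℝ F] {g : X → F}

theorem contDiffAt_comp_symm {c : X} {y : E} (hy : y ∈ (extChartAt I c).target)
    (hg : ContMDiffAt I 𝓘(ℝ, F) ∞ g ((extChartAt I c).symm y)) :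
    ContDiffAt ℝ ∞ (fun z => g ((extChartAt I c).symm z)) y := by
  have h := (contMDiffAt_iff_source_of_mem_source (chart_symm_mem_source hy)).1 hg
  rw [I.range_eq_univ, (extChartAt I c).right_inv hy, contMDiffWithinAt_univ] at h
  exact h.contDiffAt

theorem contMDiffAt_of_comp_symm {x : X}
    (hg : ContDiffAt ℝ ∞ (fun z => g ((extChartAt I x).symm z)) (extChartAt I x x)) :
    ContMDiffAt I 𝓘(ℝ, F) ∞ g x := by
  rw [contMDiffAt_iff_source, I.range_eq_univ, contMDiffWithinAt_univ]
  exact hg.contMDiffAt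

theorem fderiv_comp_symm_self {x : X} (hg : MDifferentiableAt I 𝓘(ℝ, F) g x) :
    fderiv ℝ (fun z => g ((extChartAt I x).symm z)) (extChartAt I x x) = tdiff I g x := by
  have : mfderiv I 𝓘(ℝ, F) g x = fderivWithin ℝ (writtenInExtChartAt I 𝓘(ℝ, F) x g) (range I)
      (extChartAt I x x) := by
    unfold mfderiv
    exact if_pos hg
  refine Eq.trans ?_ this.symm
  rw [I.range_eq_univ, fderivWithin_univ]
  rfl

theorem tdiff_comp_symm {c : X} {y : E} (hy : y ∈ (extChartAt I c).target)
    (hg : MDifferentiableAt I 𝓘(ℝ, F) g ((extChartAt I c).symm y)) :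
    (tdiff I g ((extChartAt I c).symm y)).comp
        (mfderiv 𝓘(ℝ, E) I (extChartAt I c).symm y : E →L[ℝ] E) =
      fderiv ℝ (fun z => g ((extChartAt I c).symm z)) y := by
  have h := mfderiv_comp y hg (mdiff_chart_symm hy)
  rw [mfderiv_eq_fderiv] at h
  exact h.symm

end Tdiff

end ChernWeil

namespace ChernWeil
open LevelSurface
open scoped Matrix

/-! ### The Maurer-Cartan form of the spin covering -/

/-- The conjugate transpose. -/
def conjTransposeL : Mat 2 ℂ →L[ℝ] Mat 2 ℂ :=
  LinearMap.toContinuousLinearMap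
    { toFun := fun X => Matrix.conjTranspose X
      map_add' := fun X Y => Matrix.conjTranspose_add X Y
      map_smul' := fun c X => (Matrix.conjTranspose_smul c X).trans (by rw [star_trivial]; rfl) }

/-- The matrix of an element of `SU(2)`. -/
def suMat (A : SU2) : Mat 2 ℂ := A.1

/-- The first factor of an element of `Spin(4)`. -/
def fstMat (s : Spin4) : Mat 2 ℂ := suMat s.1

/-- The second factor of an element of `Spin(4)`. -/
def sndMat (s : Spin4) : Mat 2 ℂ := suMat s.2

/-- The unit quaternions. -/
def quat (l : Fin 4) : Mat 2 ℂ := quaternionUnit l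

/-- The quaternion with coordinates a row of a matrix. -/
def rowL (l : Fin 4) : Mat 4 ℝ →L[ℝ] Mat 2 ℂ := ∑ k, (entryL l k).smulRight (quat k)

theorem rowL_apply (l : Fin 4) (X : Mat 4 ℝ) : rowL l X = ∑ k, X l k • quat k := by
  simp [rowL, sum_apply]

theorem rowL_rotation (l : Fin 4) (s : Spin4) :
    rowL l (rotation s) = conjTransposeL (fstMat s) * quat l * sndMat s :=
  (rowL_apply l _).trans (SpinAlgebra.sum_spinCover_smul s l)

theorem conjTransposeL_mul_self (A : SU2) :
    conjTransposeL (suMat A) * suMat A = 1 :=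
  SpinAlgebra.star_mul_self A

/-- The Cayley-Hamilton relation `A* = tr A - A` in `SU(2)`, multiplied by `X`. -/
theorem traceL_conjTransposeL_mul (A : SU2) (X : Mat 2 ℂ) :
    traceL (conjTransposeL (suMat A) * X) =
      traceL (suMat A) * traceL X -
        traceL (suMat A * X) := by
  obtain ⟨a, b, c, d, h⟩ := SpinAlgebra.SU2_eq A
  have h' : ∀ Y Z : Matrix (Fin 2) (Fin 2) ℂ, Y = (a : ℝ) • quaternionUnit 0 +
      b • quaternionUnit 1 + c • quaternionUnit 2 + d • quaternionUnit 3 →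
      (Yᴴ * Z).trace = Y.trace * Z.trace - (Y * Z).trace := by
    intro Y Z hY
    rw [hY]
    simp [quaternionUnit, Matrix.trace, Matrix.mul_apply, Fin.sum_univ_two]
    ring
  exact h' A.1 X h

variable {E : Type*} [NormedAddCommGroup E] [NormedSpace ℝ E]

section Curve

variable {s : E → Spin4} {y : E}

/-- The Maurer-Cartan form of `SU(2)` is traceless and skew-Hermitian. The second property is the
derivative of `a* a = 1`, and the first one follows from it with the derivative of `a* = tr a - a`.
-/
theorem traceL_conjTransposeL_mul_fderiv {a : E → Mat 2 ℂ} (ha : ∀ z, ∃ A : SU2, a z = suMat A)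
    (hd : DifferentiableAt ℝ a y) (v : E) :
    traceL (conjTransposeL (a y) * fderiv ℝ a y v) = 0 ∧
      conjTransposeL (fderiv ℝ a y v) * a y = -(conjTransposeL (a y) * fderiv ℝ a y v) := by
  have hc : DifferentiableAt ℝ (fun z => conjTransposeL (a z)) y :=
    conjTransposeL.differentiableAt.comp y hd
  have h1 : ∀ z X, traceL (conjTransposeL (a z) * X) = traceL (a z) * traceL X -
      traceL (a z * X) := by
    intro z X
    obtain ⟨A, hA⟩ := ha z
    rw [hA]
    exact traceL_conjTransposeL_mul A X
  have h2 : (fun z => conjTransposeL (a z) * a z) = fun _ => 1 := by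
    funext z
    obtain ⟨A, hA⟩ := ha z
    rw [hA]
    exact conjTransposeL_mul_self A
  have e2 : fderiv ℝ (fun z => conjTransposeL (a z) * a z) y v = fderiv ℝ (fun _ => (1 : Mat 2 ℂ)) y v :=
    congrArg (fun g : E → Mat 2 ℂ => fderiv ℝ g y v) h2
  rw [fderiv_mul_apply hc hd, fderiv_clm_apply_comp _ hd, fderiv_const_apply, zero_apply] at e2
  refine ⟨?_, eq_neg_of_add_eq_zero_left e2⟩
  have h3 := h1 y (fderiv ℝ a y v)
  have e3 : fderiv ℝ (fun z => traceL (conjTransposeL (a z) * a y)) y v =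
      fderiv ℝ (fun z => traceL (a z) * traceL (a y) - traceL (a z * a y)) y v :=
    congrArg (fun g : E → ℂ => fderiv ℝ g y v) (funext fun z => h1 z (a y))
  have ht : DifferentiableAt ℝ (fun z => traceL (a z)) y := (traceL : Mat 2 ℂ →L[ℝ] ℂ).differentiableAt.comp y hd
  have ht' : DifferentiableAt ℝ (fun z => traceL (a z * a y)) y :=
    (traceL : Mat 2 ℂ →L[ℝ] ℂ).differentiableAt.comp y (hd.mul_const _)
  rw [fderiv_clm_apply_comp _ (hc.mul_const _), fderiv_mul_apply hc (differentiableAt_const _),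
    fderiv_clm_apply_comp _ hd, fderiv_fun_sub (ht.mul_const _) ht', sub_apply,
    fderiv_mul_apply ht (differentiableAt_const _), fderiv_clm_apply_comp _ hd,
    fderiv_clm_apply_comp _ (hd.mul_const _), fderiv_mul_apply hd (differentiableAt_const _),
    fderiv_const_apply, fderiv_const_apply, zero_apply, zero_apply, mul_zero, mul_zero, mul_zero,
    add_zero, add_zero, add_zero] at e3
  have e4 := congrArg traceL e2
  rw [map_add, map_zero, e3] at e4
  have e5 := traceL_mul_comm (a y) (fderiv ℝ a y v)
  linear_combination (1 / 2) * e4 + (1 / 2) * h3 - (1 / 2) * e5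

/-- The half spin map inverts the derivative of the double covering on one factor. It turns the
inhomogeneous gauge term of the rotation into that of the spinor bundle. -/
theorem HalfSpin.toL_maurerCartan (Ω : HalfSpin)
    (h1 : DifferentiableAt ℝ (fun z => fstMat (s z)) y)
    (h2 : DifferentiableAt ℝ (fun z => sndMat (s z)) y)
    (hR : DifferentiableAt ℝ (fun z => rotation (s z)) y) (v : E) :
    Ω.toL (transposeL (rotation (s y)) * fderiv ℝ (fun z => rotation (s z)) y v) =
      Ω.pr (fstMat (s y)⁻¹, sndMat (s y)⁻¹) *
        fderiv ℝ (fun z => Ω.pr (fstMat (s z), sndMat (s z))) y v := by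
  have hc1 : DifferentiableAt ℝ (fun z => conjTransposeL (fstMat (s z))) y :=
    conjTransposeL.differentiableAt.comp y h1
  have hc2 : DifferentiableAt ℝ (fun z => conjTransposeL (sndMat (s z))) y :=
    conjTransposeL.differentiableAt.comp y h2
  rw [fderiv_clm_apply_comp Ω.pr (h1.prodMk h2), h1.fderiv_prodMk h2]
  refine Ω.maurerCartan (s y) _ (fderiv ℝ (fun z => fstMat (s z)) y v)
    (fderiv ℝ (fun z => sndMat (s z)) y v) ?_ ?_ ?_ ?_
  · intro l
    have e2 : fderiv ℝ (fun z => rowL l (rotation (s z))) y v =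
        fderiv ℝ (fun z => conjTransposeL (fstMat (s z)) * quat l * sndMat (s z)) y v :=
      congrArg (fun g : E → Mat 2 ℂ => fderiv ℝ g y v) (funext fun z => rowL_rotation l (s z))
    rw [fderiv_clm_apply_comp _ hR, fderiv_mul_apply (hc1.mul_const _) h2,
      fderiv_mul_apply hc1 (differentiableAt_const _), fderiv_clm_apply_comp _ h1,
      fderiv_const_apply, zero_apply, mul_zero, add_zero] at e2
    exact (rowL_apply l _).symm.trans e2
  · have e := (traceL_conjTransposeL_mul_fderiv (fun z => ⟨(s z).1, rfl⟩) h1 v).1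
    rw [traceL_mul_comm] at e
    exact e
  · have e := (traceL_conjTransposeL_mul_fderiv (fun z => ⟨(s z).2, rfl⟩) h2 v)
    have e' := congrArg traceL e.2
    rw [map_neg, e.1, neg_zero] at e'
    exact (traceL_mul_comm (sndMat (s y)) (conjTransposeL (fderiv ℝ (fun z => sndMat (s z)) y v))).trans e'
  · exact (traceL_conjTransposeL_mul_fderiv (fun z => ⟨(s z).2, rfl⟩) h2 v).2

end Curve
end ChernWeil

namespace ChernWeil
open LevelSurface
open scoped Matrix

/-! ### The connection of a spin bundle attached to a pair of immersions -/

variable {E H : Type*} [NormedAddCommGroup E] [NormedSpace ℝ E] [TopologicalSpace H]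
  {I : ModelWithCorners ℝ E H} {X : Type*} [TopologicalSpace X] [ChartedSpace H X]
  [I.Boundaryless] [IsManifold I ∞ X]

/-- Frames of the tangent bundle whose transition matrices lift to the transition matrices of a
bundle through a half spin representation. -/
structure SpinFrames (Ω : HalfSpin) (V : ComplexBundle I X 2) where
  e : V.ι → Fin 4 → ∀ x : X, TangentSpace I x
  smooth_e : ∀ i k, ContMDiffOn I I.tangent ∞ (fun x => (⟨x, e i k x⟩ : TangentBundle I X)) (V.U i)
  indep : ∀ i, ∀ x ∈ V.U i, ∀ c : Fin 4 → ℝ, ∑ k, c k • e i k x = 0 → c = 0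
  lift : V.ι → V.ι → X → Spin4
  smooth_fst : ∀ i j a b, ContMDiffOn I 𝓘(ℝ, ℂ) ∞ (fun x => (lift i j x).1.1 a b) (V.U i ∩ V.U j)
  smooth_snd : ∀ i j a b, ContMDiffOn I 𝓘(ℝ, ℂ) ∞ (fun x => (lift i j x).2.1 a b) (V.U i ∩ V.U j)
  lift_inv : ∀ i j, ∀ x ∈ V.U i ∩ V.U j, lift j i x = (lift i j x)⁻¹
  g_eq : ∀ i j x, V.g i j x = Ω.pr (fstMat (lift i j x), sndMat (lift i j x))
  cover_lift : ∀ i j, ∀ x ∈ V.U i ∩ V.U j, ∀ k, e j k x = ∑ l, rotation (lift i j x) l k • e i l x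

variable (I X) in
/-- A pair of maps to 3-space that is jointly an immersion, with unit normal fields. -/
structure NormalPair where
  ι₁ : X → Space
  ι₂ : X → Space
  n : X → Space
  m : X → Space
  smooth_ι₁ : ContMDiff I 𝓘(ℝ, Space) ∞ ι₁
  smooth_ι₂ : ContMDiff I 𝓘(ℝ, Space) ∞ ι₂
  smooth_n : ContMDiff I 𝓘(ℝ, Space) ∞ n
  smooth_m : ContMDiff I 𝓘(ℝ, Space) ∞ m
  dot_n : ∀ x, dot (n x) (n x) = 1
  dot_m : ∀ x, dot (m x) (m x) = 1
  normal_n : ∀ x v, dot (n x) (tdiff I ι₁ x v) = 0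
  normal_m : ∀ x v, dot (m x) (tdiff I ι₂ x v) = 0
  injective : ∀ x v, tdiff I ι₁ x v = 0 → tdiff I ι₂ x v = 0 → v = 0

theorem contMDiffAt_tdiff_apply {F : Type*} [NormedAddCommGroup F] [NormedSpace ℝ F] {g : X → F}
    (hg : ContMDiff I 𝓘(ℝ, F) ∞ g) {U : Set X} (hU : IsOpen U) {e : ∀ x : X, TangentSpace I x}
    (he : ContMDiffOn I I.tangent ∞ (fun x => (⟨x, e x⟩ : TangentBundle I X)) U) {x : X}
    (hx : x ∈ U) : ContMDiffAt I 𝓘(ℝ, F) ∞ (fun x => tdiff I g x (e x)) x := by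
  have h1 := hg.contMDiff_tangentMap (m := ∞) (by simp)
  have h2 := (contMDiff_snd_tangentBundle_modelSpace (n := ∞) F 𝓘(ℝ, F)).comp h1
  exact h2.contMDiffAt.comp x (he.contMDiffAt (hU.mem_nhds hx))

/-- The matrix with columns the images of a frame under the differential of a map. -/
def frameMat (I : ModelWithCorners ℝ E H) {X : Type*} [TopologicalSpace X] [ChartedSpace H X]
    (ι : X → Space) (e : Fin 4 → ∀ x : X, TangentSpace I x) (x : X) : Mat 4 ℝ :=
  colMat fun k => tdiff I ι x (e k x)

theorem frameMat_mul {ι : X → Space} {e e' : Fin 4 → ∀ x : X, TangentSpace I x} {x : X}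
    (P : Mat 4 ℝ) (h : ∀ k, e' k x = ∑ l, P l k • e l x) :
    frameMat I ι e' x = frameMat I ι e x * P := by
  unfold frameMat
  rw [colMat_mul]
  congr 1
  funext k
  rw [h k]
  exact (map_sum (tdiff I ι x) _ _).trans (Finset.sum_congr rfl fun l _ => map_smul (tdiff I ι x) _ _)

theorem contDiffAt_colMat {u : Fin 4 → E → Space} {y : E} (h : ∀ k, ContDiffAt ℝ ∞ (u k) y) :
    ContDiffAt ℝ ∞ (fun z => colMat fun k => u k z) y := by
  refine contDiffAt_matrix fun r k => ?_
  have h' : ∀ r, ContDiffAt ℝ ∞ (fun z => u k z r) y := contDiffAt_euclidean.1 (h k)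
  fin_cases r
  · exact h' 0
  · exact h' 1
  · exact h' 2
  · exact contDiffAt_const

theorem contDiffAt_frameMat {ι : X → Space} (hι : ContMDiff I 𝓘(ℝ, Space) ∞ ι) {U : Set X}
    (hU : IsOpen U) {e : Fin 4 → ∀ x : X, TangentSpace I x}
    (he : ∀ k, ContMDiffOn I I.tangent ∞ (fun x => (⟨x, e k x⟩ : TangentBundle I X)) U) {c : X}
    {y : E} (hy : y ∈ (extChartAt I c).target) (hyU : (extChartAt I c).symm y ∈ U) :
    ContDiffAt ℝ ∞ (fun z => frameMat I ι e ((extChartAt I c).symm z)) y :=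
  contDiffAt_colMat fun k => contDiffAt_comp_symm hy (contMDiffAt_tdiff_apply hι hU (he k) hyU)

namespace NormalPair

variable (N : NormalPair I X) {Ω : HalfSpin} {V : ComplexBundle I X 2} (T : SpinFrames Ω V)
  (p : Cutoff)

/-- The Gram matrix of a frame. -/
def gramMat (i : V.ι) (x : X) : Mat 4 ℝ :=
  gram (frameMat I N.ι₁ (T.e i) x) (frameMat I N.ι₂ (T.e i) x)

/-- The first block of the normalised frame. -/
def left (i : V.ι) (x : X) : Mat 4 ℝ := frameMat I N.ι₁ (T.e i) x * invSqrt (N.gramMat T i x)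

/-- The second block of the normalised frame. -/
def right (i : V.ι) (x : X) : Mat 4 ℝ := frameMat I N.ι₂ (T.e i) x * invSqrt (N.gramMat T i x)

theorem posDef_gramMat {i : V.ι} {x : X} (hx : x ∈ V.U i) : Matrix.PosDef (N.gramMat T i x) := by
  refine posDef_gram fun c h1 h2 => T.indep i x hx c (N.injective x _ ?_ ?_)
  · refine Eq.trans ?_ h1
    exact (map_sum (tdiff I N.ι₁ x) _ _).trans
      (Finset.sum_congr rfl fun l _ => map_smul (tdiff I N.ι₁ x) _ _)
  · refine Eq.trans ?_ h2
    exact (map_sum (tdiff I N.ι₂ x) _ _).trans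
      (Finset.sum_congr rfl fun l _ => map_smul (tdiff I N.ι₂ x) _ _)

theorem frameRel {i : V.ι} {x : X} (hx : x ∈ V.U i) :
    FrameRel (N.left T i x) (N.right T i x) (N.n x) (N.m x) :=
  frameRel_normalize (N.dot_n x) (N.dot_m x) (fun _ => N.normal_n x _) (fun _ => N.normal_m x _)
    (N.posDef_gramMat T hx)

section Smooth

variable {i : V.ι} {c : X} {y : E} (hy : y ∈ (extChartAt I c).target)
  (hi : (extChartAt I c).symm y ∈ V.U i)
include hy hi

theorem eventually_mem : ∀ᶠ z in 𝓝 y, z ∈ (extChartAt I c).target ∧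
    (extChartAt I c).symm z ∈ V.U i :=
  (isOpen_chart_preimage (V.isOpen i) c).mem_nhds ⟨hy, hi⟩

theorem contDiffAt_invSqrt_gramMat :
    ContDiffAt ℝ ∞ (fun z => invSqrt (N.gramMat T i ((extChartAt I c).symm z))) y := by
  have h1 := contDiffAt_frameMat N.smooth_ι₁ (V.isOpen i) (T.smooth_e i) hy hi
  have h2 := contDiffAt_frameMat N.smooth_ι₂ (V.isOpen i) (T.smooth_e i) hy hi
  refine contDiffAt_invSqrt ?_ ?_
  · exact ((ContDiffAt.continuousLinearMap_comp transposeL h1).mul h1).add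
      ((ContDiffAt.continuousLinearMap_comp transposeL h2).mul h2)
  · filter_upwards [eventually_mem hy hi] with z hz using N.posDef_gramMat T hz.2

theorem contDiffAt_left :
    ContDiffAt ℝ ∞ (fun z => N.left T i ((extChartAt I c).symm z)) y :=
  (contDiffAt_frameMat N.smooth_ι₁ (V.isOpen i) (T.smooth_e i) hy hi).mul
    (N.contDiffAt_invSqrt_gramMat T hy hi)

theorem contDiffAt_right :
    ContDiffAt ℝ ∞ (fun z => N.right T i ((extChartAt I c).symm z)) y :=
  (contDiffAt_frameMat N.smooth_ι₂ (V.isOpen i) (T.smooth_e i) hy hi).mul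
    (N.contDiffAt_invSqrt_gramMat T hy hi)

end Smooth

theorem mdiff_left {i : V.ι} {x : X} (hx : x ∈ V.U i) :
    MDifferentiableAt I 𝓘(ℝ, Mat 4 ℝ) (N.left T i) x :=
  (contMDiffAt_of_comp_symm (N.contDiffAt_left T (mem_target_chart x)
    (Set.mem_of_eq_of_mem (extChartAt_to_inv (I := I) x) hx))).mdifferentiableAt (by simp)

theorem mdiff_right {i : V.ι} {x : X} (hx : x ∈ V.U i) :
    MDifferentiableAt I 𝓘(ℝ, Mat 4 ℝ) (N.right T i) x :=
  (contMDiffAt_of_comp_symm (N.contDiffAt_right T (mem_target_chart x)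
    (Set.mem_of_eq_of_mem (extChartAt_to_inv (I := I) x) hx))).mdifferentiableAt (by simp)

/-- The localised connection form with respect to the frame `i`. -/
def matForm (i : V.ι) (x : X) : E →L[ℝ] Mat 2 ℂ :=
  Ω.toL.comp (frameForm (N.left T i x) (N.right T i x) (tdiff I (N.left T i) x)
    (tdiff I (N.right T i) x) (N.n x) (N.m x) (p.form (N.n x) (tdiff I N.n x))
    (p.form (N.m x) (tdiff I N.m x)))

/-- The entries of the localised connection form. -/
def entryForm (i : V.ι) (a b : Fin 2) (x : X) : TangentSpace I x →L[ℝ] ℂ :=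
  (entryL a b).comp (N.matForm T p i x)

/-- The localised connection form in a chart. -/
def chartMatForm (c : X) (i : V.ι) (z : E) : E →L[ℝ] Mat 2 ℂ :=
  Ω.toL.comp (frameForm (N.left T i ((extChartAt I c).symm z)) (N.right T i ((extChartAt I c).symm z))
    (fderiv ℝ (fun z => N.left T i ((extChartAt I c).symm z)) z)
    (fderiv ℝ (fun z => N.right T i ((extChartAt I c).symm z)) z)
    (N.n ((extChartAt I c).symm z)) (N.m ((extChartAt I c).symm z))
    (p.form (N.n ((extChartAt I c).symm z)) (fderiv ℝ (fun z => N.n ((extChartAt I c).symm z)) z))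
    (p.form (N.m ((extChartAt I c).symm z)) (fderiv ℝ (fun z => N.m ((extChartAt I c).symm z)) z)))

theorem matForm_comp {i : V.ι} {c : X} {z : E} (hz : z ∈ (extChartAt I c).target)
    (hi : (extChartAt I c).symm z ∈ V.U i) :
    (N.matForm T p i ((extChartAt I c).symm z)).comp
      (mfderiv 𝓘(ℝ, E) I (extChartAt I c).symm z : E →L[ℝ] E) = N.chartMatForm T p c i z := by
  unfold chartMatForm matForm
  rw [← tdiff_comp_symm hz (N.mdiff_left T hi), ← tdiff_comp_symm hz (N.mdiff_right T hi),
    ← tdiff_comp_symm hz ((N.smooth_n _).mdifferentiableAt (by simp)),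
    ← tdiff_comp_symm hz ((N.smooth_m _).mdifferentiableAt (by simp))]
  rfl

theorem matForm_self {i : V.ι} {x : X} (hi : x ∈ V.U i) :
    N.matForm T p i x = N.chartMatForm T p x i (extChartAt I x x) := by
  unfold chartMatForm matForm
  rw [fderiv_comp_symm_self (N.mdiff_left T hi), fderiv_comp_symm_self (N.mdiff_right T hi),
    fderiv_comp_symm_self ((N.smooth_n _).mdifferentiableAt (by simp)),
    fderiv_comp_symm_self ((N.smooth_m _).mdifferentiableAt (by simp)), extChartAt_to_inv]

theorem contDiffAt_chartMatForm {i : V.ι} {c : X} {y : E} (hy : y ∈ (extChartAt I c).target)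
    (hi : (extChartAt I c).symm y ∈ V.U i) : ContDiffAt ℝ ∞ (N.chartMatForm T p c i) y := by
  have hf := N.contDiffAt_left T hy hi
  have hs := N.contDiffAt_right T hy hi
  have hn := contDiffAt_comp_symm hy (N.smooth_n _)
  have hm := contDiffAt_comp_symm hy (N.smooth_m _)
  have hr : ∀ {g : E → Mat 4 ℝ}, ContDiffAt ℝ ∞ g y → ContDiffAt ℝ ∞ (fderiv ℝ g) y := fun hg =>
    hg.fderiv_right (by simp)
  have hr' : ∀ {g : E → Space}, ContDiffAt ℝ ∞ g y → ContDiffAt ℝ ∞ (fderiv ℝ g) y := fun hg =>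
    hg.fderiv_right (by simp)
  exact contDiffAt_const.clm_comp (contDiffAt_frameForm hf hs hn hm (hr hf) (hr hs)
    (p.contDiffAt_form le_rfl hn (hr' hn)) (p.contDiffAt_form le_rfl hm (hr' hm)))

theorem chartForm_entryForm {i : V.ι} {c : X} {z : E} (hz : z ∈ (extChartAt I c).target)
    (hi : (extChartAt I c).symm z ∈ V.U i) (a b : Fin 2) :
    chartForm I c (N.entryForm T p i a b) z = (entryL a b).comp (N.chartMatForm T p c i z) := by
  rw [← N.matForm_comp T p hz hi]
  rfl

theorem smoothForm_entryForm (i : V.ι) (a b : Fin 2) :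
    SmoothForm I (V.U i) (N.entryForm T p i a b) := by
  rintro c y ⟨hy, hi⟩
  refine ContDiffAt.contDiffWithinAt ?_
  refine ContDiffAt.congr_of_eventuallyEq (f := fun z => (entryL a b).comp (N.chartMatForm T p c i z))
    (contDiffAt_const.clm_comp (N.contDiffAt_chartMatForm T p hy hi)) ?_
  filter_upwards [eventually_mem hy hi] with z hz using N.chartForm_entryForm T p hz.1 hz.2 a b

end NormalPair
end ChernWeil

/-! ### Gauge covariance of the localised connection. -/

namespace ChernWeil
open LevelSurface
open scoped Matrix

variable {E H : Type*} [NormedAddCommGroup E] [NormedSpace ℝ E] [TopologicalSpace H]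
  {I : ModelWithCorners ℝ E H} {X : Type*} [TopologicalSpace X] [ChartedSpace H X]
  [I.Boundaryless] [IsManifold I ∞ X]

theorem gram_comm (a b : Mat 4 ℝ) : gram a b = gram b a := add_comm _ _

namespace NormalPair

variable (N : NormalPair I X) {Ω : HalfSpin} {V : ComplexBundle I X 2} (T : SpinFrames Ω V)
  (p : Cutoff)

section Gauge

variable {i j : V.ι} {x : X}

theorem left_gauge (hi : x ∈ V.U i) (hj : x ∈ V.U j) :
    N.left T j x = N.left T i x * rotation (T.lift i j x) := by
  unfold left gramMat
  rw [frameMat_mul _ (T.cover_lift i j x ⟨hi, hj⟩), frameMat_mul _ (T.cover_lift i j x ⟨hi, hj⟩)]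
  exact normalize_rotation _ (N.posDef_gramMat T hi)

theorem right_gauge (hi : x ∈ V.U i) (hj : x ∈ V.U j) :
    N.right T j x = N.right T i x * rotation (T.lift i j x) := by
  unfold right gramMat
  rw [frameMat_mul _ (T.cover_lift i j x ⟨hi, hj⟩), frameMat_mul _ (T.cover_lift i j x ⟨hi, hj⟩),
    gram_comm, gram_comm (frameMat I N.ι₁ (T.e i) x)]
  refine normalize_rotation _ ?_
  rw [gram_comm]
  exact N.posDef_gramMat T hi

/-- Recovers the rotation from the two normalised frames; its differentiability is then inherited
from theirs. -/
theorem rotation_eq (hi : x ∈ V.U i) (hj : x ∈ V.U j) :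
    rotation (T.lift i j x) = transposeL (N.left T i x) * N.left T j x +
      transposeL (N.right T i x) * N.right T j x := by
  rw [N.left_gauge T hi hj, N.right_gauge T hi hj, ← mul_assoc, ← mul_assoc, ← add_mul,
    (N.frameRel T hi).sum, one_mul]

end Gauge

section ChartGauge

variable {i j : V.ι} {c : X} {y : E} (hy : y ∈ (extChartAt I c).target)
  (hi : (extChartAt I c).symm y ∈ V.U i) (hj : (extChartAt I c).symm y ∈ V.U j)
include hy hi hj

theorem eventually_mem₂ : ∀ᶠ z in 𝓝 y, (extChartAt I c).symm z ∈ V.U i ∧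
    (extChartAt I c).symm z ∈ V.U j := by
  filter_upwards [eventually_mem hy hi, eventually_mem hy hj] with z h1 h2 using ⟨h1.2, h2.2⟩

include N in
theorem differentiableAt_rotation :
    DifferentiableAt ℝ (fun z => rotation (T.lift i j ((extChartAt I c).symm z))) y := by
  have h : ContDiffAt ℝ ∞ (fun z => transposeL (N.left T i ((extChartAt I c).symm z)) *
      N.left T j ((extChartAt I c).symm z) + transposeL (N.right T i ((extChartAt I c).symm z)) *
      N.right T j ((extChartAt I c).symm z)) y :=
    ((ContDiffAt.continuousLinearMap_comp transposeL (N.contDiffAt_left T hy hi)).mul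
      (N.contDiffAt_left T hy hj)).add
      ((ContDiffAt.continuousLinearMap_comp transposeL (N.contDiffAt_right T hy hi)).mul
      (N.contDiffAt_right T hy hj))
  refine (h.differentiableAt (by simp)).congr_of_eventuallyEq ?_
  filter_upwards [eventually_mem₂ hy hi hj] with z hz using N.rotation_eq T hz.1 hz.2

theorem differentiableAt_fstMat :
    DifferentiableAt ℝ (fun z => fstMat (T.lift i j ((extChartAt I c).symm z))) y := by
  refine ContDiffAt.differentiableAt (n := ∞) (contDiffAt_matrix fun a b => ?_) (by simp)
  exact contDiffAt_comp_symm hy ((T.smooth_fst i j a b).contMDiffAt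
    (((V.isOpen i).inter (V.isOpen j)).mem_nhds ⟨hi, hj⟩))

theorem differentiableAt_sndMat :
    DifferentiableAt ℝ (fun z => sndMat (T.lift i j ((extChartAt I c).symm z))) y := by
  refine ContDiffAt.differentiableAt (n := ∞) (contDiffAt_matrix fun a b => ?_) (by simp)
  exact contDiffAt_comp_symm hy ((T.smooth_snd i j a b).contMDiffAt
    (((V.isOpen i).inter (V.isOpen j)).mem_nhds ⟨hi, hj⟩))

/-- Under a rotation `R` the frame form becomes `Rᵀ θ R + Rᵀ dR`. The half spin map sends the first
term to a conjugation and the second one to the Maurer-Cartan term of the transition matrix. -/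
theorem chartMatForm_gauge (v : E) :
    N.chartMatForm T p c j y v =
      chartTransition V c j i y * N.chartMatForm T p c i y v * chartTransition V c i j y +
        chartTransition V c j i y * fderiv ℝ (chartTransition V c i j) y v := by
  have hR := N.differentiableAt_rotation T hy hi hj
  have hfi := (N.contDiffAt_left T hy hi).differentiableAt (by simp)
  have hsi := (N.contDiffAt_right T hy hi).differentiableAt (by simp)
  have hev := eventually_mem₂ hy hi hj
  have e1 : (fun z => N.left T j ((extChartAt I c).symm z)) =ᶠ[𝓝 y] fun z =>
      N.left T i ((extChartAt I c).symm z) * rotation (T.lift i j ((extChartAt I c).symm z)) := by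
    filter_upwards [hev] with z hz using N.left_gauge T hz.1 hz.2
  have e2 : (fun z => N.right T j ((extChartAt I c).symm z)) =ᶠ[𝓝 y] fun z =>
      N.right T i ((extChartAt I c).symm z) * rotation (T.lift i j ((extChartAt I c).symm z)) := by
    filter_upwards [hev] with z hz using N.right_gauge T hz.1 hz.2
  have hg1 : chartTransition V c i j = fun z => Ω.pr (fstMat (T.lift i j ((extChartAt I c).symm z)),
      sndMat (T.lift i j ((extChartAt I c).symm z))) := funext fun z => T.g_eq i j _
  have hg2 : chartTransition V c j i y = Ω.pr (fstMat (T.lift i j ((extChartAt I c).symm y))⁻¹,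
      sndMat (T.lift i j ((extChartAt I c).symm y))⁻¹) := by
    rw [← T.lift_inv i j _ ⟨hi, hj⟩]
    exact T.g_eq j i _
  have hmc := Ω.toL_maurerCartan (differentiableAt_fstMat T hy hi hj)
    (differentiableAt_sndMat T hy hi hj) hR v
  have hconj := Ω.conj (T.lift i j ((extChartAt I c).symm y))
    (frameForm (N.left T i ((extChartAt I c).symm y)) (N.right T i ((extChartAt I c).symm y))
    (fderiv ℝ (fun z => N.left T i ((extChartAt I c).symm z)) y)
    (fderiv ℝ (fun z => N.right T i ((extChartAt I c).symm z)) y)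
    (N.n ((extChartAt I c).symm y)) (N.m ((extChartAt I c).symm y))
    (p.form (N.n ((extChartAt I c).symm y)) (fderiv ℝ (fun z => N.n ((extChartAt I c).symm z)) y))
    (p.form (N.m ((extChartAt I c).symm y)) (fderiv ℝ (fun z => N.m ((extChartAt I c).symm z)) y)) v)
  have hsum := (N.frameRel T hi).sum
  rw [hg2, hg1, ← hmc]
  refine Eq.trans ?_ (congrArg (· + _) hconj)
  rw [← map_add]
  refine congrArg Ω.toL (Eq.trans (frameForm_apply ..) ?_)
  rw [frameForm_apply, e1.fderiv_eq, e2.fderiv_eq, fderiv_mul_apply hfi hR,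
    fderiv_mul_apply hsi hR, N.left_gauge T hi hj, N.right_gauge T hi hj]
  generalize rotation (T.lift i j ((extChartAt I c).symm y)) = R
  generalize fderiv ℝ (fun z => rotation (T.lift i j ((extChartAt I c).symm z))) y v = R'
  generalize N.left T i ((extChartAt I c).symm y) = f at *
  generalize N.right T i ((extChartAt I c).symm y) = s at *
  -- Inserting the orthonormality relation splits the Maurer-Cartan term into the two pieces coming
  -- from the product rule for `f R` and `s R`.
  have : transposeL R * R' = transposeL R * (transposeL f * f + transposeL s * s) * R' := by
    rw [hsum, mul_one]
  rw [this]
  simp only [transposeL_mul, mul_add, add_mul, mul_smul_comm, smul_mul_assoc, mul_assoc]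
  abel

end ChartGauge

/-- The localised connection. -/
def connection : V.Connection where
  form := N.entryForm T p
  smooth i a b := N.smoothForm_entryForm T p i a b
  gauge i j x hx v := by
    have hs := extChartAt_to_inv (I := I) x
    have h := N.chartMatForm_gauge T p (mem_target_chart x) (Set.mem_of_eq_of_mem hs hx.1)
      (Set.mem_of_eq_of_mem hs hx.2) v
    rw [← N.matForm_self T p hx.1, ← N.matForm_self T p hx.2] at h
    have h1 : ∀ i j, chartTransition V x i j (extChartAt I x x) = V.g i j x := fun i j =>
      congrArg (V.g i j) hs
    have h2 : fderiv ℝ (chartTransition V x i j) (extChartAt I x x) v =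
        (Matrix.of fun a b => mfderiv I 𝓘(ℝ, ℂ) (fun z => V.g i j z a b) x v :
          Matrix (Fin 2) (Fin 2) ℂ) := by
      ext a b
      exact fderiv_chartTransition_self V hx.1 hx.2 v a b
    rw [h1, h1, h2] at h
    exact h

theorem chartMatrix_connection {i : V.ι} {c : X} {z : E} (hz : z ∈ (extChartAt I c).target)
    (hi : (extChartAt I c).symm z ∈ V.U i) :
    chartMatrix I c ((N.connection T p).form i) z = N.chartMatForm T p c i z := by
  ext v a b
  rw [chartMatrix_apply, Mat.of_apply]
  exact congrArg (fun L : E →L[ℝ] ℂ => L v) (N.chartForm_entryForm T p hz hi a b)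

/-- The second Chern form of the localised connection at a point. -/
theorem chernField_connection {i : V.ι} {x : X} (hi : x ∈ V.U i) (v : Fin 4 → E) :
    chernField (N.connection T p) x v =
      ((-(1 / (8 * Real.pi ^ 2)) * Ω.sign * wedge22 (fun a b : ℝ => a * b)
        (transposeL (N.left T i x) * crossL (N.n x) * N.left T i x)
        (transposeL (N.right T i x) * crossL (N.m x) * N.right T i x) *
        (p.weight (N.n x 2) * p.weight (N.m x 2) * wedge22 (fun a b : ℝ => a * b)
          (fun k l => areaForm (tdiff I N.n x) (v k) (v l))
          (fun k l => areaForm (tdiff I N.m x) (v k) (v l))) : ℝ) : ℂ) := by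
  have hx := extChartAt_to_inv (I := I) x
  have hy := mem_target_chart (I := I) x
  have hi' := Set.mem_of_eq_of_mem hx hi
  have h1 := secondChern_frameForm Ω p (N.contDiffAt_left T hy hi') (N.contDiffAt_right T hy hi')
    (contDiffAt_comp_symm hy (N.smooth_n _)) (contDiffAt_comp_symm hy (N.smooth_m _))
    (by filter_upwards [eventually_mem hy hi'] with z hz using N.frameRel T hz.2) v
  rw [fderiv_comp_symm_self ((N.smooth_n _).mdifferentiableAt (by simp)),
    fderiv_comp_symm_self ((N.smooth_m _).mdifferentiableAt (by simp)), hx] at h1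
  refine (chernForm_eq (N.connection T p) hy hi' v).trans (Eq.trans (congrArg secondChern ?_) h1)
  funext k l
  refine curv_congr ?_ _ _
  filter_upwards [eventually_mem hy hi'] with z hz using N.chartMatrix_connection T p hz.1 hz.2

end NormalPair
end ChernWeil

/-! ### The volume form, and the disappearance of the orientation. -/

namespace ChernWeil
open LevelSurface
open scoped Matrix

variable {E H : Type*} [NormedAddCommGroup E] [NormedSpace ℝ E] [TopologicalSpace H]
  {I : ModelWithCorners ℝ E H} {X : Type*} [TopologicalSpace X] [ChartedSpace H X]
  [I.Boundaryless] [IsManifold I ∞ X]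

/-- The triple product with two vectors in the image of a linear map. -/
def tripleₗ (n : Space) (L : E →L[ℝ] Space) : E →ₗ[ℝ] E →ₗ[ℝ] ℝ :=
  LinearMap.mk₂ ℝ (fun v w => triple n (L v) (L w))
    (fun a b c => by simp only [triple, map_add, PiLp.add_apply]; ring)
    (fun t a b => by simp only [triple, map_smul, PiLp.smul_apply, smul_eq_mul]; ring)
    (fun a b c => by simp only [triple, map_add, PiLp.add_apply]; ring)
    (fun t a b => by simp only [triple, map_smul, PiLp.smul_apply, smul_eq_mul]; ring)

theorem tripleₗ_self (n : Space) (L : E →L[ℝ] Space) (v : E) : tripleₗ n L v v = 0 := by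
  simp only [tripleₗ, LinearMap.mk₂_apply, triple]
  ring

namespace NormalPair

variable (N : NormalPair I X) {Ω : HalfSpin} {V : ComplexBundle I X 2} (T : SpinFrames Ω V)
  (p : Cutoff)

/-- The volume form of a pair of maps with normal fields: the exterior product of the two
pulled back area forms. -/
def vol (x : X) : E [⋀^Fin 4]→ₗ[ℝ] ℝ :=
  wedge22Alt (LinearMap.mul ℝ ℝ) (tripleₗ (N.n x) (tdiff I N.ι₁ x))
    (tripleₗ (N.m x) (tdiff I N.ι₂ x)) (tripleₗ_self _ _) (tripleₗ_self _ _)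

theorem vol_apply (x : X) (v : Fin 4 → E) :
    N.vol x v = wedge22 (fun a b : ℝ => a * b)
      (fun k l => triple (N.n x) (tdiff I N.ι₁ x (v k)) (tdiff I N.ι₁ x (v l)))
      (fun k l => triple (N.m x) (tdiff I N.ι₂ x (v k)) (tdiff I N.ι₂ x (v l))) := rfl

theorem block_eq {ι : X → Space} {e : Fin 4 → ∀ x : X, TangentSpace I x} {x : X} (n : Space)
    (P : Mat 4 ℝ) (k l : Fin 4) :
    (transposeL (frameMat I ι e x * P) * crossL n * (frameMat I ι e x * P)) k l =
      -triple n (tdiff I ι x (∑ r, P r k • (e r x : E))) (tdiff I ι x (∑ r, P r l • (e r x : E))) := by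
  unfold frameMat
  have hm : ∀ k, tdiff I ι x (∑ r, P r k • (e r x : E)) = ∑ r, P r k • tdiff I ι x (e r x) :=
    fun k => (map_sum _ _ _).trans (Finset.sum_congr rfl fun r _ => map_smul _ _ _)
  rw [colMat_mul, colMat_block, hm, hm]

/-- The value of the volume form on the normalised frame. -/
theorem wedge22_blocks (i : V.ι) (x : X) :
    wedge22 (fun a b : ℝ => a * b)
        (transposeL (N.left T i x) * crossL (N.n x) * N.left T i x)
        (transposeL (N.right T i x) * crossL (N.m x) * N.right T i x) =
      N.vol x fun k => ∑ r, invSqrt (N.gramMat T i x) r k • (T.e i r x : E) := by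
  rw [vol_apply]
  unfold left right
  simp only [wedge22, block_eq, neg_mul_neg]

/-- The chosen orientation enters twice: as the sign of `L` relative to the frame, and as the wedge
product `±1` of the two quarter turns in the frame. The product of both is the sign of `vol` on `L`.
-/
theorem chernDensity_connection (s : SignField I X) (b : Module.Basis (Fin 4) ℝ E) {i : V.ι} {x : X}
    (hi : x ∈ V.U i) (hs : ∀ L₀ : E →L[ℝ] E, (∀ k, L₀ (b k) = T.e i k x) → s.val x L₀ = 1)
    (L : E →L[ℝ] E) :
    chernDensity s (N.connection T p) b x L =
      ((-(1 / (8 * Real.pi ^ 2)) * Ω.sign * ((SignType.sign (N.vol x fun k => L (b k)) : SignType) : ℝ) *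
        (p.weight (N.n x 2) * p.weight (N.m x 2) * wedge22 (fun a b : ℝ => a * b)
          (fun k l => areaForm (tdiff I N.n x) (L (b k)) (L (b l)))
          (fun k l => areaForm (tdiff I N.m x) (L (b k)) (L (b l)))) : ℝ) : ℂ) := by
  have : FiniteDimensional ℝ E := b.finiteDimensional_of_finite
  -- The parametrisation given by the oriented frame; `A` expresses `L` in it.
  set L₀ : E →L[ℝ] E := LinearMap.toContinuousLinearMap (b.constr ℝ fun k => (T.e i k x : E)) with hL₀
  have hb : ∀ k, L₀ (b k) = T.e i k x := fun k => b.constr_basis ℝ _ k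
  have hinj : Function.Injective L₀ := by
    rw [injective_iff_map_eq_zero]
    intro v hv
    rw [← b.sum_repr v, map_sum] at hv
    simp only [map_smul, hb] at hv
    have := T.indep i x hi _ hv
    exact b.ext_elem fun k => by simpa using congrFun this k
  obtain ⟨e, he⟩ : ∃ e : E ≃L[ℝ] E, (e : E →L[ℝ] E) = L₀ :=
    ⟨(LinearEquiv.ofInjectiveEndo (L₀ : E →ₗ[ℝ] E) hinj).toContinuousLinearEquiv, by ext; rfl⟩
  set A : E →L[ℝ] E := (e.symm : E →L[ℝ] E).comp L
  have hA : L = L₀.comp A := by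
    ext v
    rw [← he]
    simp [A]
  have hval : s.val x L = ((SignType.sign A.det : SignType) : ℝ) := by
    have h1 := s.comp x L₀ A
    rw [hs L₀ hb, mul_one] at h1
    rw [hA]
    exact h1
  set w := wedge22 (fun a b : ℝ => a * b)
        (transposeL (N.left T i x) * crossL (N.n x) * N.left T i x)
        (transposeL (N.right T i x) * crossL (N.m x) * N.right T i x) with hw
  have hw2 : w ^ 2 = 1 := (N.frameRel T hi).wedge_sq
  set P := invSqrt (N.gramMat T i x) with hP
  have hPdet : 0 < Matrix.det P := (N.posDef_gramMat T hi).invSqrt.det_pos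
  have hdet : ∀ B : E →ₗ[ℝ] E, (N.vol x fun k => L₀ (B (b k))) =
      LinearMap.det B * N.vol x fun k => L₀ (b k) := by
    intro B
    exact alternating_comp_det b ((N.vol x).compLinearMap (L₀ : E →ₗ[ℝ] E)) B
  -- Normalising by the positive definite matrix `P` does not change the sign of the volume.
  have hw1 : w = Matrix.det P * N.vol x fun k => L₀ (b k) := by
    have key : ∀ Q : Matrix (Fin 4) (Fin 4) ℝ, (N.vol x fun k => ∑ r, Q r k • (T.e i r x : E)) =
        Q.det * N.vol x fun k => L₀ (b k) := by
      intro Q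
      have h1 := hdet (Matrix.toLin b b Q)
      rw [LinearMap.det_toLin] at h1
      refine Eq.trans (congrArg (N.vol x) (funext fun k => ?_)) h1
      rw [Matrix.toLin_self, map_sum]
      exact Finset.sum_congr rfl fun r _ => ((map_smul L₀ _ _).trans (congrArg _ (hb r))).symm
    rw [hw, N.wedge22_blocks T i x, ← hP]
    exact key P
  have hsign : ((SignType.sign A.det : SignType) : ℝ) * w =
      ((SignType.sign (N.vol x fun k => L (b k)) : SignType) : ℝ) := by
    have h1 : (N.vol x fun k => L (b k)) = A.det * N.vol x fun k => L₀ (b k) := by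
      rw [hA]
      exact hdet A
    rw [h1, sign_mul, SignType.coe_mul]
    congr 1
    have h2 : SignType.sign (N.vol x fun k => L₀ (b k)) = SignType.sign w := by
      rw [hw1, sign_mul, sign_pos hPdet, one_mul]
    rw [h2]
    have h3 : (w - 1) * (w + 1) = 0 := by linear_combination hw2
    rcases mul_eq_zero.1 h3 with h | h
    · rw [sub_eq_zero.1 h]; simp
    · rw [eq_neg_of_add_eq_zero_left h]; simp
  have h2 := N.chernField_connection T p hi (fun k => L (b k))
  refine (congrArg₂ (fun (a : ℝ) (b : ℂ) => (a : ℂ) * b) hval h2).trans ?_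
  rw [← hsign, ← hw]
  push_cast
  ring

end NormalPair
end ChernWeil

/-! ### Frames of a spin structure and their pullback to the cover. -/

namespace ChernWeil
open LevelSurface
open scoped Matrix

variable {E H : Type*} [NormedAddCommGroup E] [NormedSpace ℝ E] [TopologicalSpace H]
  {I : ModelWithCorners ℝ E H} {M : Type*} [TopologicalSpace M] [ChartedSpace H M]
  [I.Boundaryless] [IsManifold I ∞ M]

section Spin

variable {o : ManifoldOrientation I M}
  {h : Bundle.ContMDiffRiemannianMetric I ∞ E (fun x : M => TangentSpace I x)}
  (S : SpinStructure o h)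

theorem SpinStructure_indep (i : S.ι) {x : M} (hx : x ∈ S.U i) (c : Fin 4 → ℝ)
    (hc : ∑ k, c k • S.e i k x = 0) : c = 0 := by
  funext k
  have h1 := congrArg (fun v => h.inner x v (S.e i k x)) hc
  simp only [map_sum, map_smul, map_zero, sum_apply, smul_apply, zero_apply,
    S.orthonormal i x hx, smul_eq_mul, mul_ite, mul_one, mul_zero, Finset.sum_ite_eq',
    Finset.mem_univ, if_true] at h1
  exact h1

theorem SpinStructure_lift_inv (i j : S.ι) {x : M} (hx : x ∈ S.U i ∩ S.U j) :
    S.lift j i x = (S.lift i j x)⁻¹ := by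
  refine eq_inv_of_mul_eq_one_left ?_
  rw [S.lift_comp j i j x ⟨⟨hx.2, hx.1⟩, hx.2⟩, S.lift_self j x hx.2]

/-- The frames of a spin structure, for the positive spinor bundle. -/
def positiveFrames : SpinFrames HalfSpin.plus S.positiveSpinor where
  e := S.e
  smooth_e := S.smooth_e
  indep i x hx := SpinStructure_indep S i hx
  lift := S.lift
  smooth_fst := S.smooth_fst
  smooth_snd := S.smooth_snd
  lift_inv i j x hx := SpinStructure_lift_inv S i j hx
  g_eq _ _ _ := rfl
  cover_lift := S.cover_lift

/-- The frames of a spin structure, for the negative spinor bundle. -/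
def negativeFrames : SpinFrames HalfSpin.minus S.negativeSpinor where
  e := S.e
  smooth_e := S.smooth_e
  indep i x hx := SpinStructure_indep S i hx
  lift := S.lift
  smooth_fst := S.smooth_fst
  smooth_snd := S.smooth_snd
  lift_inv i j x hx := SpinStructure_lift_inv S i j hx
  g_eq _ _ _ := rfl
  cover_lift := S.cover_lift

theorem signField_eq_one (b : Module.Basis (Fin 4) ℝ E) {i : S.ι} {x : M} (hx : x ∈ S.U i)
    (L : E →L[ℝ] E) (hL : ∀ k, L (b k) = S.e i k x) : (signField o b).val x L = 1 := by
  have : (fun k => L (b k)) = fun k => S.e i k x := funext hL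
  exact (congrArg (o.sign x) this).trans (S.oriented i x hx)

end Spin

section Pull

variable {N : Type*} [TopologicalSpace N] [ChartedSpace H N] [IsManifold I ∞ N] [CompleteSpace E]
  {Ω : HalfSpin} {V : ComplexBundle I M 2} (T : SpinFrames Ω V) {f : N → M}
  (hf : ContMDiff I I ∞ f) (hinv : ∀ x, (mfderiv I I f x).IsInvertible)

/-- The pullback of frames along a local diffeomorphism. -/
def SpinFrames.pull : SpinFrames Ω (pullBundle V hf) where
  e i k := VectorField.mpullback I I f (T.e i k)
  smooth_e i k := by
    intro x hx
    have h1 := (T.smooth_e i k).contMDiffAt ((V.isOpen i).mem_nhds hx)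
    exact (ContMDiffAt.mpullback_vectorField_preimage (n := ∞) h1 (hf x) (hinv x)
      (by simp)).contMDiffWithinAt
  indep i x hx c hc := by
    refine T.indep i (f x) hx c ?_
    have h1 := congrArg (mfderiv I I f x) hc
    rw [map_sum, map_zero] at h1
    refine Eq.trans (Finset.sum_congr rfl fun k _ => ?_) h1
    rw [map_smul]
    congr 1
    exact ((hinv x).self_apply_inverse _).symm
  lift i j x := T.lift i j (f x)
  smooth_fst i j a b := (T.smooth_fst i j a b).comp hf.contMDiffOn fun _ h => h
  smooth_snd i j a b := (T.smooth_snd i j a b).comp hf.contMDiffOn fun _ h => h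
  lift_inv i j x hx := T.lift_inv i j (f x) hx
  g_eq i j x := T.g_eq i j (f x)
  cover_lift i j x hx k := by
    have h1 := congrArg (mfderiv I I f x).inverse (T.cover_lift i j (f x) hx k)
    rw [map_sum] at h1
    simp only [map_smul] at h1
    exact h1

theorem SpinFrames.mfderiv_pull (i : V.ι) (k : Fin 4) (x : N) :
    mfderiv I I f x ((T.pull hf hinv).e i k x) = T.e i k (f x) :=
  (hinv x).self_apply_inverse _

end Pull

end ChernWeil

/-! ### Densities supported in disjoint charts, and charts given by local diffeomorphisms. -/

namespace Density
open MeasureTheory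

variable {E H : Type*} [NormedAddCommGroup E] [NormedSpace ℝ E] [TopologicalSpace H]
  {I : ModelWithCorners ℝ E H} {M : Type*} [TopologicalSpace M] [ChartedSpace H M]
  [FiniteDimensional ℝ E] [MeasurableSpace E] [BorelSpace E] [T2Space M] [CompactSpace M]
  [I.Boundaryless] [IsManifold I ∞ M] (μ : Measure E) [μ.IsAddHaarMeasure]
  {ρ : SmoothPartitionOfUnity M I M univ} (hρ : ρ.IsSubordinate fun c => (chartAt H c).source)

include hρ in
/-- The integral of a density supported in a disjoint union of charts. -/
theorem integral_eq_sum_charts {w : Field I M} (hw : IsDensity w) {κ : Type*} (t : Finset κ)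
    {e : κ → PartialEquiv M E} (he : ∀ i ∈ t, IsSmoothChart I (e i))
    (hd : ∀ i ∈ t, ∀ j ∈ t, i ≠ j → Disjoint (e i).source (e j).source)
    (hs : ∀ x, (∀ i ∈ t, x ∉ (e i).source) → ∀ L, w x L = 0)
    (hi : ∀ i ∈ t, IntegrableOn (pull w (e i).symm) (e i).target μ) :
    integral μ ρ w = ∑ i ∈ t, ∫ y in (e i).target, pull w (e i).symm y ∂μ := by
  classical
  -- Since the sources are disjoint, cutting by their indicators decomposes the density, and each
  -- piece is integrated in its own chart.
  let u : κ → Field I M := fun i => mulField ((e i).source.indicator 1) w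
  have hu : w = fun x L => ∑ i ∈ t, u i x L := by
    funext x L
    by_cases hx : ∀ i ∈ t, x ∉ (e i).source
    · rw [hs x hx L]
      refine (Finset.sum_eq_zero fun i hi => ?_).symm
      simp [u, mulField, hx i hi]
    · push Not at hx
      obtain ⟨i, hit, hix⟩ := hx
      rw [Finset.sum_eq_single_of_mem i hit]
      · simp [u, mulField, hix]
      · intro j hj hji
        simp [u, mulField, Set.disjoint_left.1 (hd i hit j hj hji.symm) hix]
  have hp : ∀ i, ∀ y ∈ (e i).target, pull (u i) (e i).symm y = pull w (e i).symm y := by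
    intro i y hy
    simp [u, mulField, pull, (e i).map_target hy]
  have key : ∀ i ∈ t, Integrable μ ρ (u i) ∧
      integral μ ρ (u i) = ∫ y in (e i).target, pull (u i) (e i).symm y ∂μ := by
    intro i hit
    refine integral_eq_of_chart μ hρ (hw.mulField _) (he i hit) (fun x hx L => ?_) ?_
    · simp [u, mulField, hx]
    · exact (hi i hit).congr_fun (fun y hy => (hp i y hy).symm) (he i hit).open_target.measurableSet
  conv_lhs => rw [hu]
  rw [integral_sum μ ρ t u fun i hit => (key i hit).1]
  refine Finset.sum_congr rfl fun i hit => ?_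
  rw [(key i hit).2]
  exact setIntegral_congr_fun (he i hit).open_target.measurableSet fun y hy => hp i y hy

end Density

namespace ChernWeil

variable {E H : Type*} [NormedAddCommGroup E] [NormedSpace ℝ E] [TopologicalSpace H]
  {I : ModelWithCorners ℝ E H} {X : Type*} [TopologicalSpace X] [ChartedSpace H X]
  [I.Boundaryless] [IsManifold I ∞ X] [CompleteSpace E]

/-- A smooth map with invertible differential at a point is a chart near that point. -/
theorem exists_chart {Φ : X → E} (hΦ : ContMDiff I 𝓘(ℝ, E) ∞ Φ) {c : X} {A : E ≃L[ℝ] E}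
    (hA : (A : E →L[ℝ] E) = tdiff I Φ c) {U : Set X} (hU : IsOpen U) (hc : c ∈ U) :
    ∃ e : PartialEquiv X E, Density.IsSmoothChart I e ∧ c ∈ e.source ∧ e.source ⊆ U ∧
      ∀ x ∈ e.source, e x = Φ x := by
  set φ := extChartAt I c with hφ
  set F : E → E := fun z => Φ (φ.symm z) with hF
  have hFs : ∀ y ∈ φ.target, ContDiffAt ℝ ∞ F y := fun y hy => contDiffAt_comp_symm hy (hΦ _)
  have hFd : HasFDerivAt F (A : E →L[ℝ] E) (φ c) := by
    have h1 := ((hFs _ (mem_target_chart c)).differentiableAt (by simp)).hasFDerivAt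
    rwa [fderiv_comp_symm_self ((hΦ c).mdifferentiableAt (by simp)), ← hA] at h1
  let G := (hFs _ (mem_target_chart c)).toOpenPartialHomeomorph F hFd (by simp)
  have hG : (G : E → E) = F := (hFs _ (mem_target_chart c)).toOpenPartialHomeomorph_coe hFd (by simp)
  have hT : IsOpen φ.target := isOpen_extChartAt_target c
  have hW1 : IsOpen (φ.target ∩ φ.symm ⁻¹' U) := isOpen_chart_preimage hU c
  have hFc : ContinuousOn (fderiv ℝ F) φ.target := fun y hy =>
    ((hFs y hy).continuousAt_fderiv (by simp)).continuousWithinAt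
  have hW2 : IsOpen (φ.target ∩ fderiv ℝ F ⁻¹' range ((↑) : (E ≃L[ℝ] E) → E →L[ℝ] E)) :=
    hFc.isOpen_inter_preimage hT ContinuousLinearEquiv.isOpen
  -- Restricting to points with invertible derivative makes the inverse differentiable on the whole
  -- target, not only at the image of `c`.
  set W := (φ.target ∩ φ.symm ⁻¹' U) ∩
    (φ.target ∩ fderiv ℝ F ⁻¹' range ((↑) : (E ≃L[ℝ] E) → E →L[ℝ] E)) with hW
  have hWo : IsOpen W := hW1.inter hW2
  let G' := G.restrOpen W hWo
  have hG's : G'.source = G.source ∩ W := rfl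
  have hG'c : ∀ z, G' z = F z := fun z => congrFun hG z
  have hG'd : ∀ y ∈ G'.target, DifferentiableAt ℝ G'.symm y := by
    intro y hy
    have h1 : G'.symm y ∈ G.source ∩ W := G'.map_target hy
    obtain ⟨A', hA'⟩ := h1.2.2.2
    have h2 : HasFDerivAt G' (A' : E →L[ℝ] E) (G'.symm y) := by
      have : (G' : E → E) = F := funext hG'c
      rw [this, hA']
      exact ((hFs _ h1.2.1.1).differentiableAt (by simp)).hasFDerivAt
    exact (G'.hasFDerivAt_symm hy h2).differentiableAt
  refine ⟨φ.trans G'.toPartialEquiv, ⟨?_, ?_, ?_, ?_⟩, ?_, ?_, ?_⟩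
  · rw [PartialEquiv.trans_source]
    exact (continuousOn_extChartAt c).isOpen_inter_preimage (isOpen_extChartAt_source c) G'.open_source
  · rw [PartialEquiv.trans_target]
    exact G'.continuousOn_symm.isOpen_inter_preimage G'.open_target hT
  · rintro x ⟨hx1, hx2⟩
    have h1 : x ∈ (chartAt H c).source := by rwa [← extChartAt_source I]
    have h2 : φ x ∈ G.source ∩ W := hx2
    have h3 : MDifferentiableAt 𝓘(ℝ, E) 𝓘(ℝ, E) G' (φ x) := by
      have : (G' : E → E) = F := funext hG'c
      rw [this]
      exact ((hFs _ h2.2.1.1).differentiableAt (by simp)).mdifferentiableAt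
    exact (h3.comp x (mdiff_chart h1)).mdifferentiableWithinAt
  · rintro y ⟨hy1, hy2⟩
    have h1 : MDifferentiableAt 𝓘(ℝ, E) I φ.symm (G'.symm y) := mdiff_chart_symm hy2
    exact (h1.comp y (hG'd y hy1).mdifferentiableAt).mdifferentiableWithinAt
  · refine ⟨mem_extChartAt_source c, ?_⟩
    have h1 : φ.symm (φ c) ∈ U := Set.mem_of_eq_of_mem (extChartAt_to_inv c) hc
    exact ⟨(hFs _ (mem_target_chart c)).mem_toOpenPartialHomeomorph_source hFd (by simp),
      ⟨mem_target_chart c, h1⟩, mem_target_chart c, A, hFd.fderiv.symm⟩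
  · rintro x ⟨hx1, hx2⟩
    have h2 : φ x ∈ G.source ∩ W := hx2
    have h3 : φ.symm (φ x) ∈ U := h2.2.1.2
    rwa [φ.left_inv hx1] at h3
  · rintro x ⟨hx1, hx2⟩
    refine (hG'c (φ x)).trans ?_
    change Φ (φ.symm (φ x)) = Φ x
    rw [φ.left_inv hx1]

/-- The differential of a map that restricts to a chart, on the inverse of the chart. -/
theorem tdiff_comp_chart_symm {Φ : X → E} (hΦ : ContMDiff I 𝓘(ℝ, E) ∞ Φ) {e : PartialEquiv X E}
    (he : Density.IsSmoothChart I e) (heΦ : ∀ x ∈ e.source, e x = Φ x) {y : E} (hy : y ∈ e.target) :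
    (tdiff I Φ (e.symm y)).comp (mfderiv 𝓘(ℝ, E) I e.symm y : E →L[ℝ] E) =
      ContinuousLinearMap.id ℝ E := by
  have h1 : MDifferentiableAt 𝓘(ℝ, E) I e.symm y :=
    (he.mdiff_symm y hy).mdifferentiableAt (he.open_target.mem_nhds hy)
  have h2 := mfderiv_comp y ((hΦ (e.symm y)).mdifferentiableAt (by simp)) h1
  have h3 : Φ ∘ e.symm =ᶠ[𝓝 y] id := by
    filter_upwards [he.open_target.mem_nhds hy] with z hz
    rw [Function.comp_apply, ← heΦ _ (e.map_target hz), e.right_inv hz, id]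
  rw [h3.mfderiv_eq, mfderiv_id] at h2
  exact h2.symm

end ChernWeil

/-! ### The total mass of the concentrated area form. -/

namespace ChernWeil
open LevelSurface MeasureTheory

namespace Cutoff

variable (p : Cutoff)

theorem continuous_weight : Continuous p.weight := by
  rw [continuous_iff_continuousAt]
  intro t
  by_cases ht : t < p.t₀
  · refine (continuousAt_const (y := (0 : ℝ))).congr ?_
    filter_upwards [eventually_lt_nhds ht] with x hx using (p.weight_eq_zero hx).symm
  · have h1 : Continuous (deriv p.S) := p.smooth_S.continuous_deriv (by simp)
    exact (h1.continuousAt.const_mul 2).div continuousAt_id (by have := p.pos; simp; linarith)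

theorem S_one : p.S 1 = 1 := by
  have := p.eq 1
  linarith

/-- The density of the localised area form as a function of the distance from the origin. -/
def radial (r : ℝ) : ℝ := p.weight (√(1 - r ^ 2))

theorem continuous_radial : Continuous p.radial :=
  p.continuous_weight.comp (by fun_prop)

theorem radial_eq_zero {r : ℝ} (h : 1 - p.t₀ ^ 2 < r ^ 2) : p.radial r = 0 := by
  refine p.weight_eq_zero ?_
  rw [Real.sqrt_lt' p.pos]
  linarith

/-- The substitution `t = √(1 - r²)`, with `r dr = -t dt`, turns `r · 2 S'(t) / t dr` into `-2 dS`.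
For `r² ≥ 1` both sides vanish in a neighbourhood. -/
theorem hasDerivAt_primitive (r : ℝ) :
    HasDerivAt (fun r => -2 * p.S (√(1 - r ^ 2))) (r * p.radial r) r := by
  by_cases h : 0 < 1 - r ^ 2
  · have h1 : HasDerivAt (fun r : ℝ => √(1 - r ^ 2)) (-(2 * r) / (2 * √(1 - r ^ 2))) r := by
      have := ((hasDerivAt_pow 2 r).const_sub 1).sqrt h.ne'
      simpa using this
    have h2 := ((p.smooth_S.differentiable (by simp) (√(1 - r ^ 2))).hasDerivAt.comp r h1).const_mul (-2)
    have h3 : 0 < √(1 - r ^ 2) := Real.sqrt_pos.2 h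
    have h4 : r * p.radial r = -2 * (deriv p.S (√(1 - r ^ 2)) * (-(2 * r) / (2 * √(1 - r ^ 2)))) := by
      unfold radial weight
      field_simp
    rw [h4]
    exact h2
  · have h1 : 1 - p.t₀ ^ 2 < r ^ 2 := by nlinarith [p.pos]
    rw [p.radial_eq_zero h1, mul_zero]
    refine (hasDerivAt_const r (0 : ℝ)).congr_of_eventuallyEq ?_
    have h2 : ∀ᶠ x : ℝ in 𝓝 r, 1 - p.t₀ ^ 2 < x ^ 2 :=
      (continuous_pow 2).continuousAt.eventually (lt_mem_nhds h1)
    filter_upwards [h2] with x hx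
    rw [p.S_eq_zero, mul_zero]
    exact (Real.sqrt_le_left p.pos.le).2 (by linarith)

theorem integral_radial : ∫ r in Ioi (0 : ℝ), r * p.radial r = 2 := by
  have hz : ∀ r ∈ Ioi (1 : ℝ), r * p.radial r = 0 := by
    intro r hr
    have : (1 : ℝ) < r := hr
    rw [p.radial_eq_zero (by nlinarith [p.pos]), mul_zero]
  have h1 : ∫ r in Ioi (0 : ℝ), r * p.radial r = ∫ r in Ioc (0 : ℝ) 1, r * p.radial r := by
    refine (setIntegral_eq_of_subset_of_forall_sdiff_eq_zero measurableSet_Ioi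
      (fun x hx => hx.1) fun x hx => hz x ?_)
    by_contra h
    exact hx.2 ⟨hx.1, not_lt.1 h⟩
  rw [h1, ← intervalIntegral.integral_of_le zero_le_one,
    intervalIntegral.integral_eq_sub_of_hasDerivAt (fun x _ => p.hasDerivAt_primitive x)
      (continuous_id.mul p.continuous_radial).continuousOn.intervalIntegrable]
  have h0 : p.S 0 = 0 := p.S_eq_zero 0 p.pos.le
  simp [p.S_one, h0]

/-- Polar coordinates give `2 · π · 2`, the area of the unit sphere: the whole area has been moved
to the neighbourhood of the pole. -/
theorem integral_plane : ∫ u : Plane, p.radial ‖u‖ = 4 * Real.pi := by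
  rw [integral_fun_norm_addHaar volume p.radial]
  have h1 : (volume : Measure Plane).real (Metric.ball 0 1) = Real.pi := by
    simp [Measure.real, EuclideanSpace.volume_ball_fin_two, Real.pi_pos.le]
  rw [h1]
  have h2 : Module.finrank ℝ Plane = 2 := by simp
  rw [h2]
  simp only [show (2 - 1 : ℕ) = 1 from rfl, pow_one, smul_eq_mul]
  rw [p.integral_radial]
  simp
  ring

/-- The product of the two localised area densities. -/
def density (y : Plane × Plane) : ℝ := p.radial ‖y.1‖ * p.radial ‖y.2‖

theorem continuous_density : Continuous p.density :=
  (p.continuous_radial.comp continuous_fst.norm).mul (p.continuous_radial.comp continuous_snd.norm)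

/-- The product carries the maximum norm, so one of the two factors is evaluated at distance `‖y‖`.
-/
theorem density_eq_zero {y : Plane × Plane} (h : 1 - p.t₀ ^ 2 < ‖y‖ ^ 2) : p.density y = 0 := by
  unfold density
  rcases max_choice ‖y.1‖ ‖y.2‖ with h1 | h1
  · rw [Prod.norm_def, h1] at h
    rw [p.radial_eq_zero h, zero_mul]
  · rw [Prod.norm_def, h1] at h
    rw [p.radial_eq_zero h, mul_zero]

theorem addHaar_coverBasis : coverBasis.addHaar = (volume : Measure (Plane × Plane)) := by
  have h1 : coverBasis.addHaar = ((EuclideanSpace.basisFun (Fin 2) ℝ).toBasis.prod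
    (EuclideanSpace.basisFun (Fin 2) ℝ).toBasis).addHaar := Module.Basis.addHaar_reindex _ _
  rw [h1, Module.Basis.prod_addHaar, (EuclideanSpace.basisFun (Fin 2) ℝ).addHaar_eq_volume]
  rfl

theorem integral_density : ∫ y, p.density y ∂coverBasis.addHaar = (4 * Real.pi) ^ 2 := by
  rw [addHaar_coverBasis, Measure.volume_eq_prod]
  unfold density
  rw [integral_prod_mul (fun u : Plane => p.radial ‖u‖) (fun u : Plane => p.radial ‖u‖),
    p.integral_plane]
  ring

theorem integrable_density : Integrable p.density coverBasis.addHaar := by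
  refine p.continuous_density.integrable_of_hasCompactSupport ?_
  refine HasCompactSupport.of_support_subset_isCompact
    (isCompact_closedBall (0 : Plane × Plane) 1) fun y hy => ?_
  by_contra h
  rw [mem_closedBall_zero_iff, not_le] at h
  exact hy (p.density_eq_zero (by nlinarith [p.pos]))

end Cutoff
end ChernWeil

/-! ### The Jacobian of the Gauss maps compared with the volume form. -/

namespace ChernWeil
open LevelSurface MeasureTheory

variable {E H : Type*} [NormedAddCommGroup E] [NormedSpace ℝ E] [TopologicalSpace H]
  {I : ModelWithCorners ℝ E H} {X : Type*} [TopologicalSpace X] [ChartedSpace H X]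
  [I.Boundaryless] [IsManifold I ∞ X]

/-- The form `areaForm` as a bilinear map. -/
def areaₗ (L : E →L[ℝ] Space) : E →ₗ[ℝ] E →ₗ[ℝ] ℝ :=
  LinearMap.mk₂ ℝ (fun v w => areaForm L v w)
    (fun a b c => by simp only [areaForm, map_add, PiLp.add_apply]; ring)
    (fun t a b => by simp only [areaForm, map_smul, PiLp.smul_apply, smul_eq_mul]; ring)
    (fun a b c => by simp only [areaForm, map_add, PiLp.add_apply]; ring)
    (fun t a b => by simp only [areaForm, map_smul, PiLp.smul_apply, smul_eq_mul]; ring)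

theorem areaₗ_self (L : E →L[ℝ] Space) (v : E) : areaₗ L v v = 0 := by
  simp only [areaₗ, LinearMap.mk₂_apply, areaForm]
  ring

theorem alternating_eq_mul_det {ι : Type*} [Fintype ι] [DecidableEq ι] (b : Module.Basis ι ℝ E)
    (f : E [⋀^ι]→ₗ[ℝ] ℝ) (v : ι → E) : f v = f b * b.det v := by
  conv_lhs => rw [f.eq_smul_basis_det b]
  simp

namespace NormalPair

variable (N : NormalPair I X)

/-- The exterior product of the forms `dn₀ ∧ dn₁` and `dm₀ ∧ dm₁`. -/
def gauss (x : X) : E [⋀^Fin 4]→ₗ[ℝ] ℝ :=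
  wedge22Alt (LinearMap.mul ℝ ℝ) (areaₗ (tdiff I N.n x)) (areaₗ (tdiff I N.m x))
    (areaₗ_self _) (areaₗ_self _)

theorem gauss_apply (x : X) (v : Fin 4 → E) :
    N.gauss x v = wedge22 (fun a b : ℝ => a * b)
      (fun k l => areaForm (tdiff I N.n x) (v k) (v l))
      (fun k l => areaForm (tdiff I N.m x) (v k) (v l)) := rfl

/-- On the normalisation of the frame `b` the volume form has square one, and it is determined by
its value on `b`. -/
theorem vol_basis_ne_zero (b : Module.Basis (Fin 4) ℝ E) (x : X) : N.vol x b ≠ 0 := by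
  intro h0
  let e : Fin 4 → ∀ x : X, TangentSpace I x := fun k _ => b k
  have hG : Matrix.PosDef (gram (frameMat I N.ι₁ e x) (frameMat I N.ι₂ e x)) := by
    refine posDef_gram fun c h1 h2 => ?_
    have h3 : ∑ k, c k • b k = 0 := by
      refine N.injective x _ ?_ ?_
      · refine Eq.trans ?_ h1
        exact (map_sum (tdiff I N.ι₁ x) _ _).trans
          (Finset.sum_congr rfl fun l _ => map_smul (tdiff I N.ι₁ x) _ _)
      · refine Eq.trans ?_ h2
        exact (map_sum (tdiff I N.ι₂ x) _ _).trans
          (Finset.sum_congr rfl fun l _ => map_smul (tdiff I N.ι₂ x) _ _)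
    exact funext (Fintype.linearIndependent_iff.1 b.linearIndependent c h3)
  have hF := frameRel_normalize (N.dot_n x) (N.dot_m x) (fun _ => N.normal_n x _)
    (fun _ => N.normal_m x _) hG
  have hsq := hF.wedge_sq
  have h1 : wedge22 (fun a b : ℝ => a * b)
      (transposeL (frameMat I N.ι₁ e x * invSqrt (gram (frameMat I N.ι₁ e x) (frameMat I N.ι₂ e x))) *
        crossL (N.n x) *
        (frameMat I N.ι₁ e x * invSqrt (gram (frameMat I N.ι₁ e x) (frameMat I N.ι₂ e x))))
      (transposeL (frameMat I N.ι₂ e x * invSqrt (gram (frameMat I N.ι₁ e x) (frameMat I N.ι₂ e x))) *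
        crossL (N.m x) *
        (frameMat I N.ι₂ e x * invSqrt (gram (frameMat I N.ι₁ e x) (frameMat I N.ι₂ e x)))) =
      N.vol x fun k => ∑ r, invSqrt (gram (frameMat I N.ι₁ e x) (frameMat I N.ι₂ e x)) r k •
        (e r x : E) := by
    rw [vol_apply]
    simp only [wedge22, block_eq, neg_mul_neg]
  have h2 := (congrArg (· ^ 2) h1).symm.trans hsq
  rw [alternating_eq_mul_det b, h0, zero_mul] at h2
  exact absurd h2 (by norm_num)

end NormalPair

/-- The differential of the inverse of a chart. -/
def chartD (I : ModelWithCorners ℝ E H) {X : Type*} [TopologicalSpace X] [ChartedSpace H X]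
    (c : X) (y : E) : E →L[ℝ] E := mfderiv 𝓘(ℝ, E) I (extChartAt I c).symm y

namespace NormalPair

variable (N : NormalPair I X)

section Sign

variable (b : Module.Basis (Fin 4) ℝ E)

theorem continuousAt_chart_vol (c : X) : ContinuousAt (fun y => N.vol ((extChartAt I c).symm y)
    fun k => chartD I c y (b k)) (extChartAt I c c) := by
  have hy := mem_target_chart (I := I) c
  have hd : ∀ {g : X → Space}, ContMDiff I 𝓘(ℝ, Space) ∞ g → ∀ k, ContinuousAt
      (fun y => fderiv ℝ (fun z => g ((extChartAt I c).symm z)) y (b k)) (extChartAt I c c) :=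
    fun hg k => ((contDiffAt_comp_symm hy (hg _)).continuousAt_fderiv (by simp)).clm_apply
      continuousAt_const
  have hv : ∀ {g : X → Space}, ContMDiff I 𝓘(ℝ, Space) ∞ g → ContinuousAt
      (fun y => g ((extChartAt I c).symm y)) (extChartAt I c c) :=
    fun hg => (contDiffAt_comp_symm hy (hg _)).continuousAt
  have ht : ∀ {n a a' : E → Space}, ContinuousAt n (extChartAt I c c) →
      ContinuousAt a (extChartAt I c c) → ContinuousAt a' (extChartAt I c c) →
      ContinuousAt (fun y => triple (n y) (a y) (a' y)) (extChartAt I c c) := by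
    intro n a a' hn ha ha'
    have hc : ∀ {n : E → Space}, ContinuousAt n (extChartAt I c c) → ∀ i,
        ContinuousAt (fun y => n y i) (extChartAt I c c) := fun hn i =>
      (PiLp.continuous_apply 2 _ i).continuousAt.comp hn
    have h0 := fun i => hc hn i
    have h1 := fun i => hc ha i
    have h2 := fun i => hc ha' i
    simp only [triple]
    fun_prop
  have h1 := hd N.smooth_ι₁
  have h2 := hd N.smooth_ι₂
  have h3 := fun k l => ht (hv N.smooth_n) (h1 k) (h1 l)
  have h4 := fun k l => ht (hv N.smooth_m) (h2 k) (h2 l)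
  have h5 : ContinuousAt (fun y => wedge22 (fun a b : ℝ => a * b)
      (fun k l => triple (N.n ((extChartAt I c).symm y))
        (fderiv ℝ (fun z => N.ι₁ ((extChartAt I c).symm z)) y (b k))
        (fderiv ℝ (fun z => N.ι₁ ((extChartAt I c).symm z)) y (b l)))
      (fun k l => triple (N.m ((extChartAt I c).symm y))
        (fderiv ℝ (fun z => N.ι₂ ((extChartAt I c).symm z)) y (b k))
        (fderiv ℝ (fun z => N.ι₂ ((extChartAt I c).symm z)) y (b l)))) (extChartAt I c c) := by
    simp only [wedge22]
    fun_prop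
  refine h5.congr ?_
  filter_upwards [(isOpen_extChartAt_target (I := I) c).mem_nhds hy] with y hy
  rw [vol_apply, ← tdiff_comp_symm hy ((N.smooth_ι₁ _).mdifferentiableAt (by simp)),
    ← tdiff_comp_symm hy ((N.smooth_ι₂ _).mdifferentiableAt (by simp))]
  rfl

theorem continuousAt_chart_gauss (c : X) : ContinuousAt (fun y => N.gauss ((extChartAt I c).symm y)
    fun k => chartD I c y (b k)) (extChartAt I c c) := by
  have hy := mem_target_chart (I := I) c
  have hd : ∀ {g : X → Space}, ContMDiff I 𝓘(ℝ, Space) ∞ g → ∀ k i, ContinuousAt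
      (fun y => fderiv ℝ (fun z => g ((extChartAt I c).symm z)) y (b k) i) (extChartAt I c c) :=
    fun hg k i => (PiLp.continuous_apply 2 _ i).continuousAt.comp
      (((contDiffAt_comp_symm hy (hg _)).continuousAt_fderiv (by simp)).clm_apply
      continuousAt_const)
  have h1 := hd N.smooth_n
  have h2 := hd N.smooth_m
  have h5 : ContinuousAt (fun y => wedge22 (fun a b : ℝ => a * b)
      (fun k l => areaForm (fderiv ℝ (fun z => N.n ((extChartAt I c).symm z)) y) (b k) (b l))
      (fun k l => areaForm (fderiv ℝ (fun z => N.m ((extChartAt I c).symm z)) y) (b k) (b l)))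
      (extChartAt I c c) := by
    simp only [wedge22, areaForm]
    fun_prop
  refine h5.congr ?_
  filter_upwards [(isOpen_extChartAt_target (I := I) c).mem_nhds hy] with y hy
  rw [gauss_apply, ← tdiff_comp_symm hy ((N.smooth_n _).mdifferentiableAt (by simp)),
    ← tdiff_comp_symm hy ((N.smooth_m _).mdifferentiableAt (by simp))]
  rfl

include b in
-- Both forms have top degree, so their relative sign can be tested on a single tuple.
theorem sign_mul_gauss {x : X} {s : ℝ} (hs : s = 1 ∨ s = -1) {v : Fin 4 → E}
    (h : 0 < s * (N.vol x v * N.gauss x v)) (u : Fin 4 → E) :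
    ((SignType.sign (N.vol x u) : SignType) : ℝ) * N.gauss x u = s * |N.gauss x u| := by
  have h1 : 0 < s * (N.vol x b * N.gauss x b) := by
    rw [alternating_eq_mul_det b (N.vol x), alternating_eq_mul_det b (N.gauss x)] at h
    have h2 : s * (N.vol x b * N.gauss x b) * (b.det v * b.det v) > 0 := by
      have : s * (N.vol x b * b.det v * (N.gauss x b * b.det v)) =
        s * (N.vol x b * N.gauss x b) * (b.det v * b.det v) := by ring
      rw [← this]; exact h
    by_contra hcon
    exact absurd h2 (not_lt.2 (mul_nonpos_of_nonpos_of_nonneg (not_lt.1 hcon) (mul_self_nonneg _)))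
  rw [alternating_eq_mul_det b (N.vol x), alternating_eq_mul_det b (N.gauss x)]
  generalize N.vol x b = p at *
  generalize N.gauss x b = q at *
  have h2 : ((SignType.sign p : SignType) : ℝ) = s * ((SignType.sign q : SignType) : ℝ) := by
    rcases hs with rfl | rfl
    · rcases pos_and_pos_or_neg_and_neg_of_mul_pos (by linarith : 0 < p * q) with ⟨hp, hq⟩ | ⟨hp, hq⟩
      · simp [sign_pos hp, sign_pos hq]
      · simp [sign_neg hp, sign_neg hq]
    · rcases mul_neg_iff.1 (by linarith : p * q < 0) with ⟨hp, hq⟩ | ⟨hp, hq⟩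
      · simp [sign_pos hp, sign_neg hq]
      · simp [sign_neg hp, sign_pos hq]
  rw [← sign_mul_self, sign_mul, sign_mul, SignType.coe_mul, SignType.coe_mul, h2]
  ring

theorem eventually_sign_mul_gauss {c : X} {s : ℝ} (hs : s = 1 ∨ s = -1)
    (h : 0 < s * (N.vol c b * N.gauss c b)) :
    ∀ᶠ x in 𝓝 c, ∀ u, ((SignType.sign (N.vol x u) : SignType) : ℝ) * N.gauss x u =
      s * |N.gauss x u| := by
  set φ := extChartAt I c with hφ
  have hc : ContinuousAt (fun y => s * ((N.vol (φ.symm y)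
      fun k => chartD I c y (b k)) * N.gauss (φ.symm y)
      fun k => chartD I c y (b k))) (φ c) :=
    continuousAt_const.mul ((N.continuousAt_chart_vol b c).mul (N.continuousAt_chart_gauss b c))
  have h0 : 0 < s * ((N.vol (φ.symm (φ c))
      fun k => chartD I c (φ c) (b k)) * N.gauss (φ.symm (φ c))
      fun k => chartD I c (φ c) (b k)) := by
    -- Passing to the chart multiplies both forms by the same nonzero determinant, hence their
    -- product by a positive number.
    have i1 : (mfderiv 𝓘(ℝ, E) I φ.symm (φ c)).IsInvertible := by
      have := isInvertible_mfderivWithin_extChartAt_symm (I := I) (x := c) (mem_target_chart c)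
      rwa [I.range_eq_univ, mfderivWithin_univ] at this
    obtain ⟨A, hA⟩ : ∃ A : E ≃L[ℝ] E, (A : E →L[ℝ] E) = chartD I c (φ c) := i1
    have hdet : ∀ f : E [⋀^Fin 4]→ₗ[ℝ] ℝ, (f fun k =>
        chartD I c (φ c) (b k)) =
        LinearMap.det (chartD I c (φ c) : E →ₗ[ℝ] E) * f b := fun f =>
      alternating_comp_det b f _
    have hne : LinearMap.det (chartD I c (φ c) : E →ₗ[ℝ] E) ≠ 0 := by
      rw [← hA]
      exact A.toLinearEquiv.isUnit_det'.ne_zero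
    rw [hdet, hdet, extChartAt_to_inv]
    generalize LinearMap.det (chartD I c (φ c) : E →ₗ[ℝ] E) = d at *
    have h2 : 0 < d * d := mul_self_pos.2 hne
    nlinarith [mul_pos h2 h]
  have hev := (continuousAt_extChartAt (I := I) c).eventually (hc.eventually (lt_mem_nhds h0))
  filter_upwards [hev, extChartAt_source_mem_nhds (I := I) c] with x hx hxs u
  rw [φ.left_inv hxs] at hx
  exact N.sign_mul_gauss b hs hx u

end Sign

end NormalPair

theorem coverBasis_repr (v : Plane × Plane) :
    coverBasis.repr v 0 = v.1 0 ∧ coverBasis.repr v 1 = v.1 1 ∧ coverBasis.repr v 2 = v.2 0 ∧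
      coverBasis.repr v 3 = v.2 1 := by
  refine ⟨?_, ?_, ?_, ?_⟩ <;> simp [coverBasis] <;> rfl

/-- Laplace expansion along the first two coordinates. -/
theorem coverBasis_det (v : Fin 4 → Plane × Plane) :
    coverBasis.det v = wedge22 (fun a b : ℝ => a * b)
      (fun k l => (v k).1 0 * (v l).1 1 - (v k).1 1 * (v l).1 0)
      (fun k l => (v k).2 0 * (v l).2 1 - (v k).2 1 * (v l).2 0) := by
  rw [Module.Basis.det_apply, Matrix.det_succ_row_zero]
  simp [Fin.sum_univ_succ, Matrix.det_fin_three, Module.Basis.toMatrix_apply, Fin.succAbove]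
  simp only [coverBasis_repr]
  simp only [wedge22]
  ring

end ChernWeil

/-! ### Localisation of the integral at the points where both normals point north. -/

namespace ChernWeil
open LevelSurface MeasureTheory

variable {H : Type*} [TopologicalSpace H] {I : ModelWithCorners ℝ (Plane × Plane) H}
  {X : Type*} [TopologicalSpace X] [ChartedSpace H X] [I.Boundaryless] [IsManifold I ∞ X]

/-- The orthogonal projection to the equatorial plane. -/
def flat : Space →L[ℝ] Plane :=
  LinearMap.toContinuousLinearMap
    { toFun := fun v => !₂[v 0, v 1]
      map_add' := fun v w => by ext i; fin_cases i <;> simp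
      map_smul' := fun c v => by ext i; fin_cases i <;> simp }

theorem flat_apply_zero (v : Space) : flat v 0 = v 0 := rfl

theorem flat_apply_one (v : Space) : flat v 1 = v 1 := rfl

theorem norm_flat_sq (v : Space) : ‖flat v‖ ^ 2 = v 0 * v 0 + v 1 * v 1 := by
  rw [EuclideanSpace.norm_sq_eq, Fin.sum_univ_two, flat_apply_zero, flat_apply_one]
  simp [sq]

namespace NormalPair

variable (N : NormalPair I X)

/-- The projections of the normal fields to the equatorial plane. -/
def flatMap (x : X) : Plane × Plane := (flat (N.n x), flat (N.m x))

theorem contMDiff_flatMap : ContMDiff I 𝓘(ℝ, Plane × Plane) ∞ N.flatMap := by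
  have h1 : ContMDiff I 𝓘(ℝ, Plane) ∞ fun x => flat (N.n x) := flat.contMDiff.comp N.smooth_n
  have h2 : ContMDiff I 𝓘(ℝ, Plane) ∞ fun x => flat (N.m x) := flat.contMDiff.comp N.smooth_m
  exact h1.prodMk_space h2

theorem tdiff_flatMap (x : X) (v : Plane × Plane) :
    tdiff I N.flatMap x v = (flat (tdiff I N.n x v), flat (tdiff I N.m x v)) := by
  have hy := mem_target_chart (I := I) x
  have h1 := (contDiffAt_comp_symm hy (N.smooth_n _)).differentiableAt (by simp)
  have h2 := (contDiffAt_comp_symm hy (N.smooth_m _)).differentiableAt (by simp)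
  rw [← fderiv_comp_symm_self ((N.contMDiff_flatMap x).mdifferentiableAt (by simp)),
    ← fderiv_comp_symm_self ((N.smooth_n x).mdifferentiableAt (by simp)),
    ← fderiv_comp_symm_self ((N.smooth_m x).mdifferentiableAt (by simp)),
    ← fderiv_clm_apply_comp flat h1, ← fderiv_clm_apply_comp flat h2]
  have h3 : DifferentiableAt ℝ (fun z => flat (N.n ((extChartAt I x).symm z))) (extChartAt I x x) :=
    flat.differentiableAt.comp _ h1
  have h4 : DifferentiableAt ℝ (fun z => flat (N.m ((extChartAt I x).symm z))) (extChartAt I x x) :=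
    flat.differentiableAt.comp _ h2
  have h5 := h3.fderiv_prodMk h4
  exact congrArg (fun B : Plane × Plane →L[ℝ] Plane × Plane => B v) h5

/-- The form `gauss` is the Jacobian of `flatMap`, so `flatMap` is a local chart wherever `gauss`
does not vanish. -/
theorem gauss_eq_det (x : X) (v : Fin 4 → Plane × Plane) :
    N.gauss x v = coverBasis.det fun k => tdiff I N.flatMap x (v k) := by
  rw [coverBasis_det, gauss_apply]
  simp only [tdiff_flatMap, flat_apply_zero, flat_apply_one, areaForm]

theorem exists_equiv_tdiff_flatMap {x : X} (h : N.gauss x coverBasis ≠ 0) :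
    ∃ A : (Plane × Plane) ≃L[ℝ] Plane × Plane,
      (A : Plane × Plane →L[ℝ] Plane × Plane) = tdiff I N.flatMap x := by
  have hd : (tdiff I N.flatMap x).det ≠ 0 := by
    rw [gauss_eq_det] at h
    have h1 := alternating_comp_det coverBasis coverBasis.det
      (tdiff I N.flatMap x : Plane × Plane →ₗ[ℝ] Plane × Plane)
    rw [coverBasis.det_self, mul_one] at h1
    intro h0
    exact h (h1.trans h0)
  exact ⟨(tdiff I N.flatMap x).toContinuousLinearEquivOfDetNeZero hd, rfl⟩

theorem radial_eq (p : Cutoff) {n : Space} (hn : dot n n = 1) (h : 0 < n 2) :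
    p.weight (n 2) = p.radial ‖flat n‖ := by
  unfold Cutoff.radial
  congr 1
  rw [norm_flat_sq]
  simp only [dot] at hn
  rw [show 1 - (n 0 * n 0 + n 1 * n 1) = n 2 ^ 2 by linarith [sq (n 2)], Real.sqrt_sq h.le]

theorem le_one_of_dot {n : Space} (hn : dot n n = 1) : n 2 ≤ 1 := by
  simp only [dot] at hn
  nlinarith [mul_self_nonneg (n 0), mul_self_nonneg (n 1)]

variable [T2Space X] [CompactSpace X]

/-- The points where both normals are the north pole determine the integral of densities
localised near them. -/
theorem exists_cutoff (K : Finset X) {s : X → ℝ} (hs : ∀ c ∈ K, s c = 1 ∨ s c = -1)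
    (hK : ∀ x, N.n x 2 = 1 → N.m x 2 = 1 → x ∈ K)
    (hn : ∀ c ∈ K, N.n c 2 = 1 ∧ N.m c 2 = 1)
    (hsign : ∀ c ∈ K, 0 < s c * (N.vol c coverBasis * N.gauss c coverBasis)) :
    ∃ p : Cutoff, ∀ (A : ℝ) (w : Density.Field I X), Density.IsDensity w →
      (∀ x (L : Plane × Plane →L[ℝ] Plane × Plane), w x L =
        ((A * ((SignType.sign (N.vol x fun k => L (coverBasis k)) : SignType) : ℝ) *
          (p.weight (N.n x 2) * p.weight (N.m x 2) * N.gauss x fun k => L (coverBasis k)) : ℝ) : ℂ)) →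
      ∀ ρ : SmoothPartitionOfUnity X I X univ, (ρ.IsSubordinate fun c => (chartAt H c).source) →
        Density.integral coverBasis.addHaar ρ w = ((A * (4 * Real.pi) ^ 2 * ∑ c ∈ K, s c : ℝ) : ℂ) := by
  classical
  obtain ⟨U, hU, hUd⟩ := K.finite_toSet.t2_separation
  -- Near each pole `flatMap` itself serves as chart, on a neighbourhood where both heights are
  -- positive and the relative sign of `vol` and `gauss` is constant.
  have hex : ∀ c, ∃ e : PartialEquiv X (Plane × Plane), c ∈ K → Density.IsSmoothChart I e ∧
      c ∈ e.source ∧ e.source ⊆ U c ∧ (∀ x ∈ e.source, e x = N.flatMap x) ∧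
      ∀ x ∈ e.source, 0 < N.n x 2 ∧ 0 < N.m x 2 ∧ ∀ u,
        ((SignType.sign (N.vol x u) : SignType) : ℝ) * N.gauss x u = s c * |N.gauss x u| := by
    intro c
    by_cases hc : c ∈ K
    · have hg : N.gauss c coverBasis ≠ 0 := by
        intro h0
        have := hsign c hc
        rw [h0] at this
        simp at this
      obtain ⟨A, hA⟩ := N.exists_equiv_tdiff_flatMap hg
      have hco : ∀ {n : X → Space}, ContMDiff I 𝓘(ℝ, Space) ∞ n → Continuous fun x => n x 2 :=
        fun h => (PiLp.continuous_apply 2 _ 2).comp h.continuous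
      have hev : ∀ᶠ x in 𝓝 c, x ∈ U c ∧ 0 < N.n x 2 ∧ 0 < N.m x 2 ∧ ∀ u,
          ((SignType.sign (N.vol x u) : SignType) : ℝ) * N.gauss x u = s c * |N.gauss x u| :=
        ((hU c).2.mem_nhds (hU c).1 |> fun h => (h : ∀ᶠ x in 𝓝 c, x ∈ U c)).and
          (((hco N.smooth_n).continuousAt.eventually (lt_mem_nhds (by simp only [(hn c hc).1]; exact one_pos))).and
          (((hco N.smooth_m).continuousAt.eventually (lt_mem_nhds (by simp only [(hn c hc).2]; exact one_pos))).and
          (N.eventually_sign_mul_gauss coverBasis (hs c hc) (hsign c hc))))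
      obtain ⟨W, hW, hWo, hcW⟩ := eventually_nhds_iff.1 hev
      obtain ⟨e, he, hce, heW, heΦ⟩ := exists_chart N.contMDiff_flatMap hA hWo hcW
      exact ⟨e, fun _ => ⟨he, hce, fun x hx => (hW x (heW hx)).1, heΦ, fun x hx => (hW x (heW hx)).2⟩⟩
    · exact ⟨extChartAt I c, fun h => absurd h hc⟩
  choose e he using hex
  have hzero : ∀ c ∈ K, (0 : Plane × Plane) ∈ (e c).target := by
    intro c hc
    obtain ⟨_, h2, _, h4, _⟩ := he c hc
    have h5 := (e c).map_source h2
    rw [h4 c h2] at h5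
    have hz : ∀ {n : Space}, dot n n = 1 → n 2 = 1 → flat n = 0 := by
      intro n h1 h2
      simp only [dot, h2] at h1
      ext i
      fin_cases i
      · have : n 0 = 0 := by nlinarith [mul_self_nonneg (n 0), mul_self_nonneg (n 1)]
        simpa [flat_apply_zero] using this
      · have : n 1 = 0 := by nlinarith [mul_self_nonneg (n 0), mul_self_nonneg (n 1)]
        simpa [flat_apply_one] using this
    rwa [flatMap, hz (N.dot_n c) (hn c hc).1, hz (N.dot_m c) (hn c hc).2] at h5
  -- The poles are sent to the origin, so one ball fits into all targets. The cut-off is chosen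
  -- later with its support in this ball.
  obtain ⟨δ, hδ, hball⟩ : ∃ δ > 0, ∀ c ∈ K, Metric.ball (0 : Plane × Plane) δ ⊆ (e c).target := by
    have h1 : (⋂ c ∈ K, (e c).target) ∈ 𝓝 (0 : Plane × Plane) :=
      (Filter.biInter_finset_mem K).2 fun c hc => (he c hc).1.open_target.mem_nhds (hzero c hc)
    obtain ⟨δ, hδ, h2⟩ := Metric.mem_nhds_iff.1 h1
    exact ⟨δ, hδ, fun c hc y hy => mem_iInter₂.1 (h2 hy) c hc⟩
  have hle : ∀ x, N.n x 2 ≤ 1 ∧ N.m x 2 ≤ 1 := fun x =>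
    ⟨le_one_of_dot (N.dot_n x), le_one_of_dot (N.dot_m x)⟩
  -- By compactness the smaller of the two heights stays below some `τ < 1` outside the charts, so a
  -- threshold above `τ` makes the density vanish there.
  obtain ⟨τ, hτ, hout⟩ : ∃ τ < (1 : ℝ), ∀ x, (∀ c ∈ K, x ∉ (e c).source) →
      min (N.n x 2) (N.m x 2) ≤ τ := by
    have hC : IsCompact (⋃ c ∈ K, (e c).source)ᶜ :=
      (isOpen_biUnion fun c hc => (he c hc).1.open_source).isClosed_compl.isCompact
    have hmem : ∀ x, (∀ c ∈ K, x ∉ (e c).source) ↔ x ∈ (⋃ c ∈ K, (e c).source)ᶜ := fun x => by simp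
    have hq : Continuous fun x => min (N.n x 2) (N.m x 2) :=
      ((PiLp.continuous_apply 2 _ 2).comp N.smooth_n.continuous).min
        ((PiLp.continuous_apply 2 _ 2).comp N.smooth_m.continuous)
    rcases (⋃ c ∈ K, (e c).source)ᶜ.eq_empty_or_nonempty with h | h
    · refine ⟨0, one_pos, fun x hx => ?_⟩
      rw [hmem, h] at hx
      exact absurd hx (notMem_empty x)
    · obtain ⟨x₀, hx₀, hmax⟩ := hC.exists_isMaxOn h hq.continuousOn
      refine ⟨_, ?_, fun x hx => hmax ((hmem x).1 hx)⟩
      by_contra hcon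
      have h1 : 1 ≤ min (N.n x₀ 2) (N.m x₀ 2) := not_lt.1 hcon
      have h2 := hK x₀ (le_antisymm (hle x₀).1 (h1.trans (min_le_left _ _)))
        (le_antisymm (hle x₀).2 (h1.trans (min_le_right _ _)))
      exact (hmem x₀).2 hx₀ x₀ h2 (he x₀ h2).2.1
  obtain ⟨t, ⟨ht0, htτ, htδ⟩, ht1⟩ : ∃ t : ℝ, (0 < t ∧ τ < t ∧ 1 - t ^ 2 < δ ^ 2) ∧ t < 1 := by
    have h1 : ∀ᶠ t : ℝ in 𝓝[<] 1, 0 < t ∧ τ < t ∧ 1 - t ^ 2 < δ ^ 2 := by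
      refine nhdsWithin_le_nhds ((lt_mem_nhds one_pos).and ((lt_mem_nhds hτ).and ?_))
      have h2 : ContinuousAt (fun t : ℝ => 1 - t ^ 2) 1 := by fun_prop
      exact h2.eventually (gt_mem_nhds (by simp; positivity))
    obtain ⟨t, h2, h3⟩ := (h1.and self_mem_nhdsWithin).exists
    exact ⟨t, h2, h3⟩
  obtain ⟨p, rfl⟩ := Cutoff.exists_threshold ht0 ht1
  refine ⟨p, fun A w hw hform ρ hρ => ?_⟩
  -- In the chart `flatMap` the Jacobian is `1`, the sign of `vol` becomes `s c`, and the two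
  -- weights become radial functions of the two coordinates.
  have hpull : ∀ c ∈ K, ∀ y ∈ (e c).target,
      Density.pull w (e c).symm y = ((A * s c * p.density y : ℝ) : ℂ) := by
    intro c hc y hy
    obtain ⟨h1, h2, h3, h4, h5⟩ := he c hc
    have hx := (e c).map_target hy
    obtain ⟨h6, h7, h8⟩ := h5 _ hx
    have h9 : N.flatMap ((e c).symm y) = y := by rw [← h4 _ hx, (e c).right_inv hy]
    have h10 := tdiff_comp_chart_symm N.contMDiff_flatMap h1 h4 hy
    set L : Plane × Plane →L[ℝ] Plane × Plane := mfderiv 𝓘(ℝ, Plane × Plane) I (e c).symm y with hL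
    have h11 : (N.gauss ((e c).symm y) fun k => L (coverBasis k)) = 1 := by
      rw [gauss_eq_det]
      have : (fun k => tdiff I N.flatMap ((e c).symm y) (L (coverBasis k))) = coverBasis :=
        funext fun k => congrArg (fun B : Plane × Plane →L[ℝ] Plane × Plane => B (coverBasis k)) h10
      rw [this, coverBasis.det_self]
    have h12 := h8 fun k => L (coverBasis k)
    rw [h11, mul_one, abs_one, mul_one] at h12
    refine (hform _ L).trans ?_
    rw [h12, h11, radial_eq p (N.dot_n _) h6, radial_eq p (N.dot_m _) h7, mul_one]
    have h13 : flat (N.n ((e c).symm y)) = y.1 := congrArg Prod.fst h9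
    have h14 : flat (N.m ((e c).symm y)) = y.2 := congrArg Prod.snd h9
    rw [h13, h14]
    rfl
  have hint : ∀ c, MeasureTheory.Integrable (fun y => ((A * s c * p.density y : ℝ) : ℂ))
      coverBasis.addHaar := fun c => (p.integrable_density.const_mul _).ofReal
  rw [Density.integral_eq_sum_charts coverBasis.addHaar hρ hw K (fun c hc => (he c hc).1)
    (fun i hi j hj hij => (hUd hi hj hij).mono (he i hi).2.2.1 (he j hj).2.2.1)
    (fun x hx L => ?_) fun c hc => ?_]
  · have h1 : ∀ c ∈ K, ∫ y in (e c).target, Density.pull w (e c).symm y ∂coverBasis.addHaar =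
        ((A * s c * (4 * Real.pi) ^ 2 : ℝ) : ℂ) := by
      intro c hc
      rw [setIntegral_congr_fun (he c hc).1.open_target.measurableSet (hpull c hc),
        setIntegral_eq_integral_of_forall_compl_eq_zero, integral_complex_ofReal, integral_const_mul,
        p.integral_density]
      intro y hy
      have h2 : y ∉ Metric.ball (0 : Plane × Plane) δ := fun h => hy (hball c hc h)
      rw [mem_ball_zero_iff, not_lt] at h2
      rw [p.density_eq_zero (by nlinarith)]
      simp
    rw [Finset.sum_congr rfl h1, ← Complex.ofReal_sum]
    congr 1
    rw [Finset.mul_sum]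
    exact Finset.sum_congr rfl fun c _ => by ring
  · have h1 := hout x hx
    refine (hform x L).trans ?_
    rcases min_le_iff.1 h1 with h | h
    · rw [p.weight_eq_zero (h.trans_lt htτ)]; simp
    · rw [p.weight_eq_zero (h.trans_lt htτ)]; simp
  · exact (hint c).integrableOn.congr_fun (fun y hy => (hpull c hc y hy).symm)
      (he c hc).1.open_target.measurableSet

end NormalPair
end ChernWeil

/-! ### The gradient of the defining equation and the points of the surface where it points upwards.
-/

namespace MirrorSurface
open LevelSurface ChernWeil

/-- The indices of the holes. -/
def holes (g : ℕ) : Finset ℤ := (Finset.Icc (-(g : ℤ)) g).erase 0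

/-- The function vanishing on the boundary of a hole. -/
def hole (c : ℤ) (p : Space) : ℝ := p 0 ^ 2 + (p 2 - 3 * c) ^ 2 - 1

/-- The function vanishing on the outer boundary. -/
def outer (g : ℕ) (p : Space) : ℝ := (3 * g + 2) ^ 2 - p 0 ^ 2 - p 2 ^ 2

/-- The quotient of the derivative of `planarFun` in the first variable by `2x`. -/
def factorX (g : ℕ) (p : Space) : ℝ :=
  -∏ c ∈ holes g, hole c p + outer g p * ∑ c ∈ holes g, ∏ c' ∈ (holes g).erase c, hole c' p

/-- The derivative of `planarFun` in the second variable. -/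
def derivZ (g : ℕ) (p : Space) : ℝ :=
  -(2 * p 2 * ∏ c ∈ holes g, hole c p) +
    outer g p * ∑ c ∈ holes g, (∏ c' ∈ (holes g).erase c, hole c' p) * (2 * (p 2 - 3 * c))

/-- The gradient of the equation. -/
def grad (g : ℕ) (p : Space) : Space := !₂[-2 * factorX g p * p 0, 2 * p 1, -derivZ g p]

variable {g : ℕ}

theorem equation_eq (p : Space) : equation g p = p 1 ^ 2 - outer g p * ∏ c ∈ holes g, hole c p := rfl

theorem contDiff_hole (c : ℤ) : ContDiff ℝ ∞ (hole c) := by unfold hole; fun_prop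

theorem contDiff_outer (g : ℕ) : ContDiff ℝ ∞ (outer g) := by unfold outer; fun_prop

theorem contDiff_factorX (g : ℕ) : ContDiff ℝ ∞ (factorX g) :=
  (contDiff_prod fun c _ => contDiff_hole c).neg.add ((contDiff_outer g).mul
    (ContDiff.sum fun c _ => contDiff_prod fun c' _ => contDiff_hole c'))

theorem contDiff_derivZ (g : ℕ) : ContDiff ℝ ∞ (derivZ g) := by
  have h1 : ContDiff ℝ ∞ fun p : Space => 2 * p 2 := by fun_prop
  have h2 : ∀ c : ℤ, ContDiff ℝ ∞ fun p : Space => 2 * (p 2 - 3 * (c : ℝ)) := fun c => by fun_prop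
  exact (h1.mul (contDiff_prod fun c _ => contDiff_hole c)).neg.add ((contDiff_outer g).mul
    (ContDiff.sum fun c _ => (contDiff_prod fun c' _ => contDiff_hole c').mul (h2 c)))

theorem contDiff_grad (g : ℕ) : ContDiff ℝ ∞ (grad g) := by
  have h0 := contDiff_factorX g
  have h2 := contDiff_derivZ g
  refine contDiff_euclidean.2 fun i => ?_
  fin_cases i
  · exact (contDiff_const.mul h0).mul (by fun_prop)
  · exact (by fun_prop : ContDiff ℝ ∞ fun p : Space => 2 * p 1)
  · exact h2.neg

theorem fderiv_equation (p v : Space) : fderiv ℝ (equation g) p v = dot (grad g p) v := by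
  have h : ∀ i, HasFDerivAt (fun q : Space => q i) (EuclideanSpace.proj i : Space →L[ℝ] ℝ) p :=
    fun i => (EuclideanSpace.proj i : Space →L[ℝ] ℝ).hasFDerivAt
  have hh : ∀ c : ℤ, HasFDerivAt (hole c) ((2 * p 0) • (EuclideanSpace.proj 0 : Space →L[ℝ] ℝ) +
      (2 * (p 2 - 3 * c)) • (EuclideanSpace.proj 2 : Space →L[ℝ] ℝ)) p := by
    intro c
    have : HasFDerivAt (fun q : Space => q 0 ^ 2 + (q 2 - 3 * (c : ℝ)) ^ 2)
        ((2 * p 0) • (EuclideanSpace.proj 0 : Space →L[ℝ] ℝ) +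
          (2 * (p 2 - 3 * c)) • (EuclideanSpace.proj 2 : Space →L[ℝ] ℝ)) p := by
      simpa using ((h 0).pow 2).fun_add (((h 2).sub_const (3 * (c : ℝ))).pow 2)
    exact this.sub_const 1
  have ho : HasFDerivAt (outer g) (-((2 * p 0) • (EuclideanSpace.proj 0 : Space →L[ℝ] ℝ)) -
      (2 * p 2) • (EuclideanSpace.proj 2 : Space →L[ℝ] ℝ)) p := by
    have : HasFDerivAt (fun q : Space => (3 * (g : ℝ) + 2) ^ 2 - q 0 ^ 2 - q 2 ^ 2)
        (-((2 * p 0) • (EuclideanSpace.proj 0 : Space →L[ℝ] ℝ)) -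
          (2 * p 2) • (EuclideanSpace.proj 2 : Space →L[ℝ] ℝ)) p := by
      simpa using (((h 0).pow 2).const_sub ((3 * (g : ℝ) + 2) ^ 2)).fun_sub ((h 2).pow 2)
    exact this
  have hp := HasFDerivAt.finsetProd (u := holes g) fun c _ => hh c
  have hy : HasFDerivAt (fun q : Space => q 1 ^ 2) ((2 * p 1) • (EuclideanSpace.proj 1 : Space →L[ℝ] ℝ)) p := by
    have := (h 1).pow 2
    simpa using this
  have hE : HasFDerivAt (equation g) ((2 * p 1) • (EuclideanSpace.proj 1 : Space →L[ℝ] ℝ) -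
      (outer g p • (∑ c ∈ holes g, (∏ c' ∈ (holes g).erase c, hole c' p) •
        ((2 * p 0) • (EuclideanSpace.proj 0 : Space →L[ℝ] ℝ) +
          (2 * (p 2 - 3 * c)) • (EuclideanSpace.proj 2 : Space →L[ℝ] ℝ))) +
        (∏ c ∈ holes g, hole c p) • (-((2 * p 0) • (EuclideanSpace.proj 0 : Space →L[ℝ] ℝ)) -
          (2 * p 2) • (EuclideanSpace.proj 2 : Space →L[ℝ] ℝ)))) p :=
    hy.fun_sub (ho.fun_mul hp)
  rw [hE.fderiv]
  have hd : dot (grad g p) v = -2 * factorX g p * p 0 * v 0 + 2 * p 1 * v 1 + -derivZ g p * v 2 := by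
    simp [dot, grad]
  have hc : ∀ i, (EuclideanSpace.proj i : Space →L[ℝ] ℝ) v = v i := fun _ => rfl
  rw [hd]
  have hs : ∀ P b : ℤ → ℝ, (∑ c ∈ holes g, P c • ((2 * p 0) • (EuclideanSpace.proj 0 : Space →L[ℝ] ℝ) +
      b c • (EuclideanSpace.proj 2 : Space →L[ℝ] ℝ))) v =
        (∑ c ∈ holes g, P c) * (2 * p 0 * v 0) + (∑ c ∈ holes g, P c * b c) * v 2 := fun P b => by
    simp only [sum_apply, smul_apply, add_apply, hc, smul_eq_mul, mul_add, Finset.sum_add_distrib,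
      Finset.sum_mul, mul_assoc]
  simp only [sub_apply, add_apply, smul_apply, neg_apply, hs, hc, smul_eq_mul, factorX, derivZ]
  ring

/-- The centres are at distance at least `3` and the radii are `1`, so a point on one circle is
strictly outside every other one. -/
theorem hole_pos {c c' : ℤ} {p : Space} (h : hole c p = 0) (hc : c ≠ c') : 0 < hole c' p := by
  have h2 : (1 : ℝ) ≤ |((c : ℝ) - c')| := by
    have : 1 ≤ |c - c'| := Int.one_le_abs (sub_ne_zero.2 hc)
    exact_mod_cast this
  unfold hole at *
  have h3 : (p 2 - 3 * c) ^ 2 ≤ 1 := by nlinarith [sq_nonneg (p 0)]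
  have h4 : |p 2 - 3 * c| ≤ 1 := abs_le_one_iff_mul_self_le_one.2 (by nlinarith)
  have h5 : p 0 ^ 2 + (p 2 - 3 * c') ^ 2 - 1 =
      (p 0 ^ 2 + (p 2 - 3 * c) ^ 2 - 1) + 6 * ((p 2 - 3 * c) * (c - c')) + 9 * |((c : ℝ) - c')| ^ 2 := by
    rw [sq_abs]; ring
  have h6 : -|((c : ℝ) - c')| ≤ (p 2 - 3 * c) * (c - c') := by
    have h7 := neg_abs_le ((p 2 - 3 * c) * ((c : ℝ) - c'))
    rw [abs_mul] at h7
    nlinarith [abs_nonneg ((c : ℝ) - c')]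
  rw [h5, h]
  nlinarith

section Hole

variable {c : ℤ} {p : Space} (hc : c ∈ holes g) (h : hole c p = 0)
include hc h

theorem outer_pos : 0 < outer g p := by
  by_contra hcon
  have h1 := outside_pos (g := g) (x := p 0) (z := p 2) (by unfold outer at hcon; linarith) hc
  exact h1.ne' h

theorem prod_erase_pos : 0 < ∏ c' ∈ (holes g).erase c, hole c' p :=
  Finset.prod_pos fun _ hc' => hole_pos h (Finset.ne_of_mem_erase hc').symm

/-- On one boundary circle every term containing its equation drops out. What is left has a definite
sign, positive on the holes and negative on the outer circle. -/
theorem factorX_of_hole : factorX g p = outer g p * ∏ c' ∈ (holes g).erase c, hole c' p := by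
  unfold factorX
  rw [Finset.prod_eq_zero hc h, Finset.sum_eq_single_of_mem c hc fun b _ hb =>
    Finset.prod_eq_zero (Finset.mem_erase.2 ⟨hb.symm, hc⟩) h]
  ring

theorem derivZ_of_hole :
    derivZ g p = outer g p * ((∏ c' ∈ (holes g).erase c, hole c' p) * (2 * (p 2 - 3 * c))) := by
  unfold derivZ
  rw [Finset.prod_eq_zero hc h, Finset.sum_eq_single_of_mem c hc fun b _ hb => by
    rw [Finset.prod_eq_zero (Finset.mem_erase.2 ⟨hb.symm, hc⟩) h, zero_mul]]
  ring

end Hole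

theorem prod_pos_of_outer {p : Space} (h : outer g p = 0) : 0 < ∏ c ∈ holes g, hole c p :=
  Finset.prod_pos fun _ hc => outside_pos (by unfold outer at h; linarith) hc

theorem factorX_of_outer {p : Space} (h : outer g p = 0) : factorX g p = -∏ c ∈ holes g, hole c p := by
  simp [factorX, h]

theorem derivZ_of_outer {p : Space} (h : outer g p = 0) :
    derivZ g p = -(2 * p 2 * ∏ c ∈ holes g, hole c p) := by
  simp [derivZ, h]

/-- The heights of the points where the gradient points upwards. -/
def heights (g : ℕ) : Finset ℝ := insert (3 * (g : ℝ) + 2) ((holes g).image fun c : ℤ => 3 * (c : ℝ) - 1)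

/-- The points on the vertical axis. -/
def axis (z : ℝ) : Space := !₂[0, 0, z]

/-- The sign of the curvature. -/
def heightSign (g : ℕ) (z : ℝ) : ℝ := if z = 3 * (g : ℝ) + 2 then 1 else -1

theorem abs_le_of_mem_holes {c : ℤ} (hc : c ∈ holes g) : |(c : ℝ)| ≤ g := by
  simp [holes] at hc
  rw [abs_le]
  exact ⟨by exact_mod_cast hc.2.1, by exact_mod_cast hc.2.2⟩

theorem height_ne {c : ℤ} (hc : c ∈ holes g) : 3 * (c : ℝ) - 1 ≠ 3 * (g : ℝ) + 2 := by
  have := le_of_abs_le (abs_le_of_mem_holes hc)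
  intro h
  linarith

/-- The third component of the gradient is `-derivZ`, so the gradient points upwards. The sign of
`-factorX` is that of the Gauss curvature: the surface is convex at its top and has a saddle at the
lowest point of each hole. -/
theorem heights_spec {z : ℝ} (hz : z ∈ heights g) : equation g (axis z) = 0 ∧
    derivZ g (axis z) < 0 ∧ heightSign g z * factorX g (axis z) < 0 := by
  rcases Finset.mem_insert.1 hz with rfl | hz
  · have h1 : outer g (axis (3 * (g : ℝ) + 2)) = 0 := by simp [outer, axis]
    have h2 := prod_pos_of_outer h1
    refine ⟨?_, ?_, ?_⟩
    · rw [equation_eq, h1]; simp [axis]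
    · rw [derivZ_of_outer h1]
      have h3 : axis (3 * (g : ℝ) + 2) 2 = 3 * (g : ℝ) + 2 := rfl
      rw [h3]
      have : 0 < 2 * (3 * (g : ℝ) + 2) := by positivity
      nlinarith [mul_pos this h2]
    · rw [factorX_of_outer h1, heightSign, if_pos rfl]
      linarith
  · obtain ⟨c, hc, rfl⟩ := Finset.mem_image.1 hz
    have h1 : hole c (axis (3 * (c : ℝ) - 1)) = 0 := by simp [hole, axis]
    have h2 := outer_pos hc h1
    have h3 := prod_erase_pos hc h1
    refine ⟨?_, ?_, ?_⟩
    · rw [equation_eq, Finset.prod_eq_zero hc h1]; simp [axis]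
    · rw [derivZ_of_hole hc h1]
      have h4 : axis (3 * (c : ℝ) - 1) 2 = 3 * (c : ℝ) - 1 := rfl
      rw [h4]
      nlinarith [mul_pos h2 h3]
    · rw [factorX_of_hole hc h1, heightSign, if_neg (height_ne hc)]
      linarith [mul_pos h2 h3]

/-- The zeros of the equation at which the gradient points upwards. -/
theorem exists_height {p : Space} (hp : equation g p = 0) (h0 : factorX g p * p 0 = 0)
    (h1 : p 1 = 0) (h2 : derivZ g p < 0) : ∃ z ∈ heights g, p = axis z := by
  have hp' : outer g p * ∏ c ∈ holes g, hole c p = 0 := by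
    rw [equation_eq, h1] at hp
    linarith
  have hax : ∀ z, p 0 = 0 → p 2 = z → p = axis z := by
    intro z hx hz
    ext i
    fin_cases i
    · exact hx
    · exact h1
    · exact hz
  rcases mul_eq_zero.1 hp' with h | h
  · have h3 := prod_pos_of_outer h
    rw [factorX_of_outer h] at h0
    rw [derivZ_of_outer h] at h2
    have hx : p 0 = 0 := (mul_eq_zero.1 h0).resolve_left (neg_ne_zero.2 h3.ne')
    have hz : 0 < p 2 := by
      by_contra hcon
      nlinarith [mul_nonneg (neg_nonneg.2 (not_lt.1 hcon)) h3.le]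
    refine ⟨_, Finset.mem_insert_self _ _, hax _ hx ?_⟩
    unfold outer at h
    rw [hx] at h
    have h4 : (p 2 - (3 * g + 2)) * (p 2 + (3 * g + 2)) = 0 := by linarith
    have h5 : p 2 + (3 * (g : ℝ) + 2) ≠ 0 := by positivity
    linarith [(mul_eq_zero.1 h4).resolve_right h5]
  · obtain ⟨c, hc, h⟩ := Finset.prod_eq_zero_iff.1 h
    have h3 := mul_pos (outer_pos hc h) (prod_erase_pos hc h)
    rw [factorX_of_hole hc h] at h0
    rw [derivZ_of_hole hc h, ← mul_assoc] at h2
    have hx : p 0 = 0 := (mul_eq_zero.1 h0).resolve_left h3.ne'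
    have hz : p 2 - 3 * c < 0 := by
      by_contra hcon
      nlinarith [mul_nonneg (not_lt.1 hcon) h3.le]
    refine ⟨_, Finset.mem_insert_of_mem (Finset.mem_image_of_mem _ hc), hax _ hx ?_⟩
    unfold hole at h
    rw [hx] at h
    have h4 : (p 2 - 3 * c - 1) * (p 2 - 3 * c + 1) = 0 := by linarith
    rcases mul_eq_zero.1 h4 with h5 | h5 <;> linarith

/-- One convex point and `2g` saddles: the degree of the Gauss map, which is half the Euler number
of the surface. -/
theorem sum_heightSign (g : ℕ) : ∑ z ∈ heights g, heightSign g z = 1 - 2 * (g : ℝ) := by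
  unfold heights
  rw [Finset.sum_insert, Finset.sum_image]
  · have h1 : ∀ c ∈ holes g, heightSign g (3 * (c : ℝ) - 1) = -1 := fun c hc => if_neg (height_ne hc)
    rw [Finset.sum_congr rfl h1, heightSign, if_pos rfl]
    have h2 : (holes g).card = 2 * g := by
      unfold holes
      rw [Finset.card_erase_of_mem (by simp), Int.card_Icc]
      omega
    simp [h2]
    ring
  · intro a _ b _ hab
    have : (a : ℝ) = b := by simpa using hab
    exact_mod_cast this
  · intro h
    obtain ⟨c, hc, h⟩ := Finset.mem_image.1 h
    exact height_ne hc h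

end MirrorSurface

/-! ### The unit normals of the surface and of the sphere. -/

namespace ChernWeil

variable {E H : Type*} [NormedAddCommGroup E] [NormedSpace ℝ E] [TopologicalSpace H]
  {I : ModelWithCorners ℝ E H} {X : Type*} [TopologicalSpace X] [ChartedSpace H X]

theorem tdiff_comp {F G : Type*} [NormedAddCommGroup F] [NormedSpace ℝ F] [NormedAddCommGroup G]
    [NormedSpace ℝ G] {ι : X → F} {h : F → G} {x : X} (hι : MDifferentiableAt I 𝓘(ℝ, F) ι x)
    (hh : DifferentiableAt ℝ h (ι x)) :
    tdiff I (fun z => h (ι z)) x = (fderiv ℝ h (ι x)).comp (tdiff I ι x) := by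
  have h1 := mfderiv_comp x hh.mdifferentiableAt hι
  rw [mfderiv_eq_fderiv] at h1
  exact h1

theorem tdiff_const {F : Type*} [NormedAddCommGroup F] [NormedSpace ℝ F] (c : F) (x : X) :
    tdiff I (fun _ => c) x = 0 := mfderiv_const

end ChernWeil

namespace MirrorSurface
open LevelSurface ChernWeil

variable {g : ℕ}

theorem dot_self_eq_zero {a : Space} (h : dot a a = 0) : a = 0 := by
  unfold dot at h
  have h0 : a 0 = 0 := by nlinarith [sq_nonneg (a 0), sq_nonneg (a 1), sq_nonneg (a 2)]
  have h1 : a 1 = 0 := by nlinarith [sq_nonneg (a 0), sq_nonneg (a 1), sq_nonneg (a 2)]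
  have h2 : a 2 = 0 := by nlinarith [sq_nonneg (a 0), sq_nonneg (a 1), sq_nonneg (a 2)]
  ext i
  fin_cases i
  · exact h0
  · exact h1
  · exact h2

theorem dot_self_nonneg (a : Space) : 0 ≤ dot a a := by
  unfold dot
  nlinarith [sq_nonneg (a 0), sq_nonneg (a 1), sq_nonneg (a 2)]

theorem dot_smul_smul (c d : ℝ) (a b : Space) : dot (c • a) (d • b) = c * d * dot a b := by
  simp only [dot, PiLp.smul_apply, smul_eq_mul]
  ring

theorem dot_smul_left (c : ℝ) (a b : Space) : dot (c • a) b = c * dot a b := by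
  simp only [dot, PiLp.smul_apply, smul_eq_mul]
  ring

theorem contDiff_dot_self : ContDiff ℝ ∞ fun a : Space => dot a a := by
  unfold dot
  fun_prop

/-- Regularity of the level surface keeps the gradient from vanishing, so it can be normalised. -/
theorem dot_grad_pos (p : Surface g) : 0 < dot (grad g p.1) (grad g p.1) := by
  refine lt_of_le_of_ne (dot_self_nonneg _) fun h => ?_
  refine (isRegular_equation g).fderiv_ne_zero p.1 p.2 ?_
  ext v
  rw [fderiv_equation, dot_self_eq_zero h.symm]
  simp [dot]

/-- The inverse of the length of the gradient. -/
def invLength (g : ℕ) (p : Space) : ℝ := (√(dot (grad g p) (grad g p)))⁻¹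

/-- The normalized gradient. -/
def unitNormal (g : ℕ) (p : Space) : Space := invLength g p • grad g p

theorem invLength_pos (p : Surface g) : 0 < invLength g p.1 :=
  inv_pos.2 (Real.sqrt_pos.2 (dot_grad_pos p))

theorem contDiffAt_invLength (p : Surface g) : ContDiffAt ℝ ∞ (invLength g) p.1 :=
  ((contDiff_dot_self.comp (contDiff_grad g)).contDiffAt.sqrt (dot_grad_pos p).ne').inv
    (Real.sqrt_pos.2 (dot_grad_pos p)).ne'

theorem contDiffAt_unitNormal (p : Surface g) : ContDiffAt ℝ ∞ (unitNormal g) p.1 :=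
  (contDiffAt_invLength p).smul (contDiff_grad g).contDiffAt

theorem dot_unitNormal (p : Surface g) : dot (unitNormal g p.1) (unitNormal g p.1) = 1 := by
  unfold unitNormal
  rw [dot_smul_smul, invLength, ← mul_inv, Real.mul_self_sqrt (dot_grad_pos p).le]
  exact inv_mul_cancel₀ (dot_grad_pos p).ne'

theorem contMDiff_fst_val (g : ℕ) :
    ContMDiff coverModel 𝓘(ℝ, Space) ∞ (fun x : Surface g × Sphere2 => (x.1.1 : Space)) :=
  (contMDiff_val (isRegular_equation g)).comp contMDiff_fst

theorem contMDiff_snd_val (g : ℕ) :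
    ContMDiff coverModel 𝓘(ℝ, Space) ∞ (fun x : Surface g × Sphere2 => (x.2.1 : Space)) :=
  (contMDiff_coe_sphere (n := 2) (E := Space)).comp contMDiff_snd

theorem contMDiff_unitNormal (g : ℕ) :
    ContMDiff coverModel 𝓘(ℝ, Space) ∞ (fun x : Surface g × Sphere2 => unitNormal g x.1.1) := fun x =>
  ContMDiffAt.comp (g := unitNormal g) (f := fun x : Surface g × Sphere2 => x.1.1) x
    (contDiffAt_unitNormal x.1).contMDiffAt (contMDiff_fst_val g x)

theorem dot_sphere (w : Sphere2) : dot w.1 w.1 = 1 := by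
  have h := w.2
  rw [mem_sphere_zero_iff_norm] at h
  have h2 : ‖w.1‖ ^ 2 = 1 := by rw [h]; norm_num
  rw [EuclideanSpace.norm_sq_eq, Fin.sum_univ_three] at h2
  simp only [Real.norm_eq_abs, sq_abs] at h2
  unfold dot
  linarith

theorem fderiv_dot_self (a v : Space) : fderiv ℝ (fun a : Space => dot a a) a v = 2 * dot a v := by
  have h : ∀ i, HasFDerivAt (fun q : Space => q i) (EuclideanSpace.proj i : Space →L[ℝ] ℝ) a :=
    fun i => (EuclideanSpace.proj i : Space →L[ℝ] ℝ).hasFDerivAt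
  have hd : HasFDerivAt (fun a : Space => dot a a) _ a :=
    (((h 0).fun_mul (h 0)).fun_add ((h 1).fun_mul (h 1))).fun_add ((h 2).fun_mul (h 2))
  have hc : ∀ i, (EuclideanSpace.proj i : Space →L[ℝ] ℝ) v = v i := fun _ => rfl
  rw [hd.fderiv]
  simp only [add_apply, smul_apply, hc, smul_eq_mul, dot]
  ring

/-- The charts are restrictions of linear maps, so the invertible differential of a chart factors
through the differential of the inclusion. -/
theorem mfderiv_val_injective (p : Surface g) (v : Plane)
    (hv : tdiff 𝓘(ℝ, Plane) (fun q : Surface g => q.1) p v = 0) : v = 0 := by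
  have h1 := tdiff_comp (I := 𝓘(ℝ, Plane)) (ι := fun q : Surface g => q.1)
    (h := proj (isRegular_equation g) p)
    ((contMDiff_val (isRegular_equation g) p).mdifferentiableAt (by simp))
    (proj (isRegular_equation g) p).differentiableAt
  have h3 := isInvertible_mfderiv_extChartAt (I := 𝓘(ℝ, Plane)) (mem_extChartAt_source (I := 𝓘(ℝ, Plane)) p)
  refine h3.injective (Eq.trans ?_
    (map_zero (mfderiv 𝓘(ℝ, Plane) 𝓘(ℝ, Plane) (extChartAt 𝓘(ℝ, Plane) p) p)).symm)
  refine (congrArg (fun L : Plane →L[ℝ] Plane => L v) h1).trans ?_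
  exact (congrArg (fderiv ℝ (proj (isRegular_equation g) p) p.1) hv).trans (map_zero _)

theorem tdiff_fst_val (x : Surface g × Sphere2) (v : Plane × Plane) :
    tdiff coverModel (fun x : Surface g × Sphere2 => x.1.1) x v =
      tdiff 𝓘(ℝ, Plane) (fun q : Surface g => q.1) x.1 v.1 := by
  have h := mfderiv_comp x ((contMDiff_val (isRegular_equation g) x.1).mdifferentiableAt (by simp))
    (mdifferentiableAt_fst (I := 𝓘(ℝ, Plane)) (I' := 𝓘(ℝ, Plane)) (x := x))
  rw [mfderiv_fst] at h
  exact congrArg (fun L : Plane × Plane →L[ℝ] Space => L v) h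

theorem tdiff_snd_val (x : Surface g × Sphere2) (v : Plane × Plane) :
    tdiff coverModel (fun x : Surface g × Sphere2 => x.2.1) x v =
      tdiff 𝓘(ℝ, Plane) (fun q : Sphere2 => q.1) x.2 v.2 := by
  have h := mfderiv_comp x ((contMDiff_coe_sphere (n := 2) (E := Space) (m := ∞) x.2).mdifferentiableAt (by simp))
    (mdifferentiableAt_snd (I := 𝓘(ℝ, Plane)) (I' := 𝓘(ℝ, Plane)) (x := x))
  rw [mfderiv_snd] at h
  exact congrArg (fun L : Plane × Plane →L[ℝ] Space => L v) h

/-- The product of the surface and the sphere, with their unit normal fields. -/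
def normalPair (g : ℕ) : NormalPair coverModel (Surface g × Sphere2) where
  ι₁ x := x.1.1
  ι₂ x := x.2.1
  n x := unitNormal g x.1.1
  m x := x.2.1
  smooth_ι₁ := contMDiff_fst_val g
  smooth_ι₂ := contMDiff_snd_val g
  smooth_n := contMDiff_unitNormal g
  smooth_m := contMDiff_snd_val g
  dot_n x := dot_unitNormal x.1
  dot_m x := dot_sphere x.2
  normal_n x v := by
    -- The equation is constant along the surface, so the gradient annihilates tangent vectors.
    have h1 := tdiff_comp (h := equation g) ((contMDiff_fst_val g x).mdifferentiableAt (by simp))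
      ((contDiff_equation g).differentiable (by simp) _)
    have h2 : (fun z : Surface g × Sphere2 => equation g z.1.1) = fun _ => 0 := funext fun z => z.1.2
    rw [h2, tdiff_const] at h1
    have h3 := congrArg (fun L : Plane × Plane →L[ℝ] ℝ => L v) h1
    have h4 := h3.trans (fderiv_equation x.1.1 _)
    unfold unitNormal
    rw [dot_smul_left]
    exact (congrArg (fun t => invLength g x.1.1 * t) h4.symm).trans (mul_zero _)
  normal_m x v := by
    have h1 := tdiff_comp (h := fun a : Space => dot a a)
      ((contMDiff_snd_val g x).mdifferentiableAt (by simp))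
      (contDiff_dot_self.differentiable (by simp) _)
    have h2 : (fun z : Surface g × Sphere2 => dot z.2.1 z.2.1) = fun _ => 1 :=
      funext fun z => dot_sphere z.2
    rw [h2, tdiff_const] at h1
    have h3 := congrArg (fun L : Plane × Plane →L[ℝ] ℝ => L v) h1
    have h4 := h3.trans (fderiv_dot_self x.2.1 _)
    have h5 : (0 : ℝ) = 2 * dot x.2.1 (tdiff coverModel (fun x : Surface g × Sphere2 => x.2.1) x v) := h4
    linarith
  injective x v h1 h2 := by
    have h3 := mfderiv_val_injective x.1 v.1 ((tdiff_fst_val x v).symm.trans h1)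
    have h4 := injective_mvfderiv_subtypeVal_sphere (n := 2) (E := Space) x.2
    have h5 : v.2 = 0 := by
      refine h4 (((tdiff_snd_val x v).symm.trans h2).trans ?_)
      exact (map_zero (tdiff 𝓘(ℝ, Plane) (fun q : Sphere2 => q.1) x.2)).symm
    exact Prod.ext h3 h5

end MirrorSurface

/-! ### The poles and their signs. -/

namespace MirrorSurface
open LevelSurface ChernWeil

variable {g : ℕ}

theorem axis_zero (z : ℝ) : axis z 0 = 0 := rfl
theorem axis_one (z : ℝ) : axis z 1 = 0 := rfl
theorem axis_two (z : ℝ) : axis z 2 = z := rfl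

theorem axis_injective : Function.Injective axis := fun a b h =>
  (axis_two a).symm.trans ((congrArg (fun p : Space => p 2) h).trans (axis_two b))

theorem eq_zero_of_two_eq_one {a : Space} (h : dot a a = 1) (h2 : a 2 = 1) : a 0 = 0 ∧ a 1 = 0 := by
  unfold dot at h
  rw [h2] at h
  constructor <;> nlinarith [sq_nonneg (a 0), sq_nonneg (a 1)]

/-- The north pole. -/
def northPole : Sphere2 := ⟨axis 1, by
  rw [mem_sphere_zero_iff_norm, EuclideanSpace.norm_eq]
  simp [Fin.sum_univ_three, axis]⟩

theorem eq_northPole {w : Sphere2} (h : w.1 2 = 1) : w = northPole := by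
  obtain ⟨h0, h1⟩ := eq_zero_of_two_eq_one (dot_sphere w) h
  refine Subtype.ext ?_
  ext i
  fin_cases i
  · exact h0
  · exact h1
  · exact h

theorem unitNormal_axis {z : ℝ} (hz : z ∈ heights g) : unitNormal g (axis z) = axis 1 := by
  obtain ⟨h1, h2, -⟩ := heights_spec hz
  have h3 := dot_unitNormal ⟨axis z, h1⟩
  have h4 : 0 < invLength g (axis z) := invLength_pos ⟨axis z, h1⟩
  have ha : unitNormal g (axis z) 0 = 0 := by
    change invLength g (axis z) * (-2 * factorX g (axis z) * 0) = 0
    ring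
  have hb : unitNormal g (axis z) 1 = 0 := by
    change invLength g (axis z) * (2 * 0) = 0
    ring
  have hc : 0 < unitNormal g (axis z) 2 := mul_pos h4 (neg_pos.2 h2)
  have hd : unitNormal g (axis z) 2 = 1 := by
    unfold dot at h3
    change unitNormal g (axis z) 0 * unitNormal g (axis z) 0 + unitNormal g (axis z) 1 *
      unitNormal g (axis z) 1 + unitNormal g (axis z) 2 * unitNormal g (axis z) 2 = 1 at h3
    rw [ha, hb] at h3
    nlinarith
  ext i
  fin_cases i
  · exact ha
  · exact hb
  · exact hd

/-- A unit vector with last coordinate `1` has no horizontal components, so `factorX * x` and `y`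
vanish and `derivZ` is negative. -/
theorem exists_height_of_unitNormal {p : Surface g} (h : unitNormal g p.1 2 = 1) :
    ∃ z ∈ heights g, p.1 = axis z := by
  obtain ⟨h0, h1⟩ := eq_zero_of_two_eq_one (dot_unitNormal p) h
  have h4 := invLength_pos p
  have h0' : invLength g p.1 * (-2 * factorX g p.1 * p.1 0) = 0 := h0
  have h1' : invLength g p.1 * (2 * p.1 1) = 0 := h1
  have h2' : invLength g p.1 * -derivZ g p.1 = 1 := h
  refine exists_height p.2 ?_ ?_ ?_
  · have := (mul_eq_zero.1 h0').resolve_left h4.ne'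
    linarith
  · have := (mul_eq_zero.1 h1').resolve_left h4.ne'
    linarith
  · by_contra hcon
    nlinarith [mul_nonneg h4.le (not_lt.1 hcon)]

/-- The horizontal part of the differential of the normal field on the axis. -/
theorem fderiv_unitNormal_axis {z : ℝ} (hz : z ∈ heights g) (v : Space) :
    fderiv ℝ (unitNormal g) (axis z) v 0 =
        -2 * factorX g (axis z) * invLength g (axis z) * v 0 ∧
      fderiv ℝ (unitNormal g) (axis z) v 1 = 2 * invLength g (axis z) * v 1 := by
  have hp := (contDiffAt_unitNormal ⟨axis z, (heights_spec hz).1⟩).differentiableAt (by simp)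
  have hl := (contDiffAt_invLength ⟨axis z, (heights_spec hz).1⟩).differentiableAt (by simp)
  have hx : DifferentiableAt ℝ (factorX g) (axis z) := (contDiff_factorX g).differentiable (by simp) _
  have h : ∀ i, HasFDerivAt (fun q : Space => q i) (EuclideanSpace.proj i : Space →L[ℝ] ℝ) (axis z) :=
    fun i => (EuclideanSpace.proj i : Space →L[ℝ] ℝ).hasFDerivAt
  have hi : ∀ i, fderiv ℝ (unitNormal g) (axis z) v i =
      fderiv ℝ (fun q => unitNormal g q i) (axis z) v := fun i => by
    have h1 := ((EuclideanSpace.proj i : Space →L[ℝ] ℝ).hasFDerivAt.comp (axis z) hp.hasFDerivAt).fderiv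
    exact (congrArg (fun L : Space →L[ℝ] ℝ => L v) h1).symm
  have hc : ∀ i, (EuclideanSpace.proj i : Space →L[ℝ] ℝ) v = v i := fun _ => rfl
  constructor
  · have h0 : HasFDerivAt (fun q => invLength g q * (-2 * factorX g q * q 0)) _ (axis z) :=
      hl.hasFDerivAt.fun_mul (((hx.hasFDerivAt).const_mul (-2)).fun_mul (h 0))
    rw [hi]
    change fderiv ℝ (fun q => invLength g q * (-2 * factorX g q * q 0)) (axis z) v = _
    rw [h0.fderiv]
    simp only [add_apply, smul_apply, hc, smul_eq_mul, axis_zero]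
    ring
  · have h0 : HasFDerivAt (fun q => invLength g q * (2 * q 1)) _ (axis z) :=
      hl.hasFDerivAt.fun_mul ((h 1).const_mul 2)
    rw [hi]
    change fderiv ℝ (fun q => invLength g q * (2 * q 1)) (axis z) v = _
    rw [h0.fderiv]
    simp only [add_apply, smul_apply, hc, smul_eq_mul, axis_one]
    ring

/-- The points where both normals point upwards. -/
def poles (g : ℕ) : Finset (Surface g × Sphere2) :=
  (heights g).attach.map ⟨fun z => (⟨axis z.1, (heights_spec z.2).1⟩, northPole), fun a b h =>
    Subtype.ext (axis_injective (congrArg (fun q : Surface g × Sphere2 => q.1.1) h))⟩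

theorem mem_poles {x : Surface g × Sphere2} :
    x ∈ poles g ↔ ∃ z ∈ heights g, x.1.1 = axis z ∧ x.2 = northPole := by
  unfold poles
  rw [Finset.mem_map]
  constructor
  · rintro ⟨z, -, rfl⟩
    exact ⟨z.1, z.2, rfl, rfl⟩
  · rintro ⟨z, hz, h1, h2⟩
    exact ⟨⟨z, hz⟩, Finset.mem_attach _ _, Prod.ext (Subtype.ext h1.symm) h2.symm⟩

/-- The sign of a pole. -/
def poleSign (x : Surface g × Sphere2) : ℝ := heightSign g (x.1.1 2)

theorem sum_poleSign (g : ℕ) : ∑ x ∈ poles g, poleSign x = 1 - 2 * (g : ℝ) := by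
  unfold poles
  rw [Finset.sum_map, ← sum_heightSign, ← Finset.sum_attach (heights g)]
  rfl

/-- At a pole both tangent planes are horizontal. The differential of the normal of the surface is
diagonal there and that of the sphere is the identity, so `gauss = k * vol`, where `k` has the sign
of `-factorX`. -/
theorem poleSign_mul_pos {x : Surface g × Sphere2} (hx : x ∈ poles g) :
    0 < poleSign x * ((normalPair g).vol x coverBasis * (normalPair g).gauss x coverBasis) := by
  obtain ⟨z, hz, h1, h2⟩ := mem_poles.1 hx
  obtain ⟨-, -, h3⟩ := heights_spec hz
  have h4 : 0 < invLength g (axis z) := invLength_pos ⟨axis z, (heights_spec hz).1⟩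
  set k := -2 * factorX g (axis z) * invLength g (axis z) * (2 * invLength g (axis z)) with hk
  have hn : (normalPair g).n x = axis 1 := by
    change unitNormal g x.1.1 = _
    rw [h1, unitNormal_axis hz]
  have hm : (normalPair g).m x = axis 1 := congrArg Subtype.val h2
  have ht : ∀ a b : Space, triple (axis 1) a b = a 0 * b 1 - a 1 * b 0 := fun a b => by
    simp only [triple, axis_zero, axis_one, axis_two]
    ring
  have htd : ∀ v, tdiff coverModel (normalPair g).n x v =
      fderiv ℝ (unitNormal g) (axis z) (tdiff coverModel (normalPair g).ι₁ x v) := fun v => by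
    have h5 := tdiff_comp (h := unitNormal g) ((contMDiff_fst_val g x).mdifferentiableAt (by simp))
      ((contDiffAt_unitNormal x.1).differentiableAt (by simp))
    rw [h1] at h5
    exact congrArg (fun L : Plane × Plane →L[ℝ] Space => L v) h5
  have hA : ∀ v w, areaForm (tdiff coverModel (normalPair g).n x) v w =
      k * triple ((normalPair g).n x) (tdiff coverModel (normalPair g).ι₁ x v)
        (tdiff coverModel (normalPair g).ι₁ x w) := fun v w => by
    rw [hn, ht, areaForm, htd, htd, (fderiv_unitNormal_axis hz _).1, (fderiv_unitNormal_axis hz _).1,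
      (fderiv_unitNormal_axis hz _).2, (fderiv_unitNormal_axis hz _).2, hk]
    ring
  have hB : ∀ v w, areaForm (tdiff coverModel (normalPair g).m x) v w =
      triple ((normalPair g).m x) (tdiff coverModel (normalPair g).ι₂ x v)
        (tdiff coverModel (normalPair g).ι₂ x w) := fun v w => by
    rw [hm, ht]
    rfl
  have hg : (normalPair g).gauss x coverBasis = k * (normalPair g).vol x coverBasis := by
    rw [NormalPair.gauss_apply, NormalPair.vol_apply]
    simp only [hA, hB, wedge22]
    ring
  have h6 : poleSign x = heightSign g z := by
    unfold poleSign
    rw [h1, axis_two]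
  have h7 : 0 < heightSign g z * k := by
    rw [hk]
    have : 0 < invLength g (axis z) * invLength g (axis z) := mul_pos h4 h4
    nlinarith [mul_pos (neg_pos.2 h3) this]
  have h8 := mul_pos h7 (mul_self_pos.2 ((normalPair g).vol_basis_ne_zero coverBasis x))
  rw [hg, h6]
  linarith

theorem exists_cutoff_normalPair (g : ℕ) : ∃ p : Cutoff, ∀ (A : ℝ)
    (w : Density.Field coverModel (Surface g × Sphere2)), Density.IsDensity w →
    (∀ x (L : Plane × Plane →L[ℝ] Plane × Plane), w x L =
      ((A * ((SignType.sign ((normalPair g).vol x fun k => L (coverBasis k)) : SignType) : ℝ) *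
        (p.weight ((normalPair g).n x 2) * p.weight ((normalPair g).m x 2) *
          (normalPair g).gauss x fun k => L (coverBasis k)) : ℝ) : ℂ)) →
    ∀ ρ : SmoothPartitionOfUnity (Surface g × Sphere2) coverModel (Surface g × Sphere2) univ,
      ρ.IsSubordinate (fun c => (chartAt (ModelProd Plane Plane) c).source) →
      Density.integral coverBasis.addHaar ρ w = ((A * (4 * Real.pi) ^ 2 * (1 - 2 * g) : ℝ) : ℂ) := by
  obtain ⟨p, hp⟩ := (normalPair g).exists_cutoff (poles g) (s := poleSign)
    (fun c _ => by unfold poleSign heightSign; split_ifs <;> simp)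
    (fun x hx hy => by
      obtain ⟨z, hz, h⟩ := exists_height_of_unitNormal (p := x.1) hx
      exact mem_poles.2 ⟨z, hz, h, eq_northPole hy⟩)
    (fun c hc => by
      obtain ⟨z, hz, h1, h2⟩ := mem_poles.1 hc
      refine ⟨?_, ?_⟩
      · change unitNormal g c.1.1 2 = 1
        rw [h1, unitNormal_axis hz, axis_two]
      · change c.2.1 2 = 1
        rw [h2]
        rfl)
    (fun c hc => poleSign_mul_pos hc)
  refine ⟨p, fun A w hw h ρ hρ => ?_⟩
  rw [← sum_poleSign]
  exact hp A w hw h ρ hρ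

end MirrorSurface

/-! ### The Chern numbers of the two spinor bundles. -/

section SpinorBundles
open ChernWeil MirrorSurface LevelSurface

variable {g : ℕ} {o : ManifoldOrientation coverModel (M2g g)}
  {V : ComplexBundle coverModel (M2g g) 2}

/-- The Chern integral of a bundle associated to a spin structure of the quotient. -/
theorem chernIntegral_spinFrames {Ω : HalfSpin} (T : SpinFrames Ω V)
    (hT : ∀ i, ∀ x ∈ V.U i, ∀ L : Plane × Plane →L[ℝ] Plane × Plane,
      (∀ k, L (coverBasis k) = T.e i k x) → (signField o coverBasis).val x L = 1)
    (D : V.Connection) {ρ : SmoothPartitionOfUnity (M2g g) coverModel (M2g g) univ}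
    (hρ : ρ.IsSubordinate fun c => (chartAt (ModelProd Plane Plane) c).source) :
    D.chernIntegral o coverBasis ρ = ((Ω.sign * (2 * g - 1) : ℝ) : ℂ) := by
  obtain ⟨s, hf⟩ := exists_isSmoothQuotient g
  obtain ⟨ρX, hρX⟩ := SmoothPartitionOfUnity.exists_isSubordinate_chartAt_source
    coverModel (Surface g × Sphere2)
  obtain ⟨p, hp⟩ := exists_cutoff_normalPair g
  have h1 := hf.integral_pullConnection D (signField o coverBasis) coverBasis hρ hρX
  set σ := (signField o coverBasis).pull hf.contMDiff hf.isInvertible_mfderiv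
  set T' := T.pull hf.contMDiff hf.isInvertible_mfderiv
  -- The pulled back connection is exchanged for the localised one. This is possible only on the
  -- cover, because the normals do not descend to the quotient.
  rw [integral_chernDensity_eq σ coverBasis hρX ((normalPair g).connection T' p),
    hp (-(1 / (8 * Real.pi ^ 2)) * Ω.sign) _ (isDensity_chernDensity _ _ _) ?_ ρX hρX,
    Fintype.card_units_int] at h1
  · rw [chernIntegral_eq]
    -- The factor `2` on the right is the number of sheets of the cover and cancels against it.
    have h2 : -(1 / (8 * Real.pi ^ 2)) * Ω.sign * (4 * Real.pi) ^ 2 * (1 - 2 * (g : ℝ)) =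
        2 * (Ω.sign * (2 * g - 1)) := by
      field_simp [Real.pi_ne_zero]
      ring
    rw [h2] at h1
    push_cast at h1 ⊢
    linear_combination (-(1 / 2) : ℂ) * h1
  · intro x L
    obtain ⟨i, hi⟩ := V.cover (doubleCover g x)
    refine (normalPair g).chernDensity_connection T' p σ coverBasis (i := i) hi ?_ L
    intro L₀ hL₀
    -- The pulled back frame is mapped by the differential of the covering to the oriented frame
    -- below, so its sign is `1` upstairs as well.
    refine hT i (doubleCover g x) hi _ fun k => ?_
    refine Eq.trans ?_ (SpinFrames.mfderiv_pull T hf.contMDiff hf.isInvertible_mfderiv i k x)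
    exact congrArg (mfderiv coverModel coverModel (doubleCover g) x) (hL₀ k)

end SpinorBundles

theorem corollary3p2p10 (g : ℕ) (o : ManifoldOrientation coverModel (M2g g))
    (h : Bundle.ContMDiffRiemannianMetric coverModel ∞ (LevelSurface.Plane × LevelSurface.Plane)
      (fun x : M2g g => TangentSpace coverModel x))
    (S : SpinStructure o h) :
    S.positiveSpinor.HasSecondChernNumber o coverBasis (2 * (g : ℤ) - 1) ∧
    S.negativeSpinor.HasSecondChernNumber o coverBasis (1 - 2 * (g : ℤ)) := by
  refine ⟨⟨ChernWeil.nonempty_connection _, fun D ρ hρ => ?_⟩,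
    ⟨ChernWeil.nonempty_connection _, fun D ρ hρ => ?_⟩⟩
  · refine (chernIntegral_spinFrames (ChernWeil.positiveFrames S)
      (fun i x hx => ChernWeil.signField_eq_one S coverBasis hx) D hρ).trans ?_
    change (((1 : ℝ) * (2 * g - 1) : ℝ) : ℂ) = _
    push_cast
    ring
  · refine (chernIntegral_spinFrames (ChernWeil.negativeFrames S)
      (fun i x hx => ChernWeil.signField_eq_one S coverBasis hx) D hρ).trans ?_
    change (((-1 : ℝ) * (2 * g - 1) : ℝ) : ℂ) = _
    push_cast
    ring
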